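/- A polygonal link in $\mathbb{R}^3$ is a finite union of pairwise disjoint, embedded, closed polygons, with specified vertices (a vertex may lie in the middle of a straight piece); its segments are the edges joining consecutive vertices. An elementary move on a polygonal link is one of the following operations or the reverse of one of them: (1) split an edge into two by adding a new vertex in its interior; (2) given a line segment $AB$ of the link that consists of two edges meeting in a single interior vertex $X$, and a point $C$ not on the link such that the triangle $ABC$ meets the link only in $AB$, replace $AB$ (and $X$) by the two edges $AC$ and $CB$ with the new vertex $C$. The orthogonal projection of a polygonal link to a plane is regular if all its crossings are in general position (transverse crossings of interiors of two edges) and at most two edges meet the pre-image of any point of the plane. It then gives a link diagram: the projected curves in the plane together with the information, at each crossing, which strand is the upper one. Link diagrams are considered up to planar isotopy, and a Reidemeister move is a Reidemeister move of type I, II or III on (unoriented) link diagrams, in either direction. Theorem. Let $n, k \ge 0$ be integers, let $L$ and $L'$ be polygonal links in $\mathbb{R}^3$, each with at most $n$ segments, whose orthogonal projections to a fixed plane are regular, and let $D$ and $D'$ be the link diagrams obtained by these projections. If $L$ can be transformed to $L'$ using $k$ elementary moves, then $D$ can be transformed to $D'$ using at most $2k\left(n + \tfrac{1}{2}k + 1\right)^2$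 Reidemeister moves. -/

import Mathlib

/-- Euclidean three-space. -/
abbrev Space : Type := EuclideanSpace ℝ (Fin 3)

/-- The Euclidean plane, in which link diagrams are drawn. -/
abbrev Plane : Type := EuclideanSpace ℝ (Fin 2)

/-- The closed line segment joining the two endpoints of an unordered pair of points. -/
def edgeSegment {V : Type*} [AddCommGroup V] [Module ℝ V] (e : Sym2 V) : Set V :=
  convexHull ℝ {x | x ∈ e}

/-- An (unoriented) polygonal link in `ℝ³`, recorded by its set of edges. An edge is an unordered
pair of distinct points (its two vertices); every vertex lies on exactly two edges and two
different edges meet at most in a common vertex. So the edges form finitely many pairwise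
disjoint embedded closed polygons, the components of the link. The marked vertices are part
of the data: a vertex may lie in the middle of a straight piece of the link. -/
structure PolygonalLink where
  edges : Set (Sym2 Space)
  finite : edges.Finite
  not_isDiag : ∀ e ∈ edges, ¬ e.IsDiag
  two_edges : ∀ e ∈ edges, ∀ v ∈ e, {f ∈ edges | v ∈ f}.ncard = 2
  embedded : ∀ e ∈ edges, ∀ f ∈ edges, e ≠ f →
    edgeSegment e ∩ edgeSegment f ⊆ {v | v ∈ e ∧ v ∈ f}

/-- A polygonal link diagram in the plane, recorded by the set of its straight edges and by the
relation `isOver e f`: at the crossing of the edges `e` and `f` the edge `e` is the overcrossing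
one. The vertices listed here are the corners of the polygonal curves (where exactly two edges
meet), not the crossings. No point of the plane lies on more than two edges; hence a vertex lies
on no edge but the two that end there, two edges with a common vertex have no other common point,
and two edges without a common vertex that meet do so in a single point,
interior to both, and transversally. At each such crossing exactly one of the two
edges is labelled as the upper one. -/
@[ext]
structure LinkDiagram where
  edges : Set (Sym2 Plane)
  isOver : Sym2 Plane → Sym2 Plane → Prop
  finite : edges.Finite
  not_isDiag : ∀ e ∈ edges, ¬ e.IsDiag
  two_edges : ∀ e ∈ edges, ∀ v ∈ e, {f ∈ edges | v ∈ f}.ncard = 2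
  at_most_two : ∀ x : Plane, {e ∈ edges | x ∈ edgeSegment e}.ncard ≤ 2
  over_crossing : ∀ e f, isOver e f →
    e ∈ edges ∧ f ∈ edges ∧ (∀ v ∈ e, v ∉ f) ∧ (edgeSegment e ∩ edgeSegment f).Nonempty
  over_or_under : ∀ e ∈ edges, ∀ f ∈ edges, (∀ v ∈ e, v ∉ f) →
    (edgeSegment e ∩ edgeSegment f).Nonempty → (isOver e f ↔ ¬ isOver f e)

/-! ### Elementary moves on polygonal links -/

namespace PolygonalLink

/-- The underlying point set of a link. -/
def carrier (L : PolygonalLink) : Set Space := ⋃ e ∈ L.edges, edgeSegment e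

/-- First elementary operation: the edge `AB` is split by a new vertex `X` in its interior. -/
def SplitEdge (L L' : PolygonalLink) : Prop :=
  ∃ A B X : Space, s(A, B) ∈ L.edges ∧ X ∈ openSegment ℝ A B ∧
    ∀ e, e ∈ L'.edges ↔ (e ∈ L.edges ∧ e ≠ s(A, B)) ∨ e = s(A, X) ∨ e = s(X, B)

/-- Second elementary operation: a line segment `AB` of the link with a single interior vertex `X`
is replaced by `AC` and `CB`, where `C` is not on the link and
the triangle `ABC` meets the link only in `AB`. -/
def PushAcross (L L' : PolygonalLink) : Prop :=
  ∃ A B X C : Space, s(A, X) ∈ L.edges ∧ s(X, B) ∈ L.edges ∧ X ∈ openSegment ℝ A B ∧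
    C ∉ L.carrier ∧ AffineIndependent ℝ ![A, B, C] ∧
    convexHull ℝ {A, B, C} ∩ L.carrier = segment ℝ A B ∧
    ∀ e, e ∈ L'.edges ↔
      (e ∈ L.edges ∧ e ≠ s(A, X) ∧ e ≠ s(X, B)) ∨ e = s(A, C) ∨ e = s(C, B)

/-- An elementary move: one of the two operations above, or the reverse of one of them. -/
def ElementaryMove (L L' : PolygonalLink) : Prop :=
  SplitEdge L L' ∨ SplitEdge L' L ∨ PushAcross L L' ∨ PushAcross L' L

/-- `L` can be transformed to `L'` using `k` elementary moves. -/
def TransformsIn (k : ℕ) (L L' : PolygonalLink) : Prop :=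
  ∃ S : ℕ → PolygonalLink, S 0 = L ∧ S k = L' ∧ ∀ i < k, ElementaryMove (S i) (S (i + 1))

end PolygonalLink

/-! ### Planar isotopies and Reidemeister moves on diagrams -/

namespace LinkDiagram

/-- `D'` arises from `D` by a new vertex `X` in the interior of the edge `AB`. The
drawing in the plane and its crossings do not change. -/
def Subdivision (D D' : LinkDiagram) : Prop :=
  ∃ A B X : Plane, s(A, B) ∈ D.edges ∧ X ∈ openSegment ℝ A B ∧
    (∀ e, e ∈ D'.edges ↔ (e ∈ D.edges ∧ e ≠ s(A, B)) ∨ e = s(A, X) ∨ e = s(X, B)) ∧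
    (∀ e ∈ D.edges, ∀ f ∈ D.edges, e ≠ s(A, B) → f ≠ s(A, B) → (D'.isOver e f ↔ D.isOver e f)) ∧
    ∀ e ∈ D.edges, e ≠ s(A, B) →
      (D.isOver e s(A, B) ↔ D'.isOver e s(A, X) ∨ D'.isOver e s(X, B))

/-- `D'` arises from `D` by replacing the edge `AB` by the two other sides `AC`, `CB` of the
triangle `ABC`, all other edges and the crossings between them being unchanged. -/
def ReplaceEdge (D D' : LinkDiagram) (A B C : Plane) : Prop :=
  AffineIndependent ℝ ![A, B, C] ∧ s(A, B) ∈ D.edges ∧ (∀ e ∈ D.edges, C ∉ edgeSegment e) ∧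
    (∀ e, e ∈ D'.edges ↔ (e ∈ D.edges ∧ e ≠ s(A, B)) ∨ e = s(A, C) ∨ e = s(C, B)) ∧
    ∀ e ∈ D.edges, ∀ f ∈ D.edges, e ≠ s(A, B) → f ≠ s(A, B) → (D'.isOver e f ↔ D.isOver e f)

/-- The edges of `D` other than `AB`. -/
def otherEdges (D : LinkDiagram) (A B : Plane) : Set (Sym2 Plane) :=
  {e | e ∈ D.edges ∧ e ≠ s(A, B)}

/-- The edge `e` meets the triangle `ABC` at most in the points `A`, `B`. -/
def Misses (e : Sym2 Plane) (A B C : Plane) : Prop :=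
  edgeSegment e ∩ convexHull ℝ {A, B, C} ⊆ {A, B}

/-- The edge `e` runs straight through the triangle `ABC`, entering it through the side `AB`
(so that it leaves through `AC` or `CB`). -/
def RunsThrough (e : Sym2 Plane) (A B C : Plane) : Prop :=
  (edgeSegment e ∩ segment ℝ A B).Nonempty ∧ ∀ v ∈ e, v ∉ convexHull ℝ {A, B, C}

/-- For an edge `e` running through the triangle `ABC`: the crossing of `e` with `AB` in `D` and
the crossing of `e` with the path `ACB` in `D'` have the same label. -/
def SameLabel (D D' : LinkDiagram) (e : Sym2 Plane) (A B C : Plane) : Prop :=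
  D.isOver e s(A, B) ↔ D'.isOver e s(A, C) ∨ D'.isOver e s(C, B)

/-- A planar isotopy supported near a triangle: the edge `AB` is pulled across `ABC` to `ACB`,
where the rest of the diagram meets the triangle (apart from `A` and `B`) only in
pairwise disjoint segments leading from `AB` to `AC` or `CB`. -/
def TriangleIsotopy (D D' : LinkDiagram) : Prop :=
  ∃ A B C : Plane, ReplaceEdge D D' A B C ∧
    (∀ e ∈ D.otherEdges A B,
      Misses e A B C ∨ (RunsThrough e A B C ∧ SameLabel D D' e A B C)) ∧
    ∀ e ∈ D.otherEdges A B, ∀ f ∈ D.otherEdges A B, e ≠ f →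
      RunsThrough e A B C → RunsThrough f A B C →
        edgeSegment e ∩ edgeSegment f ∩ convexHull ℝ {A, B, C} = ∅

/-- One elementary step of a (piecewise linear) isotopy of the plane carrying `D` to `D'`.
The equivalence relation generated by these steps is planar isotopy of polygonal diagrams. -/
def IsotopyStep (D D' : LinkDiagram) : Prop :=
  Subdivision D D' ∨ Subdivision D' D ∨ TriangleIsotopy D D' ∨ TriangleIsotopy D' D

/-- Reidemeister move of type I, creating a crossing: besides `AB` the triangle `ABC` contains only
an initial piece of the other edge `g` at `A`, which leaves the triangle through the side `CB`.
After `AB` is pulled to `ACB`, the edges `CB` and `g` have a crossing (with either label), which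
closes an empty loop at `A`. -/
def ReidemeisterI (D D' : LinkDiagram) : Prop :=
  ∃ A B C : Plane, ReplaceEdge D D' A B C ∧
    ∃ g ∈ D.otherEdges A B, A ∈ g ∧ (edgeSegment g ∩ openSegment ℝ C B).Nonempty ∧
      ∀ e ∈ D.otherEdges A B, e ≠ g → Misses e A B C

/-- Reidemeister move of type II, creating two crossings: besides `AB` the triangle `ABC` contains
only a piece of one edge `g`, which cuts off the corner `C`. After `AB` is pulled to `ACB` this
path crosses `g` twice, being above `g` both times or below `g` both times. -/
def ReidemeisterII (D D' : LinkDiagram) : Prop :=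
  ∃ A B C : Plane, ReplaceEdge D D' A B C ∧
    ∃ g ∈ D.otherEdges A B,
      edgeSegment g ∩ segment ℝ A B = ∅ ∧ (∀ v ∈ g, v ∉ convexHull ℝ {A, B, C}) ∧
      (edgeSegment g ∩ convexHull ℝ {A, B, C}).Nonempty ∧
      (D'.isOver g s(A, C) ↔ D'.isOver g s(C, B)) ∧
      ∀ e ∈ D.otherEdges A B, e ≠ g → Misses e A B C

/-- Reidemeister move of type III: besides `AB` the triangle `ABC` contains only pieces of two edges
`g` and `h` that cross each other inside it and lead from `AB` to `AC` or `CB`. The edge `AB` is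
pulled across this crossing. All labels are kept, and of the three strands involved one is
on top, one in the middle and one at the bottom (neither of the two cyclic labellings). -/
def ReidemeisterIII (D D' : LinkDiagram) : Prop :=
  ∃ A B C : Plane, ReplaceEdge D D' A B C ∧
    ∃ g ∈ D.otherEdges A B, ∃ h ∈ D.otherEdges A B, g ≠ h ∧
      RunsThrough g A B C ∧ RunsThrough h A B C ∧
      (edgeSegment g ∩ edgeSegment h ∩ convexHull ℝ {A, B, C}).Nonempty ∧
      SameLabel D D' g A B C ∧ SameLabel D D' h A B C ∧
      ¬ (D.isOver s(A, B) g ∧ D.isOver g h ∧ D.isOver h s(A, B)) ∧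
      ¬ (D.isOver g s(A, B) ∧ D.isOver s(A, B) h ∧ D.isOver h g) ∧
      ∀ e ∈ D.otherEdges A B, e ≠ g → e ≠ h → Misses e A B C

/-- A Reidemeister move: type I, II or III, in either direction. -/
def ReidemeisterMove (D D' : LinkDiagram) : Prop :=
  (ReidemeisterI D D' ∨ ReidemeisterII D D' ∨ ReidemeisterIII D D') ∨
    (ReidemeisterI D' D ∨ ReidemeisterII D' D ∨ ReidemeisterIII D' D)

/-- `D.TransformsIn m D'`: the diagram `D` can be transformed to `D'` using `m` Reidemeister moves,
where diagrams are considered up to planar isotopy, so that isotopy steps are not counted. -/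
inductive TransformsIn : ℕ → LinkDiagram → LinkDiagram → Prop
  | refl (D : LinkDiagram) : TransformsIn 0 D D
  | isotopy {m : ℕ} {D D' D'' : LinkDiagram} :
      TransformsIn m D D' → IsotopyStep D' D'' → TransformsIn m D D''
  | move {m : ℕ} {D D' D'' : LinkDiagram} :
      TransformsIn m D D' → ReidemeisterMove D' D'' → TransformsIn (m + 1) D D''

end LinkDiagram

/-! ### Regular projections and their diagrams -/

/-- Orthogonal projection onto a plane with orthonormal directions `b 0`, `b 1` and normal vector
`b 2`, in the coordinates of that plane. -/
noncomputable def planeProj (b : OrthonormalBasis (Fin 3) ℝ Space) : Space →ₗ[ℝ] Plane where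
  toFun p := !₂[inner ℝ (b 0) p, inner ℝ (b 1) p]
  map_add' p q := by
    ext i
    fin_cases i <;> simp [inner_add_right]
  map_smul' c p := by
    ext i
    fin_cases i <;> simp [inner_smul_right]

/-- The height of a point over the plane of projection. -/
noncomputable def planeHeight (b : OrthonormalBasis (Fin 3) ℝ Space) : Space →ₗ[ℝ] ℝ :=
  innerₗ Space (b 2)

theorem eq_of_planeProj_of_planeHeight (b : OrthonormalBasis (Fin 3) ℝ Space) {p q : Space}
    (h : planeProj b p = planeProj b q) (h' : planeHeight b p = planeHeight b q) : p = q := by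
  apply b.repr.injective
  ext i
  rw [b.repr_apply_apply, b.repr_apply_apply]
  have h0 := congrArg (fun x : Plane => x 0) h
  have h1 := congrArg (fun x : Plane => x 1) h
  simp [planeProj] at h0 h1
  simp [planeHeight] at h'
  fin_cases i
  · exact h0
  · exact h1
  · exact h'

theorem edgeSegment_mk {V : Type*} [AddCommGroup V] [Module ℝ V] (a c : V) :
    edgeSegment s(a, c) = segment ℝ a c := by
  rw [← convexHull_pair]
  unfold edgeSegment
  congr 1
  ext x
  simp

theorem mem_edgeSegment {V : Type*} [AddCommGroup V] [Module ℝ V] {e : Sym2 V} {v : V}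
    (h : v ∈ e) : v ∈ edgeSegment e := subset_convexHull ℝ _ h

theorem edgeSegment_map {V W : Type*} [AddCommGroup V] [Module ℝ V] [AddCommGroup W] [Module ℝ W]
    (f : V →ₗ[ℝ] W) (e : Sym2 V) : edgeSegment (Sym2.map f e) = f '' edgeSegment e := by
  unfold edgeSegment
  rw [f.image_convexHull]
  congr 1
  ext x
  simp [Sym2.mem_map]

theorem three_le_ncard {α : Type*} {s : Set α} (hs : s.Finite) {x y z : α} (hx : x ∈ s)
    (hy : y ∈ s) (hz : z ∈ s) (hxy : x ≠ y) (hxz : x ≠ z) (hyz : y ≠ z) : 3 ≤ s.ncard := by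
  have : ({x, y, z} : Set α).ncard = 3 := Set.ncard_eq_three.2 ⟨x, y, z, hxy, hxz, hyz, rfl⟩
  rw [← this]
  refine Set.ncard_le_ncard ?_ hs
  rintro w (rfl | rfl | rfl) <;> assumption

namespace PolygonalLink

/-- The projection of the link is regular: at most two edges meet the pre-image of any point.
A vertex already lies on two edges, so the condition excludes edges that project to a
point, vertices that project onto a further edge, overlapping projections of edges and
triple points: what remains are finitely many transverse crossings of the interiors of two edges. -/
def IsRegular (b : OrthonormalBasis (Fin 3) ℝ Space) (L : PolygonalLink) : Prop :=
  ∀ x : Plane, {e ∈ L.edges | ∃ p ∈ edgeSegment e, planeProj b p = x}.ncard ≤ 2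

variable {b : OrthonormalBasis (Fin 3) ℝ Space} {L : PolygonalLink}

theorem IsRegular.false_of_three (h : L.IsRegular b) (x : Plane) {e f g : Sym2 Space}
    (he : e ∈ L.edges) (hf : f ∈ L.edges) (hg : g ∈ L.edges)
    (hef : e ≠ f) (heg : e ≠ g) (hfg : f ≠ g)
    (hxe : ∃ p ∈ edgeSegment e, planeProj b p = x)
    (hxf : ∃ p ∈ edgeSegment f, planeProj b p = x)
    (hxg : ∃ p ∈ edgeSegment g, planeProj b p = x) : False := by
  have h3 := three_le_ncard (L.finite.subset (Set.sep_subset _ _))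
    (s := {e ∈ L.edges | ∃ p ∈ edgeSegment e, planeProj b p = x})
    ⟨he, hxe⟩ ⟨hf, hxf⟩ ⟨hg, hxg⟩ hef heg hfg
  have := h x
  omega

theorem exists_other_edge {e : Sym2 Space} (he : e ∈ L.edges) {v : Space}
    (hv : v ∈ e) : ∃ f ∈ L.edges, v ∈ f ∧ f ≠ e := by
  obtain ⟨f, hf, hfe⟩ := Set.exists_ne_of_one_lt_ncard
    (s := {f ∈ L.edges | v ∈ f}) (by rw [L.two_edges e he v hv]; norm_num) e
  exact ⟨f, hf.1, hf.2, hfe⟩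

/-- The projection separates the vertices. -/
theorem IsRegular.vertex_inj (h : L.IsRegular b) {e f : Sym2 Space} (he : e ∈ L.edges)
    (hf : f ∈ L.edges) {v w : Space} (hv : v ∈ e) (hw : w ∈ f)
    (hvw : planeProj b v = planeProj b w) : v = w := by
  by_contra hne
  obtain ⟨e', he', hve', hee'⟩ := exists_other_edge he hv
  have key : ∀ g ∈ L.edges, w ∈ g → g = e ∨ g = e' := by
    intro g hg hwg
    by_contra hcon
    push Not at hcon
    exact h.false_of_three (planeProj b v) he he' hg hee'.symm hcon.1.symm hcon.2.symm
      ⟨v, mem_edgeSegment hv, rfl⟩ ⟨v, mem_edgeSegment hve', rfl⟩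
      ⟨w, mem_edgeSegment hwg, hvw.symm⟩
  obtain ⟨f', hf', hwf', hff'⟩ := exists_other_edge hf hw
  have hwe : w ∈ e ∧ w ∈ e' := by
    rcases key f hf hw with h1 | h1 <;> rcases key f' hf' hwf' with h2 | h2 <;> subst h1 <;>
      first
        | exact absurd h2 hff'
        | (subst h2; exact ⟨by assumption, by assumption⟩)
  exact hee' ((Sym2.mem_and_mem_iff hne).1 ⟨hve', hwe.2⟩ ▸
    ((Sym2.mem_and_mem_iff hne).1 ⟨hv, hwe.1⟩).symm)

/-- The projection is injective on each edge. -/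
theorem IsRegular.edge_inj (h : L.IsRegular b) {e : Sym2 Space} (he : e ∈ L.edges) {p q : Space}
    (hp : p ∈ edgeSegment e) (hq : q ∈ edgeSegment e) (hpq : planeProj b p = planeProj b q) :
    p = q := by
  induction e using Sym2.ind with
  | _ a c =>
    have hac : planeProj b a ≠ planeProj b c := fun hac =>
      L.not_isDiag _ he (Sym2.mk_isDiag_iff.2
        (h.vertex_inj he he (Sym2.mem_mk_left a c) (Sym2.mem_mk_right a c) hac))
    rw [edgeSegment_mk, segment_eq_image'] at hp hq
    obtain ⟨s, -, rfl⟩ := hp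
    obtain ⟨t, -, rfl⟩ := hq
    have : (s - t) • (planeProj b c - planeProj b a) = 0 := by
      simp only [map_add, map_smul, map_sub] at hpq
      rw [sub_smul, sub_eq_zero]
      exact add_left_cancel hpq
    rcases smul_eq_zero.1 this with h1 | h1
    · rw [sub_eq_zero.1 h1]
    · exact absurd (sub_eq_zero.1 h1).symm hac

theorem IsRegular.map_inj (h : L.IsRegular b) :
    Set.InjOn (Sym2.map (planeProj b)) L.edges := by
  intro e he f hf hef
  refine Sym2.ext fun v => ⟨fun hv => ?_, fun hv => ?_⟩
  · have : planeProj b v ∈ Sym2.map (planeProj b) f := hef ▸ Sym2.mem_map.2 ⟨v, hv, rfl⟩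
    obtain ⟨w, hw, hwv⟩ := Sym2.mem_map.1 this
    exact h.vertex_inj hf he hw hv hwv ▸ hw
  · have : planeProj b v ∈ Sym2.map (planeProj b) e := hef ▸ Sym2.mem_map.2 ⟨v, hv, rfl⟩
    obtain ⟨w, hw, hwv⟩ := Sym2.mem_map.1 this
    exact h.vertex_inj he hf hw hv hwv ▸ hw

/-- The projections of two edges with a common vertex have no other common point. -/
theorem IsRegular.eq_of_adjacent (h : L.IsRegular b) {e f : Sym2 Space} (he : e ∈ L.edges)
    (hf : f ∈ L.edges) {v : Space} (hve : v ∈ e) (hvf : v ∈ f) {p q : Space}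
    (hp : p ∈ edgeSegment e) (hq : q ∈ edgeSegment f) (hpq : planeProj b p = planeProj b q) :
    p = q := by
  by_cases hef : e = f
  · subst hef
    exact h.edge_inj he hp hq hpq
  obtain ⟨a, rfl⟩ := hve
  obtain ⟨c, rfl⟩ := hvf
  have hac : a ≠ c := fun hac => hef (by rw [hac])
  have hva : v ≠ a := fun hva => L.not_isDiag _ he (Sym2.mk_isDiag_iff.2 hva)
  have hvc : v ≠ c := fun hvc => L.not_isDiag _ hf (Sym2.mk_isDiag_iff.2 hvc)
  -- the projection of the far end of one edge is not on the projection of the other edge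
  have key : ∀ x y : Space, s(v, x) ∈ L.edges → s(v, y) ∈ L.edges → x ≠ y → v ≠ x →
      ∀ r : ℝ, 0 ≤ r → r ≤ 1 →
      planeProj b x - planeProj b v ≠ r • (planeProj b y - planeProj b v) := by
    intro x y hx hy hxy hvx r hr0 hr1 hr
    obtain ⟨g, hg, hxg, hgx⟩ := exists_other_edge hx (Sym2.mem_mk_right v x)
    have hgy : s(v, y) ≠ g := by
      rintro rfl
      rcases Sym2.mem_iff.1 hxg with h1 | h1
      · exact hvx h1.symm
      · exact hxy h1
    refine h.false_of_three (planeProj b x) hx hy hg ?_ hgx.symm hgy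
      ⟨x, mem_edgeSegment (Sym2.mem_mk_right v x), rfl⟩ ⟨v + r • (y - v), ?_, ?_⟩
      ⟨x, mem_edgeSegment hxg, rfl⟩
    · intro heq
      exact hxy (Sym2.congr_right.1 heq)
    · rw [edgeSegment_mk, segment_eq_image']
      exact ⟨r, ⟨hr0, hr1⟩, rfl⟩
    · rw [map_add, map_smul, map_sub, ← hr]
      abel
  rw [edgeSegment_mk, segment_eq_image'] at hp hq
  obtain ⟨s, ⟨hs0, -⟩, rfl⟩ := hp
  obtain ⟨t, ⟨ht0, -⟩, rfl⟩ := hq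
  have hst : s • (planeProj b a - planeProj b v) = t • (planeProj b c - planeProj b v) := by
    simp only [map_add, map_smul, map_sub] at hpq
    exact add_left_cancel hpq
  rcases le_total t s with hts | hts
  · rcases hs0.eq_or_lt with hs | hs
    · have ht : t = 0 := le_antisymm (hs ▸ hts) ht0
      simp [← hs, ht]
    · refine absurd ?_ (key a c he hf hac hva (t / s) (by positivity) ((div_le_one hs).2 hts))
      rw [div_eq_inv_mul, mul_smul, ← hst, smul_smul, inv_mul_cancel₀ hs.ne', one_smul]
  · rcases ht0.eq_or_lt with ht | ht
    · have hs : s = 0 := le_antisymm (ht ▸ hts) hs0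
      simp [← ht, hs]
    · refine absurd ?_ (key c a hf he hac.symm hvc (s / t) (by positivity) ((div_le_one ht).2 hts))
      rw [div_eq_inv_mul, mul_smul, hst, smul_smul, inv_mul_cancel₀ ht.ne', one_smul]

/-- At a common point of the projections of two edges, the first edge is strictly above the
second one. -/
def Above (b : OrthonormalBasis (Fin 3) ℝ Space) (e f : Sym2 Space) : Prop :=
  ∃ p ∈ edgeSegment e, ∃ q ∈ edgeSegment f,
    planeProj b p = planeProj b q ∧ planeHeight b q < planeHeight b p

/-- Two edges without common vertex are not each above the other. -/
theorem not_above_of_above {e f : Sym2 Space} (he : e ∈ L.edges) (hf : f ∈ L.edges)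
    (hv : ∀ v ∈ e, v ∉ f) (h1 : Above b e f) : ¬ Above b f e := by
  rintro ⟨q', hq', p', hp', hpq', hh'⟩
  obtain ⟨p, hp, q, hq, hpq, hh⟩ := h1
  set x := planeHeight b p - planeHeight b q with hx
  set y := planeHeight b q' - planeHeight b p' with hy
  have hx0 : 0 < x := sub_pos.2 hh
  have hy0 : 0 < y := sub_pos.2 hh'
  have hxy : x + y ≠ 0 := by positivity
  have hsum : y / (x + y) + x / (x + y) = 1 := by field_simp; ring
  have hP : (y / (x + y)) • p + (x / (x + y)) • p' ∈ edgeSegment e :=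
    (convex_convexHull ℝ _) hp hp' (by positivity) (by positivity) hsum
  have hQ : (y / (x + y)) • q + (x / (x + y)) • q' ∈ edgeSegment f :=
    (convex_convexHull ℝ _) hq hq' (by positivity) (by positivity) hsum
  have heq : (y / (x + y)) • p + (x / (x + y)) • p' = (y / (x + y)) • q + (x / (x + y)) • q' := by
    apply eq_of_planeProj_of_planeHeight b
    · simp only [map_add, map_smul, hpq, hpq']
    · simp only [map_add, map_smul, smul_eq_mul]
      have e1 : planeHeight b p = x + planeHeight b q := by rw [hx]; ring
      have e2 : planeHeight b q' = y + planeHeight b p' := by rw [hy]; ring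
      rw [e1, e2]
      field_simp
      ring
  have hne : e ≠ f := by
    rintro rfl
    induction e using Sym2.ind with
    | _ a c => exact hv a (Sym2.mem_mk_left a c) (Sym2.mem_mk_left a c)
  have := L.embedded e he f hf hne ⟨hP, heq ▸ hQ⟩
  exact hv _ this.1 this.2

/-- The link diagram obtained from a regular projection of the link: its edges are the projections
of the edges of the link, and the higher edge at a crossing is the overcrossing one. -/
noncomputable def diagram (b : OrthonormalBasis (Fin 3) ℝ Space) (L : PolygonalLink)
    (h : L.IsRegular b) : LinkDiagram where
  edges := Sym2.map (planeProj b) '' L.edges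
  isOver e' f' := ∃ e ∈ L.edges, ∃ f ∈ L.edges,
    Sym2.map (planeProj b) e = e' ∧ Sym2.map (planeProj b) f = f' ∧ Above b e f
  finite := L.finite.image _
  not_isDiag := by
    rintro _ ⟨e, he, rfl⟩
    induction e using Sym2.ind with
    | _ a c =>
      intro hd
      rw [Sym2.map_mk, Sym2.mk_isDiag_iff] at hd
      exact L.not_isDiag _ he (Sym2.mk_isDiag_iff.2
        (h.vertex_inj he he (Sym2.mem_mk_left a c) (Sym2.mem_mk_right a c) hd))
  two_edges := by
    rintro _ ⟨e, he, rfl⟩ v' hv'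
    obtain ⟨v, hv, rfl⟩ := Sym2.mem_map.1 hv'
    refine Eq.trans ?_ (L.two_edges e he v hv)
    rw [← Set.InjOn.ncard_image (h.map_inj.mono (Set.sep_subset L.edges fun f => v ∈ f))]
    congr 1
    ext f'
    constructor
    · rintro ⟨⟨f, hf, rfl⟩, hvf⟩
      obtain ⟨w, hw, hwv⟩ := Sym2.mem_map.1 hvf
      exact ⟨f, ⟨hf, h.vertex_inj hf he hw hv hwv ▸ hw⟩, rfl⟩
    · rintro ⟨f, ⟨hf, hvf⟩, rfl⟩
      exact ⟨⟨f, hf, rfl⟩, Sym2.mem_map.2 ⟨v, hvf, rfl⟩⟩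
  at_most_two := by
    intro x
    have hfin : {e ∈ L.edges | ∃ p ∈ edgeSegment e, planeProj b p = x}.Finite :=
      L.finite.subset (Set.sep_subset _ _)
    refine le_trans (le_trans (Set.ncard_le_ncard ?_ (hfin.image (Sym2.map (planeProj b))))
      (Set.ncard_image_le hfin)) (h x)
    rintro _ ⟨⟨e, he, rfl⟩, hx⟩
    rw [edgeSegment_map] at hx
    exact ⟨e, ⟨he, hx⟩, rfl⟩
  over_crossing := by
    rintro _ _ ⟨e, he, f, hf, rfl, rfl, p, hp, q, hq, hpq, hh⟩
    refine ⟨⟨e, he, rfl⟩, ⟨f, hf, rfl⟩, ?_, planeProj b p, ?_, ?_⟩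
    · intro v' hve hvf
      obtain ⟨v, hv, rfl⟩ := Sym2.mem_map.1 hve
      obtain ⟨w, hw, hwv⟩ := Sym2.mem_map.1 hvf
      have hvw := h.vertex_inj hf he hw hv hwv
      subst hvw
      rw [h.eq_of_adjacent he hf hv hw hp hq hpq] at hh
      exact lt_irrefl _ hh
    · rw [edgeSegment_map]
      exact ⟨p, hp, rfl⟩
    · rw [edgeSegment_map]
      exact ⟨q, hq, hpq.symm⟩
  over_or_under := by
    rintro _ ⟨e, he, rfl⟩ _ ⟨f, hf, rfl⟩ hv ⟨x, hxe, hxf⟩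
    have hv' : ∀ v ∈ e, v ∉ f := fun v hve hvf =>
      hv _ (Sym2.mem_map.2 ⟨v, hve, rfl⟩) (Sym2.mem_map.2 ⟨v, hvf, rfl⟩)
    rw [edgeSegment_map] at hxe hxf
    obtain ⟨p, hp, rfl⟩ := hxe
    obtain ⟨q, hq, hqp⟩ := hxf
    have hne : e ≠ f := by
      rintro rfl
      induction e using Sym2.ind with
      | _ a c => exact hv' a (Sym2.mem_mk_left a c) (Sym2.mem_mk_left a c)
    constructor
    · rintro ⟨e₁, he₁, f₁, hf₁, hee, hff, hab⟩ ⟨f₂, hf₂, e₂, he₂, hff', hee', hba⟩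
      rw [h.map_inj he₁ he hee, h.map_inj hf₁ hf hff] at hab
      rw [h.map_inj he₂ he hee', h.map_inj hf₂ hf hff'] at hba
      exact not_above_of_above he hf hv' hab hba
    · intro hno
      refine ⟨e, he, f, hf, rfl, rfl, p, hp, q, hq, hqp.symm, ?_⟩
      rcases lt_trichotomy (planeHeight b q) (planeHeight b p) with hlt | heq | hgt
      · exact hlt
      · have hpq := eq_of_planeProj_of_planeHeight b hqp heq
        have := L.embedded e he f hf hne ⟨hp, hpq ▸ hq⟩
        exact absurd this.2 (hv' _ this.1)
      · exact absurd ⟨f, hf, e, he, rfl, rfl, q, hq, p, hp, hqp, hgt⟩ hno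

end PolygonalLink

/-! ### Shadows of edges and good edge sets -/

/-- The projection of a spatial edge to the plane. -/
def sh (b : OrthonormalBasis (Fin 3) ℝ Space) (e : Sym2 Space) : Set Plane :=
  edgeSegment (Sym2.map (planeProj b) e)

theorem sh_mk (b : OrthonormalBasis (Fin 3) ℝ Space) (p q : Space) :
    sh b s(p, q) = segment ℝ (planeProj b p) (planeProj b q) := by
  rw [sh, Sym2.map_mk, edgeSegment_mk]

theorem mem_sh_iff {b : OrthonormalBasis (Fin 3) ℝ Space} {e : Sym2 Space} {x : Plane} :
    x ∈ sh b e ↔ ∃ p ∈ edgeSegment e, planeProj b p = x := by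
  rw [sh, edgeSegment_map]; rfl

theorem proj_mem_sh {b : OrthonormalBasis (Fin 3) ℝ Space} {e : Sym2 Space} {p : Space}
    (h : p ∈ edgeSegment e) : planeProj b p ∈ sh b e := mem_sh_iff.2 ⟨p, h, rfl⟩

theorem vertex_mem_sh {b : OrthonormalBasis (Fin 3) ℝ Space} {e : Sym2 Space} {p : Space}
    (h : p ∈ e) : planeProj b p ∈ sh b e := proj_mem_sh (mem_edgeSegment h)

/-- The edges form a finite graph all of whose vertices have degree two. -/
structure TwoRegular (E : Set (Sym2 Space)) : Prop where
  fin : E.Finite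
  nd : ∀ e ∈ E, ¬ e.IsDiag
  deg : ∀ e ∈ E, ∀ v ∈ e, {f ∈ E | v ∈ f}.ncard = 2

/-- The edges are those of a polygonal link whose projection is regular. -/
structure Good (b : OrthonormalBasis (Fin 3) ℝ Space) (E : Set (Sym2 Space)) : Prop extends
    TwoRegular E where
  sp : ∀ e ∈ E, ∀ f ∈ E, (∀ v ∈ e, v ∉ f) → Disjoint (edgeSegment e) (edgeSegment f)
  tr : ∀ e ∈ E, ∀ f ∈ E, ∀ g ∈ E, e ≠ f → e ≠ g → f ≠ g →
    ∀ x, x ∈ sh b e → x ∈ sh b f → x ∉ sh b g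

theorem exists_eq_mk_of_mem {α : Type*} {e : Sym2 α} {v : α} (h : v ∈ e) :
    ∃ a, e = s(v, a) := h

theorem TwoRegular.other {E : Set (Sym2 Space)} (h : TwoRegular E) {e : Sym2 Space} (he : e ∈ E)
    {v : Space} (hv : v ∈ e) : ∃ f ∈ E, v ∈ f ∧ f ≠ e := by
  obtain ⟨f, hf, hfe⟩ := Set.exists_ne_of_one_lt_ncard
    (s := {f ∈ E | v ∈ f}) (by rw [h.deg e he v hv]; norm_num) e
  exact ⟨f, hf.1, hf.2, hfe⟩

theorem TwoRegular.not_three {E : Set (Sym2 Space)} (h : TwoRegular E) {e f g : Sym2 Space}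
    (he : e ∈ E) (hf : f ∈ E) (hg : g ∈ E) (hef : e ≠ f) (heg : e ≠ g) (hfg : f ≠ g)
    {v : Space} (hve : v ∈ e) (hvf : v ∈ f) (hvg : v ∈ g) : False := by
  have h3 := three_le_ncard (h.fin.subset (Set.sep_subset _ _)) (s := {f ∈ E | v ∈ f})
    ⟨he, hve⟩ ⟨hf, hvf⟩ ⟨hg, hvg⟩ hef heg hfg
  rw [h.deg e he v hve] at h3
  omega

section segments

variable {V : Type*} [AddCommGroup V] [Module ℝ V]

theorem overlap_aux {p q r s x y : V} {α β γ δ : ℝ} (hα : 0 ≤ α) (hαβ : α < β)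
    (hβ : β ≤ 1) (hγ : 0 ≤ γ) (hγδ : γ < δ) (hδ : δ ≤ 1)
    (h1 : x = p + α • (q - p)) (h2 : y = p + β • (q - p))
    (h3 : x = r + γ • (s - r)) (h4 : y = r + δ • (s - r)) :
    r ∈ segment ℝ p q ∨ p ∈ segment ℝ r s := by
  set κ := (β - α) / (δ - γ) with hκ
  have hκ0 : 0 < κ := div_pos (by linarith) (by linarith)
  have hδγ : δ - γ ≠ 0 := by linarith
  have hd : (δ - γ) • (s - r) = (β - α) • (q - p) := by
    have : y - x = y - x := rfl
    nth_rewrite 1 [h4, h3] at this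
    rw [h1, h2] at this
    rw [sub_smul, sub_smul]
    rwa [add_sub_add_left_eq_sub, add_sub_add_left_eq_sub] at this
  have hs : s - r = κ • (q - p) := by
    rw [hκ, div_eq_inv_mul, mul_smul, ← hd, smul_smul, inv_mul_cancel₀ hδγ, one_smul]
  have hr : r = p + (α - γ * κ) • (q - p) := by
    have : r = x - γ • (s - r) := by rw [h3]; abel
    rw [this, h1, hs, smul_smul, sub_smul]; abel
  rcases le_or_gt 0 (α - γ * κ) with h | h
  · left
    rw [segment_eq_image']
    exact ⟨_, ⟨h, by nlinarith⟩, hr.symm⟩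
  · right
    rw [segment_eq_image']
    refine ⟨(γ * κ - α) / κ, ⟨by apply div_nonneg <;> linarith, ?_⟩, ?_⟩
    · rw [div_le_one hκ0]; nlinarith
    · change r + ((γ * κ - α) / κ) • (s - r) = p
      rw [hs, smul_smul, div_mul_cancel₀ _ hκ0.ne', hr, add_assoc, ← add_smul]
      simp

/-- Two segments with two common points overlap: an end of one of them lies on the other one. -/
theorem segment_overlap {p q r s x y : V} (hxy : x ≠ y) (h1 : x ∈ segment ℝ p q)
    (h2 : y ∈ segment ℝ p q) (h3 : x ∈ segment ℝ r s) (h4 : y ∈ segment ℝ r s) :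
    r ∈ segment ℝ p q ∨ s ∈ segment ℝ p q ∨ p ∈ segment ℝ r s ∨ q ∈ segment ℝ r s := by
  have hsym : ∀ {a c : V} (t : ℝ), a + t • (c - a) = c + (1 - t) • (a - c) := by
    intro a c t; module
  rw [segment_eq_image'] at h1 h2 h3 h4
  obtain ⟨α, ⟨hα0, hα1⟩, h1⟩ := h1
  obtain ⟨β, ⟨hβ0, hβ1⟩, h2⟩ := h2
  obtain ⟨γ, ⟨hγ0, hγ1⟩, h3⟩ := h3
  obtain ⟨δ, ⟨hδ0, hδ1⟩, h4⟩ := h4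
  simp only at h1 h2 h3 h4
  have hαβ : α ≠ β := by rintro rfl; exact hxy (h1.symm.trans h2)
  have hγδ : γ ≠ δ := by rintro rfl; exact hxy (h3.symm.trans h4)
  have h1' := (hsym α).symm.trans h1
  have h2' := (hsym β).symm.trans h2
  have h3' := (hsym γ).symm.trans h3
  have h4' := (hsym δ).symm.trans h4
  rcases lt_or_gt_of_ne hαβ with h | h <;> rcases lt_or_gt_of_ne hγδ with h' | h'
  · have := overlap_aux hα0 h hβ1 hγ0 h' hδ1 h1.symm h2.symm h3.symm h4.symm
    tauto
  · have := overlap_aux (γ := 1 - γ) (δ := 1 - δ) hα0 h hβ1 (by linarith) (by linarith)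
      (by linarith) h1.symm h2.symm h3'.symm h4'.symm
    rw [segment_symm ℝ s r] at this
    tauto
  · have := overlap_aux (α := 1 - α) (β := 1 - β) (by linarith) (by linarith) (by linarith) hγ0 h'
      hδ1 h1'.symm h2'.symm h3.symm h4.symm
    rw [segment_symm ℝ q p] at this
    tauto
  · have := overlap_aux (α := 1 - α) (β := 1 - β) (γ := 1 - γ) (δ := 1 - δ) (by linarith)
      (by linarith) (by linarith) (by linarith) (by linarith) (by linarith)
      h1'.symm h2'.symm h3'.symm h4'.symm
    rw [segment_symm ℝ q p, segment_symm ℝ s r] at this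
    tauto

/-- Two segments starting at `v` with a further common point overlap. -/
theorem segment_overlap_of_common {v a c x : V} (hxv : x ≠ v) (h1 : x ∈ segment ℝ v a)
    (h2 : x ∈ segment ℝ v c) : a ∈ segment ℝ v c ∨ c ∈ segment ℝ v a := by
  rw [segment_eq_image'] at h1 h2
  obtain ⟨s, ⟨hs0, hs1⟩, h1⟩ := h1
  obtain ⟨t, ⟨ht0, ht1⟩, h2⟩ := h2
  simp only at h1 h2
  have hs : 0 < s := by
    rcases hs0.eq_or_lt with rfl | h
    · simp at h1; exact absurd h1.symm hxv
    · exact h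
  have ht : 0 < t := by
    rcases ht0.eq_or_lt with rfl | h
    · simp at h2; exact absurd h2.symm hxv
    · exact h
  have hst : s • (a - v) = t • (c - v) := by
    have := h1.trans h2.symm; exact add_left_cancel this
  rcases le_total t s with h | h
  · left
    rw [segment_eq_image']
    refine ⟨t / s, ⟨by positivity, (div_le_one hs).2 h⟩, ?_⟩
    change v + (t / s) • (c - v) = a
    rw [div_eq_inv_mul, mul_smul, ← hst, smul_smul, inv_mul_cancel₀ hs.ne', one_smul]; abel
  · right
    rw [segment_eq_image']
    refine ⟨s / t, ⟨by positivity, (div_le_one ht).2 h⟩, ?_⟩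
    change v + (s / t) • (a - v) = c
    rw [div_eq_inv_mul, mul_smul, hst, smul_smul, inv_mul_cancel₀ ht.ne', one_smul]; abel

end segments

namespace Good

variable {b : OrthonormalBasis (Fin 3) ℝ Space} {E : Set (Sym2 Space)}

theorem not_mem_sh (h : Good b E) {e f : Sym2 Space} (he : e ∈ E) (hf : f ∈ E) {v : Space}
    (hv : v ∈ e) (hvf : v ∉ f) : planeProj b v ∉ sh b f := by
  intro hx
  obtain ⟨g, hg, hvg, hge⟩ := h.other he hv
  exact h.tr e he g hg f hf hge.symm (by rintro rfl; exact hvf hv) (by rintro rfl; exact hvf hvg)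
    _ (vertex_mem_sh hv) (vertex_mem_sh hvg) hx

theorem vertex_inj (h : Good b E) {e f : Sym2 Space} (he : e ∈ E) (hf : f ∈ E) {v w : Space}
    (hv : v ∈ e) (hw : w ∈ f) (hvw : planeProj b v = planeProj b w) : v = w := by
  by_contra hne
  by_cases hvf : v ∈ f
  · obtain ⟨g, hg, hvg, hgf⟩ := h.other hf hvf
    have hwg : w ∉ g := fun hwg => hgf
      (((Sym2.mem_and_mem_iff hne).1 ⟨hvg, hwg⟩).trans ((Sym2.mem_and_mem_iff hne).1 ⟨hvf, hw⟩).symm)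
    exact h.not_mem_sh hf hg hw hwg (hvw ▸ vertex_mem_sh hvg)
  · exact h.not_mem_sh he hf hv hvf (hvw ▸ vertex_mem_sh hw)

theorem proj_ne (h : Good b E) {a c : Space} (he : s(a, c) ∈ E) :
    planeProj b a ≠ planeProj b c := fun hac =>
  h.nd _ he (Sym2.mk_isDiag_iff.2 (h.vertex_inj he he (Sym2.mem_mk_left a c)
    (Sym2.mem_mk_right a c) hac))

theorem ne (h : Good b E) {a c : Space} (he : s(a, c) ∈ E) : a ≠ c := fun hac =>
  h.proj_ne he (by rw [hac])

theorem edge_inj (h : Good b E) {e : Sym2 Space} (he : e ∈ E) {p q : Space}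
    (hp : p ∈ edgeSegment e) (hq : q ∈ edgeSegment e) (hpq : planeProj b p = planeProj b q) :
    p = q := by
  induction e using Sym2.ind with
  | _ a c =>
    have hac := h.proj_ne he
    rw [edgeSegment_mk, segment_eq_image'] at hp hq
    obtain ⟨s, -, rfl⟩ := hp
    obtain ⟨t, -, rfl⟩ := hq
    have : (s - t) • (planeProj b c - planeProj b a) = 0 := by
      simp only [map_add, map_smul, map_sub] at hpq
      rw [sub_smul, sub_eq_zero]
      exact add_left_cancel hpq
    rcases smul_eq_zero.1 this with h1 | h1
    · rw [sub_eq_zero.1 h1]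
    · exact absurd (sub_eq_zero.1 h1).symm hac

theorem adj (h : Good b E) {e f : Sym2 Space} (he : e ∈ E) (hf : f ∈ E) (hef : e ≠ f) {v : Space}
    (hve : v ∈ e) (hvf : v ∈ f) {x : Plane} (hxe : x ∈ sh b e) (hxf : x ∈ sh b f) :
    x = planeProj b v := by
  obtain ⟨a, rfl⟩ := exists_eq_mk_of_mem hve
  obtain ⟨c, rfl⟩ := exists_eq_mk_of_mem hvf
  have hac : a ≠ c := by rintro rfl; exact hef rfl
  by_contra hxv
  have hav := h.ne he
  have hcv := h.ne hf
  rw [sh_mk] at hxe hxf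
  rcases segment_overlap_of_common hxv hxe hxf with h1 | h1
  · exact h.not_mem_sh he hf (v := a) (by simp) (by simp [hac, hav.symm]) (by rwa [sh_mk])
  · exact h.not_mem_sh hf he (v := c) (by simp) (by simp [hac.symm, hcv.symm]) (by rwa [sh_mk])

theorem inter_subsingleton (h : Good b E) {e f : Sym2 Space} (he : e ∈ E) (hf : f ∈ E)
    (hef : e ≠ f) {x y : Plane} (hxe : x ∈ sh b e) (hxf : x ∈ sh b f) (hye : y ∈ sh b e)
    (hyf : y ∈ sh b f) : x = y := by
  by_cases hv : ∃ v ∈ e, v ∈ f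
  · obtain ⟨v, hve, hvf⟩ := hv
    rw [h.adj he hf hef hve hvf hxe hxf, h.adj he hf hef hve hvf hye hyf]
  · push Not at hv
    by_contra hxy
    induction e using Sym2.ind with
    | _ p q =>
    induction f using Sym2.ind with
    | _ r s =>
    rw [sh_mk] at hxe hxf hye hyf
    have hv' : ∀ v ∈ s(r, s), v ∉ s(p, q) := fun v h1 h2 => hv v h2 h1
    rcases segment_overlap hxy hxe hye hxf hyf with h1 | h1 | h1 | h1
    · exact h.not_mem_sh hf he (v := r) (by simp) (hv' _ (by simp)) (by rwa [sh_mk])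
    · exact h.not_mem_sh hf he (v := s) (by simp) (hv' _ (by simp)) (by rwa [sh_mk])
    · exact h.not_mem_sh he hf (v := p) (by simp) (hv _ (by simp)) (by rwa [sh_mk])
    · exact h.not_mem_sh he hf (v := q) (by simp) (hv _ (by simp)) (by rwa [sh_mk])

/-- The polygonal link with the given edges. -/
def toLink (h : Good b E) : PolygonalLink where
  edges := E
  finite := h.fin
  not_isDiag := h.nd
  two_edges := h.deg
  embedded := by
    rintro e he f hf hef p ⟨hpe, hpf⟩
    by_cases hv : ∃ v ∈ e, v ∈ f
    · obtain ⟨v, hve, hvf⟩ := hv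
      have := h.adj he hf hef hve hvf (proj_mem_sh hpe) (proj_mem_sh hpf)
      rw [h.edge_inj he hpe (mem_edgeSegment hve) this]
      exact ⟨hve, hvf⟩
    · push Not at hv
      exact absurd hpf (Set.disjoint_left.1 (h.sp e he f hf hv) hpe)

theorem embedded (h : Good b E) {e f : Sym2 Space} (he : e ∈ E) (hf : f ∈ E) (hef : e ≠ f)
    {p : Space} (hpe : p ∈ edgeSegment e) (hpf : p ∈ edgeSegment f) : p ∈ e ∧ p ∈ f :=
  h.toLink.embedded e he f hf hef ⟨hpe, hpf⟩

theorem regular (h : Good b E) : h.toLink.IsRegular b := by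
  intro x
  by_contra hcon
  push Not at hcon
  obtain ⟨e, he, f, hf, g, hg, hef, heg, hfg⟩ := (Set.two_lt_ncard
    (h.fin.subset (Set.sep_subset _ _))).1 hcon
  exact h.tr e he.1 f hf.1 g hg.1 hef heg hfg x (mem_sh_iff.2 he.2) (mem_sh_iff.2 hf.2)
    (mem_sh_iff.2 hg.2)

theorem of_link {L : PolygonalLink} (h : L.IsRegular b) : Good b L.edges where
  fin := L.finite
  nd := L.not_isDiag
  deg := L.two_edges
  sp := by
    intro e he f hf hv
    rw [Set.disjoint_left]
    intro p hpe hpf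
    have hef : e ≠ f := by
      rintro rfl
      induction e using Sym2.ind with
      | _ a c => exact hv a (by simp) (by simp)
    have := L.embedded e he f hf hef ⟨hpe, hpf⟩
    exact hv p this.1 this.2
  tr := by
    intro e he f hf g hg hef heg hfg x hxe hxf hxg
    exact h.false_of_three x he hf hg hef heg hfg (mem_sh_iff.1 hxe) (mem_sh_iff.1 hxf)
      (mem_sh_iff.1 hxg)

/-- The diagram of the projection. -/
noncomputable def diag (h : Good b E) : LinkDiagram := h.toLink.diagram b h.regular

theorem diag_edges (h : Good b E) : h.diag.edges = Sym2.map (planeProj b) '' E := rfl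

theorem map_inj (h : Good b E) : Set.InjOn (Sym2.map (planeProj b)) E := h.regular.map_inj

theorem isOver_iff (h : Good b E) {e f : Sym2 Space} (he : e ∈ E) (hf : f ∈ E) :
    h.diag.isOver (Sym2.map (planeProj b) e) (Sym2.map (planeProj b) f) ↔
      PolygonalLink.Above b e f := by
  constructor
  · rintro ⟨e', he', f', hf', hee, hff, hab⟩
    rwa [h.map_inj he' he hee, h.map_inj hf' hf hff] at hab
  · intro hab
    exact ⟨e, he, f, hf, rfl, rfl, hab⟩

end Good

/-! ### Transformations with a bounded number of moves -/

namespace LinkDiagram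

theorem IsotopyStep.symm {D D' : LinkDiagram} (h : IsotopyStep D D') : IsotopyStep D' D := by
  unfold IsotopyStep at *; tauto

theorem ReidemeisterMove.symm {D D' : LinkDiagram} (h : ReidemeisterMove D D') :
    ReidemeisterMove D' D := by
  unfold ReidemeisterMove at *; tauto

theorem TransformsIn.trans {m m' : ℕ} {D D' D'' : LinkDiagram} (h : TransformsIn m D D')
    (h' : TransformsIn m' D' D'') : TransformsIn (m + m') D D'' := by
  induction h' with
  | refl => exact h
  | isotopy _ hs ih => exact (ih h).isotopy hs
  | move _ hs ih => exact (ih h).move hs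

theorem TransformsIn.symm {m : ℕ} {D D' : LinkDiagram} (h : TransformsIn m D D') :
    TransformsIn m D' D := by
  induction h with
  | refl D => exact .refl D
  | isotopy _ hs ih =>
    have := ((TransformsIn.refl _).isotopy hs.symm).trans ih
    rwa [zero_add] at this
  | move _ hs ih =>
    have := ((TransformsIn.refl _).move hs.symm).trans ih
    rwa [zero_add, add_comm] at this

end LinkDiagram

/-- Both edge sets are good and the diagrams differ by at most `m` Reidemeister moves. -/
def Reach (b : OrthonormalBasis (Fin 3) ℝ Space) (m : ℕ) (E E' : Set (Sym2 Space)) : Prop :=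
  ∃ (h : Good b E) (h' : Good b E'), ∃ k ≤ m, LinkDiagram.TransformsIn k h.diag h'.diag

namespace Reach

variable {b : OrthonormalBasis (Fin 3) ℝ Space} {E E' E'' : Set (Sym2 Space)} {m m' : ℕ}

theorem left (h : Reach b m E E') : Good b E := h.1

theorem right (h : Reach b m E E') : Good b E' := h.2.1

theorem refl (h : Good b E) : Reach b 0 E E := ⟨h, h, 0, le_rfl, .refl _⟩

theorem symm (h : Reach b m E E') : Reach b m E' E := by
  obtain ⟨h1, h2, k, hk, ht⟩ := h
  exact ⟨h2, h1, k, hk, ht.symm⟩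

theorem trans (h : Reach b m E E') (h' : Reach b m' E' E'') : Reach b (m + m') E E'' := by
  obtain ⟨h1, h2, k, hk, ht⟩ := h
  obtain ⟨h3, h4, k', hk', ht'⟩ := h'
  exact ⟨h1, h4, k + k', by omega, ht.trans ht'⟩

theorem mono (h : Reach b m E E') (hm : m ≤ m') : Reach b m' E E' := by
  obtain ⟨h1, h2, k, hk, ht⟩ := h
  exact ⟨h1, h2, k, hk.trans hm, ht⟩

theorem of_isotopy (h : Good b E) (h' : Good b E') (hs : LinkDiagram.IsotopyStep h.diag h'.diag) :
    Reach b 0 E E' := ⟨h, h', 0, le_rfl, (LinkDiagram.TransformsIn.refl _).isotopy hs⟩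

theorem of_move (h : Good b E) (h' : Good b E')
    (hs : LinkDiagram.ReidemeisterMove h.diag h'.diag) :
    Reach b 1 E E' := ⟨h, h', 1, le_rfl, (LinkDiagram.TransformsIn.refl _).move hs⟩

end Reach

theorem reach_iff_of_links {b : OrthonormalBasis (Fin 3) ℝ Space} {L L' : PolygonalLink}
    (h : L.IsRegular b) (h' : L'.IsRegular b) {m : ℕ} (hr : Reach b m L.edges L'.edges) :
    ∃ k ≤ m, LinkDiagram.TransformsIn k (L.diagram b h) (L'.diagram b h') := by
  obtain ⟨_, _, k, hk, ht⟩ := hr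
  exact ⟨k, hk, ht⟩

/-! ### Triangles in the plane -/

/-- Twice the signed area of a triangle in the plane. -/
def tdet (p q r : Plane) : ℝ := (q 0 - p 0) * (r 1 - p 1) - (q 1 - p 1) * (r 0 - p 0)

theorem tdet_swap (p q r : Plane) : tdet q p r = - tdet p q r := by unfold tdet; ring

theorem tdet_rotate (p q r : Plane) : tdet q r p = tdet p q r := by unfold tdet; ring

theorem tdet_swap_right (p q r : Plane) : tdet p r q = - tdet p q r := by unfold tdet; ring

theorem tdet_comb (p q x y : Plane) {a c : ℝ} (h : a + c = 1) :
    tdet p q (a • x + c • y) = a * tdet p q x + c * tdet p q y := by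
  obtain rfl : c = 1 - a := by linarith
  simp [tdet]; ring

theorem tdet_self_left (p q : Plane) : tdet p q p = 0 := by unfold tdet; ring

theorem tdet_self_right (p q : Plane) : tdet p q q = 0 := by unfold tdet; ring

section
variable {V : Type*} [AddCommGroup V] [Module ℝ V]

theorem mem_triangle_iff {p q r x : V} : x ∈ convexHull ℝ {p, q, r} ↔
    ∃ α β γ : ℝ, 0 ≤ α ∧ 0 ≤ β ∧ 0 ≤ γ ∧ α + β + γ = 1 ∧ α • p + β • q + γ • r = x := by
  constructor
  · intro hx
    rw [convexHull_insert ⟨q, by simp⟩, convexHull_pair, mem_convexJoin] at hx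
    obtain ⟨p', rfl, y, ⟨c, d, hc, hd, hcd, rfl⟩, a, e, ha, he, hae, rfl⟩ := hx
    refine ⟨a, e * c, e * d, ha, by positivity, by positivity, ?_, ?_⟩
    · rw [add_assoc, ← mul_add, hcd, mul_one, hae]
    · rw [smul_add, smul_smul, smul_smul, add_assoc]
  · rintro ⟨α, β, γ, h1, h2, h3, h4, rfl⟩
    have hp : p ∈ convexHull ℝ {p, q, r} := subset_convexHull ℝ _ (by simp)
    have hq : q ∈ convexHull ℝ {p, q, r} := subset_convexHull ℝ _ (by simp)
    have hr : r ∈ convexHull ℝ {p, q, r} := subset_convexHull ℝ _ (by simp)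
    exact (convex_convexHull ℝ _).sum_mem (t := Finset.univ) (w := ![α, β, γ])
      (z := ![p, q, r]) (by intro i _; fin_cases i <;> simpa) (by simp [Fin.sum_univ_three, h4])
      (by intro i _; fin_cases i <;> simpa) |> fun h => by
        simpa [Fin.sum_univ_three] using h

theorem segment_subset_triangle₁₂ {p q r : V} : segment ℝ p q ⊆ convexHull ℝ {p, q, r} := by
  rw [← convexHull_pair]; exact convexHull_mono (by intro x; simp; tauto)

theorem segment_subset_triangle₁₃ {p q r : V} : segment ℝ p r ⊆ convexHull ℝ {p, q, r} := by
  rw [← convexHull_pair]; exact convexHull_mono (by intro x; simp; tauto)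

theorem segment_subset_triangle₂₃ {p q r : V} : segment ℝ q r ⊆ convexHull ℝ {p, q, r} := by
  rw [← convexHull_pair]; exact convexHull_mono (by intro x; simp; tauto)

theorem triangle_swap (p q r : V) : convexHull ℝ {q, p, r} = convexHull ℝ {p, q, r} := by
  rw [Set.insert_comm]

theorem triangle_swap_right (p q r : V) : convexHull ℝ {p, r, q} = convexHull ℝ {p, q, r} := by
  rw [Set.pair_comm]

end

theorem plane_ext {x y : Plane} (h0 : x 0 = y 0) (h1 : x 1 = y 1) : x = y := by
  ext i; fin_cases i <;> assumption

theorem tdet_barycentric {p q r x : Plane} (h : tdet p q r ≠ 0) :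
    (tdet q r x / tdet p q r) • p + (tdet r p x / tdet p q r) • q +
      (tdet p q x / tdet p q r) • r = x := by
  apply plane_ext <;> simp <;> field_simp <;> unfold tdet <;> ring

theorem tdet_barycentric_sum {p q r x : Plane} (h : tdet p q r ≠ 0) :
    tdet q r x / tdet p q r + tdet r p x / tdet p q r + tdet p q x / tdet p q r = 1 := by
  field_simp; unfold tdet; ring

theorem mem_triangle_of_tdet {p q r x : Plane} (h : tdet p q r ≠ 0)
    (h1 : 0 ≤ tdet q r x / tdet p q r) (h2 : 0 ≤ tdet r p x / tdet p q r)
    (h3 : 0 ≤ tdet p q x / tdet p q r) : x ∈ convexHull ℝ {p, q, r} :=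
  mem_triangle_iff.2 ⟨_, _, _, h1, h2, h3, tdet_barycentric_sum h, tdet_barycentric h⟩

theorem tdet_sum {p q r s t : Plane} {α β γ : ℝ} (h : α + β + γ = 1) :
    tdet s t (α • p + β • q + γ • r) = α * tdet s t p + β * tdet s t q + γ * tdet s t r := by
  obtain rfl : α = 1 - β - γ := by linarith
  simp [tdet]; ring

theorem affineIndependent_of_tdet {p q r : Plane} (h : tdet p q r ≠ 0) :
    AffineIndependent ℝ ![p, q, r] := by
  rw [affineIndependent_iff]
  intro s w hw hs i hi
  have key : ∀ w : Fin 3 → ℝ, ∑ i, w i = 0 → ∑ i, w i • (![p, q, r] i) = 0 → w = 0 := by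
    intro w hw hs
    simp only [Fin.sum_univ_three, Matrix.cons_val_zero, Matrix.cons_val_one,
      Matrix.cons_val] at hw hs
    have h0 := congrArg (fun x : Plane => x 0) hs
    have h1 := congrArg (fun x : Plane => x 1) hs
    simp at h0 h1
    have hw0 : w 0 = - w 1 - w 2 := by linarith
    rw [hw0] at h0 h1
    have e1 : w 1 * tdet p q r = 0 := by unfold tdet; linear_combination (r 1 - p 1) * h0 - (r 0 - p 0) * h1
    have e2 : w 2 * tdet p q r = 0 := by unfold tdet; linear_combination (q 0 - p 0) * h1 - (q 1 - p 1) * h0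
    have z1 : w 1 = 0 := (mul_eq_zero.1 e1).resolve_right h
    have z2 : w 2 = 0 := (mul_eq_zero.1 e2).resolve_right h
    funext i; fin_cases i
    · simp [hw0, z1, z2]
    · exact z1
    · exact z2
  have := key (fun i => if i ∈ s then w i else 0) (by simpa [Finset.sum_ite_mem] using hw)
    (by simpa [ite_smul, Finset.sum_ite_mem] using hs)
  simpa [hi] using congrFun this i

theorem tdet_eq_zero_of_mem_segment {p q x : Plane} (h : x ∈ segment ℝ p q) : tdet p q x = 0 := by
  obtain ⟨a, c, -, -, hac, rfl⟩ := h
  rw [tdet_comb _ _ _ _ hac, tdet_self_left, tdet_self_right]; ring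

theorem mem_segment_of_two {p q r : Plane} {α β γ : ℝ} (h1 : 0 ≤ α) (h2 : 0 ≤ β) (h3 : γ = 0)
    (h4 : α + β + γ = 1) : α • p + β • q + γ • r ∈ segment ℝ p q :=
  ⟨α, β, h1, h2, by linarith, by rw [h3, zero_smul, add_zero]⟩

theorem segment_exit {A B C z p : Plane} (hd : tdet A B C ≠ 0) (hz : z ∈ convexHull ℝ {A, B, C})
    (hp : p ∉ convexHull ℝ {A, B, C}) (hb : 0 ≤ tdet C A p / tdet A B C) :
    ∃ y ∈ segment ℝ z p, y ∈ segment ℝ A B ∨ y ∈ segment ℝ B C := by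
  obtain ⟨a0, b0, c0, ha0, hb0, hc0, h0, rfl⟩ := mem_triangle_iff.1 hz
  set a1 := tdet B C p / tdet A B C with ha1
  set b1 := tdet C A p / tdet A B C with hb1
  set c1 := tdet A B p / tdet A B C with hc1
  have h1 : a1 + b1 + c1 = 1 := tdet_barycentric_sum hd
  have hpe : a1 • A + b1 • B + c1 • C = p := tdet_barycentric hd
  have hneg : a1 < 0 ∨ c1 < 0 := by
    by_contra hcon
    push Not at hcon
    exact hp (mem_triangle_of_tdet hd hcon.1 hb hcon.2)
  have main : ∀ t : ℝ, 0 ≤ t → t ≤ 1 →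
      ((1 - t) * a0 + t * a1) • A + ((1 - t) * b0 + t * b1) • B + ((1 - t) * c0 + t * c1) • C ∈
        segment ℝ (a0 • A + b0 • B + c0 • C) p := by
    intro t ht0 ht1
    refine ⟨1 - t, t, by linarith, ht0, by ring, ?_⟩
    rw [← hpe]; module
  have hsum : ∀ t : ℝ, ((1 - t) * a0 + t * a1) + ((1 - t) * b0 + t * b1) +
      ((1 - t) * c0 + t * c1) = 1 := by
    intro t; linear_combination (1 - t) * h0 + t * h1
  have caseA : a1 < 0 → 0 ≤ (1 - a0 / (a0 - a1)) * c0 + a0 / (a0 - a1) * c1 →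
      ∃ y ∈ segment ℝ (a0 • A + b0 • B + c0 • C) p, y ∈ segment ℝ A B ∨ y ∈ segment ℝ B C := by
    intro hneg hc
    have hpos : 0 < a0 - a1 := by linarith
    have ht0 : 0 ≤ a0 / (a0 - a1) := by positivity
    have ht1 : a0 / (a0 - a1) ≤ 1 := by rw [div_le_one hpos]; linarith
    refine ⟨_, main _ ht0 ht1, Or.inr ?_⟩
    rw [add_assoc, add_comm]
    refine mem_segment_of_two ?_ hc ?_ ?_
    · have : 0 ≤ 1 - a0 / (a0 - a1) := by linarith
      positivity
    · field_simp; ring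
    · linear_combination hsum (a0 / (a0 - a1))
  have caseC : c1 < 0 → 0 ≤ (1 - c0 / (c0 - c1)) * a0 + c0 / (c0 - c1) * a1 →
      ∃ y ∈ segment ℝ (a0 • A + b0 • B + c0 • C) p, y ∈ segment ℝ A B ∨ y ∈ segment ℝ B C := by
    intro hneg hc
    have hpos : 0 < c0 - c1 := by linarith
    have ht0 : 0 ≤ c0 / (c0 - c1) := by positivity
    have ht1 : c0 / (c0 - c1) ≤ 1 := by rw [div_le_one hpos]; linarith
    refine ⟨_, main _ ht0 ht1, Or.inl ?_⟩
    refine mem_segment_of_two hc ?_ ?_ (hsum _)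
    · have : 0 ≤ 1 - c0 / (c0 - c1) := by linarith
      positivity
    · field_simp; ring
  by_cases hA : a1 < 0
  · by_cases hC : c1 < 0
    · have hpa : 0 < a0 - a1 := by linarith
      have hpc : 0 < c0 - c1 := by linarith
      rcases le_total (a0 * (c0 - c1)) (c0 * (a0 - a1)) with h | h
      · apply caseA hA
        have : (1 - a0 / (a0 - a1)) * c0 + a0 / (a0 - a1) * c1 =
          (c0 * (a0 - a1) - a0 * (c0 - c1)) / (a0 - a1) := by field_simp; ring
        rw [this]; apply div_nonneg <;> linarith
      · apply caseC hC
        have : (1 - c0 / (c0 - c1)) * a0 + c0 / (c0 - c1) * a1 =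
          (a0 * (c0 - c1) - c0 * (a0 - a1)) / (c0 - c1) := by field_simp; ring
        rw [this]; apply div_nonneg <;> linarith
    · apply caseA hA
      have hpa : 0 < a0 - a1 := by linarith
      have : a0 / (a0 - a1) ≤ 1 := by rw [div_le_one hpa]; linarith
      have : 0 ≤ 1 - a0 / (a0 - a1) := by linarith
      push Not at hC
      positivity
  · have hC : c1 < 0 := hneg.resolve_left hA
    push Not at hA
    apply caseC hC
    have hpa : 0 < c0 - c1 := by linarith
    have : c0 / (c0 - c1) ≤ 1 := by rw [div_le_one hpa]; linarith
    have : 0 ≤ 1 - c0 / (c0 - c1) := by linarith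
    positivity

/-- A segment that meets a triangle and ends outside of it meets the union of any two sides. -/
theorem segment_meets_two_sides {A B C p q z : Plane} (hd : tdet A B C ≠ 0)
    (hz : z ∈ convexHull ℝ {A, B, C}) (hzs : z ∈ segment ℝ p q)
    (hp : p ∉ convexHull ℝ {A, B, C}) (hq : q ∉ convexHull ℝ {A, B, C}) :
    ∃ y ∈ segment ℝ p q, y ∈ segment ℝ A B ∨ y ∈ segment ℝ B C := by
  have sub1 : segment ℝ z p ⊆ segment ℝ p q :=
    (convex_segment p q).segment_subset hzs (left_mem_segment ℝ p q)
  have sub2 : segment ℝ z q ⊆ segment ℝ p q :=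
    (convex_segment p q).segment_subset hzs (right_mem_segment ℝ p q)
  by_cases hbp : 0 ≤ tdet C A p / tdet A B C
  · obtain ⟨y, hy, h⟩ := segment_exit hd hz hp hbp
    exact ⟨y, sub1 hy, h⟩
  by_cases hbq : 0 ≤ tdet C A q / tdet A B C
  · obtain ⟨y, hy, h⟩ := segment_exit hd hz hq hbq
    exact ⟨y, sub2 hy, h⟩
  exfalso
  push Not at hbp hbq
  obtain ⟨a, c, ha, hc, hac, rfl⟩ := hzs
  obtain ⟨α, β, γ, h1, h2, h3, h4, h5⟩ := mem_triangle_iff.1 hz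
  have e1 : tdet C A (a • p + c • q) / tdet A B C = β := by
    rw [← h5, tdet_sum h4, tdet_self_left, tdet_self_right, tdet_rotate B C A, tdet_rotate A B C]
    field_simp; ring
  rw [tdet_comb _ _ _ _ hac, add_div, mul_div_assoc, mul_div_assoc] at e1
  rcases ha.eq_or_lt with h | h
  · nlinarith
  · nlinarith [mul_pos h (neg_pos.2 hbp)]

/-- Segments whose ends are separated by each other's lines intersect. -/
theorem segments_cross {p q r s : Plane} (h1 : tdet p q r * tdet p q s < 0)
    (h2 : tdet r s p * tdet r s q < 0) : ∃ x ∈ segment ℝ p q, x ∈ segment ℝ r s := by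
  set a := tdet r s p
  set c := tdet r s q
  set d := tdet p q r
  set e := tdet p q s
  have hac : c - a ≠ 0 := by
    intro h; have : c = a := by linarith
    rw [this] at h2; nlinarith [mul_self_nonneg a]
  have hde : e - d ≠ 0 := by
    intro h; have : e = d := by linarith
    rw [this] at h1; nlinarith [mul_self_nonneg d]
  have frac : ∀ {u v : ℝ}, u * v < 0 → 0 ≤ v / (v - u) ∧ 0 ≤ -u / (v - u) := by
    intro u v huv
    rcases lt_or_ge v 0 with hv | hv
    · have hu : 0 < u := by by_contra h; push Not at h; nlinarith
      exact ⟨div_nonneg_of_nonpos hv.le (by linarith),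
        div_nonneg_of_nonpos (by linarith) (by linarith)⟩
    · have hu : u < 0 := by by_contra h; push Not at h; nlinarith
      exact ⟨div_nonneg hv (by linarith), div_nonneg (by linarith) (by linarith)⟩
  refine ⟨(c / (c - a)) • p + (-a / (c - a)) • q, ⟨_, _, (frac h2).1, (frac h2).2, ?_, rfl⟩,
    e / (e - d), -d / (e - d), (frac h1).1, (frac h1).2, ?_, ?_⟩
  · field_simp; ring
  · field_simp; ring
  · apply plane_ext <;> simp <;> field_simp <;> simp only [a, c, d, e, tdet] <;> ring

/-! ### Replacing an edge by two edges -/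

variable {b : OrthonormalBasis (Fin 3) ℝ Space}

theorem Set.Finite.ncard_sep_insert {E : Set (Sym2 Space)} (hE : E.Finite) {e : Sym2 Space}
    (he : e ∉ E) (v : Space) [Decidable (v ∈ e)] :
    {f ∈ insert e E | v ∈ f}.ncard = {f ∈ E | v ∈ f}.ncard + if v ∈ e then 1 else 0 := by
  have hfin : {f ∈ E | v ∈ f}.Finite := hE.subset (Set.sep_subset _ _)
  split_ifs with hv
  · rw [← Set.ncard_insert_of_notMem (a := e) (by simp [he]) hfin]
    congr 1
    ext f
    simp only [Set.mem_ofPred_eq, Set.mem_insert_iff]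
    constructor
    · rintro ⟨rfl | h, h'⟩ <;> tauto
    · rintro (rfl | h) <;> tauto
  · rw [add_zero]
    congr 1
    ext f
    simp only [Set.mem_ofPred_eq, Set.mem_insert_iff]
    constructor
    · rintro ⟨rfl | h, h'⟩ <;> tauto
    · tauto

section combinatorics

variable {F : Set (Sym2 Space)} {A B C : Space}

theorem mk_notMem_of_fresh (hC : ∀ e ∈ F, C ∉ e) : s(A, C) ∉ F := fun h => hC _ h (by simp)

open Classical in
theorem degree_replace (hF : F.Finite) (hAB : s(A, B) ∉ F) (hne : A ≠ B) (hC : ∀ e ∈ F, C ∉ e)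
    (v : Space) (hv : v ≠ C) :
    {f ∈ insert s(A, C) (insert s(B, C) F) | v ∈ f}.ncard =
      {f ∈ insert s(A, B) F | v ∈ f}.ncard := by
  have h1 : s(A, C) ∉ insert s(B, C) F := by
    rintro (h | h)
    · exact hne (Sym2.congr_left.1 h)
    · exact mk_notMem_of_fresh hC h
  rw [Set.Finite.ncard_sep_insert (hF.insert _) h1,
    Set.Finite.ncard_sep_insert hF (mk_notMem_of_fresh hC), Set.Finite.ncard_sep_insert hF hAB]
  by_cases hA : v = A
  · subst hA; simp [hv, hne]
  · by_cases hB : v = B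
    · subst hB; simp [hv, hne.symm]
    · simp [hA, hB, hv]

theorem degree_fresh (hne : A ≠ B) (hC : ∀ e ∈ F, C ∉ e) :
    {f ∈ insert s(A, C) (insert s(B, C) F) | C ∈ f}.ncard = 2 := by
  have : {f ∈ insert s(A, C) (insert s(B, C) F) | C ∈ f} = {s(A, C), s(B, C)} := by
    ext f
    simp only [Set.mem_ofPred_eq, Set.mem_insert_iff, Set.mem_singleton_iff]
    constructor
    · rintro ⟨rfl | rfl | h, h'⟩
      · tauto
      · tauto
      · exact absurd h' (hC f h)
    · rintro (rfl | rfl) <;> simp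
  rw [this, Set.ncard_pair]
  intro h
  exact hne (Sym2.congr_left.1 h)

theorem TwoRegular.insert_vertex (h : TwoRegular (insert s(A, B) F)) (hAB : s(A, B) ∉ F)
    (hC : ∀ e ∈ insert s(A, B) F, C ∉ e) : TwoRegular (insert s(A, C) (insert s(B, C) F)) := by
  have hC' : ∀ e ∈ F, C ∉ e := fun e he => hC e (Set.mem_insert_of_mem _ he)
  have hCA : C ≠ A := by rintro rfl; exact hC _ (Set.mem_insert _ _) (by simp)
  have hCB : C ≠ B := by rintro rfl; exact hC _ (Set.mem_insert _ _) (by simp)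
  have hne : A ≠ B := fun h' => h.nd _ (Set.mem_insert _ _) (Sym2.mk_isDiag_iff.2 h')
  have hF : F.Finite := h.fin.subset (Set.subset_insert _ _)
  refine ⟨(hF.insert _).insert _, ?_, ?_⟩
  · rintro e (rfl | rfl | he)
    · simpa using hCA.symm
    · simpa using hCB.symm
    · exact h.nd e (Set.mem_insert_of_mem _ he)
  · intro e he v hv
    by_cases hvC : v = C
    · subst hvC; exact degree_fresh hne hC'
    · rw [degree_replace hF hAB hne hC' v hvC]
      rcases he with rfl | rfl | he
      · have : v = A := by simpa [hvC] using hv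
        exact h.deg s(A, B) (Set.mem_insert _ _) v (by simp [this])
      · have : v = B := by simpa [hvC] using hv
        exact h.deg s(A, B) (Set.mem_insert _ _) v (by simp [this])
      · exact h.deg e (Set.mem_insert_of_mem _ he) v hv

theorem TwoRegular.remove_vertex (h : TwoRegular (insert s(A, C) (insert s(B, C) F)))
    (hne : A ≠ B) (hAB : s(A, B) ∉ F) (hC : ∀ e ∈ F, C ∉ e) : TwoRegular (insert s(A, B) F) := by
  have hF : F.Finite := h.fin.subset fun e he => Or.inr (Or.inr he)
  have hCA : A ≠ C := fun h' => h.nd s(A, C) (by simp) (Sym2.mk_isDiag_iff.2 h')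
  have hCB : B ≠ C := fun h' => h.nd s(B, C) (by simp) (Sym2.mk_isDiag_iff.2 h')
  refine ⟨hF.insert _, ?_, ?_⟩
  · rintro e (rfl | he)
    · simpa using hne
    · exact h.nd e (Or.inr (Or.inr he))
  · rintro e he v hv
    have hvC : v ≠ C := by
      rintro rfl
      rcases he with rfl | he
      · rcases Sym2.mem_iff.1 hv with h' | h'
        · exact hCA h'.symm
        · exact hCB h'.symm
      · exact hC e he hv
    rw [← degree_replace hF hAB hne hC v hvC]
    rcases he with rfl | he
    · rcases Sym2.mem_iff.1 hv with rfl | rfl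
      · exact h.deg s(v, C) (by simp) v (by simp)
      · exact h.deg s(v, C) (by simp) v (by simp)
    · exact h.deg e (Or.inr (Or.inr he)) v hv

end combinatorics

section good

variable {F : Set (Sym2 Space)} {A B C : Space}

theorem Good.insert_vertex (h : Good b (insert s(A, B) F)) (hAB : s(A, B) ∉ F)
    (hC : ∀ e ∈ insert s(A, B) F, C ∉ e)
    (hj : ∀ x ∈ segment ℝ (planeProj b A) (planeProj b C),
      x ∈ segment ℝ (planeProj b B) (planeProj b C) → x = planeProj b C)
    (hCsh : ∀ e ∈ F, planeProj b C ∉ sh b e)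
    (hspA : ∀ e ∈ F, A ∉ e → Disjoint (segment ℝ A C) (edgeSegment e))
    (hspB : ∀ e ∈ F, B ∉ e → Disjoint (segment ℝ B C) (edgeSegment e))
    (hpair : ∀ e ∈ F, ∀ f ∈ F, e ≠ f → ∀ x ∈ sh b e, x ∈ sh b f →
      x ∉ segment ℝ (planeProj b A) (planeProj b C) ∧
      x ∉ segment ℝ (planeProj b B) (planeProj b C)) :
    Good b (insert s(A, C) (insert s(B, C) F)) := by
  refine { h.toTwoRegular.insert_vertex hAB hC with sp := ?_, tr := ?_ }
  · have key : ∀ e ∈ F, (∀ v ∈ s(A, C), v ∉ e) → Disjoint (edgeSegment s(A, C)) (edgeSegment e) := by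
      intro e he hv
      rw [edgeSegment_mk]; exact hspA e he (hv A (by simp))
    have key' : ∀ e ∈ F, (∀ v ∈ s(B, C), v ∉ e) →
        Disjoint (edgeSegment s(B, C)) (edgeSegment e) := by
      intro e he hv
      rw [edgeSegment_mk]; exact hspB e he (hv B (by simp))
    rintro e (rfl | rfl | he) f (rfl | rfl | hf) hv
    · exact absurd (hv C (by simp)) (by simp)
    · exact absurd (hv C (by simp)) (by simp)
    · exact key f hf hv
    · exact absurd (hv C (by simp)) (by simp)
    · exact absurd (hv C (by simp)) (by simp)
    · exact key' f hf hv
    · exact (key e he fun v h1 h2 => hv v h2 h1).symm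
    · exact (key' e he fun v h1 h2 => hv v h2 h1).symm
    · exact h.sp e (Or.inr he) f (Or.inr hf) hv
  · have one : ∀ e ∈ F, ∀ x, x ∈ sh b s(A, C) → x ∈ sh b s(B, C) → x ∉ sh b e := by
      intro e he x h1 h2 h3
      rw [sh_mk] at h1 h2
      rw [hj x h1 h2] at h3
      exact hCsh e he h3
    have two : ∀ e ∈ F, ∀ f ∈ F, e ≠ f → ∀ x, x ∈ sh b s(A, C) → x ∈ sh b e → x ∉ sh b f := by
      intro e he f hf hef x h1 h2 h3
      rw [sh_mk] at h1
      exact (hpair e he f hf hef x h2 h3).1 h1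
    have three : ∀ e ∈ F, ∀ f ∈ F, e ≠ f → ∀ x, x ∈ sh b s(B, C) → x ∈ sh b e → x ∉ sh b f := by
      intro e he f hf hef x h1 h2 h3
      rw [sh_mk] at h1
      exact (hpair e he f hf hef x h2 h3).2 h1
    rintro e (rfl | rfl | he) f (rfl | rfl | hf) g (rfl | rfl | hg) hef heg hfg x h1 h2 h3
    all_goals first
      | exact absurd rfl hef
      | exact absurd rfl heg
      | exact absurd rfl hfg
      | exact one _ (by assumption) x (by assumption) (by assumption) (by assumption)
      | exact two f hf g hg hfg x h1 h2 h3
      | exact two e he g hg heg x h2 h1 h3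
      | exact two e he f hf hef x h3 h1 h2
      | exact three f hf g hg hfg x h1 h2 h3
      | exact three e he g hg heg x h2 h1 h3
      | exact three e he f hf hef x h3 h1 h2
      | exact h.tr _ (Or.inr he) _ (Or.inr hf) _ (Or.inr hg) hef heg hfg x h1 h2 h3

theorem Good.remove_vertex (h : Good b (insert s(A, C) (insert s(B, C) F))) (hne : A ≠ B)
    (hAB : s(A, B) ∉ F) (hC : ∀ e ∈ F, C ∉ e)
    (hsp : ∀ e ∈ F, A ∉ e → B ∉ e → Disjoint (segment ℝ A B) (edgeSegment e))
    (hpair : ∀ e ∈ F, ∀ f ∈ F, e ≠ f → ∀ x ∈ sh b e, x ∈ sh b f →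
      x ∉ segment ℝ (planeProj b A) (planeProj b B)) :
    Good b (insert s(A, B) F) := by
  refine { h.toTwoRegular.remove_vertex hne hAB hC with sp := ?_, tr := ?_ }
  · have key : ∀ e ∈ F, (∀ v ∈ s(A, B), v ∉ e) → Disjoint (edgeSegment s(A, B)) (edgeSegment e) := by
      intro e he hv
      rw [edgeSegment_mk]; exact hsp e he (hv A (by simp)) (hv B (by simp))
    rintro e (rfl | he) f (rfl | hf) hv
    · exact absurd (hv A (by simp)) (by simp)
    · exact key f hf hv
    · exact (key e he fun v h1 h2 => hv v h2 h1).symm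
    · exact h.sp e (Or.inr (Or.inr he)) f (Or.inr (Or.inr hf)) hv
  · have two : ∀ e ∈ F, ∀ f ∈ F, e ≠ f → ∀ x, x ∈ sh b s(A, B) → x ∈ sh b e → x ∉ sh b f := by
      intro e he f hf hef x h1 h2 h3
      rw [sh_mk] at h1
      exact (hpair e he f hf hef x h2 h3) h1
    rintro e (rfl | he) f (rfl | hf) g (rfl | hg) hef heg hfg x h1 h2 h3
    all_goals first
      | exact absurd rfl hef
      | exact absurd rfl heg
      | exact absurd rfl hfg
      | exact two f hf g hg hfg x h1 h2 h3
      | exact two e he g hg heg x h2 h1 h3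
      | exact two e he f hf hef x h3 h1 h2
      | exact h.tr _ (Or.inr (Or.inr he)) _ (Or.inr (Or.inr hf)) _ (Or.inr (Or.inr hg))
          hef heg hfg x h1 h2 h3

theorem Good.mem_right_iff (h : Good b (insert s(A, C) (insert s(B, C) F))) {e' : Sym2 Plane} :
    e' ∈ h.diag.edges ↔ e' = s(planeProj b A, planeProj b C) ∨
      e' = s(planeProj b B, planeProj b C) ∨ ∃ e ∈ F, Sym2.map (planeProj b) e = e' := by
  rw [h.diag_edges]
  simp [Set.image_insert_eq]

theorem Good.mem_left_iff (h : Good b (insert s(A, B) F)) {e' : Sym2 Plane} :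
    e' ∈ h.diag.edges ↔ e' = s(planeProj b A, planeProj b B) ∨
      ∃ e ∈ F, Sym2.map (planeProj b) e = e' := by
  rw [h.diag_edges]
  simp [Set.image_insert_eq]

theorem Good.map_ne_left (h : Good b (insert s(A, B) F)) (hAB : s(A, B) ∉ F) {e : Sym2 Space}
    (he : e ∈ F) : Sym2.map (planeProj b) e ≠ s(planeProj b A, planeProj b B) := by
  intro heq
  rw [← Sym2.map_mk] at heq
  have := h.map_inj (Or.inr he) (Or.inl rfl) heq
  exact hAB (this ▸ he)

theorem Good.edges_iff (h : Good b (insert s(A, B) F))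
    (h' : Good b (insert s(A, C) (insert s(B, C) F))) (hAB : s(A, B) ∉ F) (e : Sym2 Plane) :
    e ∈ h'.diag.edges ↔ (e ∈ h.diag.edges ∧ e ≠ s(planeProj b A, planeProj b B)) ∨
      e = s(planeProj b A, planeProj b C) ∨ e = s(planeProj b C, planeProj b B) := by
  rw [h.mem_left_iff, h'.mem_right_iff]
  rw [Sym2.eq_swap (a := planeProj b C)]
  constructor
  · rintro (h1 | h1 | ⟨f, hf, rfl⟩)
    · tauto
    · tauto
    · exact Or.inl ⟨Or.inr ⟨f, hf, rfl⟩, h.map_ne_left hAB hf⟩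
  · rintro (⟨h1 | h1, h2⟩ | h1 | h1)
    · exact absurd h1 h2
    · tauto
    · tauto
    · tauto

theorem Good.exists_of_other (h : Good b (insert s(A, B) F)) {e' : Sym2 Plane}
    (he : e' ∈ h.diag.otherEdges (planeProj b A) (planeProj b B)) :
    ∃ e ∈ F, e' = Sym2.map (planeProj b) e := by
  rcases h.mem_left_iff.1 he.1 with h1 | ⟨e, h1, rfl⟩
  · exact absurd h1 he.2
  · exact ⟨e, h1, rfl⟩

theorem Good.other_of_mem (h : Good b (insert s(A, B) F)) (hAB : s(A, B) ∉ F) {e : Sym2 Space}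
    (he : e ∈ F) :
    Sym2.map (planeProj b) e ∈ h.diag.otherEdges (planeProj b A) (planeProj b B) :=
  ⟨h.mem_left_iff.2 (Or.inr ⟨e, he, rfl⟩), h.map_ne_left hAB he⟩

theorem Good.isOver_old (h : Good b (insert s(A, B) F))
    (h' : Good b (insert s(A, C) (insert s(B, C) F))) :
    ∀ e ∈ h.diag.edges, ∀ f ∈ h.diag.edges, e ≠ s(planeProj b A, planeProj b B) →
      f ≠ s(planeProj b A, planeProj b B) → (h'.diag.isOver e f ↔ h.diag.isOver e f) := by
  intro e he f hf hne hnf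
  obtain ⟨e, heF, rfl⟩ := h.exists_of_other ⟨he, hne⟩
  obtain ⟨f, hfF, rfl⟩ := h.exists_of_other ⟨hf, hnf⟩
  rw [h.isOver_iff (Or.inr heF) (Or.inr hfF), h'.isOver_iff (Or.inr (Or.inr heF))
    (Or.inr (Or.inr hfF))]

theorem Good.replaceEdge (h : Good b (insert s(A, B) F))
    (h' : Good b (insert s(A, C) (insert s(B, C) F))) (hAB : s(A, B) ∉ F)
    (hC : ∀ e ∈ F, C ∉ e)
    (hd : tdet (planeProj b A) (planeProj b B) (planeProj b C) ≠ 0) :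
    h.diag.ReplaceEdge h'.diag (planeProj b A) (planeProj b B) (planeProj b C) := by
  refine ⟨affineIndependent_of_tdet hd, h.mem_left_iff.2 (Or.inl rfl), ?_, h.edges_iff h' hAB,
    h.isOver_old h'⟩
  intro e' he'
  rcases h.mem_left_iff.1 he' with rfl | ⟨e, he, rfl⟩
  · rw [edgeSegment_mk]
    exact fun hx => hd (tdet_eq_zero_of_mem_segment hx)
  · exact h'.not_mem_sh (Or.inl rfl) (Or.inr (Or.inr he)) (by simp) (hC e he)

theorem height_consistent {S T : Set Space} (hS : Convex ℝ S) (hT : Convex ℝ T)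
    (hST : Disjoint S T) {p q p' q' : Space} (hp : p ∈ S) (hq : q ∈ T) (hp' : p' ∈ S)
    (hq' : q' ∈ T) (hpq : planeProj b p = planeProj b q) (hpq' : planeProj b p' = planeProj b q')
    (hlt : planeHeight b q < planeHeight b p) : planeHeight b q' < planeHeight b p' := by
  by_contra hle
  push Not at hle
  set x := planeHeight b p - planeHeight b q with hx
  set y := planeHeight b q' - planeHeight b p' with hy
  have hx0 : 0 < x := sub_pos.2 hlt
  have hy0 : 0 ≤ y := sub_nonneg.2 hle
  have hxy : x + y ≠ 0 := by positivity
  have hsum : y / (x + y) + x / (x + y) = 1 := by field_simp; ring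
  have hP : (y / (x + y)) • p + (x / (x + y)) • p' ∈ S :=
    hS hp hp' (by positivity) (by positivity) hsum
  have hQ : (y / (x + y)) • q + (x / (x + y)) • q' ∈ T :=
    hT hq hq' (by positivity) (by positivity) hsum
  have heq : (y / (x + y)) • p + (x / (x + y)) • p' = (y / (x + y)) • q + (x / (x + y)) • q' := by
    apply eq_of_planeProj_of_planeHeight b
    · simp only [map_add, map_smul, hpq, hpq']
    · simp only [map_add, map_smul, smul_eq_mul]
      have e1 : planeHeight b p = x + planeHeight b q := by rw [hx]; ring
      have e2 : planeHeight b q' = y + planeHeight b p' := by rw [hy]; ring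
      rw [e1, e2]
      field_simp
      ring
  exact Set.disjoint_left.1 hST hP (heq ▸ hQ)

theorem convex_edgeSegment {V : Type*} [AddCommGroup V] [Module ℝ V] (e : Sym2 V) :
    Convex ℝ (edgeSegment e) := convex_convexHull ℝ _

theorem image_triangle (p q r : Space) : planeProj b '' convexHull ℝ {p, q, r} =
    convexHull ℝ {planeProj b p, planeProj b q, planeProj b r} := by
  rw [(planeProj b).image_convexHull, Set.image_insert_eq, Set.image_pair]

theorem proj_mem_triangle {p q r x : Space} (h : x ∈ convexHull ℝ {p, q, r}) :
    planeProj b x ∈ convexHull ℝ {planeProj b p, planeProj b q, planeProj b r} := by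
  rw [← image_triangle]; exact ⟨x, h, rfl⟩

theorem proj_mem_segment {p q x : Space} (h : x ∈ segment ℝ p q) :
    planeProj b x ∈ segment ℝ (planeProj b p) (planeProj b q) := by
  rw [← edgeSegment_mk] at h
  rw [← sh_mk]; exact proj_mem_sh h

/-- An edge disjoint from a triangle that is above an edge in the triangle is above
any other such edge which it crosses. -/
theorem above_of_above {T : Set Space} (hT : Convex ℝ T) {e f g : Sym2 Space}
    (hd : Disjoint (edgeSegment e) T) (hf : edgeSegment f ⊆ T) (hg : edgeSegment g ⊆ T)
    (h : PolygonalLink.Above b e f) {x : Plane} (hx : x ∈ sh b e) (hxg : x ∈ sh b g) :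
    PolygonalLink.Above b e g := by
  obtain ⟨p, hp, q, hq, hpq, hlt⟩ := h
  obtain ⟨p', hp', rfl⟩ := mem_sh_iff.1 hx
  obtain ⟨q', hq', hpq'⟩ := mem_sh_iff.1 hxg
  exact ⟨p', hp', q', hq', hpq'.symm, height_consistent (convex_edgeSegment e) hT hd hp (hf hq)
    hp' (hg hq') hpq hpq'.symm hlt⟩

end good

/-! ### Moving an edge across a triangle -/

/-- The projection of `e` meets the projection of the triangle `ABC` at most in `A` and `B`. -/
def Avoids (b : OrthonormalBasis (Fin 3) ℝ Space) (A B C : Space) (e : Sym2 Space) : Prop :=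
  ∀ x ∈ sh b e, x ∈ convexHull ℝ {planeProj b A, planeProj b B, planeProj b C} →
    x = planeProj b A ∨ x = planeProj b B

/-- The edge `e` is disjoint from the triangle `ABC` in space, and its projection has no end in
the projected triangle and does not contain `C`. -/
structure Passes (b : OrthonormalBasis (Fin 3) ℝ Space) (A B C : Space) (e : Sym2 Space) :
    Prop where
  ends : ∀ v ∈ e, planeProj b v ∉ convexHull ℝ {planeProj b A, planeProj b B, planeProj b C}
  apex : planeProj b C ∉ sh b e
  disj : Disjoint (edgeSegment e) (convexHull ℝ {A, B, C})

/-- The edge `e` passes the triangle `ABC`, without meeting one of the sides at `C`. -/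
structure Thin (b : OrthonormalBasis (Fin 3) ℝ Space) (A B C : Space) (e : Sym2 Space) :
    Prop where
  ends : ∀ v ∈ e, planeProj b v ∉ convexHull ℝ {planeProj b A, planeProj b B, planeProj b C}
  side : Disjoint (sh b e) (segment ℝ (planeProj b A) (planeProj b C)) ∨
    Disjoint (sh b e) (segment ℝ (planeProj b B) (planeProj b C))
  disj : Disjoint (edgeSegment e) (convexHull ℝ {A, B, C})

section planar

variable {p q r x : Plane}

theorem tdet_ne_left (hd : tdet p q r ≠ 0) : p ≠ r := by
  rintro rfl; exact hd (tdet_self_left p q)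

theorem tdet_ne_right (hd : tdet p q r ≠ 0) : q ≠ r := by
  rintro rfl; exact hd (tdet_self_right p q)

theorem tdet_ne_base (hd : tdet p q r ≠ 0) : p ≠ q := by
  rintro rfl; exact hd (by unfold tdet; ring)

theorem not_mem_segment_right (hd : tdet p q r ≠ 0) : q ∉ segment ℝ p r := fun h =>
  hd (by rw [tdet_swap_right, tdet_eq_zero_of_mem_segment h, neg_zero])

theorem not_mem_segment_left (hd : tdet p q r ≠ 0) : p ∉ segment ℝ q r := fun h =>
  hd (by rw [← tdet_rotate, tdet_eq_zero_of_mem_segment h])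

theorem eq_apex_of_mem_segments (hd : tdet p q r ≠ 0) (h1 : x ∈ segment ℝ p r)
    (h2 : x ∈ segment ℝ q r) : x = r := by
  by_contra hne
  rw [segment_symm] at h1 h2
  rcases segment_overlap_of_common hne h1 h2 with h | h
  · exact not_mem_segment_left hd (by rwa [segment_symm])
  · exact not_mem_segment_right hd (by rwa [segment_symm])

end planar

section triangle

variable {F : Set (Sym2 Space)} {A B C : Space}

theorem Avoids.apex_notMem (hd : tdet (planeProj b A) (planeProj b B) (planeProj b C) ≠ 0)
    {e : Sym2 Space} (h : Avoids b A B C e) : planeProj b C ∉ sh b e := by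
  intro hx
  rcases h _ hx (subset_convexHull ℝ _ (by simp)) with h1 | h1
  · exact tdet_ne_left hd h1.symm
  · exact tdet_ne_right hd h1.symm

theorem edgeSegment_eq_of_sym2 (e : Sym2 Space) : ∃ p q, e = s(p, q) := by
  induction e using Sym2.ind with
  | _ p q => exact ⟨p, q, rfl⟩

theorem Passes.meets (hd : tdet (planeProj b A) (planeProj b B) (planeProj b C) ≠ 0)
    {e : Sym2 Space} (h : ∀ v ∈ e, planeProj b v ∉
      convexHull ℝ {planeProj b A, planeProj b B, planeProj b C})
    {z : Plane} (hz : z ∈ sh b e)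
    (hzT : z ∈ convexHull ℝ {planeProj b A, planeProj b B, planeProj b C}) :
    (∃ y ∈ sh b e, y ∈ segment ℝ (planeProj b A) (planeProj b B) ∨
      y ∈ segment ℝ (planeProj b B) (planeProj b C)) ∧
    (∃ y ∈ sh b e, y ∈ segment ℝ (planeProj b A) (planeProj b B) ∨
      y ∈ segment ℝ (planeProj b A) (planeProj b C)) ∧
    (∃ y ∈ sh b e, y ∈ segment ℝ (planeProj b A) (planeProj b C) ∨
      y ∈ segment ℝ (planeProj b B) (planeProj b C)) := by
  obtain ⟨p, q, rfl⟩ := edgeSegment_eq_of_sym2 e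
  have hp := h p (by simp)
  have hq := h q (by simp)
  rw [sh_mk] at *
  refine ⟨segment_meets_two_sides hd hzT hz hp hq, ?_, ?_⟩
  · have hd' : tdet (planeProj b B) (planeProj b A) (planeProj b C) ≠ 0 := by
      rw [tdet_swap]; exact neg_ne_zero.2 hd
    rw [← triangle_swap] at hzT hp hq
    have := segment_meets_two_sides hd' hzT hz hp hq
    rwa [segment_symm ℝ (planeProj b B) (planeProj b A)] at this
  · have hd' : tdet (planeProj b A) (planeProj b C) (planeProj b B) ≠ 0 := by
      rw [tdet_swap_right]; exact neg_ne_zero.2 hd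
    rw [← triangle_swap_right] at hzT hp hq
    have := segment_meets_two_sides hd' hzT hz hp hq
    rwa [segment_symm ℝ (planeProj b C) (planeProj b B)] at this

theorem Thin.passes {e : Sym2 Space} (h : Thin b A B C e) : Passes b A B C e where
  ends := h.ends
  disj := h.disj
  apex := by
    intro hx
    rcases h.side with h1 | h1
    · exact Set.disjoint_left.1 h1 hx (right_mem_segment ℝ _ _)
    · exact Set.disjoint_left.1 h1 hx (right_mem_segment ℝ _ _)

/-- The edge `e` passes the triangle and crosses its base. -/
def Crosses (b : OrthonormalBasis (Fin 3) ℝ Space) (A B C : Space) (e : Sym2 Space) : Prop :=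
  Passes b A B C e ∧ ∃ x ∈ sh b e, x ∈ segment ℝ (planeProj b A) (planeProj b B)

theorem Thin.avoids_or_crosses
    (hd : tdet (planeProj b A) (planeProj b B) (planeProj b C) ≠ 0)
    {e : Sym2 Space} (h : Thin b A B C e) : Avoids b A B C e ∨ Crosses b A B C e := by
  by_cases hz : ∃ z ∈ sh b e, z ∈ convexHull ℝ {planeProj b A, planeProj b B, planeProj b C}
  · right
    obtain ⟨z, hz, hzT⟩ := hz
    refine ⟨h.passes, ?_⟩
    obtain ⟨⟨y, hy, h1⟩, ⟨y', hy', h1'⟩, -⟩ := Passes.meets hd h.ends hz hzT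
    rcases h.side with hs | hs
    · exact ⟨y', hy', h1'.resolve_right fun h2 => Set.disjoint_left.1 hs hy' h2⟩
    · exact ⟨y, hy, h1.resolve_right fun h2 => Set.disjoint_left.1 hs hy h2⟩
  · left
    intro x hx hxT
    exact absurd ⟨x, hx, hxT⟩ hz

theorem Good.of_triangle (h : Good b (insert s(A, B) F)) (hAB : s(A, B) ∉ F)
    (hC : ∀ e ∈ insert s(A, B) F, C ∉ e)
    (hd : tdet (planeProj b A) (planeProj b B) (planeProj b C) ≠ 0)
    (hall : ∀ e ∈ F, Avoids b A B C e ∨ Passes b A B C e)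
    (hpair : ∀ e ∈ F, ∀ f ∈ F, e ≠ f → Passes b A B C e → Passes b A B C f →
      ∀ x ∈ sh b e, x ∈ sh b f → x ∉ segment ℝ (planeProj b A) (planeProj b C) ∧
        x ∉ segment ℝ (planeProj b B) (planeProj b C)) :
    Good b (insert s(A, C) (insert s(B, C) F)) := by
  have hne : ∀ e ∈ F, e ≠ s(A, B) := fun e he h' => hAB (h' ▸ he)
  have hbase : ∀ x, x = planeProj b A ∨ x = planeProj b B → x ∈ sh b s(A, B) := by
    rintro x (rfl | rfl) <;> rw [sh_mk]
    exacts [left_mem_segment ℝ _ _, right_mem_segment ℝ _ _]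
  refine h.insert_vertex hAB hC (fun x => eq_apex_of_mem_segments hd) ?_ ?_ ?_ ?_
  · intro e he
    rcases hall e he with h1 | h1
    · exact h1.apex_notMem hd
    · exact h1.apex
  · intro e he hA
    rw [Set.disjoint_right]
    intro p hpe hp
    rcases hall e he with h1 | h1
    · have hp' := proj_mem_segment (b := b) hp
      rcases h1 _ (proj_mem_sh hpe) (segment_subset_triangle₁₃ hp') with h2 | h2
      · exact h.not_mem_sh (Or.inl rfl) (Or.inr he) (v := A) (by simp) hA (h2 ▸ proj_mem_sh hpe)
      · rw [h2] at hp'; exact not_mem_segment_right hd hp'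
    · exact Set.disjoint_left.1 h1.disj hpe (segment_subset_triangle₁₃ hp)
  · intro e he hB
    rw [Set.disjoint_right]
    intro p hpe hp
    rcases hall e he with h1 | h1
    · have hp' := proj_mem_segment (b := b) hp
      rcases h1 _ (proj_mem_sh hpe) (segment_subset_triangle₂₃ hp') with h2 | h2
      · rw [h2] at hp'; exact not_mem_segment_left hd hp'
      · exact h.not_mem_sh (Or.inl rfl) (Or.inr he) (v := B) (by simp) hB (h2 ▸ proj_mem_sh hpe)
    · exact Set.disjoint_left.1 h1.disj hpe (segment_subset_triangle₂₃ hp)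
  · intro e he f hf hef x hxe hxf
    have key : x ∈ convexHull ℝ {planeProj b A, planeProj b B, planeProj b C} →
        Passes b A B C e ∧ Passes b A B C f := by
      intro hxT
      rcases hall e he with h1 | h1
      · exact absurd (hbase x (h1 x hxe hxT))
          (h.tr e (Or.inr he) f (Or.inr hf) _ (Or.inl rfl) hef (hne e he) (hne f hf) x hxe hxf)
      rcases hall f hf with h2 | h2
      · exact absurd (hbase x (h2 x hxf hxT))
          (h.tr e (Or.inr he) f (Or.inr hf) _ (Or.inl rfl) hef (hne e he) (hne f hf) x hxe hxf)
      exact ⟨h1, h2⟩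
    constructor
    · intro hx
      have := key (segment_subset_triangle₁₃ hx)
      exact (hpair e he f hf hef this.1 this.2 x hxe hxf).1 hx
    · intro hx
      have := key (segment_subset_triangle₂₃ hx)
      exact (hpair e he f hf hef this.1 this.2 x hxe hxf).2 hx

theorem Good.of_triangle_rev (h : Good b (insert s(A, C) (insert s(B, C) F))) (hAB : s(A, B) ∉ F)
    (hC : ∀ e ∈ F, C ∉ e)
    (hd : tdet (planeProj b A) (planeProj b B) (planeProj b C) ≠ 0)
    (hall : ∀ e ∈ F, Avoids b A B C e ∨ Passes b A B C e)
    (hpair : ∀ e ∈ F, ∀ f ∈ F, e ≠ f → Passes b A B C e → Passes b A B C f →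
      ∀ x ∈ sh b e, x ∈ sh b f → x ∉ segment ℝ (planeProj b A) (planeProj b B)) :
    Good b (insert s(A, B) F) := by
  have hne1 : ∀ e ∈ F, e ≠ s(A, C) := fun e he h' => hC e he (h' ▸ by simp)
  have hne2 : ∀ e ∈ F, e ≠ s(B, C) := fun e he h' => hC e he (h' ▸ by simp)
  have hbase : ∀ e ∈ F, ∀ f ∈ F, e ≠ f → ∀ x ∈ sh b e, x ∈ sh b f →
      ¬ (x = planeProj b A ∨ x = planeProj b B) := by
    rintro e he f hf hef x hxe hxf (rfl | rfl)
    · exact h.tr e (Or.inr (Or.inr he)) f (Or.inr (Or.inr hf)) _ (Or.inl rfl) hef (hne1 e he)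
        (hne1 f hf) _ hxe hxf (vertex_mem_sh (by simp))
    · exact h.tr e (Or.inr (Or.inr he)) f (Or.inr (Or.inr hf)) _ (Or.inr (Or.inl rfl)) hef
        (hne2 e he) (hne2 f hf) _ hxe hxf (vertex_mem_sh (by simp))
  refine h.remove_vertex (fun h' => tdet_ne_base hd (by rw [h'])) hAB hC ?_ ?_
  · intro e he hA hB
    rw [Set.disjoint_right]
    intro p hpe hp
    rcases hall e he with h1 | h1
    · have hp' := proj_mem_segment (b := b) hp
      rcases h1 _ (proj_mem_sh hpe) (segment_subset_triangle₁₂ hp') with h2 | h2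
      · exact h.not_mem_sh (Or.inl rfl) (Or.inr (Or.inr he)) (v := A) (by simp) hA
          (h2 ▸ proj_mem_sh hpe)
      · exact h.not_mem_sh (Or.inr (Or.inl rfl)) (Or.inr (Or.inr he)) (v := B) (by simp) hB
          (h2 ▸ proj_mem_sh hpe)
    · exact Set.disjoint_left.1 h1.disj hpe (segment_subset_triangle₁₂ hp)
  · intro e he f hf hef x hxe hxf hx
    have hxT := segment_subset_triangle₁₂ (r := planeProj b C) hx
    rcases hall e he with h1 | h1
    · exact hbase e he f hf hef x hxe hxf (h1 x hxe hxT)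
    rcases hall f hf with h2 | h2
    · exact hbase e he f hf hef x hxe hxf (h2 x hxf hxT)
    exact hpair e he f hf hef h1 h2 x hxe hxf hx

theorem edge_subset_triangle₁₂ : edgeSegment s(A, B) ⊆ convexHull ℝ {A, B, C} := by
  rw [edgeSegment_mk]; exact segment_subset_triangle₁₂

theorem edge_subset_triangle₁₃ : edgeSegment s(A, C) ⊆ convexHull ℝ {A, B, C} := by
  rw [edgeSegment_mk]; exact segment_subset_triangle₁₃

theorem edge_subset_triangle₂₃ : edgeSegment s(B, C) ⊆ convexHull ℝ {A, B, C} := by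
  rw [edgeSegment_mk]; exact segment_subset_triangle₂₃

theorem Crosses.sameLabel (h : Good b (insert s(A, B) F))
    (h' : Good b (insert s(A, C) (insert s(B, C) F)))
    (hd : tdet (planeProj b A) (planeProj b B) (planeProj b C) ≠ 0)
    {e : Sym2 Space} (he : e ∈ F) (hc : Crosses b A B C e) :
    h.diag.SameLabel h'.diag (Sym2.map (planeProj b) e) (planeProj b A) (planeProj b B)
      (planeProj b C) := by
  obtain ⟨hp, x, hx, hxAB⟩ := hc
  have hT := convex_convexHull ℝ {A, B, C}
  unfold LinkDiagram.SameLabel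
  rw [Sym2.eq_swap (a := planeProj b C), ← Sym2.map_mk, ← Sym2.map_mk, ← Sym2.map_mk,
    h.isOver_iff (Or.inr he) (Or.inl rfl), h'.isOver_iff (Or.inr (Or.inr he)) (Or.inl rfl),
    h'.isOver_iff (Or.inr (Or.inr he)) (Or.inr (Or.inl rfl))]
  constructor
  · intro hab
    obtain ⟨-, -, y, hy, h1 | h1⟩ := Passes.meets hd hp.ends hx (segment_subset_triangle₁₂ hxAB)
    · exact Or.inl (above_of_above hT hp.disj edge_subset_triangle₁₂ edge_subset_triangle₁₃ hab hy
        (by rwa [sh_mk]))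
    · exact Or.inr (above_of_above hT hp.disj edge_subset_triangle₁₂ edge_subset_triangle₂₃ hab hy
        (by rwa [sh_mk]))
  · rintro (hab | hab)
    · exact above_of_above hT hp.disj edge_subset_triangle₁₃ edge_subset_triangle₁₂ hab hx
        (by rwa [sh_mk])
    · exact above_of_above hT hp.disj edge_subset_triangle₂₃ edge_subset_triangle₁₂ hab hx
        (by rwa [sh_mk])

theorem Crosses.runsThrough {e : Sym2 Space} (hc : Crosses b A B C e) :
    LinkDiagram.RunsThrough (Sym2.map (planeProj b) e) (planeProj b A) (planeProj b B)
      (planeProj b C) := by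
  obtain ⟨hp, x, hx, hxAB⟩ := hc
  refine ⟨⟨x, hx, hxAB⟩, ?_⟩
  intro v hv
  obtain ⟨w, hw, rfl⟩ := Sym2.mem_map.1 hv
  exact hp.ends w hw

theorem Avoids.misses {e : Sym2 Space} (h : Avoids b A B C e) :
    LinkDiagram.Misses (Sym2.map (planeProj b) e) (planeProj b A) (planeProj b B)
      (planeProj b C) := fun x hx => by simpa using h x hx.1 hx.2

theorem Avoids.not_runsThrough (h : Good b (insert s(A, B) F)) {e : Sym2 Space} (he : e ∈ F)
    (ha : Avoids b A B C e) : ¬ LinkDiagram.RunsThrough (Sym2.map (planeProj b) e)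
      (planeProj b A) (planeProj b B) (planeProj b C) := by
  rintro ⟨⟨x, hx, hxAB⟩, hv⟩
  have key : ∀ v ∈ s(A, B), planeProj b v ∉ sh b e := by
    intro v hv' hsh
    by_cases hve : v ∈ e
    · refine hv (planeProj b v) (Sym2.mem_map.2 ⟨v, hve, rfl⟩) (subset_convexHull ℝ _ ?_)
      rcases Sym2.mem_iff.1 hv' with rfl | rfl <;> simp
    · exact h.not_mem_sh (Or.inl rfl) (Or.inr he) hv' hve hsh
  rcases ha x hx (segment_subset_triangle₁₂ hxAB) with rfl | rfl
  · exact key A (by simp) hx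
  · exact key B (by simp) hx

/-- An edge may be pulled across a triangle met only by disjoint strands crossing the edge. -/
theorem Reach.of_crosses (h : Good b (insert s(A, B) F)) (hAB : s(A, B) ∉ F)
    (hC : ∀ e ∈ insert s(A, B) F, C ∉ e)
    (hd : tdet (planeProj b A) (planeProj b B) (planeProj b C) ≠ 0)
    (hall : ∀ e ∈ F, Avoids b A B C e ∨ Crosses b A B C e)
    (hpair : ∀ e ∈ F, ∀ f ∈ F, e ≠ f → Passes b A B C e → Passes b A B C f →
      ∀ x ∈ sh b e, x ∈ sh b f →
        x ∉ convexHull ℝ {planeProj b A, planeProj b B, planeProj b C}) :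
    Reach b 0 (insert s(A, B) F) (insert s(A, C) (insert s(B, C) F)) := by
  have h' : Good b (insert s(A, C) (insert s(B, C) F)) :=
    h.of_triangle hAB hC hd (fun e he => (hall e he).imp_right And.left)
      fun e he f hf hef h1 h2 x hxe hxf =>
        ⟨fun hx => hpair e he f hf hef h1 h2 x hxe hxf (segment_subset_triangle₁₃ hx),
          fun hx => hpair e he f hf hef h1 h2 x hxe hxf (segment_subset_triangle₂₃ hx)⟩
  refine Reach.of_isotopy h h' (Or.inr (Or.inr (Or.inl ⟨planeProj b A, planeProj b B,
    planeProj b C, h.replaceEdge h' hAB (fun e he => hC e (Or.inr he)) hd, ?_, ?_⟩)))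
  · intro e' he'
    obtain ⟨e, he, rfl⟩ := h.exists_of_other he'
    rcases hall e he with h1 | h1
    · exact Or.inl h1.misses
    · exact Or.inr ⟨h1.runsThrough, h1.sameLabel h h' hd he⟩
  · intro e' he' f' hf' hef hre hrf
    obtain ⟨e, he, rfl⟩ := h.exists_of_other he'
    obtain ⟨f, hf, rfl⟩ := h.exists_of_other hf'
    have hef' : e ≠ f := by rintro rfl; exact hef rfl
    have h1 := (hall e he).resolve_left fun ha => ha.not_runsThrough h he hre
    have h2 := (hall f hf).resolve_left fun ha => ha.not_runsThrough h hf hrf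
    rw [Set.eq_empty_iff_forall_notMem]
    rintro x ⟨⟨hxe, hxf⟩, hxT⟩
    exact hpair e he f hf hef' h1.1 h2.1 x hxe hxf hxT

/-- Only one edge `g` passes the triangle. -/
theorem Reach.of_single (h : Good b (insert s(A, B) F)) (hAB : s(A, B) ∉ F)
    (hC : ∀ e ∈ insert s(A, B) F, C ∉ e)
    (hd : tdet (planeProj b A) (planeProj b B) (planeProj b C) ≠ 0) {g : Sym2 Space}
    (hall : ∀ e ∈ F, e ≠ g → Avoids b A B C e) (hg : g ∈ F → Passes b A B C g) :
    Reach b 1 (insert s(A, B) F) (insert s(A, C) (insert s(B, C) F)) := by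
  have hall' : ∀ e ∈ F, Avoids b A B C e ∨ Passes b A B C e := by
    intro e he
    by_cases heg : e = g
    · subst heg; exact Or.inr (hg he)
    · exact Or.inl (hall e he heg)
  have hempty : ∀ e ∈ F, ∀ f ∈ F, e ≠ f → ∀ x ∈ sh b e, x ∈ sh b f →
        x ∉ convexHull ℝ {planeProj b A, planeProj b B, planeProj b C} := by
    intro e he f hf hef x hxe hxf hxT
    have hne : ∀ e ∈ F, e ≠ s(A, B) := fun e he h' => hAB (h' ▸ he)
    have : x = planeProj b A ∨ x = planeProj b B := by
      by_cases heg : e = g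
      · subst heg
        exact hall f hf hef.symm x hxf hxT
      · exact hall e he heg x hxe hxT
    refine h.tr e (Or.inr he) f (Or.inr hf) _ (Or.inl rfl) hef (hne e he) (hne f hf) x hxe hxf ?_
    rcases this with rfl | rfl
    · exact vertex_mem_sh (by simp)
    · exact vertex_mem_sh (by simp)
  by_cases hcase : ∀ e ∈ F, Avoids b A B C e ∨ Crosses b A B C e
  · exact (Reach.of_crosses h hAB hC hd hcase fun e he f hf hef _ _ => hempty e he f hf hef).mono
      (by norm_num)
  push Not at hcase
  obtain ⟨g', hgF, hga, hgc⟩ := hcase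
  obtain rfl : g' = g := by
    by_contra hne
    exact hga (hall g' hgF hne)
  have hgp := hg hgF
  have h' : Good b (insert s(A, C) (insert s(B, C) F)) :=
    h.of_triangle hAB hC hd hall'
      fun e he f hf hef h1 h2 x hxe hxf =>
        ⟨fun hx => hempty e he f hf hef x hxe hxf (segment_subset_triangle₁₃ hx),
          fun hx => hempty e he f hf hef x hxe hxf (segment_subset_triangle₂₃ hx)⟩
  have hno : ∀ x ∈ sh b g', x ∉ segment ℝ (planeProj b A) (planeProj b B) :=
    fun x hx hxAB => hgc ⟨hgp, x, hx, hxAB⟩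
  obtain ⟨z, hz, hzT⟩ : ∃ z ∈ sh b g', z ∈ convexHull ℝ
      {planeProj b A, planeProj b B, planeProj b C} := by
    by_contra hcon
    push Not at hcon
    exact hga fun x hx hxT => absurd hxT (hcon x hx)
  obtain ⟨⟨y, hy, hy'⟩, ⟨w, hw, hw'⟩, -⟩ := Passes.meets hd hgp.ends hz hzT
  replace hy' := hy'.resolve_left (hno y hy)
  replace hw' := hw'.resolve_left (hno w hw)
  refine Reach.of_move h h' (Or.inl (Or.inr (Or.inl ⟨planeProj b A, planeProj b B,
    planeProj b C, h.replaceEdge h' hAB (fun e he => hC e (Or.inr he)) hd,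
    Sym2.map (planeProj b) g', h.other_of_mem hAB hgF, ?_, ?_, ⟨z, hz, hzT⟩, ?_, ?_⟩)))
  · rw [Set.eq_empty_iff_forall_notMem]
    rintro x ⟨hx, hxAB⟩
    exact hno x hx hxAB
  · intro v hv
    obtain ⟨u, hu, rfl⟩ := Sym2.mem_map.1 hv
    exact hgp.ends u hu
  · have hT := convex_convexHull ℝ {A, B, C}
    rw [Sym2.eq_swap (a := planeProj b C), ← Sym2.map_mk, ← Sym2.map_mk,
      h'.isOver_iff (Or.inr (Or.inr hgF)) (Or.inl rfl),
      h'.isOver_iff (Or.inr (Or.inr hgF)) (Or.inr (Or.inl rfl))]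
    constructor
    · intro hab
      exact above_of_above hT hgp.disj edge_subset_triangle₁₃ edge_subset_triangle₂₃ hab hy
        (by rwa [sh_mk])
    · intro hab
      exact above_of_above hT hgp.disj edge_subset_triangle₂₃ edge_subset_triangle₁₃ hab hw
        (by rwa [sh_mk])
  · intro e' he' hne
    obtain ⟨e, he, rfl⟩ := h.exists_of_other he'
    exact (hall e he (by rintro rfl; exact hne rfl)).misses

theorem not_cyclic (h : Good b (insert s(A, B) F)) {g k : Sym2 Space} (hg : g ∈ F) (hk : k ∈ F)
    (hgp : Passes b A B C g) (hkp : Passes b A B C k) {x : Plane} (hxg : x ∈ sh b g)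
    (hxk : x ∈ sh b k)
    (hxT : x ∈ convexHull ℝ {planeProj b A, planeProj b B, planeProj b C}) :
    ¬ (h.diag.isOver s(planeProj b A, planeProj b B) (Sym2.map (planeProj b) g) ∧
      h.diag.isOver (Sym2.map (planeProj b) g) (Sym2.map (planeProj b) k) ∧
      h.diag.isOver (Sym2.map (planeProj b) k) s(planeProj b A, planeProj b B)) := by
  rintro ⟨h1, h2, h3⟩
  have hT := convex_convexHull ℝ {A, B, C}
  obtain ⟨hge, hke, hgk, hne⟩ := h.diag.over_crossing _ _ h2
  refine (h.diag.over_or_under _ hge _ hke hgk hne).1 h2 ?_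
  rw [← Sym2.map_mk, h.isOver_iff (Or.inl rfl) (Or.inr hg)] at h1
  rw [← Sym2.map_mk, h.isOver_iff (Or.inr hk) (Or.inl rfl)] at h3
  rw [h.isOver_iff (Or.inr hk) (Or.inr hg)]
  obtain ⟨p, hp, q, hq, hpq, hlt⟩ := h1
  obtain ⟨p', hp', q', hq', hpq', hlt'⟩ := h3
  obtain ⟨r, hr, rfl⟩ := mem_sh_iff.1 hxg
  obtain ⟨r', hr', hrr⟩ := mem_sh_iff.1 hxk
  rw [← image_triangle] at hxT
  obtain ⟨t, ht, htr⟩ := hxT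
  have e1 := height_consistent hT (convex_edgeSegment g) hgp.disj.symm
    (edge_subset_triangle₁₂ hp) hq ht hr hpq htr hlt
  have e2 := height_consistent (convex_edgeSegment k) hT hkp.disj hp' (edge_subset_triangle₁₂ hq')
    hr' ht hpq' (hrr.trans htr.symm) hlt'
  exact ⟨r', hr', r, hr, hrr, e1.trans e2⟩

/-- Only two edges `g`, `k` crossing the base pass the triangle. -/
theorem Reach.of_double (h : Good b (insert s(A, B) F)) (hAB : s(A, B) ∉ F)
    (hC : ∀ e ∈ insert s(A, B) F, C ∉ e)
    (hd : tdet (planeProj b A) (planeProj b B) (planeProj b C) ≠ 0) {g k : Sym2 Space}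
    (hall : ∀ e ∈ F, e ≠ g → e ≠ k → Avoids b A B C e) (hg : g ∈ F) (hk : k ∈ F)
    (hgk : g ≠ k) (hgc : Crosses b A B C g) (hkc : Crosses b A B C k)
    (hX : ∀ x ∈ sh b g, x ∈ sh b k → x ∉ segment ℝ (planeProj b A) (planeProj b C) ∧
        x ∉ segment ℝ (planeProj b B) (planeProj b C)) :
    Reach b 1 (insert s(A, B) F) (insert s(A, C) (insert s(B, C) F)) := by
  have hall' : ∀ e ∈ F, Avoids b A B C e ∨ Crosses b A B C e := by
    intro e he
    by_cases heg : e = g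
    · subst heg; exact Or.inr hgc
    by_cases hek : e = k
    · subst hek; exact Or.inr hkc
    exact Or.inl (hall e he heg hek)
  have hempty : ∀ e ∈ F, ∀ f ∈ F, e ≠ f → ∀ x ∈ sh b e, x ∈ sh b f →
        x ∈ convexHull ℝ {planeProj b A, planeProj b B, planeProj b C} →
        (e = g ∧ f = k) ∨ (e = k ∧ f = g) := by
    intro e he f hf hef x hxe hxf hxT
    have hne : ∀ e ∈ F, e ≠ s(A, B) := fun e he h' => hAB (h' ▸ he)
    by_contra hcon
    have : x = planeProj b A ∨ x = planeProj b B := by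
      by_cases heg : e = g
      · exact hall f hf (by rintro rfl; exact hef heg) (by tauto) x hxf hxT
      · by_cases hek : e = k
        · exact hall f hf (by tauto) (by rintro rfl; exact hef hek) x hxf hxT
        · exact hall e he heg hek x hxe hxT
    refine h.tr e (Or.inr he) f (Or.inr hf) _ (Or.inl rfl) hef (hne e he) (hne f hf) x hxe hxf ?_
    rcases this with rfl | rfl
    · exact vertex_mem_sh (by simp)
    · exact vertex_mem_sh (by simp)
  have h' : Good b (insert s(A, C) (insert s(B, C) F)) := by
    refine h.of_triangle hAB hC hd (fun e he => (hall' e he).imp_right And.left)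
      fun e he f hf hef h1 h2 x hxe hxf => ⟨fun hx => ?_, fun hx => ?_⟩
    · rcases hempty e he f hf hef x hxe hxf (segment_subset_triangle₁₃ hx) with
        ⟨rfl, rfl⟩ | ⟨rfl, rfl⟩
      · exact (hX x hxe hxf).1 hx
      · exact (hX x hxf hxe).1 hx
    · rcases hempty e he f hf hef x hxe hxf (segment_subset_triangle₂₃ hx) with
        ⟨rfl, rfl⟩ | ⟨rfl, rfl⟩
      · exact (hX x hxe hxf).2 hx
      · exact (hX x hxf hxe).2 hx
  by_cases hcr : ∃ x ∈ sh b g, x ∈ sh b k ∧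
      x ∈ convexHull ℝ {planeProj b A, planeProj b B, planeProj b C}
  · obtain ⟨x, hxg, hxk, hxT⟩ := hcr
    refine Reach.of_move h h' (Or.inl (Or.inr (Or.inr ⟨planeProj b A, planeProj b B,
      planeProj b C, h.replaceEdge h' hAB (fun e he => hC e (Or.inr he)) hd,
      Sym2.map (planeProj b) g, h.other_of_mem hAB hg, Sym2.map (planeProj b) k,
      h.other_of_mem hAB hk, ?_, hgc.runsThrough, hkc.runsThrough, ⟨x, ⟨hxg, hxk⟩, hxT⟩,
      hgc.sameLabel h h' hd hg, hkc.sameLabel h h' hd hk,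
      not_cyclic h hg hk hgc.1 hkc.1 hxg hxk hxT, ?_, ?_⟩)))
    · exact fun heq => hgk (h.map_inj (Or.inr hg) (Or.inr hk) heq)
    · intro hcyc
      exact not_cyclic h hk hg hkc.1 hgc.1 hxk hxg hxT ⟨hcyc.2.1, hcyc.2.2, hcyc.1⟩
    · intro e' he' hne hne'
      obtain ⟨e, he, rfl⟩ := h.exists_of_other he'
      exact (hall e he (by rintro rfl; exact hne rfl) (by rintro rfl; exact hne' rfl)).misses
  · push Not at hcr
    refine (Reach.of_crosses h hAB hC hd hall' fun e he f hf hef _ _ x hxe hxf hxT => ?_).mono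
      (by norm_num)
    rcases hempty e he f hf hef x hxe hxf hxT with ⟨rfl, rfl⟩ | ⟨rfl, rfl⟩
    · exact hcr x hxe hxf hxT
    · exact hcr x hxf hxe hxT

/-- An edge is pulled across the next edge `g` at one of its ends. -/
theorem Reach.of_first (h : Good b (insert s(A, B) F)) (hAB : s(A, B) ∉ F)
    (hC : ∀ e ∈ insert s(A, B) F, C ∉ e)
    (hd : tdet (planeProj b A) (planeProj b B) (planeProj b C) ≠ 0) {g : Sym2 Space}
    (hall : ∀ e ∈ F, e ≠ g → Avoids b A B C e) (hg : g ∈ F) (hA : A ∈ g)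
    (hgd : ∀ p ∈ edgeSegment g, p ∈ convexHull ℝ {A, B, C} → p = A)
    (hgC : planeProj b C ∉ sh b g)
    (hgo : ∃ x ∈ sh b g, x ∈ openSegment ℝ (planeProj b C) (planeProj b B)) :
    Reach b 1 (insert s(A, B) F) (insert s(A, C) (insert s(B, C) F)) := by
  have hne : ∀ e ∈ F, e ≠ s(A, B) := fun e he h' => hAB (h' ▸ he)
  have hempty : ∀ e ∈ F, ∀ f ∈ F, e ≠ f → ∀ x ∈ sh b e, x ∈ sh b f →
        x ∉ convexHull ℝ {planeProj b A, planeProj b B, planeProj b C} := by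
    intro e he f hf hef x hxe hxf hxT
    have : x = planeProj b A ∨ x = planeProj b B := by
      by_cases heg : e = g
      · subst heg
        exact hall f hf hef.symm x hxf hxT
      · exact hall e he heg x hxe hxT
    refine h.tr e (Or.inr he) f (Or.inr hf) _ (Or.inl rfl) hef (hne e he) (hne f hf) x hxe hxf ?_
    rcases this with rfl | rfl
    · exact vertex_mem_sh (by simp)
    · exact vertex_mem_sh (by simp)
  have h' : Good b (insert s(A, C) (insert s(B, C) F)) := by
    refine h.insert_vertex hAB hC (fun x => eq_apex_of_mem_segments hd) ?_ ?_ ?_ ?_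
    · intro e he
      by_cases heg : e = g
      · rw [heg]; exact hgC
      · exact (hall e he heg).apex_notMem hd
    · intro e he hAe
      have heg : e ≠ g := by rintro rfl; exact hAe hA
      rw [Set.disjoint_right]
      intro p hpe hp
      have hp' := proj_mem_segment (b := b) hp
      rcases hall e he heg _ (proj_mem_sh hpe) (segment_subset_triangle₁₃ hp') with h2 | h2
      · exact h.not_mem_sh (Or.inl rfl) (Or.inr he) (v := A) (by simp) hAe (h2 ▸ proj_mem_sh hpe)
      · rw [h2] at hp'; exact not_mem_segment_right hd hp'
    · intro e he hBe
      rw [Set.disjoint_right]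
      intro p hpe hp
      have hp' := proj_mem_segment (b := b) hp
      by_cases heg : e = g
      · subst heg
        rw [hgd p hpe (segment_subset_triangle₂₃ hp)] at hp'
        exact not_mem_segment_left hd hp'
      rcases hall e he heg _ (proj_mem_sh hpe) (segment_subset_triangle₂₃ hp') with h2 | h2
      · rw [h2] at hp'; exact not_mem_segment_left hd hp'
      · exact h.not_mem_sh (Or.inl rfl) (Or.inr he) (v := B) (by simp) hBe (h2 ▸ proj_mem_sh hpe)
    · exact fun e he f hf hef x hxe hxf =>
        ⟨fun hx => hempty e he f hf hef x hxe hxf (segment_subset_triangle₁₃ hx),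
          fun hx => hempty e he f hf hef x hxe hxf (segment_subset_triangle₂₃ hx)⟩
  refine Reach.of_move h h' (Or.inl (Or.inl ⟨planeProj b A, planeProj b B,
    planeProj b C, h.replaceEdge h' hAB (fun e he => hC e (Or.inr he)) hd,
    Sym2.map (planeProj b) g, h.other_of_mem hAB hg, Sym2.mem_map.2 ⟨A, hA, rfl⟩, hgo, ?_⟩))
  intro e' he' hne
  obtain ⟨e, he, rfl⟩ := h.exists_of_other he'
  exact (hall e he (by rintro rfl; exact hne rfl)).misses

end triangle

/-! ### Subdividing an edge -/

section subdivide

variable {F : Set (Sym2 Space)} {A B C : Space}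

theorem openSegment_cases {V : Type*} [AddCommGroup V] [Module ℝ V] {p q r x : V}
    (h : r ∈ openSegment ℝ p q) (hx : x ∈ segment ℝ p q) :
    x ∈ segment ℝ p r ∨ x ∈ segment ℝ q r := by
  obtain ⟨a, c, ha, hc, hac, rfl⟩ := h
  obtain ⟨a', c', ha', hc', hac', rfl⟩ := hx
  rcases le_total c' c with hle | hle
  · left
    refine ⟨1 - c' / c, c' / c, ?_, by positivity, by ring, ?_⟩
    · rw [sub_nonneg, div_le_one hc]; exact hle
    · obtain rfl : a' = 1 - c' := by linarith
      obtain rfl : a = 1 - c := by linarith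
      rw [smul_add, smul_smul, smul_smul, div_mul_cancel₀ _ hc.ne', ← add_assoc, ← add_smul]
      congr 2
      field_simp; ring
  · right
    have hle' : a' ≤ a := by linarith
    refine ⟨1 - a' / a, a' / a, ?_, by positivity, by ring, ?_⟩
    · rw [sub_nonneg, div_le_one ha]; exact hle'
    · obtain rfl : c' = 1 - a' := by linarith
      obtain rfl : c = 1 - a := by linarith
      have : (1 - a' / a) + a' / a * (1 - a) = 1 - a' := by field_simp; ring
      rw [smul_add, smul_smul, smul_smul, div_mul_cancel₀ _ ha.ne', add_left_comm, ← add_smul,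
        this]

theorem openSegment_not_mem {V : Type*} [AddCommGroup V] [Module ℝ V] {p q r : V} (hpq : p ≠ q)
    (h : r ∈ openSegment ℝ p q) : q ∉ segment ℝ p r := by
  obtain ⟨a, c, ha, hc, hac, rfl⟩ := h
  rintro ⟨s, t, hs, ht, hst, h⟩
  have : (1 - t * c) • (q - p) = 0 := by
    obtain rfl : s = 1 - t := by linarith
    obtain rfl : a = 1 - c := by linarith
    have h' : q - ((1 - t) • p + t • ((1 - c) • p + c • q)) = 0 := by rw [h, sub_self]
    rw [← h']; module
  rcases smul_eq_zero.1 this with h1 | h1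
  · nlinarith
  · exact hpq (sub_eq_zero.1 h1).symm

theorem openSegment_inter {V : Type*} [AddCommGroup V] [Module ℝ V] {p q r x : V} (hpq : p ≠ q)
    (h : r ∈ openSegment ℝ p q) (h1 : x ∈ segment ℝ p r) (h2 : x ∈ segment ℝ q r) : x = r := by
  obtain ⟨a, c, ha, hc, hac, rfl⟩ := h
  obtain ⟨s, t, hs, ht, hst, rfl⟩ := h1
  obtain ⟨s', t', hs', ht', hst', h⟩ := h2
  have : (s' * 1 + t' * c - t * c) • (q - p) = 0 := by
    obtain rfl : s = 1 - t := by linarith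
    obtain rfl : s' = 1 - t' := by linarith
    obtain rfl : a = 1 - c := by linarith
    rw [← sub_eq_zero] at h
    rw [← h]; module
  rcases smul_eq_zero.1 this with h3 | h3
  · have : t = 1 := by
      obtain rfl : s' = 1 - t' := by linarith
      obtain rfl : a = 1 - c := by linarith
      nlinarith
    subst this
    obtain rfl : s = 0 := by linarith
    simp
  · exact absurd (sub_eq_zero.1 h3).symm hpq

theorem Good.subdivide (h : Good b (insert s(A, B) F)) (hAB : s(A, B) ∉ F)
    (hX : C ∈ openSegment ℝ A B) (hsh : ∀ e ∈ F, planeProj b C ∉ sh b e) :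
    Good b (insert s(A, C) (insert s(B, C) F)) := by
  have hne := h.ne (Or.inl rfl)
  have hpne := h.proj_ne (Or.inl rfl)
  have hX' : planeProj b C ∈ openSegment ℝ (planeProj b A) (planeProj b B) := by
    obtain ⟨a, c, ha, hc, hac, rfl⟩ := hX
    exact ⟨a, c, ha, hc, hac, by simp⟩
  have hXs := openSegment_subset_segment ℝ A B hX
  have hXB : B ≠ C := by
    rintro rfl; exact openSegment_not_mem hne hX (right_mem_segment ℝ _ _)
  have hXA : A ≠ C := by
    rintro rfl
    exact openSegment_not_mem hne.symm (by rwa [openSegment_symm]) (right_mem_segment ℝ _ _)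
  have hneF : ∀ e ∈ F, e ≠ s(A, B) := fun e he h' => hAB (h' ▸ he)
  have sub1 : segment ℝ A C ⊆ segment ℝ A B :=
    (convex_segment A B).segment_subset (left_mem_segment ℝ _ _) hXs
  have sub2 : segment ℝ B C ⊆ segment ℝ A B :=
    (convex_segment A B).segment_subset (right_mem_segment ℝ _ _) hXs
  have hXs' := openSegment_subset_segment ℝ _ _ hX'
  have sub1' := (convex_segment (planeProj b A) (planeProj b B)).segment_subset
    (left_mem_segment ℝ _ _) hXs'
  have sub2' := (convex_segment (planeProj b A) (planeProj b B)).segment_subset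
    (right_mem_segment ℝ _ _) hXs'
  refine h.insert_vertex hAB ?_ (fun x => openSegment_inter hpne hX') hsh ?_ ?_ ?_
  · rintro e (rfl | he) hCe
    · rcases Sym2.mem_iff.1 hCe with h1 | h1
      · exact hXA h1.symm
      · exact hXB h1.symm
    · exact hsh e he (vertex_mem_sh hCe)
  · intro e he hAe
    rw [Set.disjoint_right]
    intro p hpe hp
    have := h.embedded (Or.inl rfl) (Or.inr he) (hneF e he).symm
      (by rw [edgeSegment_mk]; exact sub1 hp) hpe
    rcases Sym2.mem_iff.1 this.1 with h1 | h1
    · exact hAe (h1 ▸ this.2)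
    · exact openSegment_not_mem hne hX (h1 ▸ hp)
  · intro e he hBe
    rw [Set.disjoint_right]
    intro p hpe hp
    have := h.embedded (Or.inl rfl) (Or.inr he) (hneF e he).symm
      (by rw [edgeSegment_mk]; exact sub2 hp) hpe
    rcases Sym2.mem_iff.1 this.1 with h1 | h1
    · rw [openSegment_symm] at hX
      exact openSegment_not_mem hne.symm hX (h1 ▸ hp)
    · exact hBe (h1 ▸ this.2)
  · intro e he f hf hef x hxe hxf
    have key := h.tr e (Or.inr he) f (Or.inr hf) _ (Or.inl rfl) hef (hneF e he) (hneF f hf) x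
      hxe hxf
    rw [sh_mk] at key
    exact ⟨fun hx => key (sub1' hx), fun hx => key (sub2' hx)⟩

theorem Reach.of_subdivide (h : Good b (insert s(A, B) F)) (hAB : s(A, B) ∉ F)
    (hX : C ∈ openSegment ℝ A B) (hsh : ∀ e ∈ F, planeProj b C ∉ sh b e) :
    Reach b 0 (insert s(A, B) F) (insert s(A, C) (insert s(B, C) F)) := by
  have h' := h.subdivide hAB hX hsh
  have hX' : planeProj b C ∈ openSegment ℝ (planeProj b A) (planeProj b B) := by
    obtain ⟨a, c, ha, hc, hac, rfl⟩ := hX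
    exact ⟨a, c, ha, hc, hac, by simp⟩
  have hXs := openSegment_subset_segment ℝ A B hX
  refine Reach.of_isotopy h h' (Or.inl ⟨planeProj b A, planeProj b B, planeProj b C,
    h.mem_left_iff.2 (Or.inl rfl), hX', h.edges_iff h' hAB, h.isOver_old h', ?_⟩)
  intro e' he' hne
  obtain ⟨e, he, rfl⟩ := h.exists_of_other ⟨he', hne⟩
  rw [Sym2.eq_swap (a := planeProj b C), ← Sym2.map_mk, ← Sym2.map_mk, ← Sym2.map_mk,
    h.isOver_iff (Or.inr he) (Or.inl rfl), h'.isOver_iff (Or.inr (Or.inr he)) (Or.inl rfl),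
    h'.isOver_iff (Or.inr (Or.inr he)) (Or.inr (Or.inl rfl))]
  unfold PolygonalLink.Above
  simp only [edgeSegment_mk]
  constructor
  · rintro ⟨p, hp, q, hq, hr⟩
    rcases openSegment_cases hX hq with h1 | h1
    · exact Or.inl ⟨p, hp, q, h1, hr⟩
    · exact Or.inr ⟨p, hp, q, h1, hr⟩
  · rintro (⟨p, hp, q, hq, hr⟩ | ⟨p, hp, q, hq, hr⟩)
    · exact ⟨p, hp, q, (convex_segment A B).segment_subset (left_mem_segment ℝ _ _) hXs hq, hr⟩
    · exact ⟨p, hp, q, (convex_segment A B).segment_subset (right_mem_segment ℝ _ _) hXs hq, hr⟩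

end subdivide

open Filter Topology

/-! ### Persistence of disjointness under small perturbations -/

section openness

variable {V : Type*} [NormedAddCommGroup V] [NormedSpace ℝ V] {ι : Type*} {l : Filter ι}

theorem mem_hull_vec_iff {p : Fin 3 → V} {x : V} : x ∈ convexHull ℝ {p 0, p 1, p 2} ↔
    ∃ w ∈ stdSimplex ℝ (Fin 3), ∑ i, w i • p i = x := by
  rw [mem_triangle_iff]
  constructor
  · rintro ⟨α, β, γ, h1, h2, h3, h4, h5⟩
    refine ⟨![α, β, γ], ⟨?_, ?_⟩, ?_⟩
    · intro i; fin_cases i <;> simpa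
    · simpa [Fin.sum_univ_three] using h4
    · simpa [Fin.sum_univ_three] using h5
  · rintro ⟨w, ⟨h1, h2⟩, h3⟩
    rw [Fin.sum_univ_three] at h2 h3
    exact ⟨w 0, w 1, w 2, h1 0, h1 1, h1 2, h2, h3⟩

theorem eventually_hulls_disjoint {P Q R : ι → Fin 3 → V} {P₀ Q₀ R₀ : Fin 3 → V}
    (hP : Tendsto P l (𝓝 P₀)) (hQ : Tendsto Q l (𝓝 Q₀)) (hR : Tendsto R l (𝓝 R₀))
    (h : ∀ x ∈ convexHull ℝ {P₀ 0, P₀ 1, P₀ 2}, x ∈ convexHull ℝ {Q₀ 0, Q₀ 1, Q₀ 2} →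
      x ∉ convexHull ℝ {R₀ 0, R₀ 1, R₀ 2}) :
    ∀ᶠ i in l, ∀ x ∈ convexHull ℝ {P i 0, P i 1, P i 2},
      x ∈ convexHull ℝ {Q i 0, Q i 1, Q i 2} → x ∉ convexHull ℝ {R i 0, R i 1, R i 2} := by
  set K : Set ((Fin 3 → ℝ) × (Fin 3 → ℝ) × (Fin 3 → ℝ)) :=
    stdSimplex ℝ (Fin 3) ×ˢ stdSimplex ℝ (Fin 3) ×ˢ stdSimplex ℝ (Fin 3) with hK
  have hKc : IsCompact K :=
    (isCompact_stdSimplex ℝ _).prod ((isCompact_stdSimplex ℝ _).prod (isCompact_stdSimplex ℝ _))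
  let G : ((Fin 3 → V) × (Fin 3 → V) × (Fin 3 → V)) →
      ((Fin 3 → ℝ) × (Fin 3 → ℝ) × (Fin 3 → ℝ)) → V × V := fun z w =>
    (∑ i, w.1 i • z.1 i - ∑ i, w.2.1 i • z.2.1 i, ∑ i, w.1 i • z.1 i - ∑ i, w.2.2 i • z.2.2 i)
  have hG : Continuous fun z : (((Fin 3 → V) × (Fin 3 → V) × (Fin 3 → V)) ×
      ((Fin 3 → ℝ) × (Fin 3 → ℝ) × (Fin 3 → ℝ))) => G z.1 z.2 := by
    simp only [G]; fun_prop
  have key : ∀ᶠ z in 𝓝 (P₀, Q₀, R₀), ∀ w ∈ K, G z w ≠ 0 := by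
    refine hKc.eventually_forall_of_forall_eventually fun w hw => ?_
    refine (hG.tendsto ((P₀, Q₀, R₀), w)).eventually_ne ?_
    intro h0
    have h1 : ∑ i, w.1 i • P₀ i = ∑ i, w.2.1 i • Q₀ i := sub_eq_zero.1 (congrArg Prod.fst h0)
    have h2 : ∑ i, w.1 i • P₀ i = ∑ i, w.2.2 i • R₀ i := sub_eq_zero.1 (congrArg Prod.snd h0)
    exact h _ (mem_hull_vec_iff.2 ⟨w.1, hw.1, rfl⟩) (mem_hull_vec_iff.2 ⟨w.2.1, hw.2.1, h1.symm⟩)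
      (mem_hull_vec_iff.2 ⟨w.2.2, hw.2.2, h2.symm⟩)
  filter_upwards [(hP.prodMk_nhds (hQ.prodMk_nhds hR)).eventually key] with i hi x hxP hxQ hxR
  obtain ⟨w, hw, h1⟩ := mem_hull_vec_iff.1 hxP
  obtain ⟨w', hw', h2⟩ := mem_hull_vec_iff.1 hxQ
  obtain ⟨w'', hw'', h3⟩ := mem_hull_vec_iff.1 hxR
  refine hi (w, w', w'') ⟨hw, hw', hw''⟩ ?_
  simp only [G, h1, h2, h3, sub_self]
  rfl

theorem tendsto_vec {a c d : ι → V} {a₀ c₀ d₀ : V} (ha : Tendsto a l (𝓝 a₀))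
    (hc : Tendsto c l (𝓝 c₀)) (hd : Tendsto d l (𝓝 d₀)) :
    Tendsto (fun i => ![a i, c i, d i]) l (𝓝 ![a₀, c₀, d₀]) := by
  rw [tendsto_pi_nhds]
  intro i
  fin_cases i <;> simpa

theorem eventually_triangles {a c d a' c' d' a'' c'' d'' : ι → V}
    {a₀ c₀ d₀ a₀' c₀' d₀' a₀'' c₀'' d₀'' : V}
    (ha : Tendsto a l (𝓝 a₀)) (hc : Tendsto c l (𝓝 c₀)) (hd : Tendsto d l (𝓝 d₀))
    (ha' : Tendsto a' l (𝓝 a₀')) (hc' : Tendsto c' l (𝓝 c₀')) (hd' : Tendsto d' l (𝓝 d₀'))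
    (ha'' : Tendsto a'' l (𝓝 a₀'')) (hc'' : Tendsto c'' l (𝓝 c₀'')) (hd'' : Tendsto d'' l (𝓝 d₀''))
    (h : ∀ x ∈ convexHull ℝ {a₀, c₀, d₀}, x ∈ convexHull ℝ {a₀', c₀', d₀'} →
      x ∉ convexHull ℝ {a₀'', c₀'', d₀''}) :
    ∀ᶠ i in l, ∀ x ∈ convexHull ℝ {a i, c i, d i}, x ∈ convexHull ℝ {a' i, c' i, d' i} →
      x ∉ convexHull ℝ {a'' i, c'' i, d'' i} :=
  eventually_hulls_disjoint (tendsto_vec ha hc hd) (tendsto_vec ha' hc' hd')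
    (tendsto_vec ha'' hc'' hd'') h

theorem triangle_degenerate (a c : V) : convexHull ℝ {a, c, c} = segment ℝ a c := by
  rw [Set.pair_eq_singleton, convexHull_pair]

theorem eventually_segments_triangle {a c a' c' p q r : ι → V} {a₀ c₀ a₀' c₀' p₀ q₀ r₀ : V}
    (ha : Tendsto a l (𝓝 a₀)) (hc : Tendsto c l (𝓝 c₀))
    (ha' : Tendsto a' l (𝓝 a₀')) (hc' : Tendsto c' l (𝓝 c₀'))
    (hp : Tendsto p l (𝓝 p₀)) (hq : Tendsto q l (𝓝 q₀)) (hr : Tendsto r l (𝓝 r₀))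
    (h : ∀ x ∈ segment ℝ a₀ c₀, x ∈ segment ℝ a₀' c₀' → x ∉ convexHull ℝ {p₀, q₀, r₀}) :
    ∀ᶠ i in l, ∀ x ∈ segment ℝ (a i) (c i), x ∈ segment ℝ (a' i) (c' i) →
      x ∉ convexHull ℝ {p i, q i, r i} := by
  simp only [← triangle_degenerate] at h ⊢
  exact eventually_triangles ha hc hc ha' hc' hc' hp hq hr h

theorem eventually_segment_triangle {a c p q r : ι → V} {a₀ c₀ p₀ q₀ r₀ : V}
    (ha : Tendsto a l (𝓝 a₀)) (hc : Tendsto c l (𝓝 c₀))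
    (hp : Tendsto p l (𝓝 p₀)) (hq : Tendsto q l (𝓝 q₀)) (hr : Tendsto r l (𝓝 r₀))
    (h : Disjoint (segment ℝ a₀ c₀) (convexHull ℝ {p₀, q₀, r₀})) :
    ∀ᶠ i in l, Disjoint (segment ℝ (a i) (c i)) (convexHull ℝ {p i, q i, r i}) := by
  filter_upwards [eventually_segments_triangle ha hc ha hc hp hq hr
    fun x hx _ => Set.disjoint_left.1 h hx] with i hi
  exact Set.disjoint_left.2 fun x hx => hi x hx hx

theorem eventually_point_triangle {a p q r : ι → V} {a₀ p₀ q₀ r₀ : V}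
    (ha : Tendsto a l (𝓝 a₀))
    (hp : Tendsto p l (𝓝 p₀)) (hq : Tendsto q l (𝓝 q₀)) (hr : Tendsto r l (𝓝 r₀))
    (h : a₀ ∉ convexHull ℝ {p₀, q₀, r₀}) : ∀ᶠ i in l, a i ∉ convexHull ℝ {p i, q i, r i} := by
  filter_upwards [eventually_segment_triangle ha ha hp hq hr (by simpa [segment_same] using h)]
    with i hi
  simpa [segment_same] using hi

theorem eventually_segments {a c p q : ι → V} {a₀ c₀ p₀ q₀ : V}
    (ha : Tendsto a l (𝓝 a₀)) (hc : Tendsto c l (𝓝 c₀))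
    (hp : Tendsto p l (𝓝 p₀)) (hq : Tendsto q l (𝓝 q₀))
    (h : Disjoint (segment ℝ a₀ c₀) (segment ℝ p₀ q₀)) :
    ∀ᶠ i in l, Disjoint (segment ℝ (a i) (c i)) (segment ℝ (p i) (q i)) := by
  simp only [← triangle_degenerate p₀, ← triangle_degenerate (p _)] at h ⊢
  exact eventually_segment_triangle ha hc hp hq hq h

theorem eventually_point_segment {a p q : ι → V} {a₀ p₀ q₀ : V} (ha : Tendsto a l (𝓝 a₀))
    (hp : Tendsto p l (𝓝 p₀)) (hq : Tendsto q l (𝓝 q₀)) (h : a₀ ∉ segment ℝ p₀ q₀) :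
    ∀ᶠ i in l, a i ∉ segment ℝ (p i) (q i) := by
  simp only [← triangle_degenerate] at h ⊢
  exact eventually_point_triangle ha hp hq hq h

/-- That a segment starting at a corner of a triangle leaves the triangle persists. -/
theorem eventually_cone {a y p q : ι → V} {a₀ y₀ p₀ q₀ : V}
    (ha : Tendsto a l (𝓝 a₀)) (hy : Tendsto y l (𝓝 y₀)) (hp : Tendsto p l (𝓝 p₀))
    (hq : Tendsto q l (𝓝 q₀)) (hay : y₀ ≠ a₀) (hpq : a₀ ∉ segment ℝ p₀ q₀)
    (h : ∀ x ∈ segment ℝ a₀ y₀, x ∈ convexHull ℝ {a₀, p₀, q₀} → x = a₀) :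
    ∀ᶠ i in l, ∀ x ∈ segment ℝ (a i) (y i), x ∈ convexHull ℝ {a i, p i, q i} → x = a i := by
  have h0 : (0 : V) ∉ convexHull ℝ {p₀ - a₀, q₀ - a₀, a₀ - y₀} := by
    rw [mem_triangle_iff]
    rintro ⟨α, β, γ, h1, h2, h3, h4, h5⟩
    have hx1 : a₀ + γ • (y₀ - a₀) ∈ segment ℝ a₀ y₀ :=
      ⟨1 - γ, γ, by linarith, h3, by ring, by module⟩
    have hx2 : a₀ + γ • (y₀ - a₀) ∈ convexHull ℝ {a₀, p₀, q₀} := by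
      refine mem_triangle_iff.2 ⟨γ, α, β, h3, h1, h2, by linarith, ?_⟩
      have : γ = 1 - α - β := by linarith
      have e : γ • (y₀ - a₀) = α • (p₀ - a₀) + β • (q₀ - a₀) := by
        rw [← sub_eq_zero, ← neg_eq_zero, ← h5]; module
      rw [e, this]; module
    have := h _ hx1 hx2
    rw [add_eq_left, smul_eq_zero] at this
    have hγ : γ = 0 := this.resolve_right (sub_ne_zero.2 hay)
    refine hpq ⟨α, β, h1, h2, by linarith, ?_⟩
    obtain rfl : α = 1 - β := by linarith
    rw [← sub_eq_zero, ← h5, hγ]; module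
  have t0 : Tendsto (fun _ : ι => (0 : V)) l (𝓝 0) := tendsto_const_nhds
  filter_upwards [eventually_point_triangle t0 (hp.sub ha) (hq.sub ha) (ha.sub hy) h0] with i hi
  intro x hx hxT
  by_contra hne
  apply hi
  obtain ⟨s, t, hs, ht, hst, rfl⟩ := hx
  obtain ⟨α, β, γ, h1, h2, h3, h4, h5⟩ := mem_triangle_iff.1 hxT
  have htp : 0 < t := by
    rcases ht.eq_or_lt with rfl | h
    · refine absurd ?_ hne
      obtain rfl : s = 1 := by linarith
      simp
    · exact h
  have hpos : 0 < β + γ + t := by linarith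
  refine mem_triangle_iff.2 ⟨β / (β + γ + t), γ / (β + γ + t), t / (β + γ + t), by positivity,
    by positivity, by positivity, by field_simp, ?_⟩
  have e : β • (p i - a i) + γ • (q i - a i) + t • (a i - y i) = 0 := by
    obtain rfl : s = 1 - t := by linarith
    obtain rfl : α = 1 - β - γ := by linarith
    rw [← sub_eq_zero] at h5
    rw [← h5]; module
  rw [div_eq_inv_mul, div_eq_inv_mul, div_eq_inv_mul, mul_smul, mul_smul, mul_smul, ← smul_add,
    ← smul_add, e, smul_zero]

end openness

theorem continuous_planeProj : Continuous (planeProj b) :=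
  LinearMap.continuous_of_finiteDimensional _

theorem Filter.Tendsto.proj {ι : Type*} {l : Filter ι} {f : ι → Space} {x : Space}
    (h : Tendsto f l (𝓝 x)) : Tendsto (fun i => planeProj b (f i)) l (𝓝 (planeProj b x)) :=
  (continuous_planeProj.tendsto x).comp h

theorem Filter.Tendsto.tdet {ι : Type*} {l : Filter ι} {p q r : ι → Plane} {p₀ q₀ r₀ : Plane}
    (hp : Tendsto p l (𝓝 p₀)) (hq : Tendsto q l (𝓝 q₀)) (hr : Tendsto r l (𝓝 r₀)) :
    Tendsto (fun i => tdet (p i) (q i) (r i)) l (𝓝 (tdet p₀ q₀ r₀)) := by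
  have hc : Continuous fun z : Plane × Plane × Plane => _root_.tdet z.1 z.2.1 z.2.2 := by
    unfold _root_.tdet; fun_prop
  exact (hc.tendsto (p₀, q₀, r₀)).comp (hp.prodMk_nhds (hq.prodMk_nhds hr))

/-! ### Moving a vertex -/

section vertexMove

variable {F : Set (Sym2 Space)} {A B v v' : Space}

/-- An edge on the other side of the line through `p`, `q`. -/
theorem eq_of_separated {p q r s x : Plane} (hsep : tdet p q r * tdet p q s < 0)
    (h1 : x ∈ convexHull ℝ {r, p, q}) (h2 : x ∈ segment ℝ s p) : x = p := by
  obtain ⟨α, β, γ, hα, hβ, hγ, hs, rfl⟩ := mem_triangle_iff.1 h1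
  obtain ⟨c, d, hc, hd, hcd, h⟩ := h2
  have e1 : tdet p q (α • r + β • p + γ • q) = α * tdet p q r := by
    rw [tdet_sum hs, tdet_self_left, tdet_self_right]; ring
  have e2 : tdet p q (c • s + d • p) = c * tdet p q s := by
    rw [tdet_comb _ _ _ _ hcd, tdet_self_left]; ring
  rw [h] at e2
  have e3 : c * tdet p q s = α * tdet p q r := e2.symm.trans e1
  have hc0 : c = 0 := by
    by_contra hne
    have hcp : 0 < c := lt_of_le_of_ne hc (Ne.symm hne)
    have h5 : c * (tdet p q r * tdet p q s) = α * (tdet p q r * tdet p q r) := by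
      linear_combination tdet p q r * e3
    nlinarith [mul_pos_of_neg_of_neg hsep (neg_lt_zero.2 hcp), mul_nonneg hα (mul_self_nonneg (tdet p q r))]
  rw [← h, hc0]
  obtain rfl : d = 1 := by linarith
  simp

theorem vertex_sets_eq (F : Set (Sym2 Space)) (A B v v' : Space) :
    insert s(A, v') (insert s(v, v') (insert s(B, v) F)) =
      insert s(B, v) (insert s(v', v) (insert s(A, v') F)) := by
  ext e
  simp only [Set.mem_insert_iff, Sym2.eq_swap (a := v) (b := v')]
  tauto

structure MoveHyp (b : OrthonormalBasis (Fin 3) ℝ Space) (F : Set (Sym2 Space))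
    (A B v v' : Space) : Prop where
  fresh : ∀ e ∈ F, v ∉ e
  fresh' : ∀ e ∈ F, v' ∉ e
  sep : tdet (planeProj b v) (planeProj b v') (planeProj b A) *
    tdet (planeProj b v) (planeProj b v') (planeProj b B) < 0

namespace MoveHyp

theorem symm (h : MoveHyp b F A B v v') : MoveHyp b F B A v' v where
  fresh := h.fresh'
  fresh' := h.fresh
  sep := by
    have := h.sep
    rw [tdet_swap (planeProj b v) (planeProj b v') (planeProj b A),
      tdet_swap (planeProj b v) (planeProj b v') (planeProj b B)]
    linarith

theorem detA (h : MoveHyp b F A B v v') :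
    tdet (planeProj b A) (planeProj b v) (planeProj b v') ≠ 0 := by
  rw [← tdet_rotate]
  intro h0
  have := h.sep
  rw [h0] at this
  simp at this

theorem detB (h : MoveHyp b F A B v v') :
    tdet (planeProj b B) (planeProj b v') (planeProj b v) ≠ 0 := h.symm.detA

theorem ne_AB (h : MoveHyp b F A B v v') : A ≠ B := by
  rintro rfl
  have := h.sep
  nlinarith [mul_self_nonneg (tdet (planeProj b v) (planeProj b v') (planeProj b A))]

theorem notMem (h : MoveHyp b F A B v v') : s(A, v) ∉ insert s(B, v) F := by
  rintro (h1 | h1)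
  · exact h.ne_AB (Sym2.congr_left.1 h1)
  · exact h.fresh _ h1 (by simp)

theorem notMem' (h : MoveHyp b F A B v v') : s(B, v') ∉ insert s(A, v') F := h.symm.notMem

theorem fresh_all (h : MoveHyp b F A B v v') :
    ∀ e ∈ insert s(A, v) (insert s(B, v) F), v' ∉ e := by
  have h1 : v' ≠ A := fun h' => tdet_ne_left h.detA (by rw [h'])
  have h2 : v' ≠ v := fun h' => tdet_ne_right h.detA (by rw [h'])
  have h3 : v' ≠ B := fun h' => tdet_ne_base h.detB (by rw [h'])
  rintro e (rfl | rfl | he)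
  · simp [h1, h2]
  · simp [h2, h3]
  · exact h.fresh' e he

theorem avoids_far (h : MoveHyp b F A B v v') : Avoids b A v v' s(B, v) := by
  intro x hx hxT
  rw [sh_mk] at hx
  exact Or.inr (eq_of_separated h.sep hxT hx)

theorem avoids_far' (h : MoveHyp b F A B v v') : Avoids b B v' v s(A, v') := h.symm.avoids_far

theorem not_passes (_h : MoveHyp b F A B v v') : ¬ Passes b A v v' s(B, v) := fun hp =>
  hp.ends v (by simp) (subset_convexHull ℝ _ (by simp))

theorem fresh_mid (h : MoveHyp b F A B v v') :
    ∀ e ∈ insert s(B, v') (insert s(A, v') F), v ∉ e := h.symm.fresh_all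

end MoveHyp

/-- A vertex may be moved if the two triangles swept by its edges are met only by disjoint strands
that do not meet the path of the vertex. -/
theorem Reach.vertex_move (h : Good b (insert s(A, v) (insert s(B, v) F)))
    (hm : MoveHyp b F A B v v')
    (hA : ∀ e ∈ F, Avoids b A v v' e ∨ Thin b A v v' e)
    (hB : ∀ e ∈ F, Avoids b B v' v e ∨ Thin b B v' v e)
    (hpA : ∀ e ∈ F, ∀ f ∈ F, e ≠ f → Passes b A v v' e → Passes b A v v' f →
      ∀ x ∈ sh b e, x ∈ sh b f →
        x ∉ convexHull ℝ {planeProj b A, planeProj b v, planeProj b v'})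
    (hpB : ∀ e ∈ F, ∀ f ∈ F, e ≠ f → Passes b B v' v e → Passes b B v' v f →
      ∀ x ∈ sh b e, x ∈ sh b f →
        x ∉ convexHull ℝ {planeProj b B, planeProj b v', planeProj b v}) :
    Reach b 0 (insert s(A, v) (insert s(B, v) F)) (insert s(A, v') (insert s(B, v') F)) := by
  have step : ∀ {A B v v' : Space}, MoveHyp b F A B v v' →
      (∀ e ∈ F, Avoids b A v v' e ∨ Thin b A v v' e) →
      (∀ e ∈ F, ∀ f ∈ F, e ≠ f → Passes b A v v' e → Passes b A v v' f →
        ∀ x ∈ sh b e, x ∈ sh b f →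
        x ∉ convexHull ℝ {planeProj b A, planeProj b v, planeProj b v'}) →
      (∀ e ∈ insert s(B, v) F, Avoids b A v v' e ∨ Crosses b A v v' e) ∧
      (∀ e ∈ insert s(B, v) F, ∀ f ∈ insert s(B, v) F, e ≠ f → Passes b A v v' e →
        Passes b A v v' f → ∀ x ∈ sh b e, x ∈ sh b f →
        x ∉ convexHull ℝ {planeProj b A, planeProj b v, planeProj b v'}) := by
    intro A B v v' hm hA hpA
    constructor
    · rintro e (rfl | he)
      · exact Or.inl hm.avoids_far
      · exact (hA e he).elim Or.inl fun ht => ht.avoids_or_crosses hm.detA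
    · rintro e (rfl | he) f (rfl | hf) hef h1 h2
      · exact absurd rfl hef
      · exact absurd h1 hm.not_passes
      · exact absurd h2 hm.not_passes
      · exact hpA e he f hf hef h1 h2
  have s1 := step hm hA hpA
  have s2 := step hm.symm hB hpB
  have r1 := Reach.of_crosses h hm.notMem hm.fresh_all hm.detA s1.1 s1.2
  have g1 := r1.right
  rw [vertex_sets_eq] at r1 g1
  have g2 : Good b (insert s(B, v') (insert s(A, v') F)) := by
    refine g1.of_triangle_rev hm.notMem' (fun e he => hm.fresh_mid e (Or.inr he)) hm.detB
      (fun e he => (s2.1 e he).imp_right And.left)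
      fun e he f hf hef h1 h2 x hx1 hx2 hx3 =>
        s2.2 e he f hf hef h1 h2 x hx1 hx2 (segment_subset_triangle₁₂ hx3)
  have r2 := Reach.of_crosses g2 hm.notMem' hm.fresh_mid hm.detB s2.1 s2.2
  rw [Set.insert_comm s(A, v')]
  exact r1.trans r2.symm

/-- A vertex is moved across at most one strand `g`. -/
theorem Reach.vertex_move_single (h : Good b (insert s(A, v) (insert s(B, v) F)))
    (hm : MoveHyp b F A B v v') {g : Sym2 Space}
    (hA : ∀ e ∈ F, e ≠ g → Avoids b A v v' e) (hB : ∀ e ∈ F, e ≠ g → Avoids b B v' v e)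
    (hgA : Passes b A v v' g) (hgB : Passes b B v' v g) :
    Reach b 2 (insert s(A, v) (insert s(B, v) F)) (insert s(A, v') (insert s(B, v') F)) ∧
    (Disjoint (sh b g) (segment ℝ (planeProj b v) (planeProj b v')) →
      Reach b 0 (insert s(A, v) (insert s(B, v) F)) (insert s(A, v') (insert s(B, v') F))) := by
  have r1 : Reach b 1 _ _ := Reach.of_single h hm.notMem hm.fresh_all hm.detA (g := g)
    (by
      rintro e (rfl | he) hne
      · exact hm.avoids_far
      · exact hA e he hne) (fun _ => hgA)
  have hall : ∀ e ∈ insert s(A, v') F, e ≠ g → Avoids b B v' v e := by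
    rintro e (rfl | he) hne
    · exact hm.avoids_far'
    · exact hB e he hne
  have g1 := r1.right
  rw [vertex_sets_eq] at r1 g1
  have hfr : ∀ e ∈ insert s(A, v') F, v ∉ e := fun e he => hm.fresh_mid e (Or.inr he)
  have hpair : ∀ e ∈ insert s(A, v') F, ∀ f ∈ insert s(A, v') F, e ≠ f → ∀ x ∈ sh b e, x ∈ sh b f →
      x ∉ convexHull ℝ {planeProj b B, planeProj b v', planeProj b v} := by
    intro e he f hf hef x hxe hxf hxT
    have : x = planeProj b B ∨ x = planeProj b v' := by
      by_cases heg : e = g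
      · exact hall f hf (by rintro rfl; exact hef heg) x hxf hxT
      · exact hall e he heg x hxe hxT
    rcases this with rfl | rfl
    · exact g1.tr e (Or.inr (Or.inr he)) f (Or.inr (Or.inr hf)) _ (Or.inl rfl) hef
        (fun h' => hfr e he (h' ▸ by simp)) (fun h' => hfr f hf (h' ▸ by simp)) _ hxe hxf
        (vertex_mem_sh (by simp))
    · exact g1.tr e (Or.inr (Or.inr he)) f (Or.inr (Or.inr hf)) _ (Or.inr (Or.inl rfl)) hef
        (fun h' => hfr e he (h' ▸ by simp)) (fun h' => hfr f hf (h' ▸ by simp)) _ hxe hxf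
        (vertex_mem_sh (by simp))
  have g2 : Good b (insert s(B, v') (insert s(A, v') F)) := by
    refine g1.of_triangle_rev hm.notMem' hfr hm.detB
      (fun e he => ?_)
      fun e he f hf hef _ _ x hx1 hx2 hx3 =>
        hpair e he f hf hef x hx1 hx2 (segment_subset_triangle₁₂ hx3)
    by_cases heg : e = g
    · rw [heg]; exact Or.inr hgB
    · exact Or.inl (hall e he heg)
  have r2 : Reach b 1 _ _ := Reach.of_single g2 hm.notMem' hm.fresh_mid hm.detB hall fun _ => hgB
  refine ⟨?_, fun hd => ?_⟩
  · rw [Set.insert_comm s(A, v')]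
    exact r1.trans r2.symm
  · refine Reach.vertex_move h hm ?_ ?_ ?_ ?_
    · intro e he
      by_cases heg : e = g
      · rw [heg]; exact Or.inr ⟨hgA.ends, Or.inr hd, hgA.disj⟩
      · exact Or.inl (hA e he heg)
    · intro e he
      by_cases heg : e = g
      · rw [heg]
        exact Or.inr ⟨hgB.ends, Or.inr (by rwa [segment_symm]), hgB.disj⟩
      · exact Or.inl (hB e he heg)
    · intro e he f hf hef _ _ x hxe hxf hxT
      have : x = planeProj b A ∨ x = planeProj b v := by
        by_cases heg : e = g
        · exact hA f hf (by rintro rfl; exact hef heg) x hxf hxT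
        · exact hA e he heg x hxe hxT
      refine h.tr e (Or.inr (Or.inr he)) f (Or.inr (Or.inr hf)) _ (Or.inl rfl) hef
        (fun h' => hm.fresh e he (h' ▸ by simp)) (fun h' => hm.fresh f hf (h' ▸ by simp)) _ hxe hxf
        ?_
      rcases this with rfl | rfl <;> exact vertex_mem_sh (by simp)
    · exact fun e he f hf hef _ _ => hpair e (Or.inr he) f (Or.inr hf) hef

end vertexMove

/-! ### Perturbations -/

/-- The edge set in which a vertex `v` with neighbours `A` and `B` is added to `F`. -/
abbrev Corner (A B v : Space) (F : Set (Sym2 Space)) : Set (Sym2 Space) :=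
  insert s(A, v) (insert s(B, v) F)

theorem Corner.swap (A B v : Space) (F : Set (Sym2 Space)) : Corner A B v F = Corner B A v F :=
  Set.insert_comm _ _ _

theorem Corner.map (φ : Space → Space) (A B v : Space) (F : Set (Sym2 Space)) :
    Sym2.map φ '' Corner A B v F = Corner (φ A) (φ B) (φ v) (Sym2.map φ '' F) := by
  simp only [Corner, Set.image_insert_eq, Sym2.map_mk]

theorem planeProj_surjective : Function.Surjective (planeProj b) := fun w =>
  ⟨w 0 • b 0 + w 1 • b 1, by
    have h := b.orthonormal
    have e (i j : Fin 3) : inner ℝ (b i) (b j) = if i = j then (1 : ℝ) else 0 :=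
      orthonormal_iff_ite.1 h i j
    apply plane_ext <;> simp [planeProj, inner_add_right, inner_smul_right, e]⟩

section vertexMove

variable {ι : Type*} {l : Filter ι} {F : Set (Sym2 Space)} {A B v : Space}
  {ψ : ι → Space → Space} {p q : ι → Space}

theorem sh_map_mk (φ : Space → Space) (u w : Space) : sh b (Sym2.map φ s(u, w)) =
    segment ℝ (planeProj b (φ u)) (planeProj b (φ w)) := by
  rw [Sym2.map_mk, sh_mk]

theorem eventually_thin_or_avoids (h : Good b (Corner A B v F)) (hv : ∀ e ∈ F, v ∉ e)
    (hψ : ∀ x, Tendsto (fun i => ψ i x) l (𝓝 x)) (hp : Tendsto p l (𝓝 v))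
    (hq : Tendsto q l (𝓝 v)) {e : Sym2 Space} (he : e ∈ F) :
    ∀ᶠ i in l, Avoids b (ψ i A) (p i) (q i) (Sym2.map (ψ i) e) ∨
      Thin b (ψ i A) (p i) (q i) (Sym2.map (ψ i) e) := by
  have heE : e ∈ Corner A B v F := Or.inr (Or.inr he)
  have hAE : s(A, v) ∈ Corner A B v F := Or.inl rfl
  have hne : e ≠ s(A, v) := fun h' => hv e he (h' ▸ by simp)
  have hAv := h.proj_ne hAE
  by_cases hA : A ∈ e
  · obtain ⟨u, rfl⟩ := exists_eq_mk_of_mem hA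
    have hAu := h.proj_ne heE
    filter_upwards [eventually_cone (hψ A).proj (hψ u).proj hp.proj hq.proj hAu.symm
      (by rw [segment_same]; exact hAv)
      (fun x hx hxT => h.adj heE hAE hne (by simp) (by simp) (by rwa [sh_mk])
        (by rwa [sh_mk, ← triangle_degenerate]))] with i hi
    refine Or.inl fun x hx hxT => Or.inl ?_
    rw [sh_map_mk] at hx
    exact hi x hx hxT
  · obtain ⟨u, w, rfl⟩ := edgeSegment_eq_of_sym2 e
    have hend : ∀ y ∈ s(u, w), ∀ᶠ i in l, planeProj b (ψ i y) ∉
        convexHull ℝ {planeProj b (ψ i A), planeProj b (p i), planeProj b (q i)} := by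
      intro y hy
      refine eventually_point_triangle (hψ y).proj (hψ A).proj hp.proj hq.proj ?_
      rw [triangle_degenerate, ← sh_mk]
      refine h.not_mem_sh heE hAE hy ?_
      rw [Sym2.mem_iff]
      rintro (rfl | rfl)
      · exact hA hy
      · exact hv _ he hy
    have hsp := h.sp _ heE _ hAE (fun y hy hy' => by
      rcases Sym2.mem_iff.1 hy' with rfl | rfl
      · exact hA hy
      · exact hv _ he hy)
    rw [edgeSegment_mk, edgeSegment_mk, ← triangle_degenerate A] at hsp
    have hvs : planeProj b v ∉ sh b s(u, w) :=
      h.not_mem_sh hAE heE (by simp) (hv _ he)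
    rw [sh_mk] at hvs
    filter_upwards [hend u (by simp), hend w (by simp),
      eventually_segment_triangle (hψ u) (hψ w) (hψ A) hp hq hsp,
      eventually_segments (hψ u).proj (hψ w).proj hp.proj hq.proj
        (by rw [segment_same]; exact Set.disjoint_singleton_right.2 hvs)] with i h1 h2 h3 h4
    refine Or.inr ⟨?_, Or.inr ?_, ?_⟩
    · simp only [Sym2.map_mk, Sym2.mem_iff]
      rintro y (rfl | rfl) <;> assumption
    · rwa [sh_map_mk]
    · rwa [Sym2.map_mk, edgeSegment_mk]

theorem eventually_pairs (h : Good b (Corner A B v F)) (hv : ∀ e ∈ F, v ∉ e)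
    (hψ : ∀ x, Tendsto (fun i => ψ i x) l (𝓝 x)) (hp : Tendsto p l (𝓝 v))
    (hq : Tendsto q l (𝓝 v)) {e f : Sym2 Space} (he : e ∈ F) (hf : f ∈ F) (hef : e ≠ f) :
    ∀ᶠ i in l, ∀ x ∈ sh b (Sym2.map (ψ i) e), x ∈ sh b (Sym2.map (ψ i) f) →
      x ∉ convexHull ℝ {planeProj b (ψ i A), planeProj b (p i), planeProj b (q i)} := by
  have hne : ∀ e ∈ F, e ≠ s(A, v) := fun e he h' => hv e he (h' ▸ by simp)
  have htr := fun x => h.tr e (Or.inr (Or.inr he)) f (Or.inr (Or.inr hf)) _ (Or.inl rfl) hef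
    (hne e he) (hne f hf) x
  obtain ⟨u, w, rfl⟩ := edgeSegment_eq_of_sym2 e
  obtain ⟨u', w', rfl⟩ := edgeSegment_eq_of_sym2 f
  simp only [sh_map_mk]
  refine eventually_segments_triangle (hψ u).proj (hψ w).proj (hψ u').proj (hψ w').proj (hψ A).proj
    hp.proj hq.proj fun x hx hx' => ?_
  rw [triangle_degenerate, ← sh_mk]
  exact htr x (by rwa [sh_mk]) (by rwa [sh_mk])

theorem eventually_fresh (hv : ∀ e ∈ F, v ∉ e) (hF : F.Finite)
    (hψ : ∀ x, Tendsto (fun i => ψ i x) l (𝓝 x)) (hp : Tendsto p l (𝓝 v)) :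
    ∀ᶠ i in l, ∀ e ∈ Sym2.map (ψ i) '' F, p i ∉ e := by
  have : ∀ᶠ i in l, ∀ e ∈ F, p i ∉ Sym2.map (ψ i) e := by
    rw [eventually_all_finite hF]
    intro e he
    have hve := hv e he
    obtain ⟨u, w, rfl⟩ := edgeSegment_eq_of_sym2 e
    simp only [Sym2.mem_iff, not_or] at hve
    have h1 : ∀ {y : Space}, v ≠ y → ∀ᶠ i in l, p i ≠ ψ i y := fun hy =>
      (hp.prodMk_nhds (hψ _)).eventually
        ((isClosed_eq continuous_fst continuous_snd).isOpen_compl.mem_nhds hy)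
    filter_upwards [h1 hve.1, h1 hve.2] with i h2 h3
    simp [h2, h3]
  filter_upwards [this] with i hi
  rintro _ ⟨e, he, rfl⟩
  exact hi e he

/-- A vertex may be moved by a small amount, in a direction that separates its neighbours, while
the other vertices are kept close to a good position. -/
theorem eventually_vertex_move (h : Good b (Corner A B v F)) (hv : ∀ e ∈ F, v ∉ e)
    (hψ : ∀ x, Tendsto (fun i => ψ i x) l (𝓝 x)) (hp : Tendsto p l (𝓝 v))
    (hq : Tendsto q l (𝓝 v)) :
    ∀ᶠ i in l, Good b (Corner (ψ i A) (ψ i B) (p i) (Sym2.map (ψ i) '' F)) →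
      tdet (planeProj b (p i)) (planeProj b (q i)) (planeProj b (ψ i A)) *
        tdet (planeProj b (p i)) (planeProj b (q i)) (planeProj b (ψ i B)) < 0 →
      Reach b 0 (Corner (ψ i A) (ψ i B) (p i) (Sym2.map (ψ i) '' F))
        (Corner (ψ i A) (ψ i B) (q i) (Sym2.map (ψ i) '' F)) := by
  have hF : F.Finite := h.fin.subset fun e he => Or.inr (Or.inr he)
  have h' : Good b (Corner B A v F) := by rwa [Corner.swap]
  filter_upwards [eventually_fresh hv hF hψ hp, eventually_fresh hv hF hψ hq,
    (eventually_all_finite hF).2 fun e he => eventually_thin_or_avoids h hv hψ hp hq he,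
    (eventually_all_finite hF).2 fun e he => eventually_thin_or_avoids h' hv hψ hq hp he,
    (eventually_all_finite hF).2 fun e he => (eventually_all_finite hF).2 fun f hf =>
      eventually_imp_distrib_left.2 fun hef => eventually_pairs h hv hψ hp hq he hf hef,
    (eventually_all_finite hF).2 fun e he => (eventually_all_finite hF).2 fun f hf =>
      eventually_imp_distrib_left.2 fun hef => eventually_pairs h' hv hψ hq hp he hf hef]
    with i h1 h2 h3 h4 h5 h6 hg hs
  refine Reach.vertex_move hg ⟨h1, h2, hs⟩ ?_ ?_ ?_ ?_
  · rintro _ ⟨e, he, rfl⟩; exact h3 e he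
  · rintro _ ⟨e, he, rfl⟩; exact h4 e he
  · rintro _ ⟨e, he, rfl⟩ _ ⟨f, hf, rfl⟩ hef _ _
    exact h5 e he f hf (fun h => hef (by rw [h]))
  · rintro _ ⟨e, he, rfl⟩ _ ⟨f, hf, rfl⟩ hef _ _
    exact h6 e he f hf (fun h => hef (by rw [h]))

end vertexMove

/-- Two segments with only their first endpoint in common are strictly separated by a line. -/
theorem exists_separating {v a c : Plane} (ha : a ≠ v) (hc : c ≠ v)
    (h : ∀ x ∈ segment ℝ v a, x ∈ segment ℝ v c → x = v) :
    ∃ w : Plane, tdet v (v + w) a * tdet v (v + w) c < 0 := by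
  by_cases h0 : tdet v a c = 0
  · refine ⟨!₂[-(a 1 - v 1), a 0 - v 0], ?_⟩
    have e1 : tdet v (v + !₂[-(a 1 - v 1), a 0 - v 0]) a =
        -((a 0 - v 0) * (a 0 - v 0) + (a 1 - v 1) * (a 1 - v 1)) := by
      simp [tdet]; ring
    have e2 : tdet v (v + !₂[-(a 1 - v 1), a 0 - v 0]) c =
        -((a 0 - v 0) * (c 0 - v 0) + (a 1 - v 1) * (c 1 - v 1)) := by
      simp [tdet]; ring
    rw [e1, e2]
    have hpos : ∀ {x : Plane}, x ≠ v →
        0 < (x 0 - v 0) * (x 0 - v 0) + (x 1 - v 1) * (x 1 - v 1) := by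
      intro x hx
      have h1 := mul_self_nonneg (x 0 - v 0)
      have h2 := mul_self_nonneg (x 1 - v 1)
      rcases (add_nonneg h1 h2).eq_or_lt with h3 | h3
      · refine absurd (plane_ext ?_ ?_) hx
        · exact sub_eq_zero.1 (mul_self_eq_zero.1 (by linarith))
        · exact sub_eq_zero.1 (mul_self_eq_zero.1 (by linarith))
      · exact h3
    have hna := hpos ha
    have hnc := hpos hc
    set N := (a 0 - v 0) * (a 0 - v 0) + (a 1 - v 1) * (a 1 - v 1)
    set D := (a 0 - v 0) * (c 0 - v 0) + (a 1 - v 1) * (c 1 - v 1) with hD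
    by_contra hcon
    have hD0 : 0 ≤ D := by
      by_contra hneg
      exact hcon (by nlinarith)
    unfold tdet at h0
    have hNM : D * D = N * ((c 0 - v 0) * (c 0 - v 0) + (c 1 - v 1) * (c 1 - v 1)) := by
      linear_combination (-((a 0 - v 0) * (c 1 - v 1) - (a 1 - v 1) * (c 0 - v 0))) * h0
    have hDp : 0 < D := by
      rcases hD0.eq_or_lt with h3 | h3
      · rw [← h3] at hNM
        nlinarith [mul_pos hna hnc]
      · exact h3
    have hcv : c = v + (D / N) • (a - v) := by
      apply plane_ext
      · simp
        field_simp
        linear_combination (-(a 1 - v 1)) * h0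
      · simp
        field_simp
        linear_combination (a 0 - v 0) * h0
    set κ := D / N with hκ
    have hκ0 : 0 < κ := div_pos hDp hna
    rcases le_total κ 1 with h1 | h1
    · exact hc (h c (hcv ▸ ⟨1 - κ, κ, by linarith, hκ0.le, by ring, by module⟩)
        (right_mem_segment ℝ v c))
    · refine ha (h a (right_mem_segment ℝ v a) ⟨1 - 1 / κ, 1 / κ, ?_, by positivity, by ring, ?_⟩)
      · have := (div_le_one hκ0).2 h1; linarith
      · rw [hcv, smul_add, smul_smul, one_div_mul_cancel hκ0.ne']; module
  · refine ⟨(a - v) + (c - v), ?_⟩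
    have e1 : tdet v (v + ((a - v) + (c - v))) a = - tdet v a c := by simp [tdet]; ring
    have e2 : tdet v (v + ((a - v) + (c - v))) c = tdet v a c := by simp [tdet]; ring
    rw [e1, e2]
    nlinarith [mul_self_pos.2 h0]

theorem tdet_direction (v w x : Plane) (t : ℝ) : tdet v (v + t • w) x = t * tdet v (v + w) x := by
  simp [tdet]; ring

theorem tdet_direction' (v w x : Plane) (t : ℝ) :
    tdet (v + t • w) v x = -(t * tdet v (v + w) x) := by
  rw [tdet_swap, tdet_direction]

theorem Good.exists_corner {E : Set (Sym2 Space)} (h : Good b E) {e : Sym2 Space} (he : e ∈ E)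
    {v : Space} (hv : v ∈ e) : ∃ A B F, A ≠ B ∧ E = Corner A B v F ∧ ∀ f ∈ F, v ∉ f := by
  obtain ⟨f, hf, hvf, hfe⟩ := h.other he hv
  obtain ⟨A, rfl⟩ := exists_eq_mk_of_mem hv
  obtain ⟨B, rfl⟩ := exists_eq_mk_of_mem hvf
  refine ⟨A, B, {g ∈ E | v ∉ g}, ?_, ?_, fun f hf => hf.2⟩
  · rintro rfl; exact hfe rfl
  · ext g
    simp only [Set.mem_insert_iff, Set.mem_ofPred_eq]
    constructor
    · intro hg
      by_cases hvg : v ∈ g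
      · by_contra hcon
        push Not at hcon
        refine h.not_three he hf hg hfe.symm ?_ ?_ hv hvf hvg
        · rintro rfl; exact hcon.1 Sym2.eq_swap
        · rintro rfl; exact hcon.2.1 Sym2.eq_swap
      · exact Or.inr (Or.inr ⟨hg, hvg⟩)
    · rintro (rfl | rfl | hg)
      · rwa [Sym2.eq_swap]
      · rwa [Sym2.eq_swap]
      · exact hg.1

theorem Good.exists_separating {A B v : Space} {F : Set (Sym2 Space)} (h : Good b (Corner A B v F))
    (hAB : A ≠ B) : ∃ w : Space, tdet (planeProj b v) (planeProj b v + planeProj b w)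
      (planeProj b A) * tdet (planeProj b v) (planeProj b v + planeProj b w) (planeProj b B) < 0 := by
  have h1 : s(A, v) ∈ Corner A B v F := Or.inl rfl
  have h2 : s(B, v) ∈ Corner A B v F := Or.inr (Or.inl rfl)
  obtain ⟨w, hw⟩ := _root_.exists_separating (h.proj_ne h1) (h.proj_ne h2) (fun x hx hx' =>
    h.adj h1 h2 (fun h' => hAB (Sym2.congr_left.1 h')) (v := v) (by simp) (by simp)
      (by rwa [sh_mk, segment_symm]) (by rwa [sh_mk, segment_symm]))
  obtain ⟨w', rfl⟩ := planeProj_surjective (b := b) w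
  exact ⟨w', hw⟩

theorem Sym2.map_congr_on {α β : Type*} {f g : α → β} {e : Sym2 α} (h : ∀ x ∈ e, f x = g x) :
    Sym2.map f e = Sym2.map g e := by
  induction e using Sym2.ind with
  | _ x y => simp only [Sym2.map_mk]; rw [h x (by simp), h y (by simp)]

open Classical in
theorem eventually_perturb_finset {ι : Type*} {l : Filter ι} {ψ : ι → Space → Space}
    {E : Set (Sym2 Space)} (h : Good b E) (hψ : ∀ x, Tendsto (fun i => ψ i x) l (𝓝 x))
    (T : Finset Space) :
    ∀ᶠ i in l, Reach b 0 E (Sym2.map (fun x => if x ∈ T then ψ i x else x) '' E) := by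
  induction T using Finset.induction_on with
  | empty =>
    refine Eventually.of_forall fun i => ?_
    have : Sym2.map (fun x => if x ∈ (∅ : Finset Space) then ψ i x else x) '' E = E := by
      simp
    rw [this]
    exact .refl h
  | insert v T hvT ih =>
    by_cases hvE : ∃ e ∈ E, v ∈ e
    · obtain ⟨e, he, hve⟩ := hvE
      obtain ⟨A, B, F, hAB, rfl, hv⟩ := h.exists_corner he hve
      obtain ⟨w, hw⟩ := h.exists_separating hAB
      set φ : ι → Space → Space := fun i x => if x ∈ T then ψ i x else x with hφ
      have hφt : ∀ x, Tendsto (fun i => φ i x) l (𝓝 x) := by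
        intro x
        simp only [hφ]
        split_ifs
        · exact hψ x
        · exact tendsto_const_nhds
      have hφv : ∀ i, φ i v = v := fun i => by simp [hφ, hvT]
      have hAv := h.ne (a := A) (c := v) (Or.inl rfl)
      have hBv := h.ne (a := B) (c := v) (Or.inr (Or.inl rfl))
      have himg : ∀ i, Sym2.map (fun x => if x ∈ insert v T then ψ i x else x) '' Corner A B v F =
          Corner (φ i A) (φ i B) (ψ i v) (Sym2.map (φ i) '' F) := by
        intro i
        have : ∀ x, x ≠ v → (if x ∈ insert v T then ψ i x else x) = φ i x := by
          intro x hx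
          simp [hφ, hx]
        have hF : Sym2.map (fun x => if x ∈ insert v T then ψ i x else x) '' F =
            Sym2.map (φ i) '' F := by
          exact Set.image_congr fun f hf => Sym2.map_congr_on fun x hx => this x
            fun hxv => hv f hf (hxv ▸ hx)
        rw [Corner.map, hF, this A hAv, this B hBv, if_pos (by simp)]
      simp only [himg]
      replace ih : ∀ᶠ i in l, Reach b 0 (Corner A B v F)
          (Corner (φ i A) (φ i B) v (Sym2.map (φ i) '' F)) := by
        filter_upwards [ih] with i hi
        have := Corner.map (φ i) A B v F
        rw [hφv] at this
        rwa [← this]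
      set L := (𝓝[>] (0 : ℝ)).curry l with hL
      have tS : Tendsto (fun z : ℝ × ι => z.1) L (𝓝 0) :=
        (tendsto_fst.mono_left curry_le_prod).mono_right nhdsWithin_le_nhds
      have tI : Tendsto (fun z : ℝ × ι => z.2) L l := tendsto_snd.mono_left curry_le_prod
      have tp : Tendsto (fun z : ℝ × ι => v + z.1 • w) L (𝓝 v) := by
        simpa using tendsto_const_nhds.add (tS.smul_const w)
      have m1 := eventually_vertex_move (l := L) (ψ := fun z => φ z.2) h hv
        (fun x => (hφt x).comp tI) (tendsto_const_nhds (x := v)) tp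
      have m2 := eventually_vertex_move (l := L) (ψ := fun z => φ z.2) h hv
        (fun x => (hφt x).comp tI) tp ((hψ v).comp tI)
      rw [eventually_curry_iff] at m1 m2
      obtain ⟨s, ⟨hs1, hs2⟩, hs⟩ := ((m1.and m2).and self_mem_nhdsWithin).exists
      have hs : 0 < s := hs
      have hsep : ∀ᶠ i in l, tdet (planeProj b v) (planeProj b (v + s • w)) (planeProj b (φ i A)) *
          tdet (planeProj b v) (planeProj b (v + s • w)) (planeProj b (φ i B)) < 0 := by
        refine ((tendsto_const_nhds.tdet tendsto_const_nhds (hφt A).proj).mul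
          (tendsto_const_nhds.tdet tendsto_const_nhds (hφt B).proj)).eventually_lt_const ?_
        rw [map_add, map_smul, tdet_direction, tdet_direction]
        nlinarith [mul_pos hs hs]
      have hsep' : ∀ᶠ i in l,
          tdet (planeProj b (v + s • w)) (planeProj b (ψ i v)) (planeProj b (φ i A)) *
          tdet (planeProj b (v + s • w)) (planeProj b (ψ i v)) (planeProj b (φ i B)) < 0 := by
        refine ((tendsto_const_nhds.tdet (hψ v).proj (hφt A).proj).mul
          (tendsto_const_nhds.tdet (hψ v).proj (hφt B).proj)).eventually_lt_const ?_
        rw [map_add, map_smul, tdet_direction', tdet_direction']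
        nlinarith [mul_pos hs hs]
      filter_upwards [ih, hs1, hs2, hsep, hsep'] with i r0 r1 r2 h1 h2
      have r1 := r1 r0.right h1
      exact (r0.trans r1).trans (r2 r1.right h2)
    · push Not at hvE
      filter_upwards [ih] with i hi
      have : Sym2.map (fun x => if x ∈ insert v T then ψ i x else x) '' E =
          Sym2.map (fun x => if x ∈ T then ψ i x else x) '' E := by
        refine Set.image_congr fun e he => Sym2.map_congr_on fun x hx => ?_
        have : x ≠ v := by rintro rfl; exact hvE e he hx
        simp [this]
      rwa [this]

/-- Moving all vertices by a small amount changes the diagram by a planar isotopy. -/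
theorem eventually_perturb {ι : Type*} {l : Filter ι} {ψ : ι → Space → Space}
    {E : Set (Sym2 Space)} (h : Good b E) (hψ : ∀ x, Tendsto (fun i => ψ i x) l (𝓝 x)) :
    ∀ᶠ i in l, Reach b 0 E (Sym2.map (ψ i) '' E) := by
  classical
  have hV : {v | ∃ e ∈ E, v ∈ e}.Finite := by
    have : {v | ∃ e ∈ E, v ∈ e} = ⋃ e ∈ E, {v | v ∈ e} := by ext; simp
    rw [this]
    refine h.fin.biUnion fun e _ => ?_
    induction e using Sym2.ind with
    | _ x y =>
      refine (Set.toFinite {x, y}).subset fun z hz => ?_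
      simpa using hz
  filter_upwards [eventually_perturb_finset h hψ hV.toFinset] with i hi
  have : Sym2.map (fun x => if x ∈ hV.toFinset then ψ i x else x) '' E = Sym2.map (ψ i) '' E := by
    refine Set.image_congr fun e he => Sym2.map_congr_on fun x hx => ?_
    rw [if_pos]
    simpa using ⟨e, he, hx⟩
  rwa [this] at hi

/-! ### Points in general position -/

/-- No three points are collinear and no three segments with different end points are
concurrent. -/
structure SG (W : Set Plane) : Prop where
  tri : ∀ p ∈ W, ∀ q ∈ W, ∀ r ∈ W, p ≠ q → p ≠ r → q ≠ r → tdet p q r ≠ 0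
  six : ∀ p ∈ W, ∀ q ∈ W, ∀ r ∈ W, ∀ s ∈ W, ∀ u ∈ W, ∀ t ∈ W, [p, q, r, s, u, t].Nodup →
    ∀ x ∈ segment ℝ p q, x ∈ segment ℝ r s → x ∉ segment ℝ u t

theorem SG.empty : SG ∅ := ⟨by simp, by simp⟩

theorem SG.mono {W W' : Set Plane} (h : SG W) (hW : W' ⊆ W) : SG W' where
  tri p hp q hq r hr := h.tri p (hW hp) q (hW hq) r (hW hr)
  six p hp q hq r hr s hs u hu t ht :=
    h.six p (hW hp) q (hW hq) r (hW hr) s (hW hs) u (hW hu) t (hW ht)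

theorem continuous_tdet {X : Type*} [TopologicalSpace X] {f g k : X → Plane} (hf : Continuous f)
    (hg : Continuous g) (hk : Continuous k) : Continuous fun x => tdet (f x) (g x) (k x) := by
  unfold tdet; fun_prop

theorem isOpen_tdet_ne (q y : Plane) : IsOpen {x | tdet x q y ≠ 0} :=
  (isClosed_eq (continuous_tdet continuous_id continuous_const continuous_const)
    continuous_const).isOpen_compl

theorem dense_tdet_ne {q y : Plane} (h : q ≠ y) : Dense {x | tdet x q y ≠ 0} := by
  intro x
  by_cases hx : tdet x q y = 0
  · set n : Plane := !₂[-(y 1 - q 1), y 0 - q 0] with hn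
    have hpos : 0 < (y 0 - q 0) * (y 0 - q 0) + (y 1 - q 1) * (y 1 - q 1) := by
      have h1 := mul_self_nonneg (y 0 - q 0)
      have h2 := mul_self_nonneg (y 1 - q 1)
      rcases (add_nonneg h1 h2).eq_or_lt with h3 | h3
      · refine absurd (plane_ext ?_ ?_) h.symm
        · exact sub_eq_zero.1 (mul_self_eq_zero.1 (by linarith))
        · exact sub_eq_zero.1 (mul_self_eq_zero.1 (by linarith))
      · exact h3
    have ht : Tendsto (fun t : ℝ => x + t • n) (𝓝[>] 0) (𝓝 x) := by
      have : Tendsto (fun t : ℝ => x + t • n) (𝓝 0) (𝓝 (x + (0 : ℝ) • n)) :=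
        (Continuous.tendsto (by fun_prop) _)
      simp only [zero_smul, add_zero] at this
      exact this.mono_left nhdsWithin_le_nhds
    refine mem_closure_of_tendsto ht ?_
    filter_upwards [self_mem_nhdsWithin] with t (ht : 0 < t)
    have : tdet (x + t • n) q y =
        t * ((y 0 - q 0) * (y 0 - q 0) + (y 1 - q 1) * (y 1 - q 1)) := by
      have e : tdet (x + t • n) q y = tdet x q y +
        t * ((y 0 - q 0) * (y 0 - q 0) + (y 1 - q 1) * (y 1 - q 1)) := by
        simp [tdet, hn]; ring
      rw [e, hx, zero_add]
    show tdet (x + t • n) q y ≠ 0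
    rw [this]
    positivity
  · exact subset_closure hx

theorem SG.crossing_unique {W : Set Plane} (h : SG W) {r s u t : Plane} (hr : r ∈ W) (hs : s ∈ W)
    (hu : u ∈ W) (ht : t ∈ W) (hd : [r, s, u, t].Nodup) {x y : Plane} (hx : x ∈ segment ℝ r s)
    (hx' : x ∈ segment ℝ u t) (hy : y ∈ segment ℝ r s) (hy' : y ∈ segment ℝ u t) : x = y := by
  by_contra hxy
  simp only [List.nodup_cons, List.mem_cons, List.not_mem_nil, or_false, not_or] at hd
  rcases segment_overlap hxy hx hy hx' hy' with h1 | h1 | h1 | h1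
  all_goals
    have := tdet_eq_zero_of_mem_segment h1
    first
      | exact h.tri _ hr _ hs _ hu (by tauto) (by tauto) (by tauto) this
      | exact h.tri _ hr _ hs _ ht (by tauto) (by tauto) (by tauto) this
      | exact h.tri _ hu _ ht _ hr (by tauto) (by tauto) (by tauto) this
      | exact h.tri _ hu _ ht _ hs (by tauto) (by tauto) (by tauto) this

theorem nodup_five {α : Type*} {q r s u t : α} (h1 : q ≠ r) (h2 : q ≠ s) (h3 : q ≠ u) (h4 : q ≠ t)
    (h5 : r ≠ s) (h6 : r ≠ u) (h7 : r ≠ t) (h8 : s ≠ u) (h9 : s ≠ t) (h10 : u ≠ t) :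
    [q, r, s, u, t].Nodup := by
  simp [*]

theorem SG.dense_insert {W : Set Plane} (h : SG W) (hW : W.Finite) :
    Dense {x | x ∉ W ∧ SG (insert x W)} := by
  have := hW.to_subtype
  have d1 : Dense (⋂ w : W, {x : Plane | x ≠ w}) :=
    dense_iInter_of_isOpen (fun w => isOpen_ne) fun w => dense_compl_singleton _
  have o1 : IsOpen (⋂ w : W, {x : Plane | x ≠ w}) := isOpen_iInter_of_finite fun w => isOpen_ne
  have key2 : ∀ z : W × W, ∃ O : Set Plane, IsOpen O ∧ Dense O ∧
      (z.1 ≠ z.2 → ∀ x ∈ O, tdet x z.1 z.2 ≠ 0) := by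
    intro z
    by_cases hz : (z.1 : Plane) = z.2
    · exact ⟨Set.univ, isOpen_univ, dense_univ, fun hne => absurd (Subtype.ext hz) hne⟩
    · exact ⟨_, isOpen_tdet_ne _ _, dense_tdet_ne hz, fun _ x hx => hx⟩
  choose O hO1 hO2 hO3 using key2
  have d2 : Dense (⋂ z, O z) := dense_iInter_of_isOpen hO1 hO2
  have o2 : IsOpen (⋂ z, O z) := isOpen_iInter_of_finite hO1
  have key3 : ∀ z : W × W × W × W × W, ∃ O : Set Plane, IsOpen O ∧ Dense O ∧
      ([(z.1 : Plane), z.2.1, z.2.2.1, z.2.2.2.1, z.2.2.2.2].Nodup → ∀ x ∈ O,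
        ∀ y ∈ segment ℝ (z.2.1 : Plane) z.2.2.1, y ∈ segment ℝ (z.2.2.2.1 : Plane) z.2.2.2.2 →
        y ∉ segment ℝ x z.1) := by
    rintro ⟨⟨q, hq⟩, ⟨r, hr⟩, ⟨s, hs⟩, ⟨u, hu⟩, ⟨t, ht⟩⟩
    by_cases hz : [q, r, s, u, t].Nodup ∧ ∃ y ∈ segment ℝ r s, y ∈ segment ℝ u t
    · obtain ⟨hd, y, hy1, hy2⟩ := hz
      have hd4 := (List.nodup_cons.1 hd).2
      have hqy : q ≠ y := by
        rintro rfl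
        simp only [List.nodup_cons, List.mem_cons, List.not_mem_nil, or_false, not_or] at hd
        exact h.tri r hr s hs q hq (by tauto) (by tauto) (by tauto)
          (tdet_eq_zero_of_mem_segment hy1)
      refine ⟨_, isOpen_tdet_ne _ _, dense_tdet_ne hqy, fun _ x hx y' hy1' hy2' hy' => hx ?_⟩
      rw [h.crossing_unique hr hs hu ht hd4 hy1 hy2 hy1' hy2']
      exact tdet_eq_zero_of_mem_segment hy'
    · exact ⟨Set.univ, isOpen_univ, dense_univ,
        fun hd x _ y hy hy' _ => hz ⟨hd, y, hy, hy'⟩⟩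
  choose Q hQ1 hQ2 hQ3 using key3
  have d3 : Dense (⋂ z, Q z) := dense_iInter_of_isOpen hQ1 hQ2
  refine ((d1.inter_of_isOpen_left d2 o1).inter_of_isOpen_left d3 (o1.inter o2)).mono ?_
  rintro x ⟨⟨hx1, hx2⟩, hx3⟩
  have hxW : x ∉ W := fun hx => Set.mem_iInter.1 hx1 ⟨x, hx⟩ rfl
  have k2 : ∀ {q r}, q ∈ W → r ∈ W → q ≠ r → tdet x q r ≠ 0 := fun {q r} hq hr hqr =>
    hO3 (⟨q, hq⟩, ⟨r, hr⟩) (fun h => hqr (congrArg Subtype.val h)) x (Set.mem_iInter.1 hx2 _)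
  have k3 : ∀ {q r s u t}, q ∈ W → r ∈ W → s ∈ W → u ∈ W → t ∈ W → [q, r, s, u, t].Nodup →
      ∀ y ∈ segment ℝ r s, y ∈ segment ℝ u t → y ∉ segment ℝ x q :=
    fun {q r s u t} hq hr hs hu ht hd =>
    hQ3 (⟨q, hq⟩, ⟨r, hr⟩, ⟨s, hs⟩, ⟨u, hu⟩, ⟨t, ht⟩) hd x (Set.mem_iInter.1 hx3 _)
  refine ⟨hxW, ?_, ?_⟩
  · rintro p (rfl | hp) q (rfl | hq) r (rfl | hr) hpq hpr hqr
    all_goals first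
      | exact absurd rfl hpq
      | exact absurd rfl hpr
      | exact absurd rfl hqr
      | exact h.tri p hp q hq r hr hpq hpr hqr
      | exact k2 hq hr hqr
      | (rw [← tdet_rotate]; exact k2 hr hp hpr.symm)
      | (rw [tdet_rotate]; exact k2 hp hq hpq)
  · intro p hp q hq r hr s hs u hu t ht hd
    have hm : ∀ {y}, y ∈ insert x W → y ≠ x → y ∈ W := fun hy hne => hy.resolve_left hne
    have hd' := hd
    simp only [List.nodup_cons, List.mem_cons, List.not_mem_nil, or_false, not_or, not_false_eq_true,
      List.nodup_nil, and_true] at hd'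
    obtain ⟨⟨a1, a2, a3, a4, a5⟩, ⟨b1, b2, b3, b4⟩, ⟨c1, c2, c3⟩, ⟨e1, e2⟩, f1⟩ := hd'
    by_cases hpx : p = x
    · subst hpx
      intro y y1 y2 y3
      exact k3 (hm hq (Ne.symm a1)) (hm hr (Ne.symm a2)) (hm hs (Ne.symm a3)) (hm hu (Ne.symm a4))
        (hm ht (Ne.symm a5)) (nodup_five b1 b2 b3 b4 c1 c2 c3 e1 e2 f1) y y2 y3 y1
    by_cases hqx : q = x
    · subst hqx
      intro y y1 y2 y3
      rw [segment_symm] at y1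
      exact k3 (hm hp hpx) (hm hr (Ne.symm b1)) (hm hs (Ne.symm b2)) (hm hu (Ne.symm b3))
        (hm ht (Ne.symm b4)) (nodup_five a2 a3 a4 a5 c1 c2 c3 e1 e2 f1) y y2 y3 y1
    by_cases hrx : r = x
    · subst hrx
      intro y y1 y2 y3
      exact k3 (hm hs (Ne.symm c1)) (hm hp hpx) (hm hq hqx) (hm hu (Ne.symm c2))
        (hm ht (Ne.symm c3)) (nodup_five (Ne.symm a3) (Ne.symm b2) e1 e2 a1 a4 a5 b3 b4 f1) y y1 y3 y2
    by_cases hsx : s = x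
    · subst hsx
      intro y y1 y2 y3
      rw [segment_symm] at y2
      exact k3 (hm hr hrx) (hm hp hpx) (hm hq hqx) (hm hu (Ne.symm e1))
        (hm ht (Ne.symm e2)) (nodup_five (Ne.symm a2) (Ne.symm b1) c2 c3 a1 a4 a5 b3 b4 f1) y y1 y3 y2
    by_cases hux : u = x
    · subst hux
      intro y y1 y2 y3
      exact k3 (hm ht (Ne.symm f1)) (hm hp hpx) (hm hq hqx) (hm hr hrx) (hm hs hsx)
        (nodup_five (Ne.symm a5) (Ne.symm b4) (Ne.symm c3) (Ne.symm e2) a1 a2 a3 b1 b2 c1) y y1 y2 y3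
    by_cases htx : t = x
    · subst htx
      intro y y1 y2 y3
      rw [segment_symm] at y3
      exact k3 (hm hu hux) (hm hp hpx) (hm hq hqx) (hm hr hrx) (hm hs hsx)
        (nodup_five (Ne.symm a4) (Ne.symm b3) (Ne.symm c2) (Ne.symm e1) a1 a2 a3 b1 b2 c1) y y1 y2 y3
    exact h.six p (hm hp hpx) q (hm hq hqx) r (hm hr hrx) s (hm hs hsx) u (hm hu hux)
      t (hm ht htx) hd

theorem SG.exists_near {W : Set Plane} (h : SG W) (hW : W.Finite) (v : Space) {δ : ℝ}
    (hδ : 0 < δ) : ∃ p : Space, dist p v < δ ∧ planeProj b p ∉ W ∧ SG (insert (planeProj b p) W) := by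
  have hd := (h.dense_insert hW).preimage
    (LinearMap.isOpenMap_of_finiteDimensional _ (planeProj_surjective (b := b)))
  obtain ⟨p, hp, hpv⟩ := hd.exists_mem_open Metric.isOpen_ball ⟨v, Metric.mem_ball_self hδ⟩
  exact ⟨p, hpv, hp⟩

open Classical in
theorem exists_generic_finset (V : Finset Space) {δ : ℝ} (hδ : 0 < δ) :
    ∃ ψ : Space → Space, (∀ x, dist (ψ x) x < δ) ∧ Set.InjOn (fun x => planeProj b (ψ x)) V ∧
      SG ((fun x => planeProj b (ψ x)) '' V) := by
  induction V using Finset.induction_on with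
  | empty => exact ⟨id, by simpa, by simp, by simpa using SG.empty⟩
  | insert v V hv ih =>
    obtain ⟨ψ, h1, h2, h3⟩ := ih
    obtain ⟨p, hp1, hp2, hp3⟩ := h3.exists_near (b := b) (V.finite_toSet.image _) v hδ
    have hvx : ∀ x ∈ (V : Set Space), planeProj b (Function.update ψ v p x) = planeProj b (ψ x) := by
      intro x hx
      rw [Function.update_of_ne]
      rintro rfl
      exact hv hx
    have himg : (fun x => planeProj b (Function.update ψ v p x)) '' (V : Set Space) =
        (fun x => planeProj b (ψ x)) '' V := Set.image_congr hvx
    refine ⟨Function.update ψ v p, ?_, ?_, ?_⟩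
    · intro x
      by_cases hx : x = v
      · subst hx; simpa using hp1
      · rw [Function.update_of_ne hx]; exact h1 x
    · rw [Finset.coe_insert, Set.injOn_insert (by simpa using hv), himg]
      refine ⟨h2.congr fun x hx => (hvx x hx).symm, ?_⟩
      simpa using hp2
    · rw [Finset.coe_insert, Set.image_insert_eq, himg]
      simpa using hp3

theorem exists_generic {V : Set Space} (hV : V.Finite) : ∃ ψ : ℕ → Space → Space,
    (∀ x, Tendsto (fun n => ψ n x) atTop (𝓝 x)) ∧
    ∀ n, Set.InjOn (fun x => planeProj b (ψ n x)) V ∧ SG ((fun x => planeProj b (ψ n x)) '' V) := by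
  choose ψ h1 h2 h3 using fun n : ℕ =>
    exists_generic_finset (b := b) hV.toFinset (δ := 1 / ((n : ℝ) + 1)) (by positivity)
  refine ⟨ψ, fun x => ?_, fun n => ⟨by simpa using h2 n, by simpa using h3 n⟩⟩
  rw [tendsto_iff_dist_tendsto_zero]
  exact squeeze_zero (fun _ => dist_nonneg) (fun n => (h1 n x).le)
    tendsto_one_div_add_atTop_nhds_zero_nat

/-- The vertices of a set of edges. -/
def verts (E : Set (Sym2 Space)) : Set Space := {v | ∃ e ∈ E, v ∈ e}

theorem verts_finite {E : Set (Sym2 Space)} (h : E.Finite) : (verts E).Finite := by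
  have : verts E = ⋃ e ∈ E, {v | v ∈ e} := by ext; simp [verts]
  rw [this]
  refine h.biUnion fun e _ => ?_
  obtain ⟨x, y, rfl⟩ := edgeSegment_eq_of_sym2 e
  exact (Set.toFinite {x, y}).subset fun z hz => by simpa using hz

/-- An edge set with vertices in general position has a regular projection. -/
theorem Good.of_generic {E : Set (Sym2 Space)} (h : TwoRegular E)
    (hsp : ∀ e ∈ E, ∀ f ∈ E, (∀ v ∈ e, v ∉ f) → Disjoint (edgeSegment e) (edgeSegment f))
    (hinj : Set.InjOn (planeProj b) (verts E)) (hg : SG (planeProj b '' verts E)) : Good b E where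
  toTwoRegular := h
  sp := hsp
  tr := by
    have hv : ∀ {e v}, e ∈ E → v ∈ e → v ∈ verts E := fun he hv => ⟨_, he, hv⟩
    have hw : ∀ {v}, v ∈ verts E → planeProj b v ∈ planeProj b '' verts E :=
      Set.mem_image_of_mem _
    have hne : ∀ {u v}, u ∈ verts E → v ∈ verts E → u ≠ v → planeProj b u ≠ planeProj b v :=
      fun hu hv huv h' => huv (hinj hu hv h')
    have hmk : ∀ {u v}, s(u, v) ∈ E → u ≠ v := fun he h' => h.nd _ he (Sym2.mk_isDiag_iff.2 h')
    have key : ∀ e ∈ E, ∀ f ∈ E, ∀ g ∈ E, e ≠ f → e ≠ g → f ≠ g → ∀ x ∈ sh b e, x ∈ sh b f →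
        ∀ v ∈ e, v ∈ f → x ∉ sh b g := by
      intro e he f hf g hgE hef heg hfg x hxe hxf v hve hvf hxg
      obtain ⟨a, rfl⟩ := exists_eq_mk_of_mem hve
      obtain ⟨c, rfl⟩ := exists_eq_mk_of_mem hvf
      have hac : a ≠ c := by rintro rfl; exact hef rfl
      have ha := hv he (Sym2.mem_mk_right v a)
      have hc := hv hf (Sym2.mem_mk_right v c)
      have hvv := hv he (Sym2.mem_mk_left v a)
      have hd := hg.tri _ (hw ha) _ (hw hc) _ (hw hvv) (hne ha hc hac) (hne ha hvv (hmk he).symm)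
        (hne hc hvv (hmk hf).symm)
      rw [sh_mk, segment_symm] at hxe hxf
      obtain rfl := eq_apex_of_mem_segments hd hxe hxf
      by_cases hvg : v ∈ g
      · exact h.not_three he hf hgE hef heg hfg hve hvf hvg
      · obtain ⟨u, w, rfl⟩ := edgeSegment_eq_of_sym2 g
        simp only [Sym2.mem_iff, not_or] at hvg
        have hu := hv hgE (Sym2.mem_mk_left u w)
        have hww := hv hgE (Sym2.mem_mk_right u w)
        rw [sh_mk] at hxg
        exact hg.tri _ (hw hu) _ (hw hww) _ (hw hvv) (hne hu hww (hmk hgE))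
          (hne hu hvv (Ne.symm hvg.1)) (hne hww hvv (Ne.symm hvg.2))
          (tdet_eq_zero_of_mem_segment hxg)
    intro e he f hf g hgE hef heg hfg x hxe hxf hxg
    by_cases h1 : ∃ v ∈ e, v ∈ f
    · obtain ⟨v, hve, hvf⟩ := h1
      exact key e he f hf g hgE hef heg hfg x hxe hxf v hve hvf hxg
    by_cases h2 : ∃ v ∈ e, v ∈ g
    · obtain ⟨v, hve, hvg⟩ := h2
      exact key e he g hgE f hf heg hef hfg.symm x hxe hxg v hve hvg hxf
    by_cases h3 : ∃ v ∈ f, v ∈ g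
    · obtain ⟨v, hvf, hvg⟩ := h3
      exact key f hf g hgE e he hfg hef.symm heg.symm x hxf hxg v hvf hvg hxe
    push Not at h1 h2 h3
    obtain ⟨p, q, rfl⟩ := edgeSegment_eq_of_sym2 e
    obtain ⟨r, s, rfl⟩ := edgeSegment_eq_of_sym2 f
    obtain ⟨u, t, rfl⟩ := edgeSegment_eq_of_sym2 g
    simp only [Sym2.mem_iff, forall_eq_or_imp, forall_eq, not_or] at h1 h2 h3
    rw [sh_mk] at hxe hxf hxg
    have vp := hv he (Sym2.mem_mk_left p q)
    have vq := hv he (Sym2.mem_mk_right p q)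
    have vr := hv hf (Sym2.mem_mk_left r s)
    have vs := hv hf (Sym2.mem_mk_right r s)
    have vu := hv hgE (Sym2.mem_mk_left u t)
    have vt := hv hgE (Sym2.mem_mk_right u t)
    have hd : [p, q, r, s, u, t].Nodup := by
      have := hmk he
      have := hmk hf
      have := hmk hgE
      grind
    have hd' : ([p, q, r, s, u, t].map (planeProj b)).Nodup := by
      refine hd.map_on fun y hy z hz => hinj ?_ ?_
      · simp only [List.mem_cons, List.not_mem_nil, or_false] at hy
        rcases hy with rfl | rfl | rfl | rfl | rfl | rfl <;> assumption
      · simp only [List.mem_cons, List.not_mem_nil, or_false] at hz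
        rcases hz with rfl | rfl | rfl | rfl | rfl | rfl <;> assumption
    exact hg.six _ (hw vp) _ (hw vq) _ (hw vr) _ (hw vs) _ (hw vu) _ (hw vt) hd' x hxe hxf hxg

theorem TwoRegular.map {E : Set (Sym2 Space)} (h : TwoRegular E) {φ : Space → Space}
    (hφ : Set.InjOn φ (verts E)) : TwoRegular (Sym2.map φ '' E) := by
  have hinj : ∀ e ∈ E, ∀ f ∈ E, ∀ v ∈ e, ∀ w ∈ f, φ v = φ w → v = w := fun e he f hf v hv w hw =>
    hφ ⟨e, he, hv⟩ ⟨f, hf, hw⟩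
  have hinjE : Set.InjOn (Sym2.map φ) E := by
    intro e he f hf hef
    refine Sym2.ext fun v => ⟨fun hv => ?_, fun hv => ?_⟩
    · obtain ⟨w, hw, hwv⟩ := Sym2.mem_map.1 (hef ▸ Sym2.mem_map.2 ⟨v, hv, rfl⟩ : φ v ∈ Sym2.map φ f)
      exact hinj f hf e he w hw v hv hwv ▸ hw
    · obtain ⟨w, hw, hwv⟩ := Sym2.mem_map.1 (hef ▸ Sym2.mem_map.2 ⟨v, hv, rfl⟩ : φ v ∈ Sym2.map φ e)
      exact hinj e he f hf w hw v hv hwv ▸ hw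
  refine ⟨h.fin.image _, ?_, ?_⟩
  · rintro _ ⟨e, he, rfl⟩ hd
    obtain ⟨u, w, rfl⟩ := edgeSegment_eq_of_sym2 e
    rw [Sym2.map_mk, Sym2.mk_isDiag_iff] at hd
    exact h.nd _ he (Sym2.mk_isDiag_iff.2 (hinj _ he _ he u (by simp) w (by simp) hd))
  · rintro _ ⟨e, he, rfl⟩ v' hv'
    obtain ⟨v, hv, rfl⟩ := Sym2.mem_map.1 hv'
    refine Eq.trans ?_ (h.deg e he v hv)
    rw [← Set.InjOn.ncard_image (hinjE.mono (Set.sep_subset E fun f => v ∈ f))]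
    congr 1
    ext f'
    constructor
    · rintro ⟨⟨f, hf, rfl⟩, hvf⟩
      obtain ⟨w, hw, hwv⟩ := Sym2.mem_map.1 hvf
      exact ⟨f, ⟨hf, hinj f hf e he w hw v hv hwv ▸ hw⟩, rfl⟩
    · rintro ⟨f, ⟨hf, hvf⟩, rfl⟩
      exact ⟨⟨f, hf, rfl⟩, Sym2.mem_map.2 ⟨v, hvf, rfl⟩⟩

theorem verts_map (φ : Space → Space) (E : Set (Sym2 Space)) :
    verts (Sym2.map φ '' E) = φ '' verts E := by
  ext v
  constructor
  · rintro ⟨_, ⟨e, he, rfl⟩, hv⟩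
    obtain ⟨w, hw, rfl⟩ := Sym2.mem_map.1 hv
    exact ⟨w, ⟨e, he, hw⟩, rfl⟩
  · rintro ⟨w, ⟨e, he, hw⟩, rfl⟩
    exact ⟨_, ⟨e, he, rfl⟩, Sym2.mem_map.2 ⟨w, hw, rfl⟩⟩

/-- Disjointness in space of edges without common vertex. -/
def Separated (E : Set (Sym2 Space)) : Prop :=
  ∀ e ∈ E, ∀ f ∈ E, (∀ v ∈ e, v ∉ f) → Disjoint (edgeSegment e) (edgeSegment f)

theorem eventually_separated {ι : Type*} {l : Filter ι} {ψ : ι → Space → Space}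
    {E : Set (Sym2 Space)} (hE : E.Finite) (h : Separated E)
    (hψ : ∀ x, Tendsto (fun i => ψ i x) l (𝓝 x)) : ∀ᶠ i in l, Separated (Sym2.map (ψ i) '' E) := by
  have : ∀ᶠ i in l, ∀ e ∈ E, ∀ f ∈ E, (∀ v ∈ e, v ∉ f) →
      Disjoint (edgeSegment (Sym2.map (ψ i) e)) (edgeSegment (Sym2.map (ψ i) f)) := by
    rw [eventually_all_finite hE]
    intro e he
    rw [eventually_all_finite hE]
    intro f hf
    rw [eventually_imp_distrib_left]
    intro hv
    have hd := h e he f hf hv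
    obtain ⟨u, w, rfl⟩ := edgeSegment_eq_of_sym2 e
    obtain ⟨u', w', rfl⟩ := edgeSegment_eq_of_sym2 f
    simp only [Sym2.map_mk, edgeSegment_mk] at hd ⊢
    exact eventually_segments (hψ u) (hψ w) (hψ u') (hψ w') hd
  filter_upwards [this] with i hi
  rintro _ ⟨e, he, rfl⟩ _ ⟨f, hf, rfl⟩ hv
  exact hi e he f hf fun v hve hvf =>
    hv (ψ i v) (Sym2.mem_map.2 ⟨v, hve, rfl⟩) (Sym2.mem_map.2 ⟨v, hvf, rfl⟩)

theorem Good.map_of_generic {E : Set (Sym2 Space)} (h : TwoRegular E) {φ : Space → Space}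
    (hsp : Separated (Sym2.map φ '' E)) (hinj : Set.InjOn (fun x => planeProj b (φ x)) (verts E))
    (hg : SG ((fun x => planeProj b (φ x)) '' verts E)) : Good b (Sym2.map φ '' E) := by
  have hφ : Set.InjOn φ (verts E) := fun x hx y hy hxy => hinj hx hy (congrArg (planeProj b) hxy)
  refine Good.of_generic (h.map hφ) hsp ?_ ?_
  · rw [verts_map]
    rintro _ ⟨x, hx, rfl⟩ _ ⟨y, hy, rfl⟩ hxy
    rw [hinj hx hy hxy]
  · rw [verts_map, Set.image_image]
    exact hg

/-! ### The position of a link at a critical time -/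

/-- The position of an edge `e` relative to an edge from `A` to `C`. -/
structure HalfOK (b : OrthonormalBasis (Fin 3) ℝ Space) (A C : Space) (e : Sym2 Space) : Prop where
  sp : A ∉ e → Disjoint (segment ℝ A C) (edgeSegment e)
  nc : ∀ u w, e = s(u, w) → A ∉ e →
    (∃ x ∈ sh b e, x ∈ segment ℝ (planeProj b A) (planeProj b C)) →
    tdet (planeProj b A) (planeProj b u) (planeProj b w) ≠ 0
  adj : A ∈ e → ∀ x ∈ sh b e, x ∈ segment ℝ (planeProj b A) (planeProj b C) → x = planeProj b A

/-- The vertex with neighbours `A` and `B` passes through the point `C` in the direction `d`; the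
projection is regular before and after that. -/
structure Loc (b : OrthonormalBasis (Fin 3) ℝ Space) (E : Set (Sym2 Space)) (A B C d : Space) :
    Prop where
  fresh : ∀ e ∈ E, C ∉ e
  okA : ∀ e ∈ E, HalfOK b A C e
  okB : ∀ e ∈ E, HalfOK b B C e
  sep : tdet (planeProj b C) (planeProj b C + planeProj b d) (planeProj b A) *
    tdet (planeProj b C) (planeProj b C + planeProj b d) (planeProj b B) < 0
  dbl : ∀ e ∈ E, ∀ f ∈ E, e ≠ f → planeProj b C ∈ sh b e → planeProj b C ∉ sh b f
  good : ∀ᶠ τ : ℝ in 𝓝[≠] 0, Good b (Corner A B (C + τ • d) E)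

/-- The points that lie on the projections of three edges. -/
def bad (b : OrthonormalBasis (Fin 3) ℝ Space) (E : Set (Sym2 Space)) : Set Plane :=
  {x | ∃ e ∈ E, ∃ f ∈ E, ∃ g ∈ E, e ≠ f ∧ e ≠ g ∧ f ≠ g ∧ x ∈ sh b e ∧ x ∈ sh b f ∧ x ∈ sh b g}

theorem TwoRegular.move_vertex {A B v v' : Space} {F : Set (Sym2 Space)}
    (h : TwoRegular (Corner A B v F)) (hv : ∀ e ∈ F, v ∉ e) (hv' : ∀ e ∈ F, v' ∉ e) (hA : A ≠ v')
    (hB : B ≠ v') : TwoRegular (Corner A B v' F) := by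
  have hAv : A ≠ v := fun h' => h.nd _ (Or.inl rfl) (Sym2.mk_isDiag_iff.2 h')
  have hBv : B ≠ v := fun h' => h.nd _ (Or.inr (Or.inl rfl)) (Sym2.mk_isDiag_iff.2 h')
  have hF : Sym2.map (Function.update id v v') '' F = F := by
    have : Set.EqOn (Sym2.map (Function.update id v v')) id F := fun e he => by
      conv_rhs => rw [← Sym2.map_id]
      refine Sym2.map_congr_on fun x hx => Function.update_of_ne ?_ _ _
      rintro rfl
      exact hv e he hx
    rw [this.image_eq, Set.image_id]
  have hmap := Corner.map (Function.update id v v') A B v F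
  rw [hF, Function.update_self, Function.update_of_ne hAv, Function.update_of_ne hBv] at hmap
  rw [id, id] at hmap
  rw [← hmap]
  refine h.map ?_
  have hx : ∀ x ∈ verts (Corner A B v F), x ≠ v → x ≠ v' := by
    rintro x ⟨e, rfl | rfl | he, hxe⟩ hxv rfl
    · rcases Sym2.mem_iff.1 hxe with rfl | rfl
      · exact hA rfl
      · exact hxv rfl
    · rcases Sym2.mem_iff.1 hxe with rfl | rfl
      · exact hB rfl
      · exact hxv rfl
    · exact hv' e he hxe
  intro x hxE y hyE hxy
  by_cases hxv : x = v <;> by_cases hyv : y = v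
  · rw [hxv, hyv]
  · subst hxv
    rw [Function.update_self, Function.update_of_ne hyv] at hxy
    exact absurd hxy.symm (hx y hyE hyv)
  · subst hyv
    rw [Function.update_self, Function.update_of_ne hxv] at hxy
    exact absurd hxy (hx x hxE hxv)
  · rwa [Function.update_of_ne hxv, Function.update_of_ne hyv] at hxy

/-- Two segments on different sides of a line have at most an end point in common. -/
theorem eq_of_sides {p q r s x : Plane} (hsep : tdet p q r * tdet p q s < 0)
    (h1 : x ∈ segment ℝ r p) (h2 : x ∈ segment ℝ s p) : x = p :=
  eq_of_separated hsep (segment_subset_triangle₁₂ h1) h2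

theorem tdet_of_mem_segment {p q r s x : Plane} (h : x ∈ segment ℝ r s) :
    ∃ α β : ℝ, 0 ≤ α ∧ 0 ≤ β ∧ α + β = 1 ∧ tdet p q x = α * tdet p q r + β * tdet p q s := by
  obtain ⟨α, β, h1, h2, h3, rfl⟩ := h
  exact ⟨α, β, h1, h2, h3, tdet_comb _ _ _ _ h3⟩

/-- Two points of a line span it. -/
theorem tdet_eq_zero_trans {p q x y z : Plane} (hpq : p ≠ q) (hx : tdet p q x = 0)
    (hy : tdet p q y = 0) (hz : tdet p q z = 0) : tdet x y z = 0 := by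
  by_contra hne
  apply hpq
  simp only [tdet] at *
  have e0 : (q 0 - p 0) * ((y 0 - x 0) * (z 1 - x 1) - (y 1 - x 1) * (z 0 - x 0)) = 0 := by
    linear_combination (z 0 - y 0) * hx + (x 0 - z 0) * hy + (y 0 - x 0) * hz
  have e1 : (q 1 - p 1) * ((y 0 - x 0) * (z 1 - x 1) - (y 1 - x 1) * (z 0 - x 0)) = 0 := by
    linear_combination (z 1 - y 1) * hx + (x 1 - z 1) * hy + (y 1 - x 1) * hz
  apply plane_ext
  · exact (sub_eq_zero.1 ((mul_eq_zero.1 e0).resolve_right hne)).symm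
  · exact (sub_eq_zero.1 ((mul_eq_zero.1 e1).resolve_right hne)).symm

theorem Good.of_bad_empty {E : Set (Sym2 Space)} {A B C v : Space} (hg : Good b (Corner A B v E))
    (hv : ∀ e ∈ E, v ∉ e) (fresh : ∀ e ∈ E, C ∉ e) (hA : A ≠ C) (hB : B ≠ C)
    (spA : ∀ e ∈ E, A ∉ e → Disjoint (segment ℝ A C) (edgeSegment e))
    (spB : ∀ e ∈ E, B ∉ e → Disjoint (segment ℝ B C) (edgeSegment e))
    (hb : bad b (Corner A B C E) = ∅) : Good b (Corner A B C E) := by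
  refine ⟨hg.toTwoRegular.move_vertex hv fresh hA hB, ?_, ?_⟩
  · rintro e (rfl | rfl | he) f (rfl | rfl | hf) hv
    · exact absurd (hv A (by simp)) (by simp)
    · exact absurd (hv C (by simp)) (by simp)
    · rw [edgeSegment_mk]; exact spA f hf (hv A (by simp))
    · exact absurd (hv C (by simp)) (by simp)
    · exact absurd (hv B (by simp)) (by simp)
    · rw [edgeSegment_mk]; exact spB f hf (hv B (by simp))
    · rw [edgeSegment_mk]; exact (spA e he fun h' => hv A h' (by simp)).symm
    · rw [edgeSegment_mk]; exact (spB e he fun h' => hv B h' (by simp)).symm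
    · exact hg.sp e (Or.inr (Or.inr he)) f (Or.inr (Or.inr hf)) hv
  · intro e he f hf g hg' hef heg hfg x hxe hxf hxg
    have : x ∈ bad b (Corner A B C E) := ⟨e, he, f, hf, g, hg', hef, heg, hfg, hxe, hxf, hxg⟩
    rw [hb] at this
    exact this

/-- The edges at a point on three edges, other than `C`. -/
theorem bad_cases {E : Set (Sym2 Space)} {A B C v : Space} (hv : Good b (Corner A B v E))
    (hs : ∀ x ∈ segment ℝ (planeProj b A) (planeProj b C),
      x ∈ segment ℝ (planeProj b B) (planeProj b C) → x = planeProj b C) {x : Plane}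
    (hx : x ∈ bad b (Corner A B C E)) :
    (∃ e ∈ E, ∃ f ∈ E, e ≠ f ∧ x ∈ sh b e ∧ x ∈ sh b f ∧
      (x ∈ segment ℝ (planeProj b A) (planeProj b C) ∨
        x ∈ segment ℝ (planeProj b B) (planeProj b C))) ∨
    (x = planeProj b C ∧ ∃ e ∈ E, x ∈ sh b e) := by
  have main : ∀ e ∈ Corner A B C E, ∀ f ∈ Corner A B C E, ∀ g ∈ E, e ≠ f → e ≠ g → f ≠ g →
      x ∈ sh b e → x ∈ sh b f → x ∈ sh b g → (∃ e ∈ E, ∃ f ∈ E, e ≠ f ∧ x ∈ sh b e ∧ x ∈ sh b f ∧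
      (x ∈ segment ℝ (planeProj b A) (planeProj b C) ∨
        x ∈ segment ℝ (planeProj b B) (planeProj b C))) ∨
    (x = planeProj b C ∧ ∃ e ∈ E, x ∈ sh b e) := by
    rintro e (rfl | rfl | he) f (rfl | rfl | hf) g hg hef heg hfg hxe hxf hxg
    · exact absurd rfl hef
    · rw [sh_mk] at hxe hxf
      exact Or.inr ⟨hs x hxe hxf, g, hg, hxg⟩
    · rw [sh_mk] at hxe
      exact Or.inl ⟨f, hf, g, hg, hfg, hxf, hxg, Or.inl hxe⟩
    · rw [sh_mk] at hxe hxf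
      exact Or.inr ⟨hs x hxf hxe, g, hg, hxg⟩
    · exact absurd rfl hef
    · rw [sh_mk] at hxe
      exact Or.inl ⟨f, hf, g, hg, hfg, hxf, hxg, Or.inr hxe⟩
    · rw [sh_mk] at hxf
      exact Or.inl ⟨e, he, g, hg, heg, hxe, hxg, Or.inl hxf⟩
    · rw [sh_mk] at hxf
      exact Or.inl ⟨e, he, g, hg, heg, hxe, hxg, Or.inr hxf⟩
    · exact absurd hxg (hv.tr e (Or.inr (Or.inr he)) f (Or.inr (Or.inr hf)) g (Or.inr (Or.inr hg))
        hef heg hfg x hxe hxf)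
  obtain ⟨e, he, f, hf, g, hg, hef, heg, hfg, hxe, hxf, hxg⟩ := hx
  rcases hg with rfl | rfl | hg
  · rcases hf with rfl | rfl | hf
    · exact absurd rfl hfg
    · rcases he with rfl | rfl | he
      · exact absurd rfl heg
      · exact absurd rfl hef
      · exact main _ (Or.inl rfl) _ (Or.inr (Or.inl rfl)) e he hfg.symm heg.symm hef.symm hxg hxf hxe
    · exact main _ (Or.inl rfl) e he f hf heg.symm hfg.symm hef hxg hxe hxf
  · rcases hf with rfl | rfl | hf
    · rcases he with rfl | rfl | he
      · exact absurd rfl hef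
      · exact absurd rfl heg
      · exact main _ (Or.inl rfl) _ (Or.inr (Or.inl rfl)) e he hfg hef.symm heg.symm hxf hxg hxe
    · exact absurd rfl hfg
    · exact main _ (Or.inr (Or.inl rfl)) e he f hf heg.symm hfg.symm hef hxg hxe hxf
  · exact main e he f hf g hg hef heg hfg hxe hxf hxg

namespace Loc

variable {E : Set (Sym2 Space)} {A B C d : Space}

theorem symm (h : Loc b E A B C d) : Loc b E B A C d where
  fresh := h.fresh
  okA := h.okB
  okB := h.okA
  sep := by rw [mul_comm]; exact h.sep
  dbl := h.dbl
  good := by simpa only [Corner.swap B A] using h.good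

theorem detA (h : Loc b E A B C d) :
    tdet (planeProj b C) (planeProj b C + planeProj b d) (planeProj b A) ≠ 0 := by
  intro h0
  have := h.sep
  rw [h0] at this
  simp at this

theorem projA_ne (h : Loc b E A B C d) : planeProj b A ≠ planeProj b C := fun h' =>
  h.detA (by rw [h', tdet_self_left])

theorem projB_ne (h : Loc b E A B C d) : planeProj b B ≠ planeProj b C := h.symm.projA_ne

theorem projA_ne_projB (h : Loc b E A B C d) : planeProj b A ≠ planeProj b B := by
  intro h'
  have := h.sep
  rw [h'] at this
  nlinarith [mul_self_nonneg
    (tdet (planeProj b C) (planeProj b C + planeProj b d) (planeProj b B))]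

theorem inter (h : Loc b E A B C d) {x : Plane}
    (hA : x ∈ segment ℝ (planeProj b A) (planeProj b C))
    (hB : x ∈ segment ℝ (planeProj b B) (planeProj b C)) : x = planeProj b C :=
  eq_of_sides h.sep hA hB

theorem B_notMem (h : Loc b E A B C d) :
    planeProj b B ∉ segment ℝ (planeProj b A) (planeProj b C) := fun hB =>
  h.projB_ne (h.inter hB (left_mem_segment ℝ _ _))

theorem env (h : Loc b E A B C d) : ∃ v, Good b (Corner A B v E) := by
  obtain ⟨τ, hτ⟩ := h.good.exists
  exact ⟨_, hτ⟩

theorem fin (h : Loc b E A B C d) : E.Finite := by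
  obtain ⟨v, hv⟩ := h.env
  exact hv.fin.subset fun e he => Or.inr (Or.inr he)

theorem tendsto_point (C d : Space) (s : Set ℝ) :
    Tendsto (fun τ : ℝ => C + τ • d) (𝓝[s] 0) (𝓝 C) := by
  have : Tendsto (fun τ : ℝ => C + τ • d) (𝓝 0) (𝓝 (C + (0 : ℝ) • d)) :=
    Continuous.tendsto (by fun_prop) _
  rw [zero_smul, add_zero] at this
  exact this.mono_left nhdsWithin_le_nhds

theorem fresh_near (h : Loc b E A B C d) : ∀ᶠ τ : ℝ in 𝓝[≠] 0, ∀ e ∈ E, C + τ • d ∉ e := by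
  have := eventually_fresh (ψ := fun _ x => x) (l := 𝓝[≠] (0 : ℝ)) h.fresh h.fin
    (fun x => tendsto_const_nhds) (tendsto_point C d _)
  simpa using this

/-- The moving edges are not yet in the way of the other edges. -/
theorem exists_env (h : Loc b E A B C d) :
    ∃ v, Good b (Corner A B v E) ∧ (∀ e ∈ E, v ∉ e) := by
  obtain ⟨τ, h1, h2⟩ := (h.good.and h.fresh_near).exists
  exact ⟨_, h1, h2⟩

theorem A_of_mem (h : Loc b E A B C d) {e f : Sym2 Space} (he : e ∈ E) (hf : f ∈ E) (hef : e ≠ f)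
    (hA : A ∈ e) : A ∉ f := by
  intro hA'
  obtain ⟨v, hg, hv⟩ := h.exists_env
  exact hg.not_three (Or.inr (Or.inr he)) (Or.inr (Or.inr hf)) (g := s(A, v)) (Or.inl rfl) hef
    (fun h' => hv _ he (h' ▸ by simp)) (fun h' => hv _ hf (h' ▸ by simp)) hA hA' (by simp)

theorem A_notMem_sh (h : Loc b E A B C d) {e : Sym2 Space} (he : e ∈ E) (hA : A ∉ e) :
    planeProj b A ∉ sh b e := by
  obtain ⟨v, hg, hv⟩ := h.exists_env
  exact hg.not_mem_sh (Or.inl rfl) (Or.inr (Or.inr he)) (by simp) hA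

/-- At a double point on the edge `AC`, the other two edges do not end in `A`. -/
theorem A_notMem (h : Loc b E A B C d) {e f : Sym2 Space} (he : e ∈ E) (hf : f ∈ E) (hef : e ≠ f)
    {x : Plane} (hxe : x ∈ sh b e) (hxf : x ∈ sh b f)
    (hxA : x ∈ segment ℝ (planeProj b A) (planeProj b C)) : A ∉ e := by
  intro hA
  have hA' := h.A_of_mem he hf hef hA
  rw [(h.okA e he).adj hA x hxe hxA] at hxf
  exact h.A_notMem_sh hf hA' hxf

theorem good_zero (h : Loc b E A B C d) (hb : bad b (Corner A B C E) = ∅) :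
    Good b (Corner A B C E) := by
  obtain ⟨v, hg, hv⟩ := h.exists_env
  exact hg.of_bad_empty hv h.fresh (fun h' => h.projA_ne (by rw [h']))
    (fun h' => h.projB_ne (by rw [h'])) (fun e he => (h.okA e he).sp)
    (fun e he => (h.okB e he).sp) hb

theorem reach_of_good (h : Loc b E A B C d) (hg : Good b (Corner A B C E)) :
    ∀ᶠ τ : ℝ in 𝓝[>] 0, Reach b 0 (Corner A B (C + (-τ) • d) E) (Corner A B (C + τ • d) E) := by
  have hneg : Tendsto (fun τ : ℝ => -τ) (𝓝[>] 0) (𝓝[≠] 0) := by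
    refine tendsto_nhdsWithin_iff.2 ⟨?_, ?_⟩
    · exact ((continuous_neg.tendsto' 0 0 neg_zero)).mono_left nhdsWithin_le_nhds
    · filter_upwards [self_mem_nhdsWithin] with τ (hτ : 0 < τ)
      exact (neg_lt_zero.2 hτ).ne
  have := eventually_vertex_move (ψ := fun _ x => x) (l := 𝓝[>] (0 : ℝ)) hg h.fresh
    (fun x => tendsto_const_nhds) ((tendsto_point C d _).comp hneg) (tendsto_point C d _)
  filter_upwards [this, hneg.eventually h.good, self_mem_nhdsWithin] with τ h1 h2 (hτ : 0 < τ)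
  simp only [Function.comp_apply, Sym2.map_id', id, Set.image_id'] at h1
  refine h1 h2 ?_
  have e : ∀ x, tdet (planeProj b (C + (-τ) • d)) (planeProj b (C + τ • d)) x =
      2 * τ * tdet (planeProj b C) (planeProj b C + planeProj b d) x := by
    intro x
    simp [tdet]; ring
  rw [e, e]
  nlinarith [h.sep, mul_pos hτ hτ]

theorem bad_cases (h : Loc b E A B C d) {x : Plane} (hx : x ∈ bad b (Corner A B C E)) :
    (∃ e ∈ E, ∃ f ∈ E, e ≠ f ∧ x ∈ sh b e ∧ x ∈ sh b f ∧
      (x ∈ segment ℝ (planeProj b A) (planeProj b C) ∨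
        x ∈ segment ℝ (planeProj b B) (planeProj b C))) ∨
    (x = planeProj b C ∧ ∃ e ∈ E, x ∈ sh b e) := by
  obtain ⟨v, hv⟩ := h.env
  exact _root_.bad_cases hv (fun x => h.inter) hx

end Loc

/-! ### Subdivision at a critical time -/

theorem Corner.comm (A B v a c w : Space) (F : Set (Sym2 Space)) :
    Corner A B v (Corner a c w F) = Corner a c w (Corner A B v F) := by
  ext e; simp only [Set.mem_insert_iff]; tauto

theorem Corner.comm_insert (A B v : Space) (e : Sym2 Space) (F : Set (Sym2 Space)) :
    Corner A B v (insert e F) = insert e (Corner A B v F) := by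
  ext e; simp only [Set.mem_insert_iff]; tauto

theorem proj_mem_openSegment {p q m : Space} (h : m ∈ openSegment ℝ p q) :
    planeProj b m ∈ openSegment ℝ (planeProj b p) (planeProj b q) := by
  obtain ⟨α, β, h1, h2, h3, rfl⟩ := h
  exact ⟨α, β, h1, h2, h3, by simp⟩

theorem segment_subset_of_openSegment {V : Type*} [AddCommGroup V] [Module ℝ V] {p q m : V}
    (h : m ∈ openSegment ℝ p q) : segment ℝ p m ⊆ segment ℝ p q :=
  (convex_segment p q).segment_subset (left_mem_segment ℝ p q) (openSegment_subset_segment ℝ p q h)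

theorem sh_subset_of_openSegment {p q m : Space} (h : m ∈ openSegment ℝ p q) :
    sh b s(p, m) ⊆ sh b s(p, q) := by
  rw [sh_mk, sh_mk]
  exact segment_subset_of_openSegment (proj_mem_openSegment h)

theorem openSegment_symm_mem {V : Type*} [AddCommGroup V] [Module ℝ V] {p q m : V}
    (h : m ∈ openSegment ℝ p q) : m ∈ openSegment ℝ q p := by rwa [openSegment_symm]

theorem HalfOK.subdivide {A C p q m : Space} (h : HalfOK b A C s(p, q))
    (hpq : planeProj b p ≠ planeProj b q) (hm : m ∈ openSegment ℝ p q)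
    (hA : planeProj b m ∉ segment ℝ (planeProj b A) (planeProj b C)) :
    HalfOK b A C s(p, m) := by
  have hsub := sh_subset_of_openSegment (b := b) hm
  have hfar : A = q → ∀ x ∈ sh b s(p, m), x ∉ segment ℝ (planeProj b A) (planeProj b C) := by
    rintro rfl x hx hxA
    have := h.adj (by simp) x (hsub hx) hxA
    rw [this, sh_mk] at hx
    exact openSegment_not_mem hpq (proj_mem_openSegment hm) hx
  refine ⟨fun hAe => ?_, fun u w huw hAe hx => ?_, fun hAe x hx hxA => ?_⟩
  · by_cases hq : A = q
    · refine Set.disjoint_left.2 fun z hz hz' => hfar hq _ (proj_mem_sh hz') (proj_mem_segment hz)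
    · refine (h.sp ?_).mono_right ?_
      · simp only [Sym2.mem_iff, not_or] at hAe ⊢
        exact ⟨hAe.1, hq⟩
      · rw [edgeSegment_mk, edgeSegment_mk]
        exact segment_subset_of_openSegment hm
  · obtain ⟨x, hx, hxA⟩ := hx
    have hq : A ≠ q := fun hq => hfar hq x hx hxA
    have hd : tdet (planeProj b A) (planeProj b p) (planeProj b m) ≠ 0 := by
      have h0 := h.nc p q rfl
        (by simp only [Sym2.mem_iff, not_or] at hAe ⊢; exact ⟨hAe.1, hq⟩) ⟨x, hsub hx, hxA⟩
      obtain ⟨α, β, h1, h2, h3, h4⟩ := proj_mem_openSegment (b := b) hm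
      rw [← h4, tdet_comb _ _ _ _ h3, tdet_self_right]
      simp only [mul_zero, zero_add]
      exact mul_ne_zero h2.ne' h0
    rcases Sym2.eq_iff.1 huw with ⟨rfl, rfl⟩ | ⟨rfl, rfl⟩
    · exact hd
    · rw [tdet_swap_right]; exact neg_ne_zero.2 hd
  · rcases Sym2.mem_iff.1 hAe with rfl | rfl
    · exact h.adj (by simp) x (hsub hx) hxA
    · exact absurd (left_mem_segment ℝ _ _) hA

namespace Loc

variable {E F : Set (Sym2 Space)} {A B C d p q m : Space}

theorem eventually_notMem_segment (_h : Loc b E A B C d) {x : Plane}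
    (hx : x ∉ segment ℝ (planeProj b A) (planeProj b C)) (s : Set ℝ) :
    ∀ᶠ τ : ℝ in 𝓝[s] 0, x ∉ segment ℝ (planeProj b A) (planeProj b (C + τ • d)) :=
  eventually_point_segment tendsto_const_nhds tendsto_const_nhds (tendsto_point C d s).proj hx

theorem env_proj_ne (h : Loc b E A B C d) (he : s(p, q) ∈ E) : planeProj b p ≠ planeProj b q := by
  obtain ⟨v, hv⟩ := h.env
  exact hv.proj_ne (Or.inr (Or.inr he))

theorem subdivide (h : Loc b (insert s(p, q) F) A B C d) (hk : s(p, q) ∉ F)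
    (hm : m ∈ openSegment ℝ p q) (hsh : ∀ f ∈ F, planeProj b m ∉ sh b f)
    (hA : planeProj b m ∉ segment ℝ (planeProj b A) (planeProj b C))
    (hB : planeProj b m ∉ segment ℝ (planeProj b B) (planeProj b C)) :
    Loc b (Corner p q m F) A B C d ∧
    bad b (Corner A B C (Corner p q m F)) ⊆ bad b (Corner A B C (insert s(p, q) F)) ∧
    ∀ᶠ τ : ℝ in 𝓝[≠] 0, Reach b 0 (Corner A B (C + τ • d) (insert s(p, q) F))
      (Corner A B (C + τ • d) (Corner p q m F)) := by
  have hpq : planeProj b p ≠ planeProj b q := h.env_proj_ne (Or.inl rfl)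
  have hm' := openSegment_symm_mem hm
  have hsub₁ := sh_subset_of_openSegment (b := b) hm
  have hsub₂ : sh b s(q, m) ⊆ sh b s(p, q) := by
    rw [Sym2.eq_swap (a := p)]; exact sh_subset_of_openSegment hm'
  have hboth : ∀ x ∈ sh b s(p, m), x ∈ sh b s(q, m) → x = planeProj b m := by
    intro x hx hx'
    rw [sh_mk] at hx hx'
    exact openSegment_inter hpq (proj_mem_openSegment hm) hx hx'
  have hCm : planeProj b C ≠ planeProj b m := fun h' => hA (h' ▸ right_mem_segment ℝ _ _)
  have hreach : ∀ᶠ τ : ℝ in 𝓝[≠] 0, Reach b 0 (Corner A B (C + τ • d) (insert s(p, q) F))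
      (Corner A B (C + τ • d) (Corner p q m F)) := by
    filter_upwards [h.good, h.fresh_near, h.eventually_notMem_segment hA _,
      h.symm.eventually_notMem_segment hB _] with τ h1 h2 h3 h4
    rw [Corner.comm_insert] at h1 ⊢
    rw [Corner.comm]
    refine Reach.of_subdivide h1 ?_ hm ?_
    · have := h2 _ (Or.inl rfl)
      rintro (h' | h' | h')
      · exact this (h' ▸ by simp)
      · exact this (h' ▸ by simp)
      · exact hk h'
    · rintro f (rfl | rfl | hf)
      · rwa [sh_mk]
      · rwa [sh_mk]
      · exact hsh f hf
  refine ⟨⟨?_, ?_, ?_, h.sep, ?_, hreach.mono fun τ => Reach.right⟩, ?_, hreach⟩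
  · have := h.fresh _ (Or.inl rfl)
    simp only [Sym2.mem_iff, not_or] at this
    have hCm : C ≠ m := fun h' => hCm (by rw [h'])
    rintro e (rfl | rfl | he)
    · simp [this.1, hCm]
    · simp [this.2, hCm]
    · exact h.fresh e (Or.inr he)
  · rintro e (rfl | rfl | he)
    · exact (h.okA _ (Or.inl rfl)).subdivide hpq hm hA
    · exact HalfOK.subdivide (q := p) (by rw [Sym2.eq_swap]; exact h.okA _ (Or.inl rfl)) hpq.symm
        hm' hA
    · exact h.okA e (Or.inr he)
  · rintro e (rfl | rfl | he)
    · exact (h.okB _ (Or.inl rfl)).subdivide hpq hm hB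
    · exact HalfOK.subdivide (q := p) (by rw [Sym2.eq_swap]; exact h.okB _ (Or.inl rfl)) hpq.symm
        hm' hB
    · exact h.okB e (Or.inr he)
  · have hkf : ∀ {f}, f ∈ F → f ≠ s(p, q) := fun hf h' => hk (h' ▸ hf)
    rintro e (rfl | rfl | he) f (rfl | rfl | hf) hef h1 h2
    · exact hef rfl
    · exact hCm (hboth _ h1 h2)
    · exact h.dbl _ (Or.inr hf) _ (Or.inl rfl) (hkf hf) h2 (hsub₁ h1)
    · exact hCm (hboth _ h2 h1)
    · exact hef rfl
    · exact h.dbl _ (Or.inr hf) _ (Or.inl rfl) (hkf hf) h2 (hsub₂ h1)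
    · exact h.dbl _ (Or.inr he) _ (Or.inl rfl) (hkf he) h1 (hsub₁ h2)
    · exact h.dbl _ (Or.inr he) _ (Or.inl rfl) (hkf he) h1 (hsub₂ h2)
    · exact h.dbl _ (Or.inr he) _ (Or.inr hf) hef h1 h2
  · obtain ⟨v, hgv, hv⟩ := h.exists_env
    have hfresh := h.fresh _ (Or.inl rfl)
    -- every edge comes from an old edge, and only two of them from the same one
    have old : ∀ e ∈ Corner A B C (Corner p q m F),
        ∃ e' ∈ Corner A B C (insert s(p, q) F), sh b e ⊆ sh b e' ∧
          (e = e' ∧ e ≠ s(p, q) ∨ e' = s(p, q) ∧ (e = s(p, m) ∨ e = s(q, m))) := by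
      rintro e (rfl | rfl | rfl | rfl | he)
      · exact ⟨_, Or.inl rfl, subset_rfl, Or.inl ⟨rfl, fun h' => hfresh (h' ▸ by simp)⟩⟩
      · exact ⟨_, Or.inr (Or.inl rfl), subset_rfl, Or.inl ⟨rfl, fun h' => hfresh (h' ▸ by simp)⟩⟩
      · exact ⟨_, Or.inr (Or.inr (Or.inl rfl)), hsub₁, Or.inr ⟨rfl, Or.inl rfl⟩⟩
      · exact ⟨_, Or.inr (Or.inr (Or.inl rfl)), hsub₂, Or.inr ⟨rfl, Or.inr rfl⟩⟩
      · exact ⟨e, Or.inr (Or.inr (Or.inr he)), subset_rfl, Or.inl ⟨rfl, fun h' => hk (h' ▸ he)⟩⟩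
    have hm_far : ∀ e ∈ Corner A B C (Corner p q m F), e ≠ s(p, m) → e ≠ s(q, m) →
        planeProj b m ∉ sh b e := by
      rintro e (rfl | rfl | rfl | rfl | he) h1 h2
      · rwa [sh_mk]
      · rwa [sh_mk]
      · exact absurd rfl h1
      · exact absurd rfl h2
      · exact hsh e he
    have pair : ∀ e ∈ Corner A B C (Corner p q m F), ∀ f ∈ Corner A B C (Corner p q m F),
        ∀ g ∈ Corner A B C (Corner p q m F), ∀ e' f', e ≠ f → e ≠ g → f ≠ g →
        (e = e' ∧ e ≠ s(p, q) ∨ e' = s(p, q) ∧ (e = s(p, m) ∨ e = s(q, m))) →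
        (f = f' ∧ f ≠ s(p, q) ∨ f' = s(p, q) ∧ (f = s(p, m) ∨ f = s(q, m))) →
        ∀ x ∈ sh b e, x ∈ sh b f → x ∈ sh b g → e' ≠ f' := by
      rintro e he f hf g hg e' f' hef heg hfg hee hff x hxe hxf hxg rfl
      rcases hee with ⟨rfl, hne⟩ | ⟨rfl, hee⟩
      · rcases hff with ⟨rfl, -⟩ | ⟨h', -⟩
        · exact hef rfl
        · exact hne h'
      · rcases hff with ⟨rfl, h'⟩ | ⟨-, hff⟩
        · exact h' rfl
        · rcases hee with rfl | rfl <;> rcases hff with rfl | rfl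
          · exact hef rfl
          · exact hm_far g hg heg.symm hfg.symm (hboth x hxe hxf ▸ hxg)
          · exact hm_far g hg hfg.symm heg.symm (hboth x hxf hxe ▸ hxg)
          · exact hef rfl
    rintro x ⟨e, he, f, hf, g, hg, hef, heg, hfg, hxe, hxf, hxg⟩
    obtain ⟨e', he', hse, hce⟩ := old e he
    obtain ⟨f', hf', hsf, hcf⟩ := old f hf
    obtain ⟨g', hg', hsg, hcg⟩ := old g hg
    exact ⟨e', he', f', hf', g', hg',
      pair e he f hf g hg e' f' hef heg hfg hce hcf x hxe hxf hxg,
      pair e he g hg f hf e' g' heg hef hfg.symm hce hcg x hxe hxg hxf,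
      pair f hf g hg e he f' g' hfg hef.symm heg.symm hcf hcg x hxf hxg hxe, hse hxe, hsf hxf, hsg hxg⟩

/-- Near a point `y` of the edge `pq` over the moving edge `AC` one can subdivide. -/
theorem eventually_subdivide (h : Loc b (insert s(p, q) F) A B C d) (hk : s(p, q) ∉ F)
    {y : Space} (hy : y ∈ segment ℝ p q) (hyp : y ≠ p) (hA : A ∉ s(p, q))
    (hyA : planeProj b y ∈ segment ℝ (planeProj b A) (planeProj b C))
    (hyC : planeProj b y ≠ planeProj b C) :
    ∀ᶠ σ : ℝ in 𝓝[>] 0, y + σ • (p - y) ∈ openSegment ℝ p q ∧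
      (∀ f ∈ F, planeProj b (y + σ • (p - y)) ∉ sh b f) ∧
      planeProj b (y + σ • (p - y)) ∉ segment ℝ (planeProj b A) (planeProj b C) ∧
      planeProj b (y + σ • (p - y)) ∉ segment ℝ (planeProj b B) (planeProj b C) := by
  have hpq : planeProj b p ≠ planeProj b q := h.env_proj_ne (Or.inl rfl)
  have hE : s(p, q) ∈ insert s(p, q) F := Or.inl rfl
  have hys : planeProj b y ∈ sh b s(p, q) := proj_mem_sh (by rwa [edgeSegment_mk])
  obtain ⟨v, hgv, hv⟩ := h.exists_env
  have hyp' : planeProj b y ≠ planeProj b p := fun h' => hyp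
    (hgv.edge_inj (Or.inr (Or.inr hE)) (by rwa [edgeSegment_mk])
      (by rw [edgeSegment_mk]; exact left_mem_segment ℝ p q) h')
  have hopen : ∀ᶠ σ : ℝ in 𝓝[>] 0, y + σ • (p - y) ∈ openSegment ℝ p q := by
    filter_upwards [Ioo_mem_nhdsGT (zero_lt_one (α := ℝ))] with σ hσ
    obtain ⟨α, β, h1, h2, h3, rfl⟩ := hy
    have hβ : 0 < β := by
      rcases h2.eq_or_lt with rfl | h2
      · refine absurd ?_ hyp
        obtain rfl : α = 1 := by linarith
        simp
      · exact h2
    refine ⟨(1 - σ) * α + σ, (1 - σ) * β, ?_, mul_pos (by linarith [hσ.2]) hβ, ?_, ?_⟩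
    · nlinarith [hσ.1, hσ.2, mul_nonneg (sub_nonneg.2 hσ.2.le) h1]
    · linear_combination (1 - σ) * h3
    · module
  have tm := tendsto_point y (p - y) (Set.Ioi 0)
  have hmem : ∀ᶠ σ : ℝ in 𝓝[>] 0, planeProj b (y + σ • (p - y)) ∈ sh b s(p, q) := by
    filter_upwards [hopen] with σ hσ
    exact proj_mem_sh (by rw [edgeSegment_mk]; exact openSegment_subset_segment ℝ p q hσ)
  have hne : ∀ᶠ σ : ℝ in 𝓝[>] 0, planeProj b (y + σ • (p - y)) ≠ planeProj b y := by
    filter_upwards [self_mem_nhdsWithin] with σ (hσ : 0 < σ)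
    intro h'
    rw [map_add, add_eq_left, map_smul, smul_eq_zero, map_sub] at h'
    exact hyp' (sub_eq_zero.1 (h'.resolve_left hσ.ne')).symm
  have hF : F.Finite := h.fin.subset (Set.subset_insert _ _)
  refine (hopen.and (((eventually_all_finite hF).2 fun f hf => ?_).and ((?_ : ∀ᶠ σ in _, _).and ?_)))
  · by_cases hyf : planeProj b y ∈ sh b f
    · filter_upwards [hmem, hne] with σ h1 h2 h3
      exact h2 (hgv.inter_subsingleton (Or.inr (Or.inr hE)) (Or.inr (Or.inr (Or.inr hf)))
        (fun h' => hk (h' ▸ hf)) h1 h3 hys hyf)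
    · obtain ⟨u, w, rfl⟩ := edgeSegment_eq_of_sym2 f
      simp only [sh_mk] at hyf ⊢
      exact eventually_point_segment tm.proj tendsto_const_nhds tendsto_const_nhds hyf
  · have hnc := (h.okA _ hE).nc p q rfl hA ⟨_, hys, hyA⟩
    filter_upwards [hmem, hne] with σ h1 h2 h3
    have t1 := tdet_eq_zero_of_mem_segment h3
    have t2 := tdet_eq_zero_of_mem_segment hyA
    have t3 := tdet_self_left (planeProj b A) (planeProj b C)
    rw [sh_mk] at h1 hys
    have l1 := tdet_eq_zero_of_mem_segment h1
    have l2 := tdet_eq_zero_of_mem_segment hys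
    refine hnc ?_
    have e1 := tdet_eq_zero_trans h.projA_ne t1 t2 t3
    exact tdet_eq_zero_trans h2 e1
      (tdet_eq_zero_trans hpq l1 l2 (tdet_self_left _ _))
      (tdet_eq_zero_trans hpq l1 l2 (tdet_self_right _ _))
  · exact eventually_point_segment tm.proj tendsto_const_nhds tendsto_const_nhds
      fun hB => hyC (h.inter hyA hB)

end Loc

/-! ### Removing critical points on the moving edges -/

/-- An edge `uw` that crosses `AC` at most transversally and stays away from `BC`. -/
structure NewEdge (b : OrthonormalBasis (Fin 3) ℝ Space) (A B C u w : Space) : Prop where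
  sp : Disjoint (segment ℝ A C) (segment ℝ u w)
  nc : tdet (planeProj b A) (planeProj b u) (planeProj b w) ≠ 0
  far : Disjoint (segment ℝ (planeProj b u) (planeProj b w))
    (segment ℝ (planeProj b B) (planeProj b C))

namespace NewEdge

variable {A B C u w : Space}

theorem projA_ne (h : NewEdge b A B C u w) : planeProj b A ≠ planeProj b w := tdet_ne_left h.nc

theorem notA (h : NewEdge b A B C u w) : A ∉ s(u, w) := by
  rw [Sym2.mem_iff]
  rintro (rfl | rfl)
  · exact tdet_ne_base h.nc rfl
  · exact tdet_ne_left h.nc rfl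

theorem notB (h : NewEdge b A B C u w) : B ∉ s(u, w) := by
  rw [Sym2.mem_iff]
  rintro (rfl | rfl)
  · exact Set.disjoint_left.1 h.far (left_mem_segment ℝ _ _) (left_mem_segment ℝ _ _)
  · exact Set.disjoint_left.1 h.far (right_mem_segment ℝ _ _) (left_mem_segment ℝ _ _)

theorem projC (h : NewEdge b A B C u w) : planeProj b C ∉ sh b s(u, w) := by
  rw [sh_mk]
  exact fun h' => Set.disjoint_left.1 h.far h' (right_mem_segment ℝ _ _)

theorem notC (h : NewEdge b A B C u w) : C ∉ s(u, w) := fun h' => h.projC (vertex_mem_sh h')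

theorem okA (h : NewEdge b A B C u w) : HalfOK b A C s(u, w) where
  sp _ := by rw [edgeSegment_mk]; exact h.sp
  nc p q hpq _ _ := by
    rcases Sym2.eq_iff.1 hpq with ⟨rfl, rfl⟩ | ⟨rfl, rfl⟩
    · exact h.nc
    · rw [tdet_swap_right]; exact neg_ne_zero.2 h.nc
  adj hA := absurd hA h.notA

theorem okB (h : NewEdge b A B C u w) : HalfOK b B C s(u, w) where
  sp _ := by
    rw [edgeSegment_mk]
    exact Set.disjoint_left.2 fun x hx hx' =>
      Set.disjoint_left.1 h.far (proj_mem_segment hx') (proj_mem_segment hx)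
  nc p q _ _ hx := by
    obtain ⟨x, hx, hx'⟩ := hx
    rw [sh_mk] at hx
    exact absurd hx' (Set.disjoint_left.1 h.far hx)
  adj hB := absurd hB h.notB

theorem eventually {ι : Type*} {l : Filter ι} {p : ι → Space} (h : NewEdge b A B C u w)
    (hp : Tendsto p l (𝓝 w)) : ∀ᶠ i in l, NewEdge b A B C u (p i) := by
  filter_upwards [eventually_segments (tendsto_const_nhds (x := A)) (tendsto_const_nhds (x := C))
    (tendsto_const_nhds (x := u)) hp h.sp,
    (tendsto_const_nhds.tdet tendsto_const_nhds hp.proj).eventually_ne h.nc,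
    eventually_segments tendsto_const_nhds hp.proj tendsto_const_nhds tendsto_const_nhds h.far]
    with i h1 h2 h3
  exact ⟨h1, h2, h3⟩

end NewEdge

theorem Loc.replace {E F : Set (Sym2 Space)} {A B C d a c w : Space} (h : Loc b E A B C d)
    (hF : F ⊆ E) (ha : NewEdge b A B C a w) (hc : NewEdge b A B C c w)
    (hg : ∀ᶠ τ : ℝ in 𝓝[≠] 0, Good b (Corner A B (C + τ • d) (Corner a c w F))) :
    Loc b (Corner a c w F) A B C d where
  fresh := by
    rintro e (rfl | rfl | he)
    exacts [ha.notC, hc.notC, h.fresh e (hF he)]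
  okA := by
    rintro e (rfl | rfl | he)
    exacts [ha.okA, hc.okA, h.okA e (hF he)]
  okB := by
    rintro e (rfl | rfl | he)
    exacts [ha.okB, hc.okB, h.okB e (hF he)]
  sep := h.sep
  dbl := by
    rintro e (rfl | rfl | he) f (rfl | rfl | hf) hef h1 h2
    exacts [ha.projC h1, ha.projC h1, ha.projC h1, hc.projC h1, hc.projC h1, hc.projC h1,
      ha.projC h2, hc.projC h2, h.dbl e (hF he) f (hF hf) hef h1 h2]
  good := hg

section badReplace

variable {F : Set (Sym2 Space)} {A B C a c w : Space} {g : Sym2 Space}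

theorem new_edge_not_bad (ha : NewEdge b A B C a w)
    (hdeg : ∀ f ∈ F, ∀ f' ∈ F, f ≠ f' → a ∈ f → a ∉ f')
    (hF : ∀ f ∈ F, f ≠ g → ∀ x ∈ sh b f, x ∈ segment ℝ (planeProj b a) (planeProj b w) →
      x = planeProj b a ∧ a ∈ f)
    (hg : g ∈ F → planeProj b a ∉ sh b g ∧ ∀ x ∈ sh b g,
      x ∈ segment ℝ (planeProj b a) (planeProj b w) →
      x ∉ segment ℝ (planeProj b A) (planeProj b C))
    (hgw : g ∈ F → planeProj b w ∉ sh b g)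
    (haA : planeProj b a ∉ segment ℝ (planeProj b A) (planeProj b C))
    (hwA : planeProj b w ∉ segment ℝ (planeProj b A) (planeProj b C))
    (hcw : ∀ x ∈ segment ℝ (planeProj b a) (planeProj b w), x ∈ sh b s(c, w) → x = planeProj b w)
    {y : Plane} (hy : y ∈ sh b s(a, w)) {f f' : Sym2 Space} (hf : f ∈ Corner A B C (Corner a c w F))
    (hf' : f' ∈ Corner A B C (Corner a c w F)) (hff : f ≠ f') (hfa : f ≠ s(a, w))
    (hfa' : f' ≠ s(a, w)) (hyf : y ∈ sh b f) (hyf' : y ∈ sh b f') : False := by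
  rw [sh_mk] at hy
  have haw : planeProj b a ≠ planeProj b w := tdet_ne_right ha.nc
  have cases : ∀ f ∈ Corner A B C (Corner a c w F), f ≠ s(a, w) → y ∈ sh b f →
      (f ∈ F ∧ y = planeProj b a ∧ a ∈ f) ∨
      (f = s(A, C) ∧ y ∈ segment ℝ (planeProj b A) (planeProj b C)) ∨
      (f = s(c, w) ∧ y = planeProj b w) ∨ (f = g ∧ g ∈ F ∧ y ∈ sh b g) := by
    rintro f (rfl | rfl | rfl | rfl | hf) hfa hyf
    · rw [sh_mk] at hyf; exact Or.inr (Or.inl ⟨rfl, hyf⟩)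
    · rw [sh_mk] at hyf; exact absurd hyf (Set.disjoint_left.1 ha.far hy)
    · exact absurd rfl hfa
    · exact Or.inr (Or.inr (Or.inl ⟨rfl, hcw y hy hyf⟩))
    · by_cases hfg : f = g
      · subst hfg; exact Or.inr (Or.inr (Or.inr ⟨rfl, hf, hyf⟩))
      · exact Or.inl ⟨hf, hF f hf hfg y hyf hy⟩
  rcases cases f hf hfa hyf with ⟨h1, h2, h3⟩ | ⟨h1, h2⟩ | ⟨h1, h2⟩ | ⟨h1, h2, h3⟩ <;>
    rcases cases f' hf' hfa' hyf' with ⟨h1', h2', h3'⟩ | ⟨h1', h2'⟩ | ⟨h1', h2'⟩ | ⟨h1', h2', h3'⟩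
  · exact hdeg f h1 f' h1' hff h3 h3'
  · exact haA (h2 ▸ h2')
  · exact haw (h2.symm.trans h2')
  · exact (hg h2').1 (h2 ▸ h3')
  · exact haA (h2' ▸ h2)
  · exact hff (h1.trans h1'.symm)
  · exact hwA (h2' ▸ h2)
  · exact (hg h2').2 y h3' hy h2
  · exact haw (h2'.symm.trans h2)
  · exact hwA (h2 ▸ h2')
  · exact hff (h1.trans h1'.symm)
  · exact hgw h2' (h2 ▸ h3')
  · exact (hg h2).1 (h2' ▸ h3)
  · exact (hg h2).2 y h3 hy h2'
  · exact hgw h2 (h2' ▸ h3)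
  · exact hff (h1.trans h1'.symm)

theorem bad_replace {E : Set (Sym2 Space)} (hsub : F ⊆ E) (ha : NewEdge b A B C a w)
    (hc : NewEdge b A B C c w)
    (hdega : ∀ f ∈ F, ∀ f' ∈ F, f ≠ f' → a ∈ f → a ∉ f')
    (hdegc : ∀ f ∈ F, ∀ f' ∈ F, f ≠ f' → c ∈ f → c ∉ f')
    (hFa : ∀ f ∈ F, f ≠ g → ∀ x ∈ sh b f, x ∈ segment ℝ (planeProj b a) (planeProj b w) →
      x = planeProj b a ∧ a ∈ f)
    (hFc : ∀ f ∈ F, f ≠ g → ∀ x ∈ sh b f, x ∈ segment ℝ (planeProj b c) (planeProj b w) →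
      x = planeProj b c ∧ c ∈ f)
    (hga : g ∈ F → planeProj b a ∉ sh b g ∧ ∀ x ∈ sh b g,
      x ∈ segment ℝ (planeProj b a) (planeProj b w) →
      x ∉ segment ℝ (planeProj b A) (planeProj b C))
    (hgc : g ∈ F → planeProj b c ∉ sh b g ∧ ∀ x ∈ sh b g,
      x ∈ segment ℝ (planeProj b c) (planeProj b w) →
      x ∉ segment ℝ (planeProj b A) (planeProj b C))
    (hgw : g ∈ F → planeProj b w ∉ sh b g)
    (haA : planeProj b a ∉ segment ℝ (planeProj b A) (planeProj b C))
    (hcA : planeProj b c ∉ segment ℝ (planeProj b A) (planeProj b C))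
    (hwA : planeProj b w ∉ segment ℝ (planeProj b A) (planeProj b C))
    (hac : ∀ x ∈ segment ℝ (planeProj b a) (planeProj b w),
      x ∈ segment ℝ (planeProj b c) (planeProj b w) → x = planeProj b w)
    {x₀ : Plane} (h₀ : ∀ f ∈ F, f ≠ g → x₀ ∉ sh b f)
    (hB : x₀ ∉ segment ℝ (planeProj b B) (planeProj b C)) :
    bad b (Corner A B C (Corner a c w F)) ⊆ bad b (Corner A B C E) \ {x₀} := by
  have sa := fun {y} => new_edge_not_bad (c := c) (g := g) (y := y) ha hdega hFa hga hgw haA hwA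
    (fun x hx hx' => hac x hx (by rwa [sh_mk] at hx'))
  have sc := fun {y} => new_edge_not_bad (c := a) (g := g) (y := y) hc hdegc hFc hgc hgw hcA hwA
    (fun x hx hx' => hac x (by rwa [sh_mk] at hx') hx)
  rw [Corner.swap c a] at sc
  rintro y ⟨e, he, f, hf, k, hk, hef, hek, hfk, hye, hyf, hyk⟩
  have old : ∀ e ∈ Corner A B C (Corner a c w F), ∀ f ∈ Corner A B C (Corner a c w F),
      ∀ k ∈ Corner A B C (Corner a c w F), e ≠ f → e ≠ k → f ≠ k → y ∈ sh b e → y ∈ sh b f →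
      y ∈ sh b k → e ∈ Corner A B C E ∧ (y = x₀ → e = s(A, C) ∨ e = g) := by
    rintro e (rfl | rfl | rfl | rfl | he) f hf k hk hef hek hfk hye hyf hyk
    · exact ⟨Or.inl rfl, fun _ => Or.inl rfl⟩
    · refine ⟨Or.inr (Or.inl rfl), fun h' => absurd ?_ hB⟩
      rwa [sh_mk, h'] at hye
    · exact (sa hye hf hk hfk hef.symm hek.symm hyf hyk).elim
    · exact (sc hye hf hk hfk hef.symm hek.symm hyf hyk).elim
    · refine ⟨Or.inr (Or.inr (hsub he)), fun h' => Or.inr ?_⟩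
      by_contra hne
      exact h₀ e he hne (h' ▸ hye)
  have o1 := old e he f hf k hk hef hek hfk hye hyf hyk
  have o2 := old f hf e he k hk hef.symm hfk hek hyf hye hyk
  have o3 := old k hk e he f hf hek.symm hfk.symm hef hyk hye hyf
  refine ⟨⟨e, o1.1, f, o2.1, k, o3.1, hef, hek, hfk, hye, hyf, hyk⟩, fun (h' : y = x₀) => ?_⟩
  rcases o1.2 h' with h1 | h1 <;> rcases o2.2 h' with h2 | h2 <;> rcases o3.2 h' with h3 | h3
  all_goals first
    | exact hef (h1.trans h2.symm)
    | exact hek (h1.trans h3.symm)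
    | exact hfk (h2.trans h3.symm)

end badReplace

/-- That an edge meets a triangle at most in a corner persists. -/
theorem eventually_corner {ι : Type*} {l : Filter ι} {p q : ι → Space} {p₀ q₀ u : Space}
    {f : Sym2 Space} (hp : Tendsto p l (𝓝 p₀)) (hq : Tendsto q l (𝓝 q₀))
    (hnd : ∀ w, f = s(u, w) → planeProj b w ≠ planeProj b u)
    (hu : planeProj b u ∉ segment ℝ (planeProj b p₀) (planeProj b q₀))
    (h : ∀ x ∈ sh b f, x ∈ convexHull ℝ {planeProj b u, planeProj b p₀, planeProj b q₀} →
      x = planeProj b u ∧ u ∈ f) :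
    ∀ᶠ i in l, ∀ x ∈ sh b f, x ∈ convexHull ℝ {planeProj b u, planeProj b (p i), planeProj b (q i)} →
      x = planeProj b u ∧ u ∈ f := by
  by_cases huf : u ∈ f
  · obtain ⟨w, rfl⟩ := exists_eq_mk_of_mem huf
    simp only [sh_mk] at h ⊢
    filter_upwards [eventually_cone tendsto_const_nhds tendsto_const_nhds hp.proj hq.proj
      (hnd w rfl) hu fun x hx hx' => (h x hx hx').1] with i hi x hx hx'
    exact ⟨hi x hx hx', by simp⟩
  · obtain ⟨y, z, rfl⟩ := edgeSegment_eq_of_sym2 f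
    simp only [sh_mk] at h ⊢
    filter_upwards [eventually_segment_triangle (a := fun _ => planeProj b y)
      (c := fun _ => planeProj b z) tendsto_const_nhds tendsto_const_nhds tendsto_const_nhds
      hp.proj hq.proj (Set.disjoint_left.2 fun x hx hx' => huf (h x hx hx').2)] with i hi x hx hx'
    exact absurd hx' (Set.disjoint_left.1 hi hx)

theorem disjoint_of_side {p q r s : Plane} {k : ℝ} (h1 : 0 < tdet p q r * k)
    (h2 : 0 < tdet p q s * k) : Disjoint (segment ℝ p q) (segment ℝ r s) := by
  refine Set.disjoint_left.2 fun x hx hx' => ?_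
  obtain ⟨α, β, ha, hb, hab, e⟩ := tdet_of_mem_segment (p := p) (q := q) hx'
  rw [tdet_eq_zero_of_mem_segment hx] at e
  have : 0 = α * (tdet p q r * k) + β * (tdet p q s * k) := by linear_combination k * e
  rcases ha.eq_or_lt with rfl | ha
  · obtain rfl : β = 1 := by linarith
    linarith
  · nlinarith [mul_pos ha h1, mul_nonneg hb h2.le]

/-- A point outside finitely many lines. -/
theorem tdet_ne_zero_dense {p q : Plane} (h : p ≠ q) : Dense {x | tdet p q x ≠ 0} := by
  simpa only [tdet_rotate] using dense_tdet_ne h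

theorem isOpen_tdet_ne' (p q : Plane) : IsOpen {x | tdet p q x ≠ 0} := by
  simpa only [tdet_rotate] using isOpen_tdet_ne p q

/-- The edge set `E` can be replaced by `E'` near a critical time, where the point `x` is no longer
critical. -/
def Removable (b : OrthonormalBasis (Fin 3) ℝ Space) (E : Set (Sym2 Space)) (A B C d : Space)
    (m : ℕ) (x : Plane) : Prop :=
  ∃ E', Loc b E' A B C d ∧ bad b (Corner A B C E') ⊆ bad b (Corner A B C E) \ {x} ∧
    ∀ᶠ τ : ℝ in 𝓝[>] 0, ∃ m₁ m₂, m₁ + m₂ ≤ m ∧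
      Reach b m₁ (Corner A B (C + (-τ) • d) E) (Corner A B (C + (-τ) • d) E') ∧
      Reach b m₂ (Corner A B (C + τ • d) E') (Corner A B (C + τ • d) E)

theorem fresh_corner {A B P v : Space} {F : Set (Sym2 Space)} (hA : A ≠ v) (hB : B ≠ v)
    (hP : P ≠ v) (hF : ∀ e ∈ F, v ∉ e) : ∀ e ∈ Corner A B P F, v ∉ e := by
  rintro e (rfl | rfl | he)
  · simp [hA.symm, hP.symm]
  · simp [hB.symm, hP.symm]
  · exact hF e he

theorem tendsto_neg_punctured : Tendsto (fun τ : ℝ => -τ) (𝓝[>] 0) (𝓝[≠] 0) := by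
  refine tendsto_nhdsWithin_iff.2 ⟨?_, ?_⟩
  · exact ((continuous_neg.tendsto' 0 0 neg_zero)).mono_left nhdsWithin_le_nhds
  · filter_upwards [self_mem_nhdsWithin] with τ (hτ : 0 < τ)
    exact (neg_lt_zero.2 hτ).ne

theorem punctured_of_pos : 𝓝[>] (0 : ℝ) ≤ 𝓝[≠] 0 :=
  nhdsWithin_mono _ fun _ (h : 0 < _) => h.ne'

theorem Loc.removable_of_reach {E E' : Set (Sym2 Space)} {A B C d : Space} {x : Plane}
    (h' : Loc b E' A B C d) (hb : bad b (Corner A B C E') ⊆ bad b (Corner A B C E) \ {x})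
    (hr : ∀ᶠ τ : ℝ in 𝓝[≠] 0, Reach b 1 (Corner A B (C + τ • d) E) (Corner A B (C + τ • d) E')) :
    Removable b E A B C d 2 x := by
  refine ⟨E', h', hb, ?_⟩
  filter_upwards [tendsto_neg_punctured.eventually hr, punctured_of_pos hr] with τ h1 h2
  exact ⟨1, 1, le_rfl, h1, h2.symm⟩

namespace Loc

variable {F : Set (Sym2 Space)} {A B C d a c v : Space}

theorem tdet_moving (A C d : Space) (x : Plane) (τ : ℝ) :
    tdet (planeProj b A) (planeProj b (C + τ • d)) x =
      tdet (planeProj b A) (planeProj b C) x +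
        τ * tdet (planeProj b A) (planeProj b A + planeProj b d) x := by
  simp [tdet]; ring

/-- The moving edge passes over the points of `AC` with positive speed. -/
theorem speed_ne {E : Set (Sym2 Space)} (h : Loc b E A B C d) {x : Plane}
    (hx : x ∈ segment ℝ (planeProj b A) (planeProj b C)) (hxA : x ≠ planeProj b A) :
    tdet (planeProj b A) (planeProj b A + planeProj b d) x ≠ 0 := by
  obtain ⟨α, β, h1, h2, h3, rfl⟩ := hx
  have hβ : β ≠ 0 := by
    rintro rfl
    obtain rfl : α = 1 := by linarith
    simp at hxA
  rw [tdet_comb _ _ _ _ h3, tdet_self_left, mul_zero, zero_add]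
  refine mul_ne_zero hβ fun h0 => h.detA ?_
  rw [← neg_eq_zero, ← h0]
  simp [tdet]; ring

set_option maxHeartbeats 1000000 in
theorem shift_vertex (h : Loc b (Corner a c v F) A B C d) (hac : a ≠ c) (hv : ∀ f ∈ F, v ∉ f)
    (hna : NewEdge b A B C a v) (hnc : NewEdge b A B C c v)
    (ha : ∀ f ∈ F, ∀ x ∈ sh b f, x ∈ segment ℝ (planeProj b a) (planeProj b v) →
      x = planeProj b a ∧ a ∈ f)
    (hc : ∀ f ∈ F, ∀ x ∈ sh b f, x ∈ segment ℝ (planeProj b c) (planeProj b v) →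
      x = planeProj b c ∧ c ∈ f)
    (hvA : planeProj b v ∈ segment ℝ (planeProj b A) (planeProj b C)) :
    Removable b (Corner a c v F) A B C d 2 (planeProj b v) := by
  obtain ⟨v₁, hgv, hv₁⟩ := h.exists_env
  have hF : F.Finite := h.fin.subset fun e he => Or.inr (Or.inr he)
  have eav : s(a, v) ∈ Corner A B v₁ (Corner a c v F) := Or.inr (Or.inr (Or.inl rfl))
  have ecv : s(c, v) ∈ Corner A B v₁ (Corner a c v F) := Or.inr (Or.inr (Or.inr (Or.inl rfl)))
  have eF : ∀ {f}, f ∈ F → f ∈ Corner A B v₁ (Corner a c v F) := fun hf =>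
    Or.inr (Or.inr (Or.inr (Or.inr hf)))
  have hFa : ∀ {f u}, f ∈ F → f ≠ s(u, v) := fun hf h' => hv _ hf (h' ▸ by simp)
  have hvC : planeProj b v ≠ planeProj b C := fun h' => hna.projC
    (by rw [← h', sh_mk]; exact right_mem_segment ℝ _ _)
  have hAC := h.projA_ne
  have hAv := hna.projA_ne
  have t0 := tdet_eq_zero_of_mem_segment hvA
  have offA : ∀ {u}, NewEdge b A B C u v → planeProj b u ∉ segment ℝ (planeProj b A) (planeProj b C) :=
    fun hn hu => hn.nc (tdet_eq_zero_trans hAC (tdet_self_left _ _) (tdet_eq_zero_of_mem_segment hu) t0)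
  have hgv' := hgv
  rw [Corner.comm] at hgv'
  obtain ⟨w₀, hw₀⟩ := hgv'.exists_separating hac
  obtain ⟨y, hyd, hys⟩ := (tdet_ne_zero_dense hAC).inter_open_nonempty
    {y | tdet (planeProj b v) y (planeProj b a) * tdet (planeProj b v) y (planeProj b c) < 0}
    (isOpen_lt (by unfold tdet; fun_prop) continuous_const) ⟨_, hw₀⟩
  obtain ⟨z, hz⟩ := planeProj_surjective (b := b) (y - planeProj b v)
  obtain rfl : y = planeProj b v + planeProj b z := by rw [hz]; abel
  have hyd : tdet (planeProj b v) (planeProj b v + planeProj b z) (planeProj b a) *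
    tdet (planeProj b v) (planeProj b v + planeProj b z) (planeProj b c) < 0 := hyd
  have tw := tendsto_point v z (Set.Ioi 0)
  have cv : Tendsto (fun _ : ℝ => v) (𝓝[>] 0) (𝓝 v) := tendsto_const_nhds
  have cor : ∀ u, s(u, v) ∈ Corner A B v₁ (Corner a c v F) →
      (∀ f ∈ F, ∀ x ∈ sh b f, x ∈ segment ℝ (planeProj b u) (planeProj b v) →
      x = planeProj b u ∧ u ∈ f) → ∀ᶠ σ : ℝ in 𝓝[>] 0, ∀ f ∈ F, ∀ x ∈ sh b f,
      x ∈ convexHull ℝ {planeProj b u, planeProj b v, planeProj b (v + σ • z)} →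
      x = planeProj b u ∧ u ∈ f := by
    intro u hu hs
    rw [eventually_all_finite hF]
    intro f hf
    refine eventually_corner cv tw ?_ ?_ ?_
    · rintro w rfl; exact (hgv.proj_ne (eF hf)).symm
    · rw [segment_same]; exact hgv.proj_ne hu
    · intro x hx hx'
      rw [triangle_degenerate] at hx'
      exact hs f hf x hx hx'
  have far : ∀ u, NewEdge b A B C u v → ∀ᶠ σ : ℝ in 𝓝[>] 0,
      Disjoint (segment ℝ (planeProj b B) (planeProj b C))
        (convexHull ℝ {planeProj b u, planeProj b v, planeProj b (v + σ • z)}) := by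
    intro u hu
    refine eventually_segment_triangle tendsto_const_nhds tendsto_const_nhds tendsto_const_nhds
      cv.proj tw.proj ?_
    rw [triangle_degenerate]; exact hu.far.symm
  have sp : ∀ u, NewEdge b A B C u v → ∀ᶠ σ : ℝ in 𝓝[>] 0,
      Disjoint (segment ℝ A C) (convexHull ℝ {u, v, v + σ • z}) := by
    intro u hu
    refine eventually_segment_triangle tendsto_const_nhds tendsto_const_nhds tendsto_const_nhds
      cv tw ?_
    rw [triangle_degenerate]; exact hu.sp
  have endA : ∀ u, NewEdge b A B C u v → s(u, v) ∈ Corner a c v F → ∀ᶠ σ : ℝ in 𝓝[>] 0,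
      planeProj b A ∉ convexHull ℝ {planeProj b u, planeProj b v, planeProj b (v + σ • z)} := by
    intro u hu he
    refine eventually_point_triangle tendsto_const_nhds tendsto_const_nhds cv.proj tw.proj ?_
    rw [triangle_degenerate, ← sh_mk]
    exact h.A_notMem_sh he hu.notA
  have fr := eventually_fresh (ψ := fun _ x => x) hv hF (fun x => tendsto_const_nhds) tw
  simp only [Sym2.map_id', id, Set.image_id'] at fr
  obtain ⟨σ, ⟨⟨⟨⟨cora, corc⟩, fara, farc⟩, ⟨spa, spc⟩, enda, endc⟩, ⟨newa, newc⟩, fr⟩, hσ⟩ :=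
    ((((((cor a eav ha).and (cor c ecv hc)).and ((far a hna).and (far c hnc))).and
      (((sp a hna).and (sp c hnc)).and ((endA a hna (Or.inl rfl)).and
        (endA c hnc (Or.inr (Or.inl rfl)))))).and
      (((hna.eventually tw).and (hnc.eventually tw)).and fr)).and self_mem_nhdsWithin).exists
  have hσ : 0 < σ := hσ
  set w := v + σ • z with hw
  have hsep : tdet (planeProj b v) (planeProj b w) (planeProj b a) *
      tdet (planeProj b v) (planeProj b w) (planeProj b c) < 0 := by
    rw [hw, map_add, map_smul, tdet_direction, tdet_direction]
    nlinarith [mul_pos hσ hσ]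
  have hν : tdet (planeProj b A) (planeProj b C) (planeProj b w) ≠ 0 := by
    have : tdet (planeProj b A) (planeProj b C) (planeProj b w) =
        σ * tdet (planeProj b A) (planeProj b C) (planeProj b v + planeProj b z) := by
      have e : tdet (planeProj b A) (planeProj b C) (planeProj b w) =
        (1 - σ) * tdet (planeProj b A) (planeProj b C) (planeProj b v) +
        σ * tdet (planeProj b A) (planeProj b C) (planeProj b v + planeProj b z) := by
        rw [hw, map_add, map_smul]
        simp [tdet]; ring
      rw [e, t0]; ring
    rw [this]
    exact mul_ne_zero hσ.ne' hys
  have hκ := h.speed_ne hvA hAv.symm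
  set κ := tdet (planeProj b A) (planeProj b A + planeProj b d) (planeProj b v)
  set ν := tdet (planeProj b A) (planeProj b C) (planeProj b w)
  have hwA : planeProj b w ∉ segment ℝ (planeProj b A) (planeProj b C) := fun h' =>
    hν (tdet_eq_zero_of_mem_segment h')
  have tC := tendsto_point C d {0}ᶜ
  have tA : Tendsto (fun _ : ℝ => A) (𝓝[≠] 0) (𝓝 A) := tendsto_const_nhds
  have farτ : ∀ u, Disjoint (segment ℝ (planeProj b B) (planeProj b C))
      (convexHull ℝ {planeProj b u, planeProj b v, planeProj b w}) → ∀ᶠ τ : ℝ in 𝓝[≠] 0,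
      Disjoint (segment ℝ (planeProj b B) (planeProj b (C + τ • d)))
        (convexHull ℝ {planeProj b u, planeProj b v, planeProj b w}) := fun u hu =>
    eventually_segment_triangle tendsto_const_nhds tC.proj tendsto_const_nhds
      tendsto_const_nhds tendsto_const_nhds hu
  have spτ : ∀ u, Disjoint (segment ℝ A C) (convexHull ℝ {u, v, w}) → ∀ᶠ τ : ℝ in 𝓝[≠] 0,
      Disjoint (segment ℝ A (C + τ • d)) (convexHull ℝ {u, v, w}) := fun u hu =>
    eventually_segment_triangle tendsto_const_nhds tC tendsto_const_nhds
      tendsto_const_nhds tendsto_const_nhds hu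
  have hmain : ∀ᶠ τ : ℝ in 𝓝[≠] 0,
      Reach b 2 (Corner A B (C + τ • d) (Corner a c v F)) (Corner A B (C + τ • d) (Corner a c w F)) ∧
      (Disjoint (segment ℝ (planeProj b A) (planeProj b (C + τ • d)))
          (segment ℝ (planeProj b v) (planeProj b w)) →
      Reach b 0 (Corner A B (C + τ • d) (Corner a c v F))
        (Corner A B (C + τ • d) (Corner a c w F))) := by
    filter_upwards [h.good, h.fresh_near, farτ a fara, farτ c farc, spτ a spa, spτ c spc,
      h.eventually_notMem_segment hwA _] with τ g1 g2 g3 g4 g5 g6 g7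
    have hCv : C + τ • d ≠ v := fun h' => g2 _ (Or.inl rfl) (h' ▸ by simp)
    have hCw : C + τ • d ≠ w := by
      intro h'
      refine Set.disjoint_left.1 g3 (right_mem_segment ℝ _ _) ?_
      rw [h']; exact subset_convexHull ℝ _ (by simp)
    have hvP : planeProj b v ∉ sh b s(A, C + τ • d) := by
      refine g1.not_mem_sh (Or.inr (Or.inr (Or.inl rfl))) (Or.inl rfl) (by simp) ?_
      rw [Sym2.mem_iff]
      rintro (rfl | h')
      · exact hna.notA (by simp)
      · exact hCv h'.symm
    rw [Corner.comm] at g1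
    rw [Corner.comm A B, Corner.comm A B, ← sh_mk]
    have hm : MoveHyp b (Corner A B (C + τ • d) F) a c v w := by
      have n1 := hna.notA
      have n2 := hna.notB
      have n3 := newa.notA
      have n4 := newa.notB
      simp only [Sym2.mem_iff, not_or] at n1 n2 n3 n4
      exact ⟨fresh_corner n1.2 n2.2 hCv hv, fresh_corner n3.2 n4.2 hCw fr, hsep⟩
    refine Reach.vertex_move_single g1 hm (g := s(A, C + τ • d)) ?_ ?_ ?_ ?_
    · rintro e (rfl | rfl | he) hne x hx hxT
      · exact absurd rfl hne
      · rw [sh_mk] at hx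
        exact absurd hxT (Set.disjoint_left.1 g3 hx)
      · exact Or.inl (cora e he x hx hxT).1
    · rintro e (rfl | rfl | he) hne x hx hxT
      · exact absurd rfl hne
      · rw [sh_mk] at hx
        rw [triangle_swap_right] at hxT
        exact absurd hxT (Set.disjoint_left.1 g4 hx)
      · rw [triangle_swap_right] at hxT
        exact Or.inl (corc e he x hx hxT).1
    · refine ⟨fun u hu => ?_, ?_, by rwa [edgeSegment_mk]⟩
      · rcases Sym2.mem_iff.1 hu with rfl | rfl
        · exact enda
        · exact Set.disjoint_left.1 g3 (right_mem_segment ℝ _ _)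
      · rwa [sh_mk]
    · refine ⟨fun u hu => ?_, hvP, ?_⟩
      · rw [triangle_swap_right]
        rcases Sym2.mem_iff.1 hu with rfl | rfl
        · exact endc
        · exact Set.disjoint_left.1 g4 (right_mem_segment ℝ _ _)
      · rw [edgeSegment_mk, triangle_swap_right]; exact g6
  have hside : ∀ᶠ τ : ℝ in 𝓝[≠] 0, 0 < τ * (κ * ν) →
      Disjoint (segment ℝ (planeProj b A) (planeProj b (C + τ • d)))
          (segment ℝ (planeProj b v) (planeProj b w)) := by
    have : Tendsto (fun τ : ℝ => tdet (planeProj b A) (planeProj b (C + τ • d)) (planeProj b w) * ν)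
        (𝓝[≠] 0) (𝓝 (ν * ν)) :=
      (tendsto_const_nhds.tdet tC.proj tendsto_const_nhds).mul_const ν
    filter_upwards [this.eventually_const_lt (mul_self_pos.2 hν)] with τ h1 h2
    refine disjoint_of_side (k := ν) ?_ h1
    rw [tdet_moving, t0]
    linarith
  have hloc : Loc b (Corner a c w F) A B C d := h.replace (fun e he => Or.inr (Or.inr he)) newa newc
    (hmain.mono fun τ hτ => hτ.1.right)
  have hgF : s(A, C) ∉ F := fun h' => h.fresh _ (Or.inr (Or.inr h')) (by simp)
  have hdeg : ∀ u, s(u, v) ∈ Corner A B v₁ (Corner a c v F) → ∀ f ∈ F, ∀ f' ∈ F, f ≠ f' → u ∈ f →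
      u ∉ f' := fun u hu f hf f' hf' hff h1 h2 =>
    hgv.not_three (eF hf) (eF hf') hu hff (hFa hf) (hFa hf') h1 h2 (by simp)
  refine ⟨_, hloc, bad_replace (g := s(A, C)) (fun e he => Or.inr (Or.inr he)) newa newc
    (hdeg a eav) (hdeg c ecv)
    (fun f hf _ x hx hx' => cora f hf x hx (segment_subset_triangle₁₃ hx'))
    (fun f hf _ x hx hx' => corc f hf x hx (segment_subset_triangle₁₃ hx'))
    (fun h' => absurd h' hgF) (fun h' => absurd h' hgF) (fun h' => absurd h' hgF)
    (offA hna) (offA hnc) hwA ?_ ?_ ?_, ?_⟩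
  · have : tdet (planeProj b w) (planeProj b v) (planeProj b a) *
        tdet (planeProj b w) (planeProj b v) (planeProj b c) < 0 := by
      rw [tdet_swap (planeProj b v), tdet_swap (planeProj b v) _ (planeProj b c)]; linarith
    exact fun x => eq_of_sides this
  · exact fun f hf _ => hgv.not_mem_sh eav (eF hf) (by simp) (hv f hf)
  · exact Set.disjoint_left.1 hna.far (right_mem_segment ℝ _ _)
  · filter_upwards [tendsto_neg_punctured.eventually hmain, punctured_of_pos hmain,
      tendsto_neg_punctured.eventually hside, punctured_of_pos hside, self_mem_nhdsWithin]
      with τ h1 h2 h3 h4 (hτ : 0 < τ)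
    rcases lt_or_gt_of_ne (mul_ne_zero hκ hν) with hlt | hgt
    · exact ⟨0, 2, le_rfl, h1.2 (h3 (by nlinarith)), h2.1.symm⟩
    · exact ⟨2, 0, le_rfl, h1.1, (h2.2 (h4 (by positivity))).symm⟩

end Loc

theorem tdet_add_smul (p q v z : Plane) (σ : ℝ) :
    tdet p q (v + σ • z) = (1 - σ) * tdet p q v + σ * tdet p q (v + z) := by
  simp [tdet]; ring

theorem mul_neg_of_comb {α β u w : ℝ} (hα : 0 < α) (hβ : 0 < β) (h : α * u + β * w = 0)
    (hu : u ≠ 0) : u * w < 0 := by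
  have : β * (u * w) = -(α * (u * u)) := by linear_combination u * h
  by_contra hcon
  push Not at hcon
  nlinarith [mul_pos hα (mul_self_pos.2 hu), mul_nonneg hβ.le hcon]

theorem triangle_of_mem {V : Type*} [AddCommGroup V] [Module ℝ V] {p q r : V}
    (h : r ∈ segment ℝ p q) : convexHull ℝ {p, q, r} = segment ℝ p q := by
  refine Set.Subset.antisymm (convexHull_min ?_ (convex_segment p q)) segment_subset_triangle₁₂
  rintro x (rfl | rfl | rfl)
  · exact left_mem_segment ℝ _ _
  · exact right_mem_segment ℝ _ _
  · exact h

namespace NewEdge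

variable {A B C u w y : Space}

theorem symm (h : NewEdge b A B C u w) : NewEdge b A B C w u where
  sp := by rw [segment_symm ℝ w]; exact h.sp
  nc := by rw [tdet_swap_right]; exact neg_ne_zero.2 h.nc
  far := by rw [segment_symm ℝ (planeProj b w)]; exact h.far

theorem sub (h : NewEdge b A B C u w) (hy : y ∈ openSegment ℝ u w) : NewEdge b A B C u y where
  sp := h.sp.mono_right (segment_subset_of_openSegment hy)
  nc := by
    obtain ⟨α, β, h1, h2, h3, h4⟩ := proj_mem_openSegment (b := b) hy
    rw [← h4, tdet_comb _ _ _ _ h3, tdet_self_right, mul_zero, zero_add]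
    exact mul_ne_zero h2.ne' h.nc
  far := h.far.mono_left (segment_subset_of_openSegment (proj_mem_openSegment hy))

end NewEdge

namespace Loc

variable {F : Set (Sym2 Space)} {A B C d a c y : Space}

set_option maxHeartbeats 1000000 in
theorem shift_edge (h : Loc b (insert s(a, c) F) A B C d) (hk : s(a, c) ∉ F) {g : Sym2 Space}
    (hg : g ∈ F) (hy : y ∈ openSegment ℝ a c) (hyg : planeProj b y ∈ sh b g)
    (hyA : planeProj b y ∈ segment ℝ (planeProj b A) (planeProj b C))
    (hn : NewEdge b A B C a c)
    (hF : ∀ f ∈ F, f ≠ g → ∀ x ∈ sh b f, x ∈ segment ℝ (planeProj b a) (planeProj b c) →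
      (x = planeProj b a ∧ a ∈ f) ∨ (x = planeProj b c ∧ c ∈ f))
    (hag : a ∉ g) (hcg : c ∉ g) : Removable b (insert s(a, c) F) A B C d 2 (planeProj b y) := by
  obtain ⟨v₁, hgv, hv₁⟩ := h.exists_env
  have hFfin : F.Finite := h.fin.subset fun e he => Or.inr he
  have eac : s(a, c) ∈ Corner A B v₁ (insert s(a, c) F) := Or.inr (Or.inr (Or.inl rfl))
  have eF : ∀ {f}, f ∈ F → f ∈ Corner A B v₁ (insert s(a, c) F) := fun hf =>
    Or.inr (Or.inr (Or.inr hf))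
  have hgne : g ≠ s(a, c) := fun h' => hk (h' ▸ hg)
  have hac := hgv.proj_ne eac
  have hy' := proj_mem_openSegment (b := b) hy
  have hys : planeProj b y ∈ sh b s(a, c) := by
    rw [sh_mk]; exact openSegment_subset_segment ℝ _ _ hy'
  have hys' : planeProj b y ∈ segment ℝ (planeProj b a) (planeProj b c) := by rwa [sh_mk] at hys
  have hyseg : y ∈ segment ℝ a c := openSegment_subset_segment ℝ _ _ hy
  have hAg : A ∉ g := h.A_notMem (Or.inr hg) (Or.inl rfl) hgne hyg hys hyA
  have hna := hn.sub hy
  have hnc := hn.symm.sub (openSegment_symm_mem hy)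
  have hAC := h.projA_ne
  obtain ⟨g₁, g₂, rfl⟩ := edgeSegment_eq_of_sym2 g
  have hgnd := hgv.proj_ne (eF hg)
  have hncg := (h.okA _ (Or.inr hg)).nc g₁ g₂ rfl hAg ⟨_, hyg, hyA⟩
  have hyg' : planeProj b y ∈ segment ℝ (planeProj b g₁) (planeProj b g₂) := by rwa [sh_mk] at hyg
  have t0 := tdet_eq_zero_of_mem_segment hyA
  have tg := tdet_eq_zero_of_mem_segment hyg'
  have tac := tdet_eq_zero_of_mem_segment hys'
  have offA : ∀ {u}, NewEdge b A B C u y →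
      tdet (planeProj b A) (planeProj b C) (planeProj b u) ≠ 0 :=
    fun hn hu => hn.nc (tdet_eq_zero_trans hAC (tdet_self_left _ _) hu t0)
  have haA := offA hna
  have hcA := offA hnc
  -- the new vertex
  obtain ⟨x, ⟨hx1, hx2⟩, hx3⟩ := (((tdet_ne_zero_dense hAC).inter_of_isOpen_left
    (tdet_ne_zero_dense hgnd) (isOpen_tdet_ne' _ _)).inter_of_isOpen_left
    (tdet_ne_zero_dense hac) ((isOpen_tdet_ne' _ _).inter (isOpen_tdet_ne' _ _))).nonempty
  obtain ⟨z, hz⟩ := planeProj_surjective (b := b) (x - planeProj b y)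
  obtain rfl : x = planeProj b y + planeProj b z := by rw [hz]; abel
  have hx1 : tdet (planeProj b A) (planeProj b C) (planeProj b y + planeProj b z) ≠ 0 := hx1
  have hx2 : tdet (planeProj b g₁) (planeProj b g₂) (planeProj b y + planeProj b z) ≠ 0 := hx2
  have hx3 : tdet (planeProj b a) (planeProj b c) (planeProj b y + planeProj b z) ≠ 0 := hx3
  have tw := tendsto_point y z (Set.Ioi 0)
  have cst : ∀ x : Space, Tendsto (fun _ : ℝ => x) (𝓝[>] 0) (𝓝 x) := fun x => tendsto_const_nhds
  have hull : ∀ {V : Type} [NormedAddCommGroup V] [NormedSpace ℝ V] {p q r : V},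
      r ∈ segment ℝ p q → convexHull ℝ {p, q, r} = segment ℝ p q := fun h => triangle_of_mem h
  have cor : ∀ᶠ σ : ℝ in 𝓝[>] 0, ∀ f ∈ F, f ≠ s(g₁, g₂) → ∀ x ∈ sh b f,
      x ∈ convexHull ℝ {planeProj b a, planeProj b c, planeProj b (y + σ • z)} →
      (x = planeProj b a ∧ a ∈ f) ∨ (x = planeProj b c ∧ c ∈ f) := by
    rw [eventually_all_finite hFfin]
    intro f hf
    rw [eventually_imp_distrib_left]
    intro hfg
    have hnd : ∀ u w, f = s(u, w) → planeProj b w ≠ planeProj b u := by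
      rintro u w rfl; exact (hgv.proj_ne (eF hf)).symm
    by_cases haf : a ∈ f
    · have hcf : c ∉ f := fun hcf => hk ((Sym2.mem_and_mem_iff
        (fun h' => hac (by rw [h']))).1 ⟨haf, hcf⟩ ▸ hf)
      filter_upwards [eventually_corner (f := f) (cst c) tw (hnd a)
        (openSegment_not_mem hac.symm (openSegment_symm_mem hy')) (fun x hx hx' => by
          rw [triangle_of_mem hys'] at hx'
          exact (hF f hf hfg x hx hx').resolve_right fun h' => hcf h'.2)] with σ hσ x hx hx'
      exact Or.inl (hσ x hx hx')
    · filter_upwards [eventually_corner (f := f) (u := c) (cst a) tw (hnd c)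
        (openSegment_not_mem hac hy') (fun x hx hx' => by
          rw [triangle_swap, triangle_of_mem hys'] at hx'
          exact (hF f hf hfg x hx hx').resolve_left fun h' => haf h'.2)] with σ hσ x hx hx'
      rw [triangle_swap] at hσ
      exact Or.inr (hσ x hx hx')
  have far : ∀ᶠ σ : ℝ in 𝓝[>] 0, Disjoint (segment ℝ (planeProj b B) (planeProj b C))
      (convexHull ℝ {planeProj b a, planeProj b c, planeProj b (y + σ • z)}) := by
    refine eventually_segment_triangle tendsto_const_nhds tendsto_const_nhds tendsto_const_nhds
      tendsto_const_nhds tw.proj ?_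
    rw [triangle_of_mem hys']; exact hn.far.symm
  have sp : ∀ u w, Disjoint (segment ℝ u w) (segment ℝ a c) → ∀ᶠ σ : ℝ in 𝓝[>] 0,
      Disjoint (segment ℝ u w) (convexHull ℝ {a, c, y + σ • z}) := by
    intro u w hu
    refine eventually_segment_triangle tendsto_const_nhds tendsto_const_nhds tendsto_const_nhds
      tendsto_const_nhds tw ?_
    rwa [triangle_of_mem hyseg]
  have hout : ∀ u, planeProj b u ∉ sh b s(a, c) → ∀ᶠ σ : ℝ in 𝓝[>] 0,
      planeProj b u ∉ convexHull ℝ {planeProj b a, planeProj b c, planeProj b (y + σ • z)} := by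
    intro u hu
    refine eventually_point_triangle tendsto_const_nhds tendsto_const_nhds tendsto_const_nhds
      tw.proj ?_
    rwa [triangle_of_mem hys', ← sh_mk]
  have hyF : ∀ f ∈ insert s(a, c) F, y ∉ f := by
    have hyac : y ∉ s(a, c) := by
      rw [Sym2.mem_iff]
      rintro (rfl | rfl)
      · exact openSegment_not_mem hac.symm (openSegment_symm_mem hy') (right_mem_segment ℝ _ _)
      · exact openSegment_not_mem hac hy' (right_mem_segment ℝ _ _)
    rintro f (rfl | hf)
    · exact hyac
    · exact fun hyf => hgv.not_mem_sh (eF hf) eac hyf hyac hys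
  have fr := eventually_fresh (ψ := fun _ x => x) hyF h.fin (fun x => tendsto_const_nhds) tw
  simp only [Sym2.map_id', id, Set.image_id'] at fr
  have hdisj : Disjoint (segment ℝ g₁ g₂) (segment ℝ a c) := by
    have := hgv.sp _ (eF hg) _ eac (fun v h1 h2 => by
      rcases Sym2.mem_iff.1 h2 with rfl | rfl
      · exact hag h1
      · exact hcg h1)
    rwa [edgeSegment_mk, edgeSegment_mk] at this
  have hgout : ∀ u ∈ s(g₁, g₂), planeProj b u ∉ sh b s(a, c) := fun u hu =>
    hgv.not_mem_sh (eF hg) eac hu fun h' => by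
      rcases Sym2.mem_iff.1 h' with rfl | rfl
      · exact hag hu
      · exact hcg hu
  obtain ⟨σ, ⟨⟨⟨⟨⟨cor, far⟩, spA, spg⟩, outA, outg₁, outg₂⟩, ⟨newa, newc⟩, fr⟩, hσ⟩⟩ :=
    ((((((cor.and far).and ((sp A C hn.sp).and (sp g₁ g₂ hdisj))).and
      ((hout A (h.A_notMem_sh (Or.inl rfl) hn.notA)).and
        ((hout g₁ (hgout _ (by simp))).and (hout g₂ (hgout _ (by simp)))))).and
      (((hna.eventually tw).and (hnc.eventually tw)).and fr)).and self_mem_nhdsWithin)).exists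
  have hσ : 0 < σ := hσ
  set w := y + σ • z with hw
  have hoff : ∀ p q : Plane, tdet p q (planeProj b y) = 0 →
      tdet p q (planeProj b y + planeProj b z) ≠ 0 → tdet p q (planeProj b w) ≠ 0 := by
    intro p q h1 h2
    rw [hw, map_add, map_smul, tdet_add_smul, h1, mul_zero, zero_add]
    exact mul_ne_zero hσ.ne' h2
  have hwA := hoff _ _ t0 hx1
  have hwg := hoff _ _ tg hx2
  have hd := hoff _ _ tac hx3
  have hwA' : planeProj b w ∉ segment ℝ (planeProj b A) (planeProj b C) := fun h' =>
    hwA (tdet_eq_zero_of_mem_segment h')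
  have hwg' : planeProj b w ∉ sh b s(g₁, g₂) := fun h' => by
    rw [sh_mk] at h'; exact hwg (tdet_eq_zero_of_mem_segment h')
  have hcross : ∀ x ∈ segment ℝ (planeProj b g₁) (planeProj b g₂),
      x ∈ segment ℝ (planeProj b A) (planeProj b C) → x = planeProj b y := by
    intro x hx hx'
    by_contra hne
    have l1 := tdet_eq_zero_of_mem_segment hx
    have l2 := tdet_eq_zero_of_mem_segment hx'
    exact hncg (tdet_eq_zero_trans hne
      (tdet_eq_zero_trans hAC l2 t0 (tdet_self_left _ _))
      (tdet_eq_zero_trans hgnd l1 tg (tdet_self_left _ _))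
      (tdet_eq_zero_trans hgnd l1 tg (tdet_self_right _ _)))
  have hywa : ∀ {u u'}, y ∈ openSegment ℝ u u' →
      tdet (planeProj b u) (planeProj b u') (planeProj b w) ≠ 0 →
      planeProj b y ∉ segment ℝ (planeProj b u) (planeProj b w) := by
    intro u u' hyu hd h'
    have := tdet_eq_zero_of_mem_segment h'
    obtain ⟨α, β, h1, h2, h3, h4⟩ := proj_mem_openSegment (b := b) hyu
    rw [← h4, tdet_comb _ _ _ _ h3, tdet_self_left, mul_zero, zero_add, tdet_swap_right] at this
    exact mul_ne_zero h2.ne' (neg_ne_zero.2 hd) this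
  have hd' : tdet (planeProj b c) (planeProj b a) (planeProj b w) ≠ 0 := by
    rw [tdet_swap]; exact neg_ne_zero.2 hd
  have hLa : ∀ x ∈ segment ℝ (planeProj b g₁) (planeProj b g₂),
      x ∈ segment ℝ (planeProj b A) (planeProj b C) →
      x ∉ segment ℝ (planeProj b a) (planeProj b w) := fun x hx hx' =>
    hcross x hx hx' ▸ hywa hy hd
  have hLc : ∀ x ∈ segment ℝ (planeProj b g₁) (planeProj b g₂),
      x ∈ segment ℝ (planeProj b A) (planeProj b C) →
      x ∉ segment ℝ (planeProj b c) (planeProj b w) := fun x hx hx' =>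
    hcross x hx hx' ▸ hywa (openSegment_symm_mem hy) hd'
  have tC := tendsto_point C d {0}ᶜ
  have hXτ : ∀ u, (∀ x ∈ segment ℝ (planeProj b g₁) (planeProj b g₂),
      x ∈ segment ℝ (planeProj b A) (planeProj b C) →
      x ∉ segment ℝ (planeProj b u) (planeProj b w)) → ∀ᶠ τ : ℝ in 𝓝[≠] 0,
      ∀ x ∈ segment ℝ (planeProj b g₁) (planeProj b g₂),
      x ∈ segment ℝ (planeProj b A) (planeProj b (C + τ • d)) →
      x ∉ segment ℝ (planeProj b u) (planeProj b w) := by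
    intro u hu
    simp only [← triangle_degenerate (planeProj b u)] at hu ⊢
    exact eventually_segments_triangle tendsto_const_nhds tendsto_const_nhds tendsto_const_nhds
      tC.proj tendsto_const_nhds tendsto_const_nhds tendsto_const_nhds hu
  have hmeet : ∀ᶠ τ : ℝ in 𝓝[≠] 0, ∃ x ∈ sh b s(A, C + τ • d),
      x ∈ segment ℝ (planeProj b a) (planeProj b c) := by
    have s1 : tdet (planeProj b A) (planeProj b C) (planeProj b a) *
        tdet (planeProj b A) (planeProj b C) (planeProj b c) < 0 := by
      obtain ⟨α, β, h1, h2, h3, h4⟩ := hy'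
      refine mul_neg_of_comb h1 h2 ?_ haA
      rw [← tdet_comb _ _ _ _ h3, h4, t0]
    have s2 : tdet (planeProj b a) (planeProj b c) (planeProj b A) *
        tdet (planeProj b a) (planeProj b c) (planeProj b C) < 0 := by
      have hT : tdet (planeProj b a) (planeProj b c) (planeProj b A) ≠ 0 := by
        rw [tdet_rotate]; exact hn.nc
      obtain ⟨α, β, h1, h2, h3, h4⟩ := hyA
      rcases h1.eq_or_lt with rfl | h1
      · obtain rfl : β = 1 := by linarith
        rw [zero_smul, one_smul, zero_add] at h4
        exact absurd (right_mem_segment ℝ _ _) (Set.disjoint_left.1 hn.far (h4 ▸ hys'))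
      rcases h2.eq_or_lt with rfl | h2
      · obtain rfl : α = 1 := by linarith
        rw [zero_smul, one_smul, add_zero] at h4
        exact absurd (h4 ▸ tac) hT
      refine mul_neg_of_comb h1 h2 ?_ hT
      rw [← tdet_comb _ _ _ _ h3, h4, tac]
    filter_upwards [((tendsto_const_nhds.tdet tC.proj tendsto_const_nhds).mul
        (tendsto_const_nhds.tdet tC.proj tendsto_const_nhds)).eventually_lt_const s1,
      (tendsto_const_nhds.mul
        (tendsto_const_nhds.tdet tendsto_const_nhds tC.proj)).eventually_lt_const s2] with τ h1 h2
    rw [sh_mk]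
    exact segments_cross h1 h2
  have hmain : ∀ᶠ τ : ℝ in 𝓝[≠] 0, Reach b 1 (Corner A B (C + τ • d) (insert s(a, c) F))
      (Corner A B (C + τ • d) (Corner a c w F)) := by
    have farτ := eventually_segment_triangle (a := fun _ => planeProj b B) tendsto_const_nhds tC.proj
      (tendsto_const_nhds (x := planeProj b a)) (tendsto_const_nhds (x := planeProj b c))
      (tendsto_const_nhds (x := planeProj b w)) far
    have spτ := eventually_segment_triangle (a := fun _ => A) tendsto_const_nhds tC
      (tendsto_const_nhds (x := a)) (tendsto_const_nhds (x := c)) (tendsto_const_nhds (x := w)) spA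
    filter_upwards [h.good, h.fresh_near, farτ, spτ, hXτ a hLa, hXτ c hLc, hmeet,
      h.eventually_notMem_segment hwA' _] with τ g1 g2 g3 g4 g5 g6 g7 g8
    have hCw : C + τ • d ≠ w := by
      intro h'
      refine Set.disjoint_left.1 g3 (right_mem_segment ℝ _ _) ?_
      rw [h']; exact subset_convexHull ℝ _ (by simp)
    have n3 := newa.notA
    have n4 := newa.notB
    simp only [Sym2.mem_iff, not_or] at n3 n4
    have hfr := fresh_corner n3.2 n4.2 hCw fr
    rw [Corner.comm_insert] at g1 hfr ⊢
    rw [Corner.comm]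
    have hτac := g2 _ (Or.inl rfl)
    refine Reach.of_double g1 ?_ hfr hd (g := s(g₁, g₂)) (k := s(A, C + τ • d)) ?_
      (Or.inr (Or.inr hg)) (Or.inl rfl) ?_ ?_ ?_ ?_
    · rintro (h' | h' | h')
      · exact hτac (h' ▸ by simp)
      · exact hτac (h' ▸ by simp)
      · exact hk h'
    · rintro e (rfl | rfl | he) h1 h2 x hx hxT
      · exact absurd rfl h2
      · rw [sh_mk] at hx
        exact absurd hxT (Set.disjoint_left.1 g3 hx)
      · exact (cor e he h1 x hx hxT).imp And.left And.left
    · exact fun h' => g2 _ (Or.inr hg) (h' ▸ by simp)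
    · refine ⟨⟨fun u hu => ?_, hwg', by rwa [edgeSegment_mk]⟩, _, hyg, hys'⟩
      rcases Sym2.mem_iff.1 hu with rfl | rfl
      · exact outg₁
      · exact outg₂
    · refine ⟨⟨fun u hu => ?_, by rwa [sh_mk], by rwa [edgeSegment_mk]⟩, g7⟩
      rcases Sym2.mem_iff.1 hu with rfl | rfl
      · exact outA
      · exact Set.disjoint_left.1 g3 (right_mem_segment ℝ _ _)
    · intro x hx hx'
      rw [sh_mk] at hx hx'
      exact ⟨g5 x hx hx', g6 x hx hx'⟩
  refine (h.replace (fun e he => Or.inr he) newa newc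
    (hmain.mono fun τ hτ => hτ.right)).removable_of_reach ?_ hmain
  have hdeg : ∀ u ∈ s(a, c), ∀ f ∈ F, ∀ f' ∈ F, f ≠ f' → u ∈ f → u ∉ f' :=
    fun u hu f hf f' hf' hff h1 h2 =>
    hgv.not_three (eF hf) (eF hf') eac hff (fun h' => hk (h' ▸ hf)) (fun h' => hk (h' ▸ hf')) h1 h2 hu
  refine bad_replace (g := s(g₁, g₂)) (fun e he => Or.inr he) newa newc
    (hdeg a (by simp)) (hdeg c (by simp)) ?_ ?_ (fun _ => ⟨?_, ?_⟩) (fun _ => ⟨?_, ?_⟩)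
    (fun _ => hwg') (fun h' => haA (tdet_eq_zero_of_mem_segment h'))
    (fun h' => hcA (tdet_eq_zero_of_mem_segment h')) hwA' ?_ ?_ ?_
  · intro f hf hfg x hx hx'
    refine (cor f hf hfg x hx (segment_subset_triangle₁₃ hx')).resolve_right fun h' => ?_
    exact not_mem_segment_right hd (h'.1 ▸ hx')
  · intro f hf hfg x hx hx'
    refine (cor f hf hfg x hx (segment_subset_triangle₂₃ hx')).resolve_left fun h' => ?_
    exact not_mem_segment_left hd (h'.1 ▸ hx')
  · exact hgv.not_mem_sh eac (eF hg) (by simp) hag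
  · intro x hx hx' hx''
    rw [sh_mk] at hx
    exact hLa x hx hx'' hx'
  · exact hgv.not_mem_sh eac (eF hg) (by simp) hcg
  · intro x hx hx' hx''
    rw [sh_mk] at hx
    exact hLc x hx hx'' hx'
  · exact fun x => eq_apex_of_mem_segments hd
  · intro f hf hfg hyf
    exact hgv.tr _ eac _ (eF hg) _ (eF hf) hgne.symm (fun h' => hk (h' ▸ hf)) hfg.symm _ hys hyg hyf
  · exact Set.disjoint_left.1 hn.far hys'

end Loc

theorem Removable.swap {E : Set (Sym2 Space)} {A B C d : Space} {m : ℕ} {x : Plane}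
    (h : Removable b E A B C d m x) : Removable b E B A C d m x := by
  obtain ⟨E', h1, h2, h3⟩ := h
  refine ⟨E', h1.symm, ?_, ?_⟩
  · rwa [Corner.swap B, Corner.swap B]
  · simpa only [Corner.swap B A] using h3

theorem Removable.of_subdivide {E E₁ : Set (Sym2 Space)} {A B C d : Space} {m : ℕ} {x : Plane}
    (hb : bad b (Corner A B C E₁) ⊆ bad b (Corner A B C E))
    (hr : ∀ᶠ τ : ℝ in 𝓝[≠] 0, Reach b 0 (Corner A B (C + τ • d) E) (Corner A B (C + τ • d) E₁))
    (h : Removable b E₁ A B C d m x) : Removable b E A B C d m x := by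
  obtain ⟨E', h1, h2, h3⟩ := h
  refine ⟨E', h1, fun y hy => ⟨hb (h2 hy).1, (h2 hy).2⟩, ?_⟩
  filter_upwards [h3, tendsto_neg_punctured.eventually hr, punctured_of_pos hr] with τ h3 h4 h5
  obtain ⟨m₁, m₂, hm, r1, r2⟩ := h3
  exact ⟨m₁, m₂, hm, by simpa using h4.trans r1, by simpa using r2.trans h5.symm⟩

theorem mem_openSegment_shrink {V : Type*} [AddCommGroup V] [Module ℝ V] {p q y : V}
    (h : y ∈ openSegment ℝ p q) {σ ρ : ℝ} (hσ : 0 < σ) (hρ : 0 < ρ) :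
    y ∈ openSegment ℝ (y + σ • (p - y)) (y + ρ • (q - y)) := by
  obtain ⟨α, β, h1, h2, h3, rfl⟩ := h
  have hpos : 0 < σ * β + ρ * α := by positivity
  refine ⟨ρ * α / (σ * β + ρ * α), σ * β / (σ * β + ρ * α), by positivity, by positivity,
    by field_simp; ring, ?_⟩
  have e1 : p - (α • p + β • q) = β • (p - q) := by
    obtain rfl : α = 1 - β := by linarith
    module
  have e2 : q - (α • p + β • q) = -(α • (p - q)) := by
    obtain rfl : β = 1 - α := by linarith
    module
  rw [e1, e2]
  have e3 : ρ * α / (σ * β + ρ * α) + σ * β / (σ * β + ρ * α) = 1 := by field_simp; ring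
  have e4 : ρ * α / (σ * β + ρ * α) * (σ * β) = σ * β / (σ * β + ρ * α) * (ρ * α) := by
    field_simp
  generalize ρ * α / (σ * β + ρ * α) = s at *
  generalize σ * β / (σ * β + ρ * α) = t at *
  obtain rfl : t = 1 - s := by linarith
  have : s • (α • p + β • q + σ • β • (p - q)) + (1 - s) • (α • p + β • q + ρ • -(α • (p - q))) =
      α • p + β • q + (s * (σ * β) - (1 - s) * (ρ * α)) • (p - q) := by module
  rw [this, e4, sub_self, zero_smul, add_zero]

namespace Loc

variable {E F : Set (Sym2 Space)} {A B C d a c v : Space}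

theorem eventually_near (F : Set (Sym2 Space)) (hF : F.Finite) {y : Space} {p : ℝ → Space}
    (hp : Tendsto p (𝓝[>] 0) (𝓝 y)) (hy : ∀ f ∈ F, planeProj b y ∉ sh b f) :
    ∀ᶠ σ : ℝ in 𝓝[>] 0, ∀ f ∈ F,
      Disjoint (sh b f) (segment ℝ (planeProj b (p σ)) (planeProj b y)) := by
  rw [eventually_all_finite hF]
  intro f hf
  obtain ⟨u, w, rfl⟩ := edgeSegment_eq_of_sym2 f
  have := hy _ hf
  rw [sh_mk] at this ⊢
  refine eventually_segments tendsto_const_nhds tendsto_const_nhds hp.proj tendsto_const_nhds ?_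
  rw [segment_same]
  exact Set.disjoint_singleton_right.2 this

theorem newEdge_of_mem (h : Loc b E A B C d) {u w : Space} (he : s(u, w) ∈ E) (hA : A ∉ s(u, w))
    (hx : ∃ x ∈ sh b s(u, w), x ∈ segment ℝ (planeProj b A) (planeProj b C))
    (hfar : Disjoint (segment ℝ (planeProj b u) (planeProj b w))
      (segment ℝ (planeProj b B) (planeProj b C))) : NewEdge b A B C u w where
  sp := by rw [← edgeSegment_mk u]; exact (h.okA _ he).sp hA
  nc := (h.okA _ he).nc u w rfl hA hx
  far := hfar

theorem insert_diff {e : Sym2 Space} (he : e ∈ E) : insert e (E \ {e}) = E := by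
  simp [Set.insert_eq_of_mem he]

theorem removable_vertex (h : Loc b (insert s(a, v) (insert s(c, v) F)) A B C d)
    (hv : ∀ f ∈ F, v ∉ f) (haF : s(a, v) ∉ insert s(c, v) F)
    (hAa : A ∉ s(a, v)) (hAc : A ∉ s(c, v))
    (hvA : planeProj b v ∈ segment ℝ (planeProj b A) (planeProj b C))
    (hvC : planeProj b v ≠ planeProj b C) :
    Removable b (insert s(a, v) (insert s(c, v) F)) A B C d 2 (planeProj b v) := by
  obtain ⟨v₁, hgv, hv₁⟩ := h.exists_env
  have hF : F.Finite := h.fin.subset fun e he => Or.inr (Or.inr he)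
  have eE : ∀ {e}, e ∈ insert s(a, v) (insert s(c, v) F) →
      e ∈ Corner A B v₁ (insert s(a, v) (insert s(c, v) F)) := fun he => Or.inr (Or.inr he)
  have ea : s(a, v) ∈ insert s(a, v) (insert s(c, v) F) := Or.inl rfl
  have ec : s(c, v) ∈ insert s(a, v) (insert s(c, v) F) := Or.inr (Or.inl rfl)
  have hav := hgv.ne (eE ea)
  have hcv := hgv.ne (eE ec)
  have pav := hgv.proj_ne (eE ea)
  have pcv := hgv.proj_ne (eE ec)
  have hvs : ∀ f ∈ F, planeProj b v ∉ sh b f := fun f hf =>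
    hgv.not_mem_sh (eE ea) (eE (Or.inr (Or.inr hf))) (by simp) (hv f hf)
  have hvB : planeProj b v ∉ segment ℝ (planeProj b B) (planeProj b C) := fun hB =>
    hvC (h.inter hvA hB)
  have hadj : ∀ x ∈ sh b s(a, v), x ∈ sh b s(c, v) → x = planeProj b v := fun x hx hx' =>
    hgv.adj (eE ea) (eE ec) (fun h' => haF (Or.inl h')) (by simp) (by simp) hx hx'
  have hfar : ∀ {p : ℝ → Space}, Tendsto p (𝓝[>] 0) (𝓝 v) → ∀ᶠ σ : ℝ in 𝓝[>] 0,
      Disjoint (segment ℝ (planeProj b (p σ)) (planeProj b v))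
        (segment ℝ (planeProj b B) (planeProj b C)) := fun hp =>
    eventually_segments hp.proj tendsto_const_nhds tendsto_const_nhds tendsto_const_nhds
      (by rw [segment_same]; exact Set.disjoint_singleton_left.2 hvB)
  obtain ⟨σ, ⟨⟨m1, m2, m3, m4⟩, n1⟩, n2⟩ := ((h.eventually_subdivide haF
    (right_mem_segment ℝ a v) hav.symm hAa hvA hvC).and
    (eventually_near F hF (tendsto_point v (a - v) _) hvs)).and
    (hfar (tendsto_point v (a - v) _)) |>.exists
  set a' := v + σ • (a - v)
  obtain ⟨h1, hb1, hr1⟩ := h.subdivide haF m1 m2 m3 m4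
  have hset : Corner a v a' (insert s(c, v) F) = insert s(c, v) (Corner a v a' F) :=
    Corner.comm_insert _ _ _ _ _
  rw [hset] at h1 hb1 hr1
  have ha'c : planeProj b a' ∉ sh b s(c, v) := m2 _ (Or.inl rfl)
  have ha'v : a' ≠ v := by
    intro h'; rw [h'] at ha'c; exact ha'c (vertex_mem_sh (by simp))
  have hcF : s(c, v) ∉ Corner a v a' F := by
    rintro (h' | h' | h')
    · refine hav (((Sym2.mem_iff).1 (h' ▸ (by simp : v ∈ s(c, v)))).resolve_right ?_).symm
      exact fun h' => ha'v h'.symm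
    · exact ha'c (vertex_mem_sh (h' ▸ by simp))
    · exact hv _ h' (by simp)
  obtain ⟨ρ, ⟨⟨k1, k2, k3, k4⟩, l1⟩, l2⟩ := ((h1.eventually_subdivide hcF
    (right_mem_segment ℝ c v) hcv.symm hAc hvA hvC).and
    (eventually_near F hF (tendsto_point v (c - v) _) hvs)).and
    (hfar (tendsto_point v (c - v) _)) |>.exists
  set c' := v + ρ • (c - v)
  obtain ⟨h2, hb2, hr2⟩ := h1.subdivide hcF k1 k2 k3 k4
  refine Removable.of_subdivide hb1 hr1 (Removable.of_subdivide hb2 hr2 ?_)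
  have hset2 : Corner c v c' (Corner a v a' F) =
      Corner a' c' v (insert s(a, a') (insert s(c, c') F)) := by
    ext e
    simp only [Set.mem_insert_iff, Sym2.eq_swap (a := v)]
    tauto
  rw [hset2] at h2 ⊢
  have hc'a : planeProj b c' ∉ sh b s(a, a') := k2 _ (Or.inl rfl)
  have hc'v : planeProj b c' ∉ sh b s(v, a') := k2 _ (Or.inr (Or.inl rfl))
  have hc'v' : c' ≠ v := by
    intro h'; rw [h'] at hc'v; exact hc'v (vertex_mem_sh (by simp))
  have A1 : ∀ u, planeProj b u ∉ segment ℝ (planeProj b A) (planeProj b C) → A ≠ u := by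
    rintro u hu rfl; exact hu (left_mem_segment ℝ _ _)
  simp only [Sym2.mem_iff, not_or] at hAa hAc
  have hvmem : ∀ u, ∃ x ∈ sh b s(u, v), x ∈ segment ℝ (planeProj b A) (planeProj b C) :=
    fun u => ⟨_, vertex_mem_sh (by simp), hvA⟩
  have pm1 := proj_mem_openSegment (b := b) m1
  have pk1 := proj_mem_openSegment (b := b) k1
  refine h2.shift_vertex ?_ ?_ ?_ ?_ ?_ ?_ hvA
  · intro h'
    exact hc'a (vertex_mem_sh (by simp [h']))
  · rintro f (rfl | rfl | hf)
    · simp [hav.symm, ha'v.symm]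
    · simp [hcv.symm, hc'v'.symm]
    · exact hv f hf
  · exact h2.newEdge_of_mem (Or.inl rfl) (by simp [A1 a' m3, hAa.2]) (hvmem _) n2
  · exact h2.newEdge_of_mem (Or.inr (Or.inl rfl)) (by simp [A1 c' k3, hAc.2]) (hvmem _) l2
  · rintro f (rfl | rfl | hf) x hx hx'
    · rw [sh_mk] at hx
      rw [segment_symm] at hx'
      exact ⟨openSegment_inter pav pm1 hx hx', by simp⟩
    · have hxa : x ∈ sh b s(a, v) := by
        rw [sh_mk, segment_symm]
        rw [segment_symm] at hx'
        exact segment_subset_of_openSegment (openSegment_symm_mem pm1) hx'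
      rw [hadj x hxa (sh_subset_of_openSegment k1 hx), sh_mk] at hx
      exact absurd hx (openSegment_not_mem pcv pk1)
    · exact absurd hx' (Set.disjoint_left.1 (n1 f hf) hx)
  · rintro f (rfl | rfl | hf) x hx hx'
    · have hxa : x ∈ sh b s(c, v) := by
        rw [sh_mk, segment_symm]
        rw [segment_symm] at hx'
        exact segment_subset_of_openSegment (openSegment_symm_mem pk1) hx'
      rw [hadj x (sh_subset_of_openSegment m1 hx) hxa, sh_mk] at hx
      exact absurd hx (openSegment_not_mem pav pm1)
    · rw [sh_mk] at hx
      rw [segment_symm] at hx'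
      exact ⟨openSegment_inter pcv pk1 hx hx', by simp⟩
    · exact absurd hx' (Set.disjoint_left.1 (l1 f hf) hx)

theorem removable_crossing {p q : Space} {g : Sym2 Space} (h : Loc b (insert s(p, q) F) A B C d)
    (hpq : s(p, q) ∉ F) (hg : g ∈ F) (hv : ∀ u ∈ g, u ∉ s(p, q)) {x : Plane}
    (hxg : x ∈ sh b g) (hxe : x ∈ sh b s(p, q))
    (hxA : x ∈ segment ℝ (planeProj b A) (planeProj b C)) (hxC : x ≠ planeProj b C) :
    Removable b (insert s(p, q) F) A B C d 2 x := by
  obtain ⟨v₁, hgv, hv₁⟩ := h.exists_env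
  have hF : F.Finite := h.fin.subset fun e he => Or.inr he
  have eE : ∀ {e}, e ∈ insert s(p, q) F → e ∈ Corner A B v₁ (insert s(p, q) F) :=
    fun he => Or.inr (Or.inr he)
  have ee : s(p, q) ∈ insert s(p, q) F := Or.inl rfl
  have hgne : g ≠ s(p, q) := fun h' => hpq (h' ▸ hg)
  have hA : A ∉ s(p, q) := h.A_notMem ee (Or.inr hg) hgne.symm hxe hxg hxA
  obtain ⟨y, hy, rfl⟩ := mem_sh_iff.1 hxe
  rw [edgeSegment_mk] at hy
  have hout : ∀ u ∈ s(p, q), planeProj b u ∉ sh b g := fun u hu =>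
    hgv.not_mem_sh (eE ee) (eE (Or.inr hg)) hu fun h' => hv u h' hu
  have hyp : y ≠ p := by rintro rfl; exact hout y (by simp) hxg
  have hyq : y ≠ q := by rintro rfl; exact hout y (by simp) hxg
  have hyo : y ∈ openSegment ℝ p q := mem_openSegment_of_ne_left_right hyp.symm hyq.symm hy
  have hxB : planeProj b y ∉ segment ℝ (planeProj b B) (planeProj b C) := fun hB =>
    hxC (h.inter hxA hB)
  have hys : ∀ f ∈ F \ {g}, planeProj b y ∉ sh b f := fun f hf hyf =>
    hgv.tr _ (eE ee) _ (eE (Or.inr hg)) _ (eE (Or.inr hf.1)) hgne.symm (fun h' => hpq (h' ▸ hf.1))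
      (Ne.symm hf.2) _ hxe hxg hyf
  have hfar : ∀ {u : ℝ → Space}, Tendsto u (𝓝[>] 0) (𝓝 y) → ∀ᶠ σ : ℝ in 𝓝[>] 0,
      Disjoint (segment ℝ (planeProj b (u σ)) (planeProj b y))
        (segment ℝ (planeProj b B) (planeProj b C)) := fun hp =>
    eventually_segments hp.proj tendsto_const_nhds tendsto_const_nhds tendsto_const_nhds
      (by rw [segment_same]; exact Set.disjoint_singleton_left.2 hxB)
  obtain ⟨σ, ⟨⟨⟨m1, m2, m3, m4⟩, n1⟩, n2⟩, hσ⟩ := (((h.eventually_subdivide hpq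
    hy hyp hA hxA hxC).and
    (eventually_near (F \ {g}) (hF.subset Set.sdiff_subset) (tendsto_point y (p - y) _) hys)).and
    (hfar (tendsto_point y (p - y) _))).and self_mem_nhdsWithin |>.exists
  have hσ : 0 < σ := hσ
  have hyo1 : y ∈ openSegment ℝ (y + σ • (p - y)) q := by
    simpa using mem_openSegment_shrink hyo hσ zero_lt_one
  set p' := y + σ • (p - y) with hp'
  obtain ⟨h1, hb1, hr1⟩ := h.subdivide hpq m1 m2 m3 m4
  have A1 : ∀ u, planeProj b u ∉ segment ℝ (planeProj b A) (planeProj b C) → A ≠ u := by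
    rintro u hu rfl; exact hu (left_mem_segment ℝ _ _)
  have hset : Corner p q p' F = insert s(q, p') (insert s(p, p') F) := Set.insert_comm _ _ _
  rw [hset] at h1 hb1 hr1
  have ppq := hgv.proj_ne (eE ee)
  have pqp' := h1.env_proj_ne (Or.inl rfl)
  have hk1 : s(q, p') ∉ insert s(p, p') F := by
    rintro (h' | h')
    · exact ppq (by rw [Sym2.congr_left.1 h'])
    · exact m2 _ h' (vertex_mem_sh (by simp))
  have hA1 : A ∉ s(q, p') := by
    simp only [Sym2.mem_iff, not_or] at hA ⊢
    exact ⟨hA.2, A1 _ m3⟩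
  obtain ⟨ρ, ⟨⟨⟨k1, k2, k3, k4⟩, l1⟩, l2⟩, hρ⟩ := (((h1.eventually_subdivide hk1
    (openSegment_subset_segment ℝ _ _ (openSegment_symm_mem hyo1)) hyq hA1 hxA hxC).and
    (eventually_near (F \ {g}) (hF.subset Set.sdiff_subset) (tendsto_point y (q - y) _) hys)).and
    (hfar (tendsto_point y (q - y) _))).and self_mem_nhdsWithin |>.exists
  have hρ : 0 < ρ := hρ
  have hyo2 : y ∈ openSegment ℝ p' (y + ρ • (q - y)) := mem_openSegment_shrink hyo hσ hρ
  set q' := y + ρ • (q - y) with hq'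
  obtain ⟨h2, hb2, hr2⟩ := h1.subdivide hk1 k1 k2 k3 k4
  refine Removable.of_subdivide hb1 hr1 (Removable.of_subdivide hb2 hr2 ?_)
  have hset2 : Corner q p' q' (insert s(p, p') F) =
      insert s(p', q') (insert s(q, q') (insert s(p, p') F)) := Set.insert_comm _ _ _
  rw [hset2] at h2 ⊢
  have pm1 := proj_mem_openSegment (b := b) m1
  have pk1 := proj_mem_openSegment (b := b) k1
  have pyo2 := proj_mem_openSegment (b := b) hyo2
  refine h2.shift_edge ?_ (Or.inr (Or.inr hg)) hyo2 hxg hxA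
    (h2.newEdge_of_mem (Or.inl rfl) ?_ ⟨_, ?_, hxA⟩ ?_) ?_ ?_ ?_
  · rintro (h' | h' | h')
    · exact pqp' (by rw [Sym2.congr_left.1 h'])
    · exact k2 _ (Or.inl rfl) (vertex_mem_sh (h' ▸ by simp))
    · exact k2 _ (Or.inr h') (vertex_mem_sh (by simp))
  · simp [A1 _ m3, A1 _ k3]
  · rw [sh_mk]; exact openSegment_subset_segment ℝ _ _ pyo2
  · refine Set.disjoint_left.2 fun x hx hx' => ?_
    rcases openSegment_cases pyo2 hx with h' | h'
    · exact Set.disjoint_left.1 n2 h' hx'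
    · exact Set.disjoint_left.1 l2 h' hx'
  · rintro f (rfl | rfl | hf) hfg x hx hx'
    · rw [sh_mk] at hx
      exact Or.inr ⟨openSegment_inter pqp' pk1 hx hx', by simp⟩
    · rw [sh_mk] at hx
      refine Or.inl ⟨openSegment_inter ppq pm1 hx ?_, by simp⟩
      rw [segment_symm]
      exact segment_subset_of_openSegment (openSegment_symm_mem pk1) hx'
    · rcases openSegment_cases pyo2 hx' with h' | h'
      · exact absurd h' (Set.disjoint_left.1 (n1 f ⟨hf, hfg⟩) hx)
      · exact absurd h' (Set.disjoint_left.1 (l1 f ⟨hf, hfg⟩) hx)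
  · exact fun h' => m2 g hg (vertex_mem_sh h')
  · exact fun h' => k2 g (Or.inr hg) (vertex_mem_sh h')

theorem removable_A (h : Loc b E A B C d) {e f : Sym2 Space} (he : e ∈ E) (hf : f ∈ E)
    (hef : e ≠ f) {x : Plane} (hxe : x ∈ sh b e) (hxf : x ∈ sh b f)
    (hxA : x ∈ segment ℝ (planeProj b A) (planeProj b C)) (hxC : x ≠ planeProj b C) :
    Removable b E A B C d 2 x := by
  obtain ⟨v₁, hgv, hv₁⟩ := h.exists_env
  have eE : ∀ {e}, e ∈ E → e ∈ Corner A B v₁ E := fun he => Or.inr (Or.inr he)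
  have hAe := h.A_notMem he hf hef hxe hxf hxA
  have hAf := h.A_notMem hf he hef.symm hxf hxe hxA
  by_cases hv : ∃ v ∈ e, v ∈ f
  · obtain ⟨v, hve, hvf⟩ := hv
    obtain rfl := hgv.adj (eE he) (eE hf) hef hve hvf hxe hxf
    obtain ⟨a, rfl⟩ := exists_eq_mk_of_mem hve
    obtain ⟨c, rfl⟩ := exists_eq_mk_of_mem hvf
    rw [Sym2.eq_swap] at he hef hAe
    rw [Sym2.eq_swap (a := v)] at hf hef hAf
    obtain ⟨F, rfl, hF1, hF2⟩ : ∃ F, E = insert s(a, v) (insert s(c, v) F) ∧ s(a, v) ∉ F ∧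
        s(c, v) ∉ F := by
      refine ⟨E \ {s(a, v), s(c, v)}, ?_, by simp, by simp⟩
      ext e
      simp only [Set.mem_insert_iff, Set.mem_sdiff, Set.mem_singleton_iff, not_or]
      constructor
      · intro h'; tauto
      · rintro (rfl | rfl | h')
        exacts [he, hf, h'.1]
    refine h.removable_vertex ?_ ?_ hAe hAf hxA hxC
    · intro f' hf' hvf'
      refine hgv.not_three (eE he) (eE hf) (eE (Or.inr (Or.inr hf'))) hef ?_ ?_
        (Sym2.mem_mk_right a v) (Sym2.mem_mk_right c v) hvf'
      · rintro rfl; exact hF1 hf'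
      · rintro rfl; exact hF2 hf'
    · rintro (h' | h')
      · exact hef h'
      · exact hF1 h'
  · push Not at hv
    obtain ⟨p, q, rfl⟩ := edgeSegment_eq_of_sym2 f
    have hE := insert_diff hf
    rw [← hE] at h ⊢
    exact h.removable_crossing (by simp) (g := e) ⟨he, by simpa using hef⟩ hv hxe hxf hxA hxC

theorem removable (h : Loc b E A B C d) {x : Plane} (hx : x ∈ bad b (Corner A B C E))
    (hxC : x ≠ planeProj b C) : Removable b E A B C d 2 x := by
  rcases h.bad_cases hx with ⟨e, he, f, hf, hef, hxe, hxf, h' | h'⟩ | ⟨h', -⟩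
  · exact h.removable_A he hf hef hxe hxf h' hxC
  · exact (h.symm.removable_A he hf hef hxe hxf h' hxC).swap
  · exact absurd h' hxC

end Loc

/-! ### Passing a critical time -/

namespace Loc

variable {E F : Set (Sym2 Space)} {A B C d a : Space}

theorem reach_insert (hF : F.Finite) (ha : a ∈ openSegment ℝ A C)
    (hAC : planeProj b A ≠ planeProj b C) (hBC : planeProj b B ≠ planeProj b C)
    (hspeed : tdet (planeProj b A) (planeProj b A + planeProj b d) (planeProj b a) ≠ 0)
    (hB : ∀ x ∈ segment ℝ (planeProj b A) (planeProj b C),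
      x ∈ segment ℝ (planeProj b B) (planeProj b C) → x = planeProj b C)
    (hg : ∀ᶠ τ : ℝ in 𝓝[≠] 0, Good b (Corner A B (C + τ • d) F))
    (hfresh : ∀ᶠ τ : ℝ in 𝓝[≠] 0, ∀ e ∈ F, C + τ • d ∉ e)
    (hadj : ∀ f ∈ F, A ∈ f → ∀ x ∈ sh b f, x ∈ segment ℝ (planeProj b A) (planeProj b C) →
      x = planeProj b A)
    (hsp : ∀ f ∈ F, A ∉ f → Disjoint (segment ℝ A C) (edgeSegment f))
    (hends : ∀ f ∈ F, A ∉ f → ∀ u ∈ f, planeProj b u ∉ segment ℝ (planeProj b A) (planeProj b C))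
    (hside : ∀ f ∈ F, A ∉ f → Disjoint (sh b f) (segment ℝ (planeProj b A) (planeProj b a)) ∨
      Disjoint (sh b f) (segment ℝ (planeProj b a) (planeProj b C)))
    (hpair : ∀ f ∈ F, ∀ k ∈ F, f ≠ k → ∀ x ∈ sh b f, x ∈ sh b k →
      x ∉ segment ℝ (planeProj b A) (planeProj b C)) :
    ∀ᶠ τ : ℝ in 𝓝[≠] 0, Reach b 0 (Corner A B (C + τ • d) F)
      (Corner a B (C + τ • d) (insert s(A, a) F)) := by
  obtain ⟨τ₀, hg₀, hfr₀⟩ := (hg.and hfresh).exists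
  have eF : ∀ {f}, f ∈ F → f ∈ Corner A B (C + τ₀ • d) F := fun hf => Or.inr (Or.inr hf)
  have pa := proj_mem_openSegment (b := b) ha
  have pas : planeProj b a ∈ segment ℝ (planeProj b A) (planeProj b C) :=
    openSegment_subset_segment ℝ _ _ pa
  have aseg : a ∈ segment ℝ A C := openSegment_subset_segment ℝ _ _ ha
  have hAa : planeProj b A ≠ planeProj b a := fun h' =>
    openSegment_not_mem hAC.symm (openSegment_symm_mem pa) (h' ▸ right_mem_segment ℝ _ _)
  have hCa : planeProj b C ∉ segment ℝ (planeProj b A) (planeProj b a) := openSegment_not_mem hAC pa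
  have hCne : planeProj b C ≠ planeProj b a := fun h' => hCa (h' ▸ right_mem_segment ℝ _ _)
  have hAB : A ≠ B := by
    rintro rfl
    exact hAC (hB _ (left_mem_segment ℝ _ _) (left_mem_segment ℝ _ _))
  have hBa : planeProj b B ≠ planeProj b a := fun h' =>
    hBC (hB _ (h' ▸ pas) (left_mem_segment ℝ _ _))
  have hafr : ∀ f ∈ F, a ∉ f := by
    intro f hf haf
    by_cases hAf : A ∈ f
    · exact hAa (hadj f hf hAf _ (vertex_mem_sh haf) pas).symm
    · exact hends f hf hAf a haf pas
  have tC := tendsto_point C d {0}ᶜ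
  have cst : ∀ x : Space, Tendsto (fun _ : ℝ => x) (𝓝[≠] 0) (𝓝 x) := fun x => tendsto_const_nhds
  have hBcone : ∀ᶠ τ : ℝ in 𝓝[≠] 0, ∀ x ∈ segment ℝ (planeProj b (C + τ • d)) (planeProj b B),
      x ∈ convexHull ℝ {planeProj b (C + τ • d), planeProj b A, planeProj b a} →
      x = planeProj b (C + τ • d) := by
    refine eventually_cone tC.proj (cst B).proj (cst A).proj (cst a).proj hBC hCa ?_
    intro x hx hx'
    rw [triangle_swap, triangle_of_mem pas] at hx'
    rw [segment_symm] at hx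
    exact hB x hx' hx
  have hall : ∀ᶠ τ : ℝ in 𝓝[≠] 0, ∀ f ∈ F,
      Avoids b A (C + τ • d) a f ∨ Thin b A (C + τ • d) a f := by
    rw [eventually_all_finite hF]
    intro f hf
    by_cases hAf : A ∈ f
    · have := hadj f hf hAf
      obtain ⟨u, rfl⟩ := exists_eq_mk_of_mem hAf
      simp only [sh_mk] at this
      filter_upwards [eventually_cone (cst A).proj (cst u).proj tC.proj (cst a).proj
        (hg₀.proj_ne (eF hf)).symm
        (fun h' => openSegment_not_mem hAC.symm (openSegment_symm_mem pa) h')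
        (fun x hx hx' => this x hx (by rwa [triangle_of_mem pas] at hx'))] with τ h1
      refine Or.inl fun x hx hx' => Or.inl (h1 x ?_ hx')
      rwa [sh_mk] at hx
    · have h1 := hsp f hf hAf
      have h2 := hends f hf hAf
      have h3 := hside f hf hAf
      obtain ⟨u, w, rfl⟩ := edgeSegment_eq_of_sym2 f
      have hend : ∀ u' ∈ s(u, w), ∀ᶠ τ : ℝ in 𝓝[≠] 0, planeProj b u' ∉
          convexHull ℝ {planeProj b A, planeProj b (C + τ • d), planeProj b a} := by
        intro u' hu'
        refine eventually_point_triangle tendsto_const_nhds tendsto_const_nhds tC.proj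
          tendsto_const_nhds ?_
        rw [triangle_of_mem pas]
        exact h2 u' hu'
      have hs : ∀ᶠ τ : ℝ in 𝓝[≠] 0, Disjoint (sh b s(u, w))
          (segment ℝ (planeProj b A) (planeProj b a)) ∨ Disjoint (sh b s(u, w))
          (segment ℝ (planeProj b (C + τ • d)) (planeProj b a)) := by
        rcases h3 with h3 | h3
        · exact Eventually.of_forall fun τ => Or.inl h3
        · rw [sh_mk] at h3 ⊢
          rw [segment_symm ℝ (planeProj b a)] at h3
          exact (eventually_segments tendsto_const_nhds tendsto_const_nhds tC.proj
            tendsto_const_nhds h3).mono fun τ => Or.inr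
      filter_upwards [hend u (by simp), hend w (by simp), hs,
        eventually_segment_triangle (cst u) (cst w) (cst A) tC (cst a)
          (by rw [triangle_of_mem aseg, ← edgeSegment_mk u]; exact h1.symm)] with τ k1 k2 k3 k4
      refine Or.inr ⟨fun u' hu' => ?_, k3, by rwa [edgeSegment_mk]⟩
      rcases Sym2.mem_iff.1 hu' with rfl | rfl <;> assumption
  have hprs : ∀ᶠ τ : ℝ in 𝓝[≠] 0, ∀ f ∈ F, ∀ k ∈ F, f ≠ k → ∀ x ∈ sh b f, x ∈ sh b k →
      x ∉ convexHull ℝ {planeProj b A, planeProj b (C + τ • d), planeProj b a} := by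
    rw [eventually_all_finite hF]
    intro f hf
    rw [eventually_all_finite hF]
    intro k hk
    rw [eventually_imp_distrib_left]
    intro hfk
    have := hpair f hf k hk hfk
    obtain ⟨u, w, rfl⟩ := edgeSegment_eq_of_sym2 f
    obtain ⟨u', w', rfl⟩ := edgeSegment_eq_of_sym2 k
    simp only [sh_mk] at this ⊢
    refine eventually_segments_triangle tendsto_const_nhds tendsto_const_nhds tendsto_const_nhds
      tendsto_const_nhds tendsto_const_nhds tC.proj tendsto_const_nhds ?_
    rwa [triangle_of_mem pas]
  filter_upwards [hg, hfresh, hBcone, hall, hprs, self_mem_nhdsWithin,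
    tC.proj.eventually_ne hCne] with τ g1 g2 g3 g4 g5 hτ g6
  have hτ : τ ≠ 0 := hτ
  have hset : Corner a B (C + τ • d) (insert s(A, a) F) =
      insert s(A, a) (insert s(C + τ • d, a) (insert s(B, C + τ • d) F)) := by
    ext e
    simp only [Set.mem_insert_iff, Sym2.eq_swap (a := a)]
    tauto
  rw [hset]
  have hd : tdet (planeProj b A) (planeProj b (C + τ • d)) (planeProj b a) ≠ 0 := by
    rw [tdet_moving, tdet_eq_zero_of_mem_segment pas, zero_add]
    exact mul_ne_zero hτ hspeed
  have hBP : ¬ Passes b A (C + τ • d) a s(B, C + τ • d) := fun hp =>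
    hp.ends (C + τ • d) (by simp) (subset_convexHull ℝ _ (by simp))
  refine Reach.of_crosses g1 ?_ ?_ hd ?_ ?_
  · rintro (h' | h')
    · exact hAB (Sym2.congr_left.1 h')
    · exact g2 _ h' (by simp)
  · have h1 : a ≠ A := fun h' => hAa (by rw [h'])
    have h2 : a ≠ B := fun h' => hBa (by rw [h'])
    have h3 : a ≠ C + τ • d := fun h' => g6 (by rw [← h'])
    rintro e (rfl | rfl | he)
    · simp [h1, h3]
    · simp [h2, h3]
    · exact hafr e he
  · rintro e (rfl | he)
    · refine Or.inl fun x hx hx' => Or.inr ?_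
      rw [sh_mk, segment_symm] at hx
      rw [triangle_swap] at hx'
      exact g3 x hx hx'
    · exact (g4 e he).elim Or.inl fun ht => ht.avoids_or_crosses hd
  · rintro e (rfl | he) f (rfl | hf) hef h1 h2
    · exact absurd rfl hef
    · exact absurd h1 hBP
    · exact absurd h2 hBP
    · exact g5 e he f hf hef

/-- If only `C` is critical, no end point of an edge lies over `AC`. -/
theorem ends_of_bad (h : Loc b E A B C d) (hb : bad b (Corner A B C E) ⊆ {planeProj b C})
    {f : Sym2 Space} (hf : f ∈ E) (hA : A ∉ f) {u : Space} (hu : u ∈ f) :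
    planeProj b u ∉ segment ℝ (planeProj b A) (planeProj b C) := by
  intro hx
  obtain ⟨v, hgv, hv⟩ := h.exists_env
  have hfA : ∀ {f P}, f ∈ E → f ≠ s(P, C) := fun hf h' => h.fresh _ hf (h' ▸ by simp)
  obtain ⟨k, hk, huk, hkf⟩ := hgv.other (Or.inr (Or.inr hf)) hu
  have hkE : k ∈ E := by
    rcases hk with rfl | rfl | hk
    · rcases Sym2.mem_iff.1 huk with rfl | rfl
      · exact absurd hu hA
      · exact absurd hu (hv f hf)
    · rcases Sym2.mem_iff.1 huk with rfl | rfl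
      · exact absurd hx h.B_notMem
      · exact absurd hu (hv f hf)
    · exact hk
  have : planeProj b u ∈ bad b (Corner A B C E) := ⟨f, Or.inr (Or.inr hf), k, Or.inr (Or.inr hkE),
    s(A, C), Or.inl rfl, hkf.symm, hfA hf, hfA hkE, vertex_mem_sh hu, vertex_mem_sh huk, by
      rwa [sh_mk]⟩
  have hC : planeProj b u = planeProj b C := hb this
  exact h.dbl f hf k hkE hkf.symm (hC ▸ vertex_mem_sh hu) (hC ▸ vertex_mem_sh huk)

theorem pair_of_bad (h : Loc b E A B C d) (hb : bad b (Corner A B C E) ⊆ {planeProj b C})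
    {f k : Sym2 Space} (hf : f ∈ E) (hk : k ∈ E) (hfk : f ≠ k) {x : Plane} (hxf : x ∈ sh b f)
    (hxk : x ∈ sh b k) : x ∉ segment ℝ (planeProj b A) (planeProj b C) := by
  intro hx
  have hfA : ∀ {f P}, f ∈ E → f ≠ s(P, C) := fun hf h' => h.fresh _ hf (h' ▸ by simp)
  have : x ∈ bad b (Corner A B C E) := ⟨f, Or.inr (Or.inr hf), k, Or.inr (Or.inr hk),
    s(A, C), Or.inl rfl, hfk, hfA hf, hfA hk, hxf, hxk, by rwa [sh_mk]⟩
  obtain rfl : x = planeProj b C := hb this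
  exact h.dbl f hf k hk hfk hxf hxk

theorem strand_inter (h : Loc b E A B C d) {g : Sym2 Space} (hg : g ∈ E)
    (hC : planeProj b C ∈ sh b g) : A ∉ g ∧ ∀ x ∈ sh b g,
      x ∈ segment ℝ (planeProj b A) (planeProj b C) → x = planeProj b C := by
  have hAg : A ∉ g := fun hA => h.projA_ne ((h.okA g hg).adj hA _ hC (right_mem_segment ℝ _ _)).symm
  refine ⟨hAg, fun x hx hx' => ?_⟩
  by_contra hne
  have hnc := (h.okA g hg).nc
  obtain ⟨u, w, rfl⟩ := edgeSegment_eq_of_sym2 g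
  have l1 := tdet_eq_zero_of_mem_segment hx'
  have l2 := tdet_self_right (planeProj b A) (planeProj b C)
  obtain ⟨v, hgv⟩ := h.env
  have huw := hgv.proj_ne (Or.inr (Or.inr hg))
  refine hnc u w rfl hAg ⟨x, hx, hx'⟩ ?_
  rw [sh_mk] at hx hC
  have m1 := tdet_eq_zero_of_mem_segment hx
  have m2 := tdet_eq_zero_of_mem_segment hC
  exact tdet_eq_zero_trans hne (tdet_eq_zero_trans h.projA_ne l1 l2 (tdet_self_left _ _))
    (tdet_eq_zero_trans huw m1 m2 (tdet_self_left _ _))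
    (tdet_eq_zero_trans huw m1 m2 (tdet_self_right _ _))

end Loc

namespace Loc

variable {E F : Set (Sym2 Space)} {A B C d a c : Space} {g : Sym2 Space}

theorem disjoint_half (h : Loc b E A B C d) (ha : a ∈ openSegment ℝ A C) :
    Disjoint (segment ℝ (planeProj b A) (planeProj b a))
      (segment ℝ (planeProj b B) (planeProj b C)) := by
  have pa := proj_mem_openSegment (b := b) ha
  refine Set.disjoint_left.2 fun x hx hx' => openSegment_not_mem h.projA_ne pa ?_
  rwa [← h.inter (segment_subset_of_openSegment pa hx) hx']

theorem half_subset (ha : a ∈ openSegment ℝ A C) :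
    segment ℝ (planeProj b a) (planeProj b C) ⊆ segment ℝ (planeProj b A) (planeProj b C) := by
  have := segment_subset_of_openSegment (openSegment_symm_mem (proj_mem_openSegment (b := b) ha))
  rwa [segment_symm ℝ _ (planeProj b a), segment_symm ℝ _ (planeProj b A)] at this

theorem strand_side {ι : Type*} {l : Filter ι} (h : Loc b E A B C d)
    (hb : bad b (Corner A B C E) ⊆ {planeProj b C}) (hg : g ∈ E) (hC : planeProj b C ∈ sh b g)
    (ha : a ∈ openSegment ℝ A C) (hc : c ∈ openSegment ℝ B C)
    (hnear : ∀ f ∈ E, f ≠ g → Disjoint (sh b f) (segment ℝ (planeProj b a) (planeProj b C)))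
    {p q : ι → Space} (hp : Tendsto p l (𝓝 C)) (hq : Tendsto q l (𝓝 C)) :
    ∀ᶠ i in l, (∀ e ∈ insert s(A, a) (insert s(B, c) E), e ≠ g → Avoids b a (p i) (q i) e) ∧
      (∀ u ∈ g, planeProj b u ∉ convexHull ℝ {planeProj b a, planeProj b (p i), planeProj b (q i)}) ∧
      Disjoint (edgeSegment g) (convexHull ℝ {a, p i, q i}) := by
  have pa := proj_mem_openSegment (b := b) ha
  have sub := half_subset (b := b) ha
  have hAg := (h.strand_inter hg hC).1
  have far : ∀ f : Sym2 Space, Disjoint (sh b f) (segment ℝ (planeProj b a) (planeProj b C)) →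
      ∀ᶠ i in l, Avoids b a (p i) (q i) f := by
    intro f hf
    obtain ⟨u, w, rfl⟩ := edgeSegment_eq_of_sym2 f
    rw [sh_mk, ← triangle_degenerate (planeProj b a)] at hf
    filter_upwards [eventually_segment_triangle tendsto_const_nhds tendsto_const_nhds
      tendsto_const_nhds hp.proj hq.proj hf] with i hi x hx hx'
    rw [sh_mk] at hx
    exact absurd hx' (Set.disjoint_left.1 hi hx)
  have haA : planeProj b a ≠ planeProj b A := fun h' =>
    openSegment_not_mem h.projA_ne.symm (openSegment_symm_mem pa) (h' ▸ right_mem_segment ℝ _ _)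
  have haC : planeProj b a ≠ planeProj b C := fun h' =>
    openSegment_not_mem h.projA_ne pa (h' ▸ right_mem_segment ℝ _ _)
  have h1 : ∀ᶠ i in l, Avoids b a (p i) (q i) s(A, a) := by
    filter_upwards [eventually_cone (tendsto_const_nhds (x := planeProj b a))
      (tendsto_const_nhds (x := planeProj b A)) hp.proj hq.proj haA.symm (by rwa [segment_same])
      (fun x hx hx' => by
        rw [triangle_degenerate] at hx'
        rw [segment_symm] at hx
        exact openSegment_inter h.projA_ne pa hx (by rwa [segment_symm]))] with i hi x hx hx'
    rw [sh_mk, segment_symm] at hx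
    exact Or.inl (hi x hx hx')
  have h2 : ∀ᶠ i in l, Avoids b a (p i) (q i) s(B, c) := far _ <| by
    rw [sh_mk]
    exact Set.disjoint_left.2 fun x hx hx' => Set.disjoint_left.1 (h.symm.disjoint_half hc) hx (sub hx')
  have h3 : ∀ᶠ i in l, ∀ e ∈ E, e ≠ g → Avoids b a (p i) (q i) e := by
    rw [eventually_all_finite h.fin]
    intro e he
    rw [eventually_imp_distrib_left]
    exact fun hne => far e (hnear e he hne)
  have hend : ∀ u ∈ g, ∀ᶠ i in l, planeProj b u ∉
      convexHull ℝ {planeProj b a, planeProj b (p i), planeProj b (q i)} := by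
    intro u hu
    refine eventually_point_triangle tendsto_const_nhds tendsto_const_nhds hp.proj hq.proj ?_
    rw [triangle_degenerate]
    exact fun h' => h.ends_of_bad hb hg hAg hu (sub h')
  have hsp := (h.okA g hg).sp hAg
  obtain ⟨u, w, rfl⟩ := edgeSegment_eq_of_sym2 g
  have h4 : ∀ᶠ i in l, Disjoint (edgeSegment s(u, w)) (convexHull ℝ {a, p i, q i}) := by
    simp only [edgeSegment_mk] at hsp ⊢
    refine eventually_segment_triangle tendsto_const_nhds tendsto_const_nhds tendsto_const_nhds
      hp hq ?_
    rw [triangle_degenerate]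
    refine Set.disjoint_left.2 fun x hx hx' => Set.disjoint_left.1 hsp ?_ hx
    have := segment_subset_of_openSegment (openSegment_symm_mem ha)
    rw [segment_symm ℝ C A, segment_symm ℝ C a] at this
    exact this hx'
  filter_upwards [h1, h2, h3, h4, hend u (by simp), hend w (by simp)] with i k1 k2 k3 k4 k5 k6
  refine ⟨?_, fun v hv => ?_, k4⟩
  · rintro e (rfl | rfl | he) hne
    exacts [k1, k2, k3 e he hne]
  · rcases Sym2.mem_iff.1 hv with rfl | rfl <;> assumption

theorem reach_center (h : Loc b E A B C d) (hb : bad b (Corner A B C E) ⊆ {planeProj b C})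
    (hg : g ∈ E) (hC : planeProj b C ∈ sh b g) :
    ∀ᶠ τ : ℝ in 𝓝[>] 0, Reach b 2 (Corner A B (C + (-τ) • d) E) (Corner A B (C + τ • d) E) := by
  have hb' : bad b (Corner B A C E) ⊆ {planeProj b C} := by rwa [Corner.swap]
  have near : ∀ P : Space, ∀ᶠ σ : ℝ in 𝓝[>] 0, ∀ f ∈ E \ {g},
      Disjoint (sh b f) (segment ℝ (planeProj b (C + σ • (P - C))) (planeProj b C)) := fun P =>
    eventually_near _ (h.fin.subset Set.sdiff_subset) (tendsto_point C (P - C) _)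
      fun f hf => h.dbl g hg f hf.1 (fun h' => hf.2 h'.symm) hC
  have hlt : ∀ᶠ σ : ℝ in 𝓝[>] 0, σ < 1 := nhdsWithin_le_nhds (eventually_lt_nhds zero_lt_one)
  obtain ⟨σ, ⟨⟨near1, near2⟩, hσ1⟩, hσ⟩ :=
    (((near A).and (near B)).and hlt).and self_mem_nhdsWithin |>.exists
  have hσ : 0 < σ := hσ
  have mem : ∀ P : Space, C + σ • (P - C) ∈ openSegment ℝ P C := fun P =>
    ⟨σ, 1 - σ, hσ, by linarith, by ring, by module⟩
  have ha := mem A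
  have hc := mem B
  have hsgn : ∀ P : Space, tdet (planeProj b C) (planeProj b C + planeProj b d)
      (planeProj b (C + σ • (P - C))) =
      σ * tdet (planeProj b C) (planeProj b C + planeProj b d) (planeProj b P) := by
    intro P
    simp [tdet]; ring
  have sgA := hsgn A
  have sgB := hsgn B
  set a := C + σ • (A - C)
  set c := C + σ • (B - C)
  have pa := proj_mem_openSegment (b := b) ha
  have pc := proj_mem_openSegment (b := b) hc
  have pas := openSegment_subset_segment ℝ _ _ pa
  have pcs := openSegment_subset_segment ℝ _ _ pc
  have hCa := openSegment_not_mem h.projA_ne pa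
  have hCc := openSegment_not_mem h.projB_ne pc
  have haA : planeProj b a ≠ planeProj b A := fun h' =>
    openSegment_not_mem h.projA_ne.symm (openSegment_symm_mem pa) (h' ▸ right_mem_segment ℝ _ _)
  have hcB : planeProj b c ≠ planeProj b B := fun h' =>
    openSegment_not_mem h.projB_ne.symm (openSegment_symm_mem pc) (h' ▸ right_mem_segment ℝ _ _)
  have haC : planeProj b a ≠ planeProj b C := fun h' => hCa (h' ▸ right_mem_segment ℝ _ _)
  have hcC : planeProj b c ≠ planeProj b C := fun h' => hCc (h' ▸ right_mem_segment ℝ _ _)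
  have hfar := h.disjoint_half ha
  have haB : planeProj b a ∉ segment ℝ (planeProj b B) (planeProj b C) :=
    Set.disjoint_left.1 hfar (right_mem_segment ℝ _ _)
  have strand := h.strand_inter hg hC
  have strand' := h.symm.strand_inter hg hC
  have tC := tendsto_point C d {0}ᶜ
  have r1 := reach_insert h.fin ha h.projA_ne h.projB_ne (h.speed_ne pas haA)
    (fun x => h.inter) h.good h.fresh_near (fun f hf => (h.okA f hf).adj)
    (fun f hf => (h.okA f hf).sp) (fun f hf hA u => h.ends_of_bad hb hf hA)
    (by
      intro f hf hA
      by_cases hfg : f = g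
      · subst hfg
        refine Or.inl (Set.disjoint_left.2 fun x hx hx' => hCa ?_)
        rwa [← strand.2 x hx (segment_subset_of_openSegment pa hx')]
      · exact Or.inr (near1 f ⟨hf, hfg⟩))
    (fun f hf k hk => h.pair_of_bad hb hf hk)
  have hfr : ∀ᶠ τ : ℝ in 𝓝[≠] 0, ∀ e ∈ insert s(A, a) E, C + τ • d ∉ e := by
    filter_upwards [h.fresh_near, tC.proj.eventually_ne h.projA_ne.symm,
      tC.proj.eventually_ne haC.symm] with τ k1 k2 k3
    rintro e (rfl | he)
    · rw [Sym2.mem_iff]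
      rintro (h' | h')
      · exact k2 (by rw [h'])
      · exact k3 (by rw [h'])
    · exact k1 e he
  have r2 := reach_insert (F := insert s(A, a) E) (b := b) (d := d) (h.fin.insert _) hc h.projB_ne
    haC (h.symm.speed_ne pcs hcB) (fun x hx hx' => h.inter (half_subset ha hx') hx)
    (r1.mono fun τ hτ => by rw [Corner.swap]; exact hτ.right) hfr
    (by
      rintro f (rfl | hf) hB
      · exfalso
        rcases Sym2.mem_iff.1 hB with rfl | rfl
        · exact h.projA_ne_projB rfl
        · exact h.B_notMem pas
      · exact (h.okB f hf).adj hB)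
    (by
      rintro f (rfl | hf) hB
      · refine Set.disjoint_left.2 fun x hx hx' => ?_
        rw [edgeSegment_mk] at hx'
        exact Set.disjoint_left.1 hfar (proj_mem_segment hx') (proj_mem_segment hx)
      · exact (h.okB f hf).sp hB)
    (by
      rintro f (rfl | hf) hB u hu
      · rcases Sym2.mem_iff.1 hu with rfl | rfl
        · exact h.symm.B_notMem
        · exact haB
      · exact h.symm.ends_of_bad hb' hf hB hu)
    (by
      rintro f (rfl | hf) hB
      · left
        rw [sh_mk]
        exact Set.disjoint_left.2 fun x hx hx' => Set.disjoint_left.1 hfar hx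
          (segment_subset_of_openSegment pc hx')
      by_cases hfg : f = g
      · subst hfg
        refine Or.inl (Set.disjoint_left.2 fun x hx hx' => hCc ?_)
        rwa [← strand'.2 x hx (segment_subset_of_openSegment pc hx')]
      · exact Or.inr (near2 f ⟨hf, hfg⟩))
    (by
      rintro f (rfl | hf) k (rfl | hk) hfk x hxf hxk hx
      · exact hfk rfl
      · rw [sh_mk] at hxf
        exact Set.disjoint_left.1 hfar hxf hx
      · rw [sh_mk] at hxk
        exact Set.disjoint_left.1 hfar hxk hx
      · exact h.symm.pair_of_bad hb' hf hk hfk hxf hxk hx)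
  have r3 : ∀ᶠ τ : ℝ in 𝓝[≠] 0, Reach b 0 (Corner A B (C + τ • d) E)
      (Corner c a (C + τ • d) (insert s(B, c) (insert s(A, a) E))) := by
    filter_upwards [r1, r2] with τ k1 k2
    rw [Corner.swap a B] at k1
    exact k1.trans k2
  have hfr' : ∀ᶠ τ : ℝ in 𝓝[≠] 0, ∀ e ∈ insert s(B, c) (insert s(A, a) E), C + τ • d ∉ e := by
    filter_upwards [hfr, tC.proj.eventually_ne h.projB_ne.symm,
      tC.proj.eventually_ne hcC.symm] with τ k1 k2 k3
    rintro e (rfl | he)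
    · rw [Sym2.mem_iff]
      rintro (h' | h')
      · exact k2 (by rw [h'])
      · exact k3 (by rw [h'])
    · exact k1 e he
  have tp := tendsto_point C d (Set.Ioi 0)
  have tn : Tendsto (fun τ : ℝ => C + (-τ) • d) (𝓝[>] 0) (𝓝 C) := tC.comp tendsto_neg_punctured
  have sA := h.strand_side hb hg hC ha hc (fun f hf hne => near1 f ⟨hf, hne⟩) tp tn
  have sB := h.symm.strand_side hb' hg hC hc ha (fun f hf hne => near2 f ⟨hf, hne⟩) tn tp
  filter_upwards [sA, sB, punctured_of_pos r3, tendsto_neg_punctured.eventually r3,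
    punctured_of_pos hfr', tendsto_neg_punctured.eventually hfr', self_mem_nhdsWithin]
    with τ kA kB k3 k3' f1 f2 (hτ : 0 < τ)
  have hm : MoveHyp b (insert s(B, c) (insert s(A, a) E)) c a (C + (-τ) • d) (C + τ • d) := by
    refine ⟨f2, f1, ?_⟩
    have e : ∀ x, tdet (planeProj b (C + (-τ) • d)) (planeProj b (C + τ • d)) x =
        2 * τ * tdet (planeProj b C) (planeProj b C + planeProj b d) x := by
      intro x
      simp [tdet]; ring
    rw [e, e, sgA, sgB]
    nlinarith [h.sep, mul_pos (mul_pos hτ hτ) (mul_pos hσ hσ)]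
  have hgF : g ∈ insert s(B, c) (insert s(A, a) E) := Or.inr (Or.inr hg)
  refine k3'.trans ((Reach.vertex_move_single k3'.right hm (g := g) kB.1 ?_ ?_ ?_).1.trans k3.symm)
  · rw [Set.insert_comm]
    exact kA.1
  · exact ⟨kB.2.1, k3.right.not_mem_sh (Or.inl rfl) (Or.inr (Or.inr hgF)) (by simp) (f1 g hgF),
      kB.2.2⟩
  · exact ⟨kA.2.1, k3'.right.not_mem_sh (Or.inl rfl) (Or.inr (Or.inr hgF)) (by simp) (f2 g hgF),
      kA.2.2⟩

/-- The cost of passing a critical time. -/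
theorem reach {n : ℕ} (h : Loc b E A B C d) (hfin : (bad b (Corner A B C E)).Finite)
    (hn : (bad b (Corner A B C E)).ncard ≤ n) :
    ∀ᶠ τ : ℝ in 𝓝[>] 0,
      Reach b (2 * n) (Corner A B (C + (-τ) • d) E) (Corner A B (C + τ • d) E) := by
  induction n generalizing E with
  | zero =>
    rw [Nat.le_zero, Set.ncard_eq_zero hfin] at hn
    exact h.reach_of_good (h.good_zero hn)
  | succ n ih =>
    by_cases hC : ∃ x ∈ bad b (Corner A B C E), x ≠ planeProj b C
    · obtain ⟨x, hx, hxC⟩ := hC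
      obtain ⟨E', h', hb', hr⟩ := h.removable hx hxC
      have hle : (bad b (Corner A B C E')).ncard ≤ n := by
        have := Set.ncard_le_ncard hb' (hfin.subset Set.sdiff_subset)
        rw [Set.ncard_sdiff_singleton_of_mem hx] at this
        omega
      filter_upwards [hr, ih h' (hfin.subset (hb'.trans Set.sdiff_subset)) hle] with τ k1 k2
      obtain ⟨m₁, m₂, hm, r1, r2⟩ := k1
      exact (r1.trans (k2.trans r2)).mono (by omega)
    · push Not at hC
      rcases (bad b (Corner A B C E)).eq_empty_or_nonempty with he | ⟨x, hx⟩
      · exact (h.reach_of_good (h.good_zero he)).mono fun τ k => k.mono (by omega)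
      · rcases h.bad_cases hx with ⟨e, he, f, hf, hef, hxe, hxf, -⟩ | ⟨-, g, hg, hxg⟩
        · rw [hC x hx] at hxe hxf
          exact absurd hxf (h.dbl e he f hf hef hxe)
        · rw [hC x hx] at hxg
          exact (h.reach_center hC hg hxg).mono fun τ k => k.mono (by omega)

end Loc

/-! ### Moving a vertex along a segment -/

/-- The triangle `APQ` is not met by the edges that do not end in `A`. -/
structure HalfTrack (b : OrthonormalBasis (Fin 3) ℝ Space) (E : Set (Sym2 Space)) (A P Q : Space) :
    Prop where
  sp : ∀ e ∈ E, A ∉ e → Disjoint (convexHull ℝ {A, P, Q}) (edgeSegment e)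
  nc : ∀ u w, s(u, w) ∈ E → A ∉ s(u, w) → tdet (planeProj b A) (planeProj b u) (planeProj b w) ≠ 0

/-- The projections of the edges that end in `A` do not meet the triangle `APQ` elsewhere. -/
def Conical (b : OrthonormalBasis (Fin 3) ℝ Space) (E : Set (Sym2 Space)) (A P Q : Space) : Prop :=
  ∀ e ∈ E, A ∈ e → ∀ x ∈ sh b e,
    x ∈ convexHull ℝ {planeProj b A, planeProj b P, planeProj b Q} → x = planeProj b A

/-- The position of the link relative to the triangle `APQ` that is swept by an edge. -/
structure HalfSweep (b : OrthonormalBasis (Fin 3) ℝ Space) (E : Set (Sym2 Space)) (A P Q : Space) :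
    Prop extends HalfTrack b E A P Q where
  cone : Conical b E A P Q

/-- The vertex with neighbours `A` and `B` can be moved from `P` to `Q`. -/
structure Sweep (b : OrthonormalBasis (Fin 3) ℝ Space) (E : Set (Sym2 Space)) (A B P Q : Space) :
    Prop where
  good : Good b (Corner A B P E)
  halfA : HalfSweep b E A P Q
  halfB : HalfSweep b E B P Q
  sep : tdet (planeProj b P) (planeProj b Q) (planeProj b A) *
    tdet (planeProj b P) (planeProj b Q) (planeProj b B) < 0
  dbl : ∀ e ∈ E, ∀ f ∈ E, e ≠ f → ∀ x ∈ sh b e, x ∈ sh b f →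
    x ∉ segment ℝ (planeProj b P) (planeProj b Q)
  lin : ∀ e ∈ E, (sh b e ∩ segment ℝ (planeProj b P) (planeProj b Q)).Subsingleton

/-- The position of the moving vertex. -/
def along (P Q : Space) (t : ℝ) : Space := P + t • (Q - P)

theorem continuous_along (P Q : Space) : Continuous (along P Q) := by
  unfold along; fun_prop

theorem along_mem {P Q : Space} {t : ℝ} (ht : t ∈ Set.Icc (0 : ℝ) 1) :
    along P Q t ∈ segment ℝ P Q := by
  rw [segment_eq_image']
  exact ⟨t, ht, rfl⟩

theorem along_add (P Q : Space) (t τ : ℝ) : along P Q (t + τ) = along P Q t + τ • (Q - P) := by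
  unfold along; module

theorem tdet_along (P Q : Space) (t : ℝ) (x : Plane) : tdet (planeProj b (along P Q t))
    (planeProj b (along P Q t) + planeProj b (Q - P)) x = tdet (planeProj b P) (planeProj b Q) x := by
  simp [along, tdet]; ring

theorem tdet_along_along (P Q : Space) (s t : ℝ) (x : Plane) : tdet (planeProj b (along P Q s))
    (planeProj b (along P Q t)) x = (t - s) * tdet (planeProj b P) (planeProj b Q) x := by
  simp [along, tdet]; ring

theorem segment_along_subset {A P Q : Space} {t : ℝ} (ht : t ∈ Set.Icc (0 : ℝ) 1) :
    segment ℝ A (along P Q t) ⊆ convexHull ℝ {A, P, Q} :=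
  (convex_convexHull ℝ _).segment_subset (subset_convexHull ℝ _ (by simp))
    (segment_subset_triangle₂₃ (along_mem ht))

theorem proj_segment_along_subset {A P Q : Space} {t : ℝ} (ht : t ∈ Set.Icc (0 : ℝ) 1) :
    segment ℝ (planeProj b A) (planeProj b (along P Q t)) ⊆
      convexHull ℝ {planeProj b A, planeProj b P, planeProj b Q} :=
  (convex_convexHull ℝ _).segment_subset (subset_convexHull ℝ _ (by simp))
    (segment_subset_triangle₂₃ (proj_mem_segment (along_mem ht)))

theorem HalfSweep.half {E : Set (Sym2 Space)} {A P Q : Space} (h : HalfSweep b E A P Q) {t : ℝ}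
    (ht : t ∈ Set.Icc (0 : ℝ) 1) {e : Sym2 Space} (he : e ∈ E) : HalfOK b A (along P Q t) e where
  sp hA := (h.sp e he hA).mono_left (segment_along_subset ht)
  nc u w hu hA _ := by subst hu; exact h.nc u w he hA
  adj hA x hx hx' := h.cone e he hA x hx (proj_segment_along_subset ht hx')

namespace Sweep

variable {E : Set (Sym2 Space)} {A B P Q : Space} {t s : ℝ}

theorem symm (h : Sweep b E A B P Q) : Sweep b E B A P Q :=
  ⟨by rw [Corner.swap]; exact h.good, h.halfB, h.halfA, by rw [mul_comm]; exact h.sep, h.dbl, h.lin⟩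

theorem detA (h : Sweep b E A B P Q) : tdet (planeProj b P) (planeProj b Q) (planeProj b A) ≠ 0 := by
  intro h0
  have := h.sep
  rw [h0] at this
  simp at this

theorem projA_ne (h : Sweep b E A B P Q) (t : ℝ) : planeProj b A ≠ planeProj b (along P Q t) := by
  intro h'
  have := tdet_along (b := b) P Q t (planeProj b A)
  rw [← h', tdet_self_left] at this
  exact h.detA this.symm

theorem proj_ne (h : Sweep b E A B P Q) : planeProj b P ≠ planeProj b Q := tdet_ne_base h.detA

theorem fresh (h : Sweep b E A B P Q) (ht : t ∈ Set.Icc (0 : ℝ) 1) : ∀ e ∈ E, along P Q t ∉ e := by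
  intro e he hC
  by_cases hA : A ∈ e
  · exact h.projA_ne t (((h.halfA.half ht he).adj hA _ (vertex_mem_sh hC)
      (right_mem_segment ℝ _ _)).symm)
  · exact Set.disjoint_left.1 ((h.halfA.half ht he).sp hA) (right_mem_segment ℝ _ _)
      (mem_edgeSegment hC)

theorem fin (h : Sweep b E A B P Q) : E.Finite :=
  h.good.fin.subset fun _ he => Or.inr (Or.inr he)

theorem freshP (h : Sweep b E A B P Q) : ∀ e ∈ E, P ∉ e := by
  have := h.fresh (t := 0) ⟨le_rfl, zero_le_one⟩
  simpa [along] using this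

theorem inter (h : Sweep b E A B P Q) {x : Plane}
    (hA : x ∈ segment ℝ (planeProj b A) (planeProj b (along P Q t)))
    (hB : x ∈ segment ℝ (planeProj b B) (planeProj b (along P Q t))) :
    x = planeProj b (along P Q t) := by
  refine eq_of_sides (q := planeProj b (along P Q t) + planeProj b (Q - P)) ?_ hA hB
  rw [tdet_along, tdet_along]
  exact h.sep

theorem good_of_bad_empty (h : Sweep b E A B P Q) (ht : t ∈ Set.Icc (0 : ℝ) 1)
    (hb : bad b (Corner A B (along P Q t) E) = ∅) : Good b (Corner A B (along P Q t) E) :=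
  h.good.of_bad_empty h.freshP (h.fresh ht) (fun h' => h.projA_ne t (by rw [← h']))
    (fun h' => h.symm.projA_ne t (by rw [← h'])) (fun _ he => (h.halfA.half ht he).sp)
    (fun _ he => (h.halfB.half ht he).sp) hb

/-- The times and places where three edges meet. -/
def events (b : OrthonormalBasis (Fin 3) ℝ Space) (E : Set (Sym2 Space)) (A B P Q : Space) :
    Set (ℝ × Plane) :=
  {p | p.1 ∈ Set.Icc (0 : ℝ) 1 ∧ p.2 ∈ bad b (Corner A B (along P Q p.1) E)}

theorem A_of_two (h : Sweep b E A B P Q) {e f : Sym2 Space} (he : e ∈ insert s(P, Q) E)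
    (hf : f ∈ insert s(P, Q) E) (hef : e ≠ f) (hAe : planeProj b A ∈ sh b e)
    (hAf : planeProj b A ∈ sh b f) : False := by
  have hN : planeProj b A ∉ sh b s(P, Q) := fun hA => by
    rw [sh_mk] at hA
    exact h.detA (tdet_eq_zero_of_mem_segment hA)
  rcases he with rfl | he
  · exact hN hAe
  rcases hf with rfl | hf
  · exact hN hAf
  have mem : ∀ {e}, e ∈ E → planeProj b A ∈ sh b e → A ∈ e := fun he hA => by
    by_contra hA'
    exact h.good.not_mem_sh (Or.inl rfl) (Or.inr (Or.inr he)) (by simp) hA' hA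
  exact h.good.not_three (Or.inr (Or.inr he)) (Or.inr (Or.inr hf)) (g := s(A, P)) (Or.inl rfl) hef
    (fun h' => h.freshP _ he (h' ▸ by simp)) (fun h' => h.freshP _ hf (h' ▸ by simp))
    (mem he hAe) (mem hf hAf) (by simp)

theorem time_same (h : Sweep b E A B P Q) {x : Plane} (hxA : x ≠ planeProj b A)
    (ht : x ∈ segment ℝ (planeProj b A) (planeProj b (along P Q t)))
    (hs : x ∈ segment ℝ (planeProj b A) (planeProj b (along P Q s))) : t = s := by
  have hne : tdet (planeProj b A) (planeProj b A + planeProj b (Q - P)) x ≠ 0 := by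
    obtain ⟨α, β, h1, h2, h3, rfl⟩ := ht
    have hβ : β ≠ 0 := by
      rintro rfl
      obtain rfl : α = 1 := by linarith
      simp at hxA
    rw [tdet_comb _ _ _ _ h3, tdet_self_left, mul_zero, zero_add]
    refine mul_ne_zero hβ fun h0 => h.detA ?_
    rw [← tdet_along P Q t, ← neg_eq_zero, ← h0]
    simp [tdet]; ring
  have e1 := tdet_eq_zero_of_mem_segment ht
  have e2 := tdet_eq_zero_of_mem_segment hs
  unfold along at e1 e2
  rw [Loc.tdet_moving] at e1 e2
  have : (t - s) * tdet (planeProj b A) (planeProj b A + planeProj b (Q - P)) x = 0 := by linarith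
  exact sub_eq_zero.1 ((mul_eq_zero.1 this).resolve_right hne)

theorem time_opp (h : Sweep b E A B P Q) {x : Plane}
    (ht : x ∈ segment ℝ (planeProj b A) (planeProj b (along P Q t)))
    (hs : x ∈ segment ℝ (planeProj b B) (planeProj b (along P Q s))) : t = s := by
  have hz : ∀ r, tdet (planeProj b P) (planeProj b Q) (planeProj b (along P Q r)) = 0 := fun r => by
    rw [← tdet_along P Q r, tdet_self_left]
  obtain ⟨α, β, h1, h2, h3, rfl⟩ := ht
  obtain ⟨γ, δ, h4, h5, h6, hx⟩ := hs
  have e := congrArg (tdet (planeProj b P) (planeProj b Q)) hx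
  rw [tdet_comb _ _ _ _ h3, tdet_comb _ _ _ _ h6, hz, hz] at e
  have hA := h.detA
  have hsep := h.sep
  have hprod : α * (tdet (planeProj b P) (planeProj b Q) (planeProj b A) *
      tdet (planeProj b P) (planeProj b Q) (planeProj b A)) = γ *
      (tdet (planeProj b P) (planeProj b Q) (planeProj b A) *
        tdet (planeProj b P) (planeProj b Q) (planeProj b B)) := by
    linear_combination (-tdet (planeProj b P) (planeProj b Q) (planeProj b A)) * e
  have hα : α = 0 := by
    have := mul_self_pos.2 hA
    nlinarith
  have hγ : γ = 0 := by
    rw [hα, zero_mul] at hprod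
    exact (mul_eq_zero.1 hprod.symm).resolve_right hsep.ne
  obtain rfl : β = 1 := by linarith
  obtain rfl : δ = 1 := by linarith
  rw [hα, hγ] at hx
  simp only [zero_smul, one_smul, zero_add] at hx
  have : (s - t) • (planeProj b Q - planeProj b P) = 0 := by
    simp only [along, map_add, map_smul, map_sub] at hx
    rw [sub_smul, sub_eq_zero]
    exact add_left_cancel hx
  rcases smul_eq_zero.1 this with h' | h'
  · linarith
  · exact absurd (sub_eq_zero.1 h').symm h.proj_ne

theorem exists_key (h : Sweep b E A B P Q) {p : ℝ × Plane} (hp : p ∈ events b E A B P Q) :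
    ∃ e ∈ insert s(P, Q) E, ∃ f ∈ insert s(P, Q) E, e ≠ f ∧ p.2 ∈ sh b e ∧ p.2 ∈ sh b f ∧
      (p.2 ∈ segment ℝ (planeProj b A) (planeProj b (along P Q p.1)) ∨
        p.2 ∈ segment ℝ (planeProj b B) (planeProj b (along P Q p.1))) := by
  rcases bad_cases h.good (fun x => h.inter) hp.2 with ⟨e, he, f, hf, hef, h1, h2, h3⟩ | ⟨h1, e, he, h2⟩
  · exact ⟨e, Or.inr he, f, Or.inr hf, hef, h1, h2, h3⟩
  · refine ⟨e, Or.inr he, s(P, Q), Or.inl rfl, fun h' => h.freshP _ he (h' ▸ by simp), h2, ?_, ?_⟩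
    · rw [h1, sh_mk]
      exact proj_mem_segment (along_mem hp.1)
    · rw [h1]
      exact Or.inl (right_mem_segment ℝ _ _)

theorem subsingleton (h : Sweep b E A B P Q) {e f : Sym2 Space} (he : e ∈ insert s(P, Q) E)
    (hf : f ∈ insert s(P, Q) E) (hef : e ≠ f) : (sh b e ∩ sh b f).Subsingleton := by
  rcases he with rfl | he <;> rcases hf with rfl | hf
  · exact absurd rfl hef
  · rw [Set.inter_comm, sh_mk]
    exact h.lin f hf
  · rw [sh_mk]
    exact h.lin e he
  · exact fun x hx y hy => h.good.inter_subsingleton (Or.inr (Or.inr he)) (Or.inr (Or.inr hf)) hef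
      hx.1 hx.2 hy.1 hy.2

theorem events_finite (h : Sweep b E A B P Q) : (events b E A B P Q).Finite ∧
    (events b E A B P Q).ncard ≤ (E.ncard + 1).choose 2 := by
  classical
  have hNE : s(P, Q) ∉ E := fun h' => h.freshP _ h' (by simp)
  have hfin := h.fin.insert s(P, Q)
  choose! k hk f hf hne h1 h2 h3 using fun p (hp : p ∈ events b E A B P Q) => h.exists_key hp
  set K : Set (Finset (Sym2 Space)) := ↑((hfin.toFinset).powersetCard 2)
  have hmaps : ∀ p ∈ events b E A B P Q, ({k p, f p} : Finset (Sym2 Space)) ∈ K := by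
    intro p hp
    rw [Finset.mem_coe, Finset.mem_powersetCard]
    refine ⟨?_, Finset.card_pair (hne p hp)⟩
    intro e he
    rw [Finset.mem_insert, Finset.mem_singleton] at he
    rw [hfin.mem_toFinset]
    rcases he with rfl | rfl
    exacts [hk p hp, hf p hp]
  have hinj : Set.InjOn (fun p => ({k p, f p} : Finset (Sym2 Space))) (events b E A B P Q) := by
    intro p hp q hq hpq
    have hpq : ({k p, f p} : Finset (Sym2 Space)) = {k q, f q} := hpq
    have m1 : k p = k q ∨ k p = f q := by
      have : k p ∈ ({k q, f q} : Finset (Sym2 Space)) := hpq ▸ by simp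
      simpa using this
    have m2 : f p = k q ∨ f p = f q := by
      have : f p ∈ ({k q, f q} : Finset (Sym2 Space)) := hpq ▸ by simp
      simpa using this
    have q1 : q.2 ∈ sh b (k p) := by rcases m1 with e | e <;> rw [e]; exacts [h1 q hq, h2 q hq]
    have q2 : q.2 ∈ sh b (f p) := by rcases m2 with e | e <;> rw [e]; exacts [h1 q hq, h2 q hq]
    have hx : p.2 = q.2 := h.subsingleton (hk p hp) (hf p hp) (hne p hp)
      ⟨h1 p hp, h2 p hp⟩ ⟨q1, q2⟩
    have hxA : q.2 ≠ planeProj b A := fun h' =>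
      h.A_of_two (hk p hp) (hf p hp) (hne p hp) (h' ▸ q1) (h' ▸ q2)
    have hxB : q.2 ≠ planeProj b B := fun h' =>
      h.symm.A_of_two (hk p hp) (hf p hp) (hne p hp) (h' ▸ q1) (h' ▸ q2)
    refine Prod.ext ?_ hx
    have p3 := h3 p hp
    rw [hx] at p3
    rcases p3 with p3 | p3 <;> rcases h3 q hq with q3 | q3
    · exact h.time_same hxA p3 q3
    · exact h.time_opp p3 q3
    · exact (h.time_opp q3 p3).symm
    · exact h.symm.time_same hxB p3 q3
  have hK : K.Finite := Finset.finite_toSet _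
  refine ⟨Set.Finite.of_injOn hmaps hinj hK, (Set.ncard_le_ncard_of_injOn _ hmaps hinj hK).trans ?_⟩
  rw [Set.ncard_coe_finset, Finset.card_powersetCard, ← Set.ncard_eq_toFinset_card _ hfin,
    Set.ncard_insert_of_notMem hNE h.fin]

theorem good_iff (h : Sweep b E A B P Q) (ht : t ∈ Set.Icc (0 : ℝ) 1) :
    Good b (Corner A B (along P Q t) E) ↔ ∀ x, (t, x) ∉ events b E A B P Q := by
  constructor
  · rintro hg x ⟨-, e, he, f, hf, g, hg', h1, h2, h3, h4, h5, h6⟩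
    exact hg.tr e he f hf g hg' h1 h2 h3 x h4 h5 h6
  · intro hx
    exact h.good_of_bad_empty ht (Set.eq_empty_of_forall_notMem fun x h' => hx x ⟨ht, h'⟩)

theorem loc (h : Sweep b E A B P Q) (ht : t ∈ Set.Ioo (0 : ℝ) 1) :
    Loc b E A B (along P Q t) (Q - P) := by
  have ht' := Set.Ioo_subset_Icc_self ht
  refine ⟨h.fresh ht', fun _ he => h.halfA.half ht' he, fun _ he => h.halfB.half ht' he, ?_, ?_, ?_⟩
  · rw [tdet_along, tdet_along]
    exact h.sep
  · exact fun e he f hf hef h1 h2 => h.dbl e he f hf hef _ h1 h2 (proj_mem_segment (along_mem ht'))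
  · have h1 : Tendsto (fun τ : ℝ => t + τ) (𝓝[≠] 0) (𝓝 t) := by
      have : Tendsto (fun τ : ℝ => t + τ) (𝓝 0) (𝓝 (t + 0)) := Continuous.tendsto (by fun_prop) _
      rw [add_zero] at this
      exact this.mono_left nhdsWithin_le_nhds
    have h2 : ∀ᶠ r : ℝ in 𝓝 t, ∀ p ∈ events b E A B P Q, p.1 ≠ t → r ≠ p.1 := by
      rw [eventually_all_finite h.events_finite.1]
      intro p _
      rw [eventually_imp_distrib_left]
      exact fun hne => eventually_ne_nhds hne.symm
    filter_upwards [h1.eventually h2, h1.eventually (Ioo_mem_nhds ht.1 ht.2), self_mem_nhdsWithin]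
      with τ k1 k2 (k3 : τ ≠ 0)
    rw [← along_add]
    refine (h.good_iff (Set.Ioo_subset_Icc_self k2)).2 fun x hx => ?_
    exact k1 _ hx (by simpa using k3) rfl

theorem reach_good (h : Sweep b E A B P Q) (ht : t ∈ Set.Icc (0 : ℝ) 1)
    (hs : s ∈ Set.Icc (0 : ℝ) 1)
    (hg : ∀ r ∈ Set.uIcc s t, Good b (Corner A B (along P Q r) E)) :
    Reach b 0 (Corner A B (along P Q s) E) (Corner A B (along P Q t) E) := by
  have hsub : Set.uIcc s t ⊆ Set.Icc (0 : ℝ) 1 := Set.uIcc_subset_Icc hs ht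
  refine Set.ordConnected_uIcc.isPreconnected.induction₂' (s := Set.uIcc s t)
    (P := fun s t => Reach b 0 (Corner A B (along P Q s) E) (Corner A B (along P Q t) E)) ?_
    (fun _ _ _ _ _ _ h1 h2 => h1.trans h2) Set.left_mem_uIcc Set.right_mem_uIcc
  intro r hr
  have := eventually_vertex_move (ψ := fun _ x => x) (l := 𝓝 r) (p := fun _ => along P Q r)
    (q := along P Q) (hg r hr) (h.fresh (hsub hr)) (fun x => tendsto_const_nhds)
    tendsto_const_nhds (continuous_along P Q).continuousAt
  filter_upwards [mem_nhdsWithin_of_mem_nhds this] with u hu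
  have : Reach b 0 (Corner A B (along P Q r) E) (Corner A B (along P Q u) E) := by
    by_cases hru : u = r
    · rw [hru]
      exact .refl (hg r hr)
    simp only [Sym2.map_id', id, Set.image_id'] at hu
    refine hu (hg r hr) ?_
    rw [tdet_along_along, tdet_along_along]
    nlinarith [h.sep, mul_self_pos.2 (sub_ne_zero.2 hru)]
  exact ⟨this, this.symm⟩

theorem reach_times (h : Sweep b E A B P Q) (n : ℕ) : ∀ {s t : ℝ}, s ∈ Set.Icc (0 : ℝ) 1 →
    t ∈ Set.Icc (0 : ℝ) 1 → s ≤ t → Good b (Corner A B (along P Q s) E) →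
    Good b (Corner A B (along P Q t) E) →
    {p ∈ events b E A B P Q | s < p.1 ∧ p.1 < t}.ncard ≤ n →
    Reach b (2 * {p ∈ events b E A B P Q | s < p.1 ∧ p.1 < t}.ncard)
      (Corner A B (along P Q s) E) (Corner A B (along P Q t) E) := by
  have hfin := h.events_finite.1
  induction n with
  | zero =>
    intro s t hs ht hst gs gt hn
    rw [Nat.le_zero, Set.ncard_eq_zero (hfin.subset (Set.sep_subset _ _))] at hn
    refine (h.reach_good ht hs fun r hr => ?_).mono (Nat.zero_le _)
    rw [Set.uIcc_of_le hst] at hr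
    rcases hr.1.eq_or_lt with rfl | h1
    · exact gs
    rcases hr.2.eq_or_lt with rfl | h2
    · exact gt
    refine (h.good_iff ⟨hs.1.trans hr.1, hr.2.trans ht.2⟩).2 fun x hx => ?_
    have : (r, x) ∈ {p ∈ events b E A B P Q | s < p.1 ∧ p.1 < t} := ⟨hx, h1, h2⟩
    rw [hn] at this
    exact this
  | succ n ih =>
    intro s t hs ht hst gs gt hn
    rcases {p ∈ events b E A B P Q | s < p.1 ∧ p.1 < t}.eq_empty_or_nonempty with he | ⟨p, hp, hp1, hp2⟩
    · exact ih hs ht hst gs gt (by rw [he]; simp)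
    have hloc := h.loc (t := p.1) ⟨hs.1.trans_lt hp1, hp2.trans_le ht.2⟩
    set Z := {p.1} ×ˢ bad b (Corner A B (along P Q p.1) E)
    have hZ : Z ⊆ events b E A B P Q := by
      rintro ⟨r, x⟩ ⟨rfl, hx⟩
      exact ⟨hp.1, hx⟩
    have hbfin : (bad b (Corner A B (along P Q p.1) E)).Finite :=
      ((hfin.subset hZ).image Prod.snd).subset fun x hx => ⟨(p.1, x), ⟨rfl, hx⟩, rfl⟩
    have hZn : Z.ncard = (bad b (Corner A B (along P Q p.1) E)).ncard := by
      rw [Set.ncard_prod, Set.ncard_singleton, one_mul]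
    have hlt : ∀ {a : ℝ}, 0 < a → ∀ᶠ τ : ℝ in 𝓝[>] 0, τ < a := fun ha =>
      nhdsWithin_le_nhds (eventually_lt_nhds ha)
    obtain ⟨τ, ⟨⟨hr, l1⟩, l2⟩, hτ⟩ := (((hloc.reach hbfin le_rfl).and (hlt (sub_pos.2 hp1))).and
      (hlt (sub_pos.2 hp2))).and self_mem_nhdsWithin |>.exists
    have hτ : 0 < τ := hτ
    rw [← along_add, ← along_add] at hr
    have fin1 : ∀ q : ℝ × Plane → Prop, {p ∈ events b E A B P Q | q p}.Finite := fun q =>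
      hfin.subset (Set.sep_subset _ _)
    have d1 : Disjoint {q ∈ events b E A B P Q | s < q.1 ∧ q.1 < p.1 + -τ} Z := by
      refine Set.disjoint_left.2 ?_
      rintro ⟨r, x⟩ ⟨-, -, h2⟩ ⟨h3, -⟩
      rw [Set.mem_singleton_iff] at h3
      simp only at h2 h3
      linarith
    have d2 : Disjoint ({q ∈ events b E A B P Q | s < q.1 ∧ q.1 < p.1 + -τ} ∪ Z)
        {q ∈ events b E A B P Q | p.1 + τ < q.1 ∧ q.1 < t} := by
      refine Set.disjoint_left.2 ?_
      rintro ⟨r, x⟩ (⟨-, -, h2⟩ | ⟨h2, -⟩) ⟨-, h3, -⟩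
      · simp only at h2 h3
        linarith
      · rw [Set.mem_singleton_iff] at h2
        simp only at h2 h3
        linarith
    have hsub : ({q ∈ events b E A B P Q | s < q.1 ∧ q.1 < p.1 + -τ} ∪ Z) ∪
        {q ∈ events b E A B P Q | p.1 + τ < q.1 ∧ q.1 < t} ⊆
        {q ∈ events b E A B P Q | s < q.1 ∧ q.1 < t} := by
      rintro q ((⟨h1, h2, h3⟩ | hq) | ⟨h1, h2, h3⟩)
      · exact ⟨h1, h2, by linarith⟩
      · have : q.1 = p.1 := hq.1
        exact ⟨hZ hq, by rw [this]; exact hp1, by rw [this]; exact hp2⟩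
      · exact ⟨h1, by linarith, h3⟩
    have hcard := Set.ncard_le_ncard hsub (fin1 _)
    rw [Set.ncard_union_eq d2 ((fin1 _).union (hfin.subset hZ)) (fin1 _),
      Set.ncard_union_eq d1 (fin1 _) (hfin.subset hZ), hZn] at hcard
    have hpos : 0 < (bad b (Corner A B (along P Q p.1) E)).ncard :=
      (Set.ncard_pos hbfin).2 ⟨p.2, hp.2⟩
    have i1 := ih hs ⟨by linarith [hs.1], by linarith [ht.2]⟩ (by linarith) gs hr.left (by omega)
    have i2 := ih (s := p.1 + τ) ⟨by linarith [hs.1], by linarith [ht.2]⟩ ht (by linarith) hr.right gt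
      (by omega)
    exact ((i1.trans hr).trans i2).mono (by omega)

/-- The cost of moving a vertex along a segment. -/
theorem reach (h : Sweep b E A B P Q) (hQ : Good b (Corner A B Q E)) :
    Reach b (E.ncard * (E.ncard + 1)) (Corner A B P E) (Corner A B Q E) := by
  have h0 : along P Q 0 = P := by simp [along]
  have h1 : along P Q 1 = Q := by simp [along]
  have := h.reach_times _ (s := 0) (t := 1) ⟨le_rfl, zero_le_one⟩ ⟨zero_le_one, le_rfl⟩ zero_le_one
    (by rw [h0]; exact h.good) (by rw [h1]; exact hQ) le_rfl
  rw [h0, h1] at this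
  refine this.mono ?_
  have k1 := Set.ncard_le_ncard (Set.sep_subset (events b E A B P Q) fun p => 0 < p.1 ∧ p.1 < 1)
    h.events_finite.1
  have k2 := h.events_finite.2
  have k3 : 2 * (E.ncard + 1).choose 2 ≤ E.ncard * (E.ncard + 1) := by
    rw [Nat.choose_two_right, Nat.add_sub_cancel, mul_comm (E.ncard)]
    exact Nat.mul_div_le _ _
  omega

end Sweep

/-! ### Turning the first piece of an edge -/

theorem triangle_const {V : Type*} [AddCommGroup V] [Module ℝ V] (a : V) :
    convexHull ℝ {a, a, a} = {a} := by simp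

theorem triangle_outer {V : Type*} [NormedAddCommGroup V] [NormedSpace ℝ V] (a c : V) :
    convexHull ℝ {a, c, a} = segment ℝ a c := by
  rw [triangle_swap, triangle_degenerate, segment_symm]

/-- A ray either enters the corner of a triangle through the opposite side or avoids it. -/
theorem ray_cases {o p q x : Plane} (hD : tdet o p q ≠ 0) (hq : tdet o q x ≠ 0)
    (hray : ∀ y ∈ segment ℝ o x, y ∈ segment ℝ o p → y = o) :
    (∀ᶠ ρ : ℝ in 𝓝[>] 0, ∃ y ∈ segment ℝ o x,
      y ∈ openSegment ℝ (o + ρ • (q - o)) (o + ρ • (p - o))) ∨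
    ∀ ρ : ℝ, 0 < ρ → ∀ y ∈ segment ℝ o x,
      y ∈ convexHull ℝ {o, o + ρ • (p - o), o + ρ • (q - o)} → y = o := by
  set D := tdet o p q
  set α := tdet o x q
  set β := tdet o p x
  have hα : α ≠ 0 := by
    intro h
    exact hq (by rw [tdet_swap_right, neg_eq_zero]; exact h)
  have hx : D • (x - o) = α • (p - o) + β • (q - o) := by
    apply plane_ext
    · simp [D, α, β, tdet]; ring
    · simp [D, α, β, tdet]; ring
  by_cases hcase : 0 < α * D ∧ 0 < β * D
  · left
    obtain ⟨h1, h2⟩ := hcase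
    have hDD := mul_self_pos.2 hD
    have hsum : 0 < (α + β) * D := by linarith
    have hs0 : α + β ≠ 0 := by rintro h; rw [h] at hsum; simp at hsum
    have hlt : ∀ᶠ ρ : ℝ in 𝓝[>] 0, ρ < (α + β) * D / (D * D) :=
      nhdsWithin_le_nhds (eventually_lt_nhds (by positivity))
    filter_upwards [hlt, self_mem_nhdsWithin] with ρ hρ1 (hρ : 0 < ρ)
    have e1 : α / (α + β) = α * D / ((α + β) * D) := by field_simp
    have e2 : β / (α + β) = β * D / ((α + β) * D) := by field_simp
    have e3 : ρ * D / (α + β) = ρ * (D * D) / ((α + β) * D) := by field_simp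
    refine ⟨o + (ρ * D / (α + β)) • (x - o), ?_, ?_⟩
    · rw [segment_eq_image']
      refine ⟨_, ⟨?_, ?_⟩, rfl⟩
      · rw [e3]; positivity
      · rw [e3, div_le_one hsum]
        rw [lt_div_iff₀ hDD] at hρ1
        exact hρ1.le
    · refine ⟨β / (α + β), α / (α + β), by rw [e2]; positivity, by rw [e1]; positivity,
        by field_simp; ring, ?_⟩
      have : (ρ * D / (α + β)) • (x - o) = (ρ / (α + β)) • (D • (x - o)) := by
        rw [smul_smul]; congr 1; ring
      rw [this, hx]
      have h3 : β / (α + β) = 1 - α / (α + β) := by field_simp; ring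
      rw [h3, smul_add (ρ / (α + β)), smul_smul (ρ / (α + β)), smul_smul (ρ / (α + β))]
      have h4 : ρ / (α + β) * β = ρ * (1 - α / (α + β)) := by field_simp; ring
      have h5 : ρ / (α + β) * α = ρ * (α / (α + β)) := by ring
      rw [h4, h5]
      module
  · right
    intro ρ hρ y hy hyT
    rw [segment_eq_image'] at hy
    obtain ⟨s, ⟨hs0, hs1⟩, rfl⟩ := hy
    obtain ⟨m, n, k, hm, hn, hk, hs, hy⟩ := mem_triangle_iff.1 hyT
    have e1 : s * β = k * (ρ * D) := by
      have := congrArg (tdet o p) hy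
      have h1 : tdet o p (o + s • (x - o)) = s * β := by simp [β, tdet]; ring
      have h2 : tdet o p (m • o + n • (o + ρ • (p - o)) + k • (o + ρ • (q - o))) = k * (ρ * D) := by
        rw [tdet_sum hs]; simp [D, tdet]; ring
      rw [h1, h2] at this
      exact this.symm
    have e2 : s * α = n * (ρ * D) := by
      have := congrArg (fun z => tdet o z q) hy
      have h1 : tdet o (o + s • (x - o)) q = s * α := by simp [α, tdet]; ring
      have h2 : tdet o (m • o + n • (o + ρ • (p - o)) + k • (o + ρ • (q - o))) q = n * (ρ * D) := by
        rw [tdet_swap_right, tdet_sum hs]; simp [D, tdet]; ring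
      simp only [h1, h2] at this
      exact this.symm
    have hs' : s = 0 := by
      by_contra hne
      have hspos : 0 < s := lt_of_le_of_ne hs0 (Ne.symm hne)
      have hDD := mul_self_pos.2 hD
      have f1 : s * (β * D) = k * ρ * (D * D) := by linear_combination D * e1
      have f2 : s * (α * D) = n * ρ * (D * D) := by linear_combination D * e2
      have g1 : 0 ≤ β * D := by
        by_contra hneg
        push Not at hneg
        have : 0 ≤ k * ρ * (D * D) := by positivity
        nlinarith
      have g2 : 0 ≤ α * D := by
        by_contra hneg
        push Not at hneg
        have : 0 ≤ n * ρ * (D * D) := by positivity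
        nlinarith
      have g2' : 0 < α * D := lt_of_le_of_ne g2 (Ne.symm (mul_ne_zero hα hD))
      have g1' : β * D = 0 := by
        by_contra h
        exact hcase ⟨g2', lt_of_le_of_ne g1 (Ne.symm h)⟩
      have hβ : β = 0 := (mul_eq_zero.1 g1').resolve_right hD
      rw [hβ, zero_smul, add_zero] at hx
      set r := α / D with hr
      have hr0 : 0 < r := by
        have : r = α * D / (D * D) := by rw [hr]; field_simp
        rw [this]; positivity
      have hxr : x - o = r • (p - o) := by
        rw [hr, div_eq_inv_mul, mul_smul, ← hx, smul_smul, inv_mul_cancel₀ hD, one_smul]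
      have := hray (o + (1 / (1 + r)) • (x - o)) (by
          rw [segment_eq_image']
          exact ⟨_, ⟨by positivity, by rw [div_le_one (by positivity)]; linarith⟩, rfl⟩) (by
          rw [segment_eq_image', hxr, smul_smul]
          exact ⟨_, ⟨by positivity, by rw [one_div_mul_eq_div, div_le_one (by positivity)]; linarith⟩,
            rfl⟩)
      have h0 : (1 / (1 + r)) • (x - o) = 0 := by simpa using this
      rcases smul_eq_zero.1 h0 with h' | h'
      · have : 0 < 1 / (1 + r) := by positivity
        linarith
      · apply hα
        have hxo : x = o := sub_eq_zero.1 h'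
        simp [α, hxo, tdet]
    simp [hs']

section tip

variable {F : Set (Sym2 Space)} {A X a u : Space}

set_option maxHeartbeats 1000000 in
/-- The first piece of the edge `Aa` is turned into a direction `u` on the same side of a plane
that contains the other edge at `A`. -/
theorem Reach.tip (h : Good b (insert s(A, a) (insert s(A, X) F)))
    (hne : s(A, a) ∉ insert s(A, X) F) (hF : ∀ f ∈ F, A ∉ f) {Λ : Space →ₗ[ℝ] ℝ}
    (hΛa : 0 < Λ (a - A)) (hΛu : 0 < Λ u) (hΛX : Λ (X - A) = 0)
    (hua : tdet (planeProj b A) (planeProj b a) (planeProj b A + planeProj b u) ≠ 0)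
    (huX : tdet (planeProj b A) (planeProj b A + planeProj b u) (planeProj b X) ≠ 0) :
    ∀ᶠ ρ : ℝ in 𝓝[>] 0, Reach b 1 (insert s(A, a) (insert s(A, X) F))
      (insert s(A, A + ρ • u) (insert s(a, A + ρ • u) (insert s(A, X) F))) := by
  have hfin : F.Finite := h.fin.subset fun e he => Or.inr (Or.inr he)
  have eF : ∀ {f}, f ∈ F → f ∈ insert s(A, a) (insert s(A, X) F) := fun hf => Or.inr (Or.inr hf)
  have eX : s(A, X) ∈ insert s(A, a) (insert s(A, X) F) := Or.inr (Or.inl rfl)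
  have hXa : s(A, X) ≠ s(A, a) := fun h' => hne (Or.inl h'.symm)
  have hfa : ∀ {f}, f ∈ F → f ≠ s(A, a) := fun hf h' => hF _ hf (h' ▸ by simp)
  have hfX : ∀ {f}, f ∈ F → f ≠ s(A, X) := fun hf h' => hF _ hf (h' ▸ by simp)
  have hAa := h.proj_ne (Or.inl rfl)
  have hAX := h.proj_ne eX
  have hadj : ∀ y ∈ segment ℝ (planeProj b A) (planeProj b X),
      y ∈ segment ℝ (planeProj b A) (planeProj b a) → y = planeProj b A := fun y hy hy' =>
    h.adj eX (Or.inl rfl) hXa (by simp) (by simp) (by rwa [sh_mk]) (by rwa [sh_mk])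
  have t1 : Tendsto (fun ρ : ℝ => A + ρ • u) (𝓝[>] 0) (𝓝 A) := Loc.tendsto_point A u _
  have t2 : Tendsto (fun ρ : ℝ => A + ρ • (a - A)) (𝓝[>] 0) (𝓝 A) := Loc.tendsto_point A (a - A) _
  have cst : ∀ x : Space, Tendsto (fun _ : ℝ => x) (𝓝[>] 0) (𝓝 x) := fun x => tendsto_const_nhds
  -- the small triangle is far from the other edges
  have small : ∀ᶠ ρ : ℝ in 𝓝[>] 0, ∀ f ∈ F, Disjoint (sh b f)
      (convexHull ℝ {planeProj b A, planeProj b (A + ρ • (a - A)), planeProj b (A + ρ • u)}) := by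
    rw [eventually_all_finite hfin]
    intro f hf
    have := h.not_mem_sh (Or.inl rfl) (eF hf) (v := A) (by simp) (hF f hf)
    obtain ⟨p, q, rfl⟩ := edgeSegment_eq_of_sym2 f
    rw [sh_mk] at this ⊢
    refine eventually_segment_triangle tendsto_const_nhds tendsto_const_nhds tendsto_const_nhds
      t2.proj t1.proj ?_
    rw [triangle_const]
    exact Set.disjoint_singleton_right.2 this
  -- the position of the edges relative to the long triangle
  have hends : ∀ p, planeProj b p ∉ segment ℝ (planeProj b A) (planeProj b a) →
      ∀ᶠ ρ : ℝ in 𝓝[>] 0, planeProj b p ∉ convexHull ℝ {planeProj b (A + ρ • u), planeProj b a,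
        planeProj b (A + ρ • (a - A))} := by
    intro p hp
    refine eventually_point_triangle tendsto_const_nhds t1.proj tendsto_const_nhds t2.proj ?_
    rwa [triangle_outer]
  have hXend := hends X fun hX => hAX (hadj _ (right_mem_segment ℝ _ _) hX).symm
  have long : ∀ᶠ ρ : ℝ in 𝓝[>] 0, ∀ f ∈ F, Avoids b (A + ρ • u) a (A + ρ • (a - A)) f ∨
      ((∀ p ∈ f, planeProj b p ∉ convexHull ℝ {planeProj b (A + ρ • u), planeProj b a,
        planeProj b (A + ρ • (a - A))}) ∧
      Disjoint (edgeSegment f) (convexHull ℝ {A + ρ • u, a, A + ρ • (a - A)})) := by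
    rw [eventually_all_finite hfin]
    intro f hf
    by_cases haf : a ∈ f
    · obtain ⟨y, rfl⟩ := exists_eq_mk_of_mem haf
      filter_upwards [eventually_cone (cst a).proj (cst y).proj t1.proj t2.proj
        (h.proj_ne (eF hf)).symm (by rw [segment_same]; exact hAa.symm)
        (fun x hx hx' => h.adj (eF hf) (Or.inl rfl) (hfa hf) (by simp) (by simp)
          (by rwa [sh_mk]) (by rwa [sh_mk, segment_symm, ← triangle_degenerate]))] with ρ hρ
      refine Or.inl fun x hx hx' => Or.inr (hρ x (by rwa [sh_mk] at hx) ?_)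
      rwa [triangle_swap]
    · have hsp := h.sp f (eF hf) s(A, a) (Or.inl rfl) (by
        intro v hv hv'
        rcases Sym2.mem_iff.1 hv' with rfl | rfl
        · exact hF f hf hv
        · exact haf hv)
      have hnv : ∀ p ∈ f, planeProj b p ∉ segment ℝ (planeProj b A) (planeProj b a) := by
        intro p hp
        rw [← sh_mk]
        refine h.not_mem_sh (eF hf) (Or.inl rfl) hp fun hp' => ?_
        rcases Sym2.mem_iff.1 hp' with rfl | rfl
        · exact hF f hf hp
        · exact haf hp
      obtain ⟨p, q, rfl⟩ := edgeSegment_eq_of_sym2 f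
      rw [edgeSegment_mk, edgeSegment_mk, ← triangle_outer A] at hsp
      filter_upwards [hends p (hnv p (by simp)), hends q (hnv q (by simp)),
        eventually_segment_triangle (cst p) (cst q) t1 (cst a) t2 hsp] with ρ k1 k2 k3
      refine Or.inr ⟨fun v hv => ?_, by rwa [edgeSegment_mk]⟩
      rcases Sym2.mem_iff.1 hv with rfl | rfl <;> assumption
  have pairs : ∀ᶠ ρ : ℝ in 𝓝[>] 0, ∀ e ∈ insert s(A, X) F, ∀ f ∈ insert s(A, X) F, e ≠ f →
      ∀ x ∈ sh b e, x ∈ sh b f → x ∉ convexHull ℝ {planeProj b (A + ρ • u), planeProj b a,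
        planeProj b (A + ρ • (a - A))} := by
    have hfin' := hfin.insert s(A, X)
    rw [eventually_all_finite hfin']
    intro e he
    rw [eventually_all_finite hfin']
    intro f hf
    rw [eventually_imp_distrib_left]
    intro hef
    have hn : ∀ {e}, e ∈ insert s(A, X) F → e ≠ s(A, a) := fun he h' => hne (h' ▸ he)
    have := fun x => h.tr e (Or.inr he) f (Or.inr hf) s(A, a) (Or.inl rfl) hef (hn he) (hn hf) x
    obtain ⟨p, q, rfl⟩ := edgeSegment_eq_of_sym2 e
    obtain ⟨p', q', rfl⟩ := edgeSegment_eq_of_sym2 f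
    simp only [sh_mk, ← triangle_outer (planeProj b A)] at this ⊢
    exact eventually_segments_triangle tendsto_const_nhds tendsto_const_nhds tendsto_const_nhds
      tendsto_const_nhds t1.proj tendsto_const_nhds t2.proj this
  have hlt : ∀ᶠ ρ : ℝ in 𝓝[>] 0, ρ < 1 := nhdsWithin_le_nhds (eventually_lt_nhds zero_lt_one)
  have hray : ∀ᶠ ρ : ℝ in 𝓝[>] 0,
      (∃ y ∈ sh b s(A, X), y ∈ openSegment ℝ (planeProj b (A + ρ • u))
        (planeProj b (A + ρ • (a - A)))) ∨
      ∀ y ∈ sh b s(A, X), y ∈ convexHull ℝ {planeProj b A, planeProj b (A + ρ • (a - A)),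
        planeProj b (A + ρ • u)} → y = planeProj b A := by
    have hq : ∀ ρ : ℝ, planeProj b (A + ρ • u) =
        planeProj b A + ρ • (planeProj b A + planeProj b u - planeProj b A) := fun ρ => by simp
    have hp : ∀ ρ : ℝ, planeProj b (A + ρ • (a - A)) =
        planeProj b A + ρ • (planeProj b a - planeProj b A) := fun ρ => by simp
    simp only [hq, hp, sh_mk]
    rcases ray_cases hua huX hadj with h' | h'
    · exact h'.mono fun ρ => Or.inl
    · filter_upwards [self_mem_nhdsWithin] with ρ hρ using Or.inr (h' ρ hρ)
  filter_upwards [small, hXend, long, pairs, hlt, hray, t1.proj.eventually_ne hAa,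
    self_mem_nhdsWithin] with ρ small hXend long pairs hρ1 hray hua' (hρ : 0 < ρ)
  have d1 : tdet (planeProj b A) (planeProj b (A + ρ • (a - A))) (planeProj b (A + ρ • u)) =
      ρ * ρ * tdet (planeProj b A) (planeProj b a) (planeProj b A + planeProj b u) := by
    simp [tdet]; ring
  have d2 : tdet (planeProj b (A + ρ • u)) (planeProj b a) (planeProj b (A + ρ • (a - A))) =
      - ((1 - ρ) * ρ * tdet (planeProj b A) (planeProj b a) (planeProj b A + planeProj b u)) := by
    simp [tdet]; ring
  have d3 : tdet (planeProj b A) (planeProj b (A + ρ • u)) (planeProj b X) =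
      ρ * tdet (planeProj b A) (planeProj b A + planeProj b u) (planeProj b X) := by
    simp [tdet]; ring
  have d4 : tdet (planeProj b A) (planeProj b (A + ρ • u)) (planeProj b a) =
      - (ρ * tdet (planeProj b A) (planeProj b a) (planeProj b A + planeProj b u)) := by
    simp [tdet]; ring
  have d5 : tdet (planeProj b A) (planeProj b (A + ρ • u)) (planeProj b (A + ρ • (a - A))) =
      - (ρ * ρ * tdet (planeProj b A) (planeProj b a) (planeProj b A + planeProj b u)) := by
    simp [tdet]; ring
  have hd1 : tdet (planeProj b A) (planeProj b (A + ρ • (a - A))) (planeProj b (A + ρ • u)) ≠ 0 := by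
    rw [d1]; exact mul_ne_zero (by positivity) hua
  have hd2 : tdet (planeProj b (A + ρ • u)) (planeProj b a) (planeProj b (A + ρ • (a - A))) ≠ 0 := by
    rw [d2]
    exact neg_ne_zero.2 (mul_ne_zero (mul_ne_zero (by linarith) hρ.ne') hua)
  have hd3 : tdet (planeProj b A) (planeProj b (A + ρ • u)) (planeProj b X) ≠ 0 := by
    rw [d3]; exact mul_ne_zero hρ.ne' huX
  have hl1 : Λ (A + ρ • u - A) = ρ * Λ u := by simp
  have hl2 : Λ (A + ρ • (a - A) - A) = ρ * Λ (a - A) := by simp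
  have hm1 : A + ρ • (a - A) ∈ openSegment ℝ A a :=
    ⟨1 - ρ, ρ, by linarith, hρ, by ring, by module⟩
  have hd4 : tdet (planeProj b A) (planeProj b (A + ρ • u)) (planeProj b a) ≠ 0 := by
    rw [d4]; exact neg_ne_zero.2 (mul_ne_zero hρ.ne' hua)
  generalize hv : A + ρ • u = v at *
  generalize hm : A + ρ • (a - A) = m at *
  have pm := proj_mem_openSegment (b := b) hm1
  have pms := openSegment_subset_segment ℝ _ _ pm
  have hAm : planeProj b A ≠ planeProj b m := tdet_ne_base hd1
  have hAv : planeProj b A ≠ planeProj b v := tdet_ne_base hd3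
  have hmv : planeProj b m ≠ planeProj b v := tdet_ne_right hd1
  have hvX : planeProj b v ≠ planeProj b X := tdet_ne_right hd3
  have ham : planeProj b a ≠ planeProj b m := tdet_ne_right hd2
  have hne' : ∀ {p q : Space}, planeProj b p ≠ planeProj b q → p ≠ q := fun h' e => h' (by rw [e])
  have hsmall : ∀ f ∈ F, planeProj b m ∉ sh b f ∧ planeProj b v ∉ sh b f := fun f hf =>
    ⟨Set.disjoint_right.1 (small f hf) (subset_convexHull ℝ _ (by simp)),
      Set.disjoint_right.1 (small f hf) (subset_convexHull ℝ _ (by simp))⟩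
  have hmF : ∀ e ∈ insert s(A, X) F, planeProj b m ∉ sh b e := by
    rintro e (rfl | he)
    · intro hx
      rw [sh_mk] at hx
      exact hAm (hadj _ hx pms).symm
    · exact (hsmall e he).1
  have hmfr : ∀ e ∈ insert s(A, X) F, m ∉ e := fun e he h' => hmF e he (vertex_mem_sh h')
  have hvfr : ∀ e ∈ insert s(A, X) F, v ∉ e := by
    rintro e (rfl | he)
    · simp [(hne' hAv).symm, hne' hvX]
    · exact fun h' => (hsmall e he).2 (vertex_mem_sh h')
  have hvX' : planeProj b v ∉ sh b s(A, X) := by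
    intro hx
    rw [sh_mk] at hx
    have := tdet_eq_zero_of_mem_segment hx
    rw [tdet_swap_right] at this
    exact hd3 (neg_eq_zero.1 this)
  have r1 := Reach.of_subdivide h hne hm1 hmF
  -- turn the first piece
  have hvall : ∀ e ∈ insert s(A, m) (insert s(a, m) (insert s(A, X) F)), v ∉ e := by
    rintro e (rfl | rfl | he)
    · simp [(hne' hAv).symm, (hne' hmv).symm]
    · simp [hne' hua', (hne' hmv).symm]
    · exact hvfr e he
  have hAmF : s(A, m) ∉ insert s(a, m) (insert s(A, X) F) := by
    rintro (h' | h')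
    · exact hne' hAa (Sym2.congr_left.1 h')
    · exact hmfr _ h' (by simp)
  have av1 : Avoids b A m v s(a, m) := by
    intro x hx hxT
    rw [sh_mk] at hx
    right
    have hline : tdet (planeProj b A) (planeProj b m) x = 0 := by
      have hxs : x ∈ segment ℝ (planeProj b A) (planeProj b a) := by
        have := segment_subset_of_openSegment (openSegment_symm_mem pm) hx
        rwa [segment_symm]
      exact tdet_eq_zero_trans hAa (tdet_self_left _ _) (tdet_eq_zero_of_mem_segment pms)
        (tdet_eq_zero_of_mem_segment hxs)
    obtain ⟨α, β, γ, h1, h2, h3, hs, rfl⟩ := mem_triangle_iff.1 hxT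
    rw [tdet_sum hs, tdet_self_left, tdet_self_right, mul_zero, mul_zero, zero_add, zero_add] at hline
    have hγ : γ = 0 := (mul_eq_zero.1 hline).resolve_right hd1
    refine openSegment_inter hAa pm ⟨α, β, h1, h2, by linarith, ?_⟩ hx
    rw [hγ, zero_smul, add_zero]
  have r2 : Reach b 1 (insert s(A, m) (insert s(a, m) (insert s(A, X) F)))
      (insert s(A, v) (insert s(m, v) (insert s(a, m) (insert s(A, X) F)))) := by
    have hgF : s(A, X) ∈ insert s(a, m) (insert s(A, X) F) := Or.inr (Or.inl rfl)
    have hrest : ∀ e ∈ insert s(a, m) (insert s(A, X) F), e ≠ s(A, X) → Avoids b A m v e := by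
      rintro e (rfl | rfl | he) hne
      · exact av1
      · exact absurd rfl hne
      · exact fun x hx hxT => absurd hxT (Set.disjoint_left.1 (small e he) hx)
    rcases hray with hray | hray
    · refine Reach.of_first r1.right hAmF hvall hd1 hrest hgF (by simp) ?_ hvX' hray
      intro p hp hpT
      rw [edgeSegment_mk, segment_eq_image'] at hp
      obtain ⟨s, -, rfl⟩ := hp
      obtain ⟨α, β, γ, h1, h2, h3, hs, hx⟩ := mem_triangle_iff.1 hpT
      have e : β * (ρ * Λ (a - A)) + γ * (ρ * Λ u) = 0 := by
        have e1 : s • (X - A) = β • (m - A) + γ • (v - A) := by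
          obtain rfl : α = 1 - β - γ := by linarith
          rw [← sub_eq_zero] at hx ⊢
          rw [← neg_eq_zero, ← hx]
          module
        have := congrArg Λ e1
        rw [map_smul, hΛX, map_add, map_smul, map_smul, hl1, hl2] at this
        simpa using this.symm
      have hβ : β = 0 := by
        by_contra hb
        have : 0 < β := lt_of_le_of_ne h2 (Ne.symm hb)
        have : 0 < β * (ρ * Λ (a - A)) := by positivity
        have : 0 ≤ γ * (ρ * Λ u) := by positivity
        linarith
      have hγ : γ = 0 := by
        rw [hβ, zero_mul, zero_add] at e
        exact (mul_eq_zero.1 e).resolve_right (by positivity)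
      rw [← hx, hβ, hγ, show α = 1 by linarith]
      simp
    · refine (Reach.of_crosses r1.right hAmF hvall hd1 (fun e he => Or.inl ?_) ?_).mono zero_le_one
      · by_cases hg : e = s(A, X)
        · subst hg
          exact fun x hx hxT => Or.inl (hray x hx hxT)
        · exact hrest e he hg
      · have npass : ∀ e ∈ insert s(a, m) (insert s(A, X) F), Passes b A m v e →
            ∀ x ∈ sh b e, x ∉ convexHull ℝ {planeProj b A, planeProj b m, planeProj b v} := by
          rintro e (rfl | rfl | he) hp
          · exact absurd (subset_convexHull ℝ _ (by simp)) (hp.ends m (by simp))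
          · exact absurd (subset_convexHull ℝ _ (by simp)) (hp.ends A (by simp))
          · exact fun x hx => Set.disjoint_left.1 (small e he) hx
        exact fun e he f hf _ hp _ x hx _ => npass e he hp x hx
  -- remove the vertex
  have hset : insert s(A, v) (insert s(m, v) (insert s(a, m) (insert s(A, X) F))) =
      insert s(v, m) (insert s(a, m) (insert s(A, v) (insert s(A, X) F))) := by
    ext e
    simp only [Set.mem_insert_iff, Sym2.eq_swap (a := v) (b := m)]
    tauto
  have g2 := r2.right
  rw [hset] at g2 r2
  have hAT : planeProj b A ∉ convexHull ℝ {planeProj b v, planeProj b a, planeProj b m} := by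
    intro hx
    obtain ⟨α, β, γ, h1, h2, h3, hs, hx⟩ := mem_triangle_iff.1 hx
    have e1 := congrArg (tdet (planeProj b A) (planeProj b v)) hx
    have e2 := congrArg (tdet (planeProj b A) (planeProj b a)) hx
    rw [tdet_sum hs, tdet_self_left, tdet_self_right, d4, d5] at e1
    rw [tdet_sum hs, tdet_self_left, tdet_self_right, tdet_eq_zero_of_mem_segment pms,
      mul_zero, mul_zero, add_zero, add_zero, tdet_swap_right, d4, neg_neg] at e2
    have hα : α = 0 := (mul_eq_zero.1 e2).resolve_right (mul_ne_zero hρ.ne' hua)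
    have e3 : ρ * tdet (planeProj b A) (planeProj b a) (planeProj b A + planeProj b u) *
        (β + γ * ρ) = 0 := by linear_combination -e1
    have : β + γ * ρ = 0 := (mul_eq_zero.1 e3).resolve_left (mul_ne_zero hρ.ne' hua)
    have hβ : β = 0 := by nlinarith [mul_nonneg h3 hρ.le]
    have hγ : γ = 0 := by
      rw [hβ, zero_add] at this
      exact (mul_eq_zero.1 this).resolve_right hρ.ne'
    linarith
  have av2 : Avoids b v a m s(A, v) := by
    intro x hx hxT
    rw [sh_mk] at hx
    left
    have hline := tdet_eq_zero_of_mem_segment hx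
    obtain ⟨α, β, γ, h1, h2, h3, hs, rfl⟩ := mem_triangle_iff.1 hxT
    rw [tdet_sum hs, tdet_self_right, d4, d5] at hline
    have e3 : ρ * tdet (planeProj b A) (planeProj b a) (planeProj b A + planeProj b u) *
        (β + γ * ρ) = 0 := by linear_combination -hline
    have : β + γ * ρ = 0 := (mul_eq_zero.1 e3).resolve_left (mul_ne_zero hρ.ne' hua)
    have hβ : β = 0 := by nlinarith [mul_nonneg h3 hρ.le]
    have hγ : γ = 0 := by
      rw [hβ, zero_add] at this
      exact (mul_eq_zero.1 this).resolve_right hρ.ne'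
    rw [hβ, hγ, show α = 1 by linarith]
    simp
  have thin : ∀ e ∈ insert s(A, v) (insert s(A, X) F), Avoids b v a m e ∨ Thin b v a m e := by
    rintro e (rfl | rfl | he)
    · exact Or.inl av2
    · refine Or.inr ⟨?_, Or.inr ?_, ?_⟩
      · intro p hp
        rcases Sym2.mem_iff.1 hp with rfl | rfl <;> assumption
      · rw [sh_mk]
        refine Set.disjoint_left.2 fun x hx hx' => ?_
        have hxa : x ∈ segment ℝ (planeProj b A) (planeProj b a) := by
          have := segment_subset_of_openSegment (openSegment_symm_mem pm) hx'
          rwa [segment_symm]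
        rw [hadj x hx hxa] at hx'
        exact openSegment_not_mem hAa.symm (openSegment_symm_mem pm) hx'
      · refine Set.disjoint_left.2 fun p hp hpT => ?_
        rw [edgeSegment_mk, segment_eq_image'] at hp
        obtain ⟨s, -, rfl⟩ := hp
        obtain ⟨α, β, γ, h1, h2, h3, hs, hx⟩ := mem_triangle_iff.1 hpT
        have e1 : s • (X - A) = α • (v - A) + β • (a - A) + γ • (m - A) := by
          obtain rfl : α = 1 - β - γ := by linarith
          rw [← sub_eq_zero] at hx ⊢
          rw [← neg_eq_zero, ← hx]
          module
        have e := congrArg Λ e1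
        rw [map_smul, hΛX, map_add, map_add, map_smul, map_smul, map_smul, hl1, hl2] at e
        simp only [smul_eq_mul, mul_zero] at e
        have k1 : 0 ≤ α * (ρ * Λ u) := by positivity
        have k2 : 0 ≤ β * Λ (a - A) := by positivity
        have k3 : 0 ≤ γ * (ρ * Λ (a - A)) := by positivity
        have hα : α = 0 := (mul_eq_zero.1 (show α * (ρ * Λ u) = 0 by linarith)).resolve_right
          (by positivity)
        have hβ : β = 0 := (mul_eq_zero.1 (show β * Λ (a - A) = 0 by linarith)).resolve_right
          (by positivity)
        have hγ : γ = 0 := (mul_eq_zero.1 (show γ * (ρ * Λ (a - A)) = 0 by linarith)).resolve_right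
          (by positivity)
        linarith
    · refine (long e he).imp_right fun hl => ⟨hl.1, Or.inl ?_, hl.2⟩
      refine (small e he).mono_right ?_
      rw [segment_symm]
      exact segment_subset_triangle₂₃
  have hvmAll : ∀ e ∈ insert s(A, v) (insert s(A, X) F), m ∉ e := by
    rintro e (rfl | he)
    · simp [(hne' hAm).symm, hne' hmv]
    · exact hmfr e he
  have hvaF : s(v, a) ∉ insert s(A, v) (insert s(A, X) F) := by
    rintro (h' | h')
    · rw [Sym2.eq_swap (a := A)] at h'
      exact hne' hAa (Sym2.congr_right.1 h').symm
    · exact hvfr _ h' (by simp)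
  have hpr : ∀ e ∈ insert s(A, v) (insert s(A, X) F), ∀ f ∈ insert s(A, v) (insert s(A, X) F),
      e ≠ f → Passes b v a m e → Passes b v a m f → ∀ x ∈ sh b e, x ∈ sh b f →
      x ∉ convexHull ℝ {planeProj b v, planeProj b a, planeProj b m} := by
    have np : ¬ Passes b v a m s(A, v) := fun hp =>
      hp.ends v (by simp) (subset_convexHull ℝ _ (by simp))
    rintro e (rfl | he) f (rfl | hf) hef h1 h2
    · exact absurd rfl hef
    · exact absurd h1 np
    · exact absurd h2 np
    · exact pairs e he f hf hef
  have g3 : Good b (insert s(v, a) (insert s(A, v) (insert s(A, X) F))) := by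
    refine g2.of_triangle_rev hvaF hvmAll hd2 (fun e he => (thin e he).imp_right Thin.passes) ?_
    exact fun e he f hf hef h1 h2 x hxe hxf hx =>
      hpr e he f hf hef h1 h2 x hxe hxf (segment_subset_triangle₁₂ hx)
  have r3 := Reach.of_crosses g3 hvaF (C := m) (by
      rintro e (rfl | he)
      · simp [hne' hmv, (hne' ham).symm]
      · exact hvmAll e he) hd2
    (fun e he => (thin e he).elim Or.inl fun ht => ht.avoids_or_crosses hd2) hpr
  have hset2 : insert s(v, a) (insert s(A, v) (insert s(A, X) F)) =
      insert s(A, v) (insert s(a, v) (insert s(A, X) F)) := by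
    rw [Set.insert_comm, Sym2.eq_swap (a := v)]
  rw [hset2] at r3
  exact (r1.trans (r2.trans r3.symm)).mono (by norm_num)

end tip

/-- The edges that end in `A` do not meet the triangle `APQ` elsewhere. -/
def MeetsAtTip (E : Set (Sym2 Space)) (A P Q : Space) : Prop :=
  ∀ e ∈ E, A ∈ e → ∀ x ∈ edgeSegment e, x ∈ convexHull ℝ {A, P, Q} → x = A

/-- The vertex with neighbours `A` and `B` can be moved from `P` to `Q`, if the other edges at `A`
and `B` are not in the way. -/
structure Track (b : OrthonormalBasis (Fin 3) ℝ Space) (E : Set (Sym2 Space)) (A B P Q : Space) :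
    Prop where
  goodP : Good b (Corner A B P E)
  goodQ : Good b (Corner A B Q E)
  halfA : HalfTrack b E A P Q
  halfB : HalfTrack b E B P Q
  sep : tdet (planeProj b P) (planeProj b Q) (planeProj b A) *
    tdet (planeProj b P) (planeProj b Q) (planeProj b B) < 0
  dbl : ∀ e ∈ E, ∀ f ∈ E, e ≠ f → ∀ x ∈ sh b e, x ∈ sh b f →
    x ∉ segment ℝ (planeProj b P) (planeProj b Q)
  lin : ∀ e ∈ E, (sh b e ∩ segment ℝ (planeProj b P) (planeProj b Q)).Subsingleton

theorem exists_linear {p q w : Space}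
    (hpq : tdet 0 (planeProj b p) (planeProj b q) ≠ 0) (hw : planeProj b w = 0) (hw0 : w ≠ 0) :
    ∃ Λ : Space →ₗ[ℝ] ℝ, Λ p = 0 ∧ Λ q = 0 ∧ 0 < Λ w := by
  have hmem : w ∉ Submodule.span ℝ {p, q} := by
    intro h
    obtain ⟨α, β, rfl⟩ := Submodule.mem_span_pair.1 h
    have h1 : α * tdet 0 (planeProj b p) (planeProj b q) = 0 := by
      have : tdet 0 (planeProj b (α • p + β • q)) (planeProj b q) = 0 := by rw [hw]; simp [tdet]
      rw [← this]; simp [tdet]; ring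
    have h2 : β * tdet 0 (planeProj b p) (planeProj b q) = 0 := by
      have : tdet 0 (planeProj b p) (planeProj b (α • p + β • q)) = 0 := by rw [hw]; simp [tdet]
      rw [← this]; simp [tdet]; ring
    rw [(mul_eq_zero.1 h1).resolve_right hpq, (mul_eq_zero.1 h2).resolve_right hpq] at hw0
    simp at hw0
  obtain ⟨f, hf, hle⟩ := Submodule.exists_le_ker_of_notMem hmem
  have hp : f p = 0 := hle (Submodule.subset_span (by simp))
  have hq : f q = 0 := hle (Submodule.subset_span (by simp))
  rcases lt_or_gt_of_ne hf with h | h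
  · exact ⟨-f, by simp [hp], by simp [hq], by simpa using h⟩
  · exact ⟨f, hp, hq, h⟩

namespace Track

variable {E : Set (Sym2 Space)} {A B P Q : Space}

theorem symm (h : Track b E A B P Q) : Track b E B A P Q :=
  ⟨by rw [Corner.swap]; exact h.goodP, by rw [Corner.swap]; exact h.goodQ, h.halfB, h.halfA,
    by rw [mul_comm]; exact h.sep, h.dbl, h.lin⟩

theorem detA (h : Track b E A B P Q) : tdet (planeProj b P) (planeProj b Q) (planeProj b A) ≠ 0 := by
  intro h0
  have := h.sep
  rw [h0] at this
  simp at this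

theorem A_ne_B (h : Track b E A B P Q) : planeProj b A ≠ planeProj b B := by
  intro h'
  have := h.sep
  rw [h'] at this
  nlinarith [mul_self_nonneg (tdet (planeProj b P) (planeProj b Q) (planeProj b B))]

theorem fresh (h : Track b E A B P Q) {X : Space} (hX : X = P ∨ X = Q) : ∀ e ∈ E, X ∉ e := by
  have mem : ∀ Y : Space, X ∈ convexHull ℝ {Y, P, Q} := fun Y =>
    subset_convexHull ℝ _ (by rcases hX with rfl | rfl <;> simp)
  intro e he hXe
  by_cases hA : A ∈ e
  · have hB : B ∉ e := by
      intro hB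
      have hAX : A ≠ X := by
        rintro rfl
        apply h.detA
        rcases hX with rfl | rfl
        · exact tdet_self_left _ _
        · exact tdet_self_right _ _
      have hAB : A ≠ B := fun h' => h.A_ne_B (by rw [h'])
      have := (Sym2.mem_and_mem_iff hAX).1 ⟨hA, hXe⟩
      rw [this, Sym2.mem_iff] at hB
      rcases hB with rfl | rfl
      · exact hAB rfl
      · apply h.symm.detA
        rcases hX with rfl | rfl
        · exact tdet_self_left _ _
        · exact tdet_self_right _ _
    exact Set.disjoint_left.1 (h.halfB.sp e he hB) (mem B) (mem_edgeSegment hXe)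
  · exact Set.disjoint_left.1 (h.halfA.sp e he hA) (mem A) (mem_edgeSegment hXe)

theorem sweep (h : Track b E A B P Q) (hA : Conical b E A P Q) (hB : Conical b E B P Q) :
    Sweep b E A B P Q :=
  ⟨h.goodP, ⟨h.halfA, hA⟩, ⟨h.halfB, hB⟩, h.sep, h.dbl, h.lin⟩

theorem A_notMem_triangle (h : Track b E A B P Q) :
    planeProj b A ∉ convexHull ℝ {planeProj b B, planeProj b P, planeProj b Q} := by
  intro hx
  obtain ⟨α, β, γ, h1, h2, h3, hs, hx⟩ := mem_triangle_iff.1 hx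
  have e := congrArg (tdet (planeProj b P) (planeProj b Q)) hx
  rw [tdet_sum hs, tdet_self_left, tdet_self_right, mul_zero, mul_zero, add_zero, add_zero] at e
  have := h.sep
  rw [← e] at this
  nlinarith [mul_self_nonneg (tdet (planeProj b P) (planeProj b Q) (planeProj b B))]

/-- A direction into which the edge that is in the way at `A` can be turned. -/
theorem exists_direction (h : Track b E A B P Q) {a : Space} (hs : ∀ x ∈ segment ℝ A a,
      x ∈ convexHull ℝ {A, P, Q} → x = A) {x : Plane}
    (hx : x ∈ segment ℝ (planeProj b A) (planeProj b a))
    (hxT : x ∈ convexHull ℝ {planeProj b A, planeProj b P, planeProj b Q})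
    (hxA : x ≠ planeProj b A) :
    ∃ (u : Space) (Λ : Space →ₗ[ℝ] ℝ), planeProj b u = planeProj b P - planeProj b Q ∧
      Λ (P - A) = 0 ∧ Λ (Q - A) = 0 ∧ 0 < Λ (a - A) ∧ 0 < Λ u ∧
      tdet (planeProj b A) (planeProj b a) (planeProj b A + planeProj b u) ≠ 0 := by
  rw [segment_eq_image'] at hx
  obtain ⟨r, ⟨hr0, hr1⟩, rfl⟩ := hx
  have hr : r ≠ 0 := by rintro rfl; simp at hxA
  have hrpos : 0 < r := lt_of_le_of_ne hr0 (Ne.symm hr)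
  obtain ⟨α, β, γ, h1, h2, h3, hsum, hx⟩ := mem_triangle_iff.1 hxT
  have hx : r • (planeProj b a - planeProj b A) =
      β • (planeProj b P - planeProj b A) + γ • (planeProj b Q - planeProj b A) := by
    obtain rfl : α = 1 - β - γ := by linarith
    rw [← sub_eq_zero] at hx ⊢
    rw [← neg_eq_zero, ← hx]
    module
  set w := r • (a - A) - β • (P - A) - γ • (Q - A) with hw
  have hw0 : planeProj b w = 0 := by
    simp only [hw, map_sub, map_smul, hx]
    abel
  have hwne : w ≠ 0 := by
    intro h0
    have := hs (A + r • (a - A)) (by rw [segment_eq_image']; exact ⟨r, ⟨hr0, hr1⟩, rfl⟩) (by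
      refine mem_triangle_iff.2 ⟨α, β, γ, h1, h2, h3, hsum, ?_⟩
      obtain rfl : α = 1 - β - γ := by linarith
      rw [← sub_eq_zero, ← neg_eq_zero, ← h0, hw]
      module)
    apply hxA
    have := congrArg (planeProj b) this
    simpa only [map_add, map_smul, map_sub] using this
  obtain ⟨Λ, hP, hQ, hΛw⟩ := exists_linear (b := b) (p := P - A) (q := Q - A) (w := w) (by
    intro h0
    apply h.detA
    rw [← h0]
    simp [tdet]; ring) hw0 hwne
  have hΛa : r * Λ (a - A) = Λ w := by
    have : Λ w = r • Λ (a - A) - β • Λ (P - A) - γ • Λ (Q - A) := by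
      rw [hw]; simp only [map_sub, map_smul]
    rw [this, hP, hQ]
    simp
  refine ⟨P - Q + w, Λ, by rw [map_add, hw0, add_zero, map_sub], hP, hQ, ?_, ?_, ?_⟩
  · by_contra hneg
    push Not at hneg
    nlinarith
  · have : Λ (P - Q + w) = Λ (P - A) - Λ (Q - A) + Λ w := by
      rw [← map_sub, ← map_add]; congr 1; abel
    rw [this, hP, hQ]
    simpa
  · rw [map_add, hw0, add_zero, map_sub]
    intro h0
    have e : r * tdet (planeProj b A) (planeProj b a) (planeProj b A +
        (planeProj b P - planeProj b Q)) = -((β + γ) *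
        tdet (planeProj b P) (planeProj b Q) (planeProj b A)) := by
      have e0 := congrArg (fun z : Plane => z 0) hx
      have e1 := congrArg (fun z : Plane => z 1) hx
      simp only [PiLp.smul_apply, PiLp.add_apply, PiLp.sub_apply, smul_eq_mul] at e0 e1
      simp only [tdet, PiLp.add_apply, PiLp.sub_apply]
      linear_combination (planeProj b P 1 - planeProj b Q 1) * e0 -
        (planeProj b P 0 - planeProj b Q 0) * e1
    rw [h0, mul_zero] at e
    have hβγ : β + γ = 0 := (mul_eq_zero.1 (neg_eq_zero.1 e.symm)).resolve_right h.detA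
    have hβ : β = 0 := by linarith
    have hγ : γ = 0 := by linarith
    rw [hβ, hγ, zero_smul, zero_smul, add_zero] at hx
    exact hxA (by simp only [hx, add_zero])

set_option maxHeartbeats 1000000 in
theorem tip (h : Track b E A B P Q) (hs : MeetsAtTip E A P Q) : ∃ E', Track b E' A B P Q ∧
    Conical b E' A P Q ∧ (MeetsAtTip E B P Q → MeetsAtTip E' B P Q) ∧
    (Conical b E B P Q → Conical b E' B P Q) ∧ E'.ncard ≤ E.ncard + 1 ∧
    Reach b 1 (Corner A B P E) (Corner A B P E') ∧
    Reach b 1 (Corner A B Q E) (Corner A B Q E') := by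
  by_cases hc : Conical b E A P Q
  · exact ⟨E, h, hc, id, id, Nat.le_succ _, (Reach.refl h.goodP).mono zero_le_one,
      (Reach.refl h.goodQ).mono zero_le_one⟩
  unfold Conical at hc
  push Not at hc
  obtain ⟨e, he, hAe, x, hx, hxT, hxA⟩ := hc
  obtain ⟨a, rfl⟩ := exists_eq_mk_of_mem hAe
  obtain ⟨F, hF, rfl⟩ : ∃ F, s(A, a) ∉ F ∧ E = insert s(A, a) F :=
    ⟨E \ {s(A, a)}, by simp, (Loc.insert_diff he).symm⟩
  have hsa := hs _ (Or.inl rfl) (by simp)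
  rw [edgeSegment_mk] at hsa
  rw [sh_mk] at hx
  obtain ⟨u, Λ, hu, hΛP, hΛQ, hΛa, hΛu, hua⟩ := h.exists_direction hsa hx hxT hxA
  have frP := h.fresh (Or.inl rfl)
  have frQ := h.fresh (Or.inr rfl)
  have hA : ∀ f ∈ F, A ∉ f := fun f hf hAf => h.goodP.not_three (e := s(A, P)) (f := s(A, a)) (g := f)
    (Or.inl rfl) (Or.inr (Or.inr (Or.inl rfl))) (Or.inr (Or.inr (Or.inr hf)))
    (fun h' => frP _ (Or.inl rfl) (h' ▸ by simp)) (fun h' => frP _ (Or.inr hf) (h' ▸ by simp))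
    (fun h' => hF (h' ▸ hf)) (by simp) (by simp) hAf
  have hFfin : F.Finite := h.goodP.fin.subset fun e he => Or.inr (Or.inr (Or.inr he))
  have hAB := h.A_ne_B
  have hAB' : A ≠ B := fun h' => hAB (by rw [h'])
  have hset : ∀ X, Corner A B X (insert s(A, a) F) =
      insert s(A, a) (insert s(A, X) (insert s(B, X) F)) := fun X => by
    ext e; simp only [Set.mem_insert_iff]; tauto
  have hset' : ∀ X v, Corner A B X (insert s(A, v) (insert s(a, v) F)) =
      insert s(A, v) (insert s(a, v) (insert s(A, X) (insert s(B, X) F))) := fun X v => by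
    ext e; simp only [Set.mem_insert_iff]; tauto
  have step : ∀ X, (X = P ∨ X = Q) → Good b (Corner A B X (insert s(A, a) F)) →
      ∀ᶠ ρ : ℝ in 𝓝[>] 0, Reach b 1 (Corner A B X (insert s(A, a) F))
        (Corner A B X (insert s(A, A + ρ • u) (insert s(a, A + ρ • u) F))) := by
    intro X hX hg
    have fr := h.fresh hX
    have hAX : A ≠ X := by
      rintro rfl
      rcases hX with rfl | rfl
      · exact h.detA (tdet_self_left _ _)
      · exact h.detA (tdet_self_right _ _)
    rw [hset] at hg
    simp only [hset, hset']
    refine Reach.tip hg ?_ ?_ hΛa hΛu ?_ hua ?_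
    · rintro (h' | h' | h')
      · exact fr _ (Or.inl rfl) (h' ▸ by simp)
      · exact fr _ (Or.inl rfl) (h' ▸ by simp)
      · exact hF h'
    · rintro f (rfl | hf)
      · simp [hAB', hAX]
      · exact hA f hf
    · rcases hX with rfl | rfl <;> assumption
    · intro h0
      apply h.detA
      rw [hu] at h0
      rw [← h0]
      rcases hX with rfl | rfl
      · simp [tdet]; ring
      · simp [tdet]; ring
  have t : Tendsto (fun ρ : ℝ => A + ρ • u) (𝓝[>] 0) (𝓝 A) := Loc.tendsto_point A u _
  have cst : ∀ x : Space, Tendsto (fun _ : ℝ => x) (𝓝[>] 0) (𝓝 x) := fun x => tendsto_const_nhds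
  have hAT := h.A_notMem_triangle
  have hAT' : A ∉ convexHull ℝ {B, P, Q} := fun h' => hAT (proj_mem_triangle h')
  have hPQ : planeProj b P ≠ planeProj b Q := tdet_ne_base h.detA
  have hBPQ : ∀ x ∈ segment ℝ (planeProj b P) (planeProj b Q), x ≠ planeProj b B := by
    rintro x hx rfl
    exact h.symm.detA (tdet_eq_zero_of_mem_segment hx)
  have hAPQ : planeProj b A ∉ segment ℝ (planeProj b P) (planeProj b Q) := fun hx =>
    h.detA (tdet_eq_zero_of_mem_segment hx)
  have k1 : ∀ᶠ ρ : ℝ in 𝓝[>] 0, Disjoint (convexHull ℝ {B, P, Q}) (segment ℝ A (A + ρ • u)) := by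
    filter_upwards [eventually_segment_triangle (cst A) t (cst B) (cst P) (cst Q)
      (by rw [segment_same]; exact Set.disjoint_singleton_left.2 hAT')] with ρ hρ using hρ.symm
  have k2 : ∀ᶠ ρ : ℝ in 𝓝[>] 0, B ≠ a →
      Disjoint (convexHull ℝ {B, P, Q}) (segment ℝ a (A + ρ • u)) := by
    rw [Filter.eventually_imp_distrib_left]
    intro hBa
    have := h.halfB.sp s(A, a) (Or.inl rfl) (by simp [hBa, Ne.symm hAB'])
    rw [edgeSegment_mk, segment_symm] at this
    filter_upwards [eventually_segment_triangle (cst a) t (cst B) (cst P) (cst Q) this.symm]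
      with ρ hρ using hρ.symm
  have k3 : ∀ᶠ ρ : ℝ in 𝓝[>] 0, B ≠ a →
      tdet (planeProj b B) (planeProj b a) (planeProj b (A + ρ • u)) ≠ 0 := by
    rw [Filter.eventually_imp_distrib_left]
    intro hBa
    refine (tendsto_const_nhds.tdet tendsto_const_nhds t.proj).eventually_ne ?_
    exact h.halfB.nc a A (by rw [Sym2.eq_swap]; exact Or.inl rfl) (by simp [hBa, Ne.symm hAB'])
  have k4 : ∀ᶠ ρ : ℝ in 𝓝[>] 0, Disjoint (segment ℝ (planeProj b A) (planeProj b (A + ρ • u)))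
      (segment ℝ (planeProj b P) (planeProj b Q)) := by
    refine eventually_segments tendsto_const_nhds t.proj tendsto_const_nhds tendsto_const_nhds ?_
    rw [segment_same]
    exact Set.disjoint_singleton_left.2 hAPQ
  have k5 : ∀ᶠ ρ : ℝ in 𝓝[>] 0, ∀ f ∈ F,
      ∀ x ∈ segment ℝ (planeProj b a) (planeProj b (A + ρ • u)), x ∈ sh b f →
      x ∉ segment ℝ (planeProj b P) (planeProj b Q) := by
    rw [eventually_all_finite hFfin]
    intro f hf
    have := h.dbl s(A, a) (Or.inl rfl) f (Or.inr hf) (fun h' => hF (h' ▸ hf))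
    obtain ⟨p, q, rfl⟩ := edgeSegment_eq_of_sym2 f
    simp only [sh_mk, segment_symm ℝ (planeProj b A), ← triangle_degenerate (planeProj b P)] at this ⊢
    exact eventually_segments_triangle tendsto_const_nhds t.proj tendsto_const_nhds
      tendsto_const_nhds tendsto_const_nhds tendsto_const_nhds tendsto_const_nhds this
  have k6 : ∀ᶠ ρ : ℝ in 𝓝[>] 0,
      tdet (planeProj b P) (planeProj b Q) (planeProj b (A + ρ • u)) ≠ 0 :=
    (tendsto_const_nhds.tdet tendsto_const_nhds t.proj).eventually_ne h.detA
  have k7 : ∀ᶠ ρ : ℝ in 𝓝[>] 0, B = a → MeetsAtTip (insert s(A, a) F) B P Q →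
      ∀ x ∈ segment ℝ a (A + ρ • u), x ∈ convexHull ℝ {B, P, Q} → x = B := by
    rw [Filter.eventually_imp_distrib_left]
    rintro rfl
    rw [Filter.eventually_imp_distrib_left]
    intro hp
    refine eventually_cone (cst B) t (cst P) (cst Q) hAB'
      (fun hx => hBPQ _ (proj_mem_segment hx) rfl) fun x hx hx' => ?_
    exact hp _ (Or.inl rfl) (by simp) x (by rwa [edgeSegment_mk, segment_symm]) hx'
  have k8 : ∀ᶠ ρ : ℝ in 𝓝[>] 0, B = a → Conical b (insert s(A, a) F) B P Q →
      ∀ x ∈ segment ℝ (planeProj b a) (planeProj b (A + ρ • u)),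
      x ∈ convexHull ℝ {planeProj b B, planeProj b P, planeProj b Q} → x = planeProj b B := by
    rw [Filter.eventually_imp_distrib_left]
    rintro rfl
    rw [Filter.eventually_imp_distrib_left]
    intro hp
    refine eventually_cone tendsto_const_nhds t.proj tendsto_const_nhds tendsto_const_nhds hAB
      (fun hx => hBPQ _ hx rfl) fun x hx hx' => ?_
    exact hp _ (Or.inl rfl) (by simp) x (by rwa [sh_mk, segment_symm]) hx'
  obtain ⟨ρ, ⟨⟨⟨⟨rP, rQ⟩, k1, k2⟩, ⟨k3, k4⟩, k5, k6⟩, k7, k8, k9⟩, hρ⟩ :=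
    (((((step P (Or.inl rfl) h.goodP).and (step Q (Or.inr rfl) h.goodQ)).and (k1.and k2)).and
      ((k3.and k4).and (k5.and k6))).and (k7.and (k8.and (t.proj.eventually_ne hAB)))).and
      self_mem_nhdsWithin |>.exists
  have hρ : 0 < ρ := hρ
  have gP := rP.right
  have ev : s(A, A + ρ • u) ∈ Corner A B P (insert s(A, A + ρ • u) (insert s(a, A + ρ • u) F)) :=
    Or.inr (Or.inr (Or.inl rfl))
  have ev' : s(a, A + ρ • u) ∈ Corner A B P (insert s(A, A + ρ • u) (insert s(a, A + ρ • u) F)) :=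
    Or.inr (Or.inr (Or.inr (Or.inl rfl)))
  have hAv := gP.ne ev
  have hAa : A ≠ a := h.goodP.ne (Or.inr (Or.inr (Or.inl rfl)))
  have hav := gP.proj_ne ev'
  have hBv : B ≠ A + ρ • u := fun h' => k9 (by rw [← h'])
  have hd : tdet (planeProj b A) (planeProj b a) (planeProj b (A + ρ • u)) ≠ 0 := by
    have : tdet (planeProj b A) (planeProj b a) (planeProj b (A + ρ • u)) =
        ρ * tdet (planeProj b A) (planeProj b a) (planeProj b A + planeProj b u) := by
      simp [tdet]; ring
    rw [this]
    exact mul_ne_zero hρ.ne' hua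
  have hdB : tdet (planeProj b B) (planeProj b A) (planeProj b (A + ρ • u)) ≠ 0 := by
    have : tdet (planeProj b B) (planeProj b A) (planeProj b (A + ρ • u)) =
        ρ * (tdet (planeProj b P) (planeProj b Q) (planeProj b A) -
          tdet (planeProj b P) (planeProj b Q) (planeProj b B)) := by
      rw [map_add, map_smul, hu]
      simp [tdet]; ring
    rw [this]
    refine mul_ne_zero hρ.ne' fun h0 => ?_
    have h1 := h.sep
    rw [sub_eq_zero.1 h0] at h1
    nlinarith [mul_self_nonneg (tdet (planeProj b P) (planeProj b Q) (planeProj b B))]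
  have nc_mk : ∀ {z p q u' w' : Space}, tdet (planeProj b z) (planeProj b p) (planeProj b q) ≠ 0 →
      s(u', w') = s(p, q) → tdet (planeProj b z) (planeProj b u') (planeProj b w') ≠ 0 := by
    intro z p q u' w' hd h'
    rcases Sym2.eq_iff.1 h' with ⟨rfl, rfl⟩ | ⟨rfl, rfl⟩
    · exact hd
    · rw [tdet_swap_right]
      exact neg_ne_zero.2 hd
  have hΛv : Λ (A + ρ • u - A) = ρ * Λ u := by simp
  have hv : planeProj b (A + ρ • u) - planeProj b A = ρ • (planeProj b P - planeProj b Q) := by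
    rw [map_add, map_smul, hu]; abel
  generalize A + ρ • u = v at *
  refine ⟨insert s(A, v) (insert s(a, v) F), ⟨gP, rQ.right, ⟨?_, ?_⟩, ⟨?_, ?_⟩, h.sep, ?_, ?_⟩,
    ?_, ?_, ?_, ?_, rP, rQ⟩
  · rintro e (rfl | rfl | he) hAe
    · simp at hAe
    · refine Set.disjoint_left.2 fun p hp hp' => ?_
      rw [edgeSegment_mk] at hp'
      obtain ⟨α, β, h1, h2, h3, rfl⟩ := hp'
      obtain ⟨α', β', γ', h1', h2', h3', h4', hx⟩ := mem_triangle_iff.1 hp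
      have e1 : β' • (P - A) + γ' • (Q - A) = α • (a - A) + β • (v - A) := by
        obtain rfl : α' = 1 - β' - γ' := by linarith
        obtain rfl : α = 1 - β := by linarith
        rw [← sub_eq_zero] at hx ⊢
        rw [← hx]
        module
      have e2 := congrArg Λ e1
      rw [map_add, map_add, map_smul, map_smul, map_smul, map_smul, hΛP, hΛQ, hΛv] at e2
      simp only [smul_eq_mul, mul_zero, add_zero] at e2
      have f1 : 0 ≤ α * Λ (a - A) := by positivity
      have f2 : 0 ≤ β * (ρ * Λ u) := by positivity
      have hα : α = 0 := (mul_eq_zero.1 (show α * Λ (a - A) = 0 by linarith)).resolve_right hΛa.ne'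
      have hβ : β = 0 := (mul_eq_zero.1 (show β * (ρ * Λ u) = 0 by linarith)).resolve_right
        (by positivity)
      linarith
    · exact h.halfA.sp e (Or.inr he) hAe
  · rintro u' w' (h' | h' | h') hAe
    · rw [h'] at hAe; simp at hAe
    · exact nc_mk hd h'
    · exact h.halfA.nc u' w' (Or.inr h') hAe
  · rintro e (rfl | rfl | he) hBe
    · rwa [edgeSegment_mk]
    · rw [edgeSegment_mk]
      exact k2 fun h' => hBe (h' ▸ by simp)
    · exact h.halfB.sp e (Or.inr he) hBe
  · rintro u' w' (h' | h' | h') hBe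
    · exact nc_mk hdB h'
    · exact nc_mk (k3 fun h'' => hBe (h' ▸ h'' ▸ by simp)) h'
    · exact h.halfB.nc u' w' (Or.inr h') hBe
  · have first : ∀ x ∈ sh b s(A, v), x ∉ segment ℝ (planeProj b P) (planeProj b Q) := by
      intro x hx
      rw [sh_mk] at hx
      exact Set.disjoint_left.1 k4 hx
    rintro e (rfl | rfl | he) f (rfl | rfl | hf) hef x hxe hxf
    · exact absurd rfl hef
    · exact first x hxe
    · exact first x hxe
    · exact first x hxf
    · exact absurd rfl hef
    · rw [sh_mk] at hxe
      exact k5 f hf x hxe hxf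
    · exact first x hxf
    · rw [sh_mk] at hxf
      exact k5 e he x hxf hxe
    · exact h.dbl e (Or.inr he) f (Or.inr hf) hef x hxe hxf
  · rintro e (rfl | rfl | he)
    · rintro x ⟨hx, hx'⟩
      rw [sh_mk] at hx
      exact absurd hx' (Set.disjoint_left.1 k4 hx)
    · rintro x ⟨hx, hx'⟩ y ⟨hy, hy'⟩
      rw [sh_mk] at hx hy
      by_contra hne
      have l1 := tdet_eq_zero_of_mem_segment hx
      have l2 := tdet_eq_zero_of_mem_segment hy
      have m1 := tdet_eq_zero_of_mem_segment hx'
      have m2 := tdet_eq_zero_of_mem_segment hy'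
      exact k6 (tdet_eq_zero_trans hne (tdet_eq_zero_trans hPQ m1 m2 (tdet_self_left _ _))
        (tdet_eq_zero_trans hPQ m1 m2 (tdet_self_right _ _))
        (tdet_eq_zero_trans hav l1 l2 (tdet_self_right _ _)))
    · exact h.lin e (Or.inr he)
  · rintro e (rfl | rfl | he) hAe x hx hxT
    · rw [sh_mk, segment_eq_image'] at hx
      obtain ⟨s, ⟨hs0, -⟩, rfl⟩ := hx
      simp only [hv, smul_smul] at hxT ⊢
      obtain ⟨α, β, γ, h1, h2, h3, h4, hx⟩ := mem_triangle_iff.1 hxT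
      have e := congrArg (tdet (planeProj b A) (planeProj b P)) hx
      rw [tdet_sum h4, tdet_self_left, tdet_self_right] at e
      have e' : (γ + s * ρ) * tdet (planeProj b P) (planeProj b Q) (planeProj b A) = 0 := by
        rw [← tdet_rotate] at e
        simp only [tdet, PiLp.add_apply, PiLp.smul_apply, PiLp.sub_apply, smul_eq_mul] at e ⊢
        linear_combination e
      have h5 := (mul_eq_zero.1 e').resolve_right h.detA
      have : s * ρ = 0 := by nlinarith [mul_nonneg hs0 hρ.le]
      rw [this, zero_smul, add_zero]
    · exact absurd hAe (by simp [hAa, hAv])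
    · exact absurd hAe (hA e he)
  · rintro hp e (rfl | rfl | he) hBe
    · exact absurd hBe (by simp [Ne.symm hAB', hBv])
    · rw [edgeSegment_mk]
      exact k7 ((Sym2.mem_iff.1 hBe).resolve_right hBv) hp
    · exact hp e (Or.inr he) hBe
  · rintro hp e (rfl | rfl | he) hBe
    · exact absurd hBe (by simp [Ne.symm hAB', hBv])
    · rw [sh_mk]
      exact k8 ((Sym2.mem_iff.1 hBe).resolve_right hBv) hp
    · exact hp e (Or.inr he) hBe
  · rw [Set.ncard_insert_of_notMem hF hFfin]
    exact (Set.ncard_insert_le _ _).trans (Nat.succ_le_succ (Set.ncard_insert_le _ _))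

/-- The cost of moving a vertex along a segment. -/
theorem reach (h : Track b E A B P Q) (hA : MeetsAtTip E A P Q) (hB : MeetsAtTip E B P Q) :
    Reach b ((E.ncard + 2) * (E.ncard + 3) + 4) (Corner A B P E) (Corner A B Q E) := by
  obtain ⟨E₁, h1, c1, p1, -, n1, r1, r1'⟩ := h.tip hA
  obtain ⟨E₂, h2, c2, -, c1', n2, r2, r2'⟩ := h1.symm.tip (p1 hB)
  rw [Corner.swap B A, Corner.swap B A] at r2 r2'
  have r3 := (h2.symm.sweep (c1' c1) c2).reach h2.symm.goodQ
  refine (((r1.trans r2).trans r3).trans (r2'.symm.trans r1'.symm)).mono ?_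
  have hle : E₂.ncard ≤ E.ncard + 2 := by omega
  have := Nat.mul_le_mul hle (Nat.succ_le_succ hle)
  simp only [Nat.succ_eq_add_one] at this
  linarith

end Track

/-! ### Moving a corner of a link across a triangle -/

/-- The midpoint of `A` and `B`. -/
noncomputable def mid (A B : Space) : Space := (2⁻¹ : ℝ) • (A + B)

theorem mid_comm (A B : Space) : mid A B = mid B A := by rw [mid, mid, add_comm]

theorem mid_mem (A B : Space) : mid A B ∈ openSegment ℝ A B :=
  ⟨2⁻¹, 2⁻¹, by norm_num, by norm_num, by norm_num, by rw [mid, smul_add]⟩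

theorem map_update_corner {A B v : Space} {F : Set (Sym2 Space)} (hA : A ≠ v) (hB : B ≠ v)
    (hv : ∀ e ∈ F, v ∉ e) (φ : Space → Space) (y : Space) :
    Sym2.map (Function.update φ v y) '' Corner A B v F =
      Corner (φ A) (φ B) y (Sym2.map φ '' F) := by
  have : Sym2.map (Function.update φ v y) '' F = Sym2.map φ '' F :=
    Set.image_congr fun e he => Sym2.map_congr_on fun x hx =>
      Function.update_of_ne (by rintro rfl; exact hv e he hx) _ _
  rw [Corner.map, this, Function.update_self, Function.update_of_ne hA, Function.update_of_ne hB]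

theorem tendsto_update {ι : Type*} {l : Filter ι} {φ : ι → Space → Space} {p : ι → Space} {v : Space}
    (hφ : ∀ x, Tendsto (fun i => φ i x) l (𝓝 x)) (hp : Tendsto p l (𝓝 v)) (x : Space) :
    Tendsto (fun i => Function.update (φ i) v (p i) x) l (𝓝 x) := by
  by_cases hx : x = v
  · subst hx
    simpa only [Function.update_self] using hp
  · simpa only [Function.update_of_ne hx] using hφ x

/-- The edges `AZ` and `BZ` can be moved across the triangle `ABZ`. -/
structure Arc (E : Set (Sym2 Space)) (A B Z : Space) : Prop where
  two : TwoRegular (Corner A B Z E)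
  fresh : ∀ e ∈ E, Z ∉ e
  sp : Separated E
  edge : ∀ e ∈ E, ∀ x ∈ edgeSegment e, x ∈ convexHull ℝ {A, B, Z} → x = A ∧ A ∈ e ∨ x = B ∧ B ∈ e
  notA : A ∉ convexHull ℝ {B, mid A B, Z}
  notB : B ∉ convexHull ℝ {A, mid A B, Z}

namespace Arc

variable {E : Set (Sym2 Space)} {A B Z Z' : Space}

theorem symm (h : Arc E A B Z) : Arc E B A Z :=
  ⟨by rw [Corner.swap]; exact h.two, h.fresh, h.sp,
    fun e he x hx hx' => (h.edge e he x hx (by rwa [triangle_swap])).symm,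
    by rw [mid_comm]; exact h.notB, by rw [mid_comm]; exact h.notA⟩

theorem ne (h : Arc E A B Z) : A ≠ B := by
  rintro rfl
  exact h.notA (subset_convexHull ℝ _ (by simp))

theorem half_subset (A B Z : Space) :
    convexHull ℝ {A, mid A B, Z} ⊆ convexHull ℝ {A, B, Z} := by
  refine convexHull_min ?_ (convex_convexHull ℝ _)
  rintro x (rfl | rfl | rfl)
  · exact subset_convexHull ℝ _ (by simp)
  · exact segment_subset_triangle₁₂ (openSegment_subset_segment ℝ _ _ (mid_mem _ _))
  · exact subset_convexHull ℝ _ (by simp)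

theorem disjoint (h : Arc E A B Z) {e : Sym2 Space} (he : e ∈ E) (hA : A ∉ e) :
    Disjoint (convexHull ℝ {A, mid A B, Z}) (edgeSegment e) := by
  refine Set.disjoint_left.2 fun x hx hx' => ?_
  rcases h.edge e he x hx' (half_subset _ _ _ hx) with ⟨-, h1⟩ | ⟨rfl, -⟩
  · exact hA h1
  · exact h.notB hx

theorem eq_tip (h : Arc E A B Z) {e : Sym2 Space} (he : e ∈ E) {x : Space} (hx : x ∈ edgeSegment e)
    (hx' : x ∈ convexHull ℝ {A, mid A B, Z}) : x = A := by
  rcases h.edge e he x hx (half_subset _ _ _ hx') with ⟨h1, -⟩ | ⟨rfl, -⟩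
  · exact h1
  · exact absurd hx' h.notB

theorem separated (h : Arc E A B Z) {y : Space} (hA : y ∈ convexHull ℝ {A, mid A B, Z})
    (hB : y ∈ convexHull ℝ {B, mid B A, Z}) : Separated (Corner A B y E) := by
  have key : ∀ {A B}, Arc E A B Z → y ∈ convexHull ℝ {A, mid A B, Z} → ∀ f ∈ E,
      (∀ v ∈ s(A, y), v ∉ f) → Disjoint (edgeSegment s(A, y)) (edgeSegment f) := by
    intro A B h hy f hf hv
    rw [edgeSegment_mk]
    exact (h.disjoint hf (hv A (by simp))).mono_left ((convex_convexHull ℝ _).segment_subset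
      (subset_convexHull ℝ _ (by simp)) hy)
  rintro e (rfl | rfl | he) f (rfl | rfl | hf) hv
  · exact absurd (hv y (by simp)) (by simp)
  · exact absurd (hv y (by simp)) (by simp)
  · exact key h hA f hf hv
  · exact absurd (hv y (by simp)) (by simp)
  · exact absurd (hv y (by simp)) (by simp)
  · exact key h.symm hB f hf hv
  · exact (key h hA e he fun v hv' hve => hv v hve hv').symm
  · exact (key h.symm hB e he fun v hv' hve => hv v hve hv').symm
  · exact h.sp e he f hf hv

theorem mid_ne (h : Arc E A B Z) : A ≠ mid A B := fun h' =>
  h.notA (h' ▸ subset_convexHull ℝ _ (by simp))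

theorem mid_fresh (h : Arc E A B Z) : ∀ e ∈ E, mid A B ∉ e := fun e he hm =>
  h.mid_ne (h.eq_tip he (mem_edgeSegment hm) (subset_convexHull ℝ _ (by simp))).symm

theorem eventually_half {ι : Type*} {l : Filter ι} (h : Arc E A B Z) {ψ : ι → Space → Space}
    {P : ι → Space} (hψ : ∀ x, Tendsto (fun i => ψ i x) l (𝓝 x)) (hP : Tendsto P l (𝓝 (mid A B))) :
    ∀ᶠ i in l, ∀ e ∈ E,
      (A ∉ e → Disjoint (convexHull ℝ {ψ i A, P i, ψ i Z}) (edgeSegment (Sym2.map (ψ i) e))) ∧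
      (A ∈ e → ∀ x ∈ edgeSegment (Sym2.map (ψ i) e), x ∈ convexHull ℝ {ψ i A, P i, ψ i Z} →
        x = ψ i A) := by
  rw [eventually_all_finite (h.two.fin.subset fun e he => Or.inr (Or.inr he))]
  intro e he
  by_cases hA : A ∈ e
  · obtain ⟨u, rfl⟩ := exists_eq_mk_of_mem hA
    have hAu : u ≠ A := fun h' => h.two.nd _ (Or.inr (Or.inr he)) (Sym2.mk_isDiag_iff.2 h'.symm)
    filter_upwards [eventually_cone (hψ A) (hψ u) hP (hψ Z) hAu
      (fun hx => h.notA (segment_subset_triangle₂₃ hx))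
      (fun x hx hx' => h.eq_tip he (by rwa [edgeSegment_mk]) hx')] with i hi
    refine ⟨fun h' => absurd hA h', fun _ x hx hx' => hi x ?_ hx'⟩
    rwa [Sym2.map_mk, edgeSegment_mk] at hx
  · have := h.disjoint he hA
    obtain ⟨u, w, rfl⟩ := edgeSegment_eq_of_sym2 e
    rw [edgeSegment_mk] at this
    filter_upwards [eventually_segment_triangle (hψ u) (hψ w) (hψ A) hP (hψ Z) this.symm] with i hi
    refine ⟨fun _ => ?_, fun h' => absurd h' hA⟩
    rw [Sym2.map_mk, edgeSegment_mk]
    exact hi.symm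

/-- The data of one side of a track. -/
theorem half_track {E : Set (Sym2 Space)} {V : Set Space} {φ : Space → Space} {A p q : Space}
    (hE : ∀ e ∈ E, ¬ e.IsDiag) (hV : verts E ⊆ V) (hA : A ∈ V)
    (hinj : Set.InjOn (fun x => planeProj b (φ x)) V) (hg : SG ((fun x => planeProj b (φ x)) '' V))
    (hs : ∀ e ∈ E, (A ∉ e → Disjoint (convexHull ℝ {φ A, p, q}) (edgeSegment (Sym2.map φ e))) ∧
      (A ∈ e → ∀ x ∈ edgeSegment (Sym2.map φ e), x ∈ convexHull ℝ {φ A, p, q} → x = φ A)) :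
    HalfTrack b (Sym2.map φ '' E) (φ A) p q ∧ MeetsAtTip (Sym2.map φ '' E) (φ A) p q := by
  have mem : ∀ {e}, A ∈ e → φ A ∈ Sym2.map φ e := fun h => Sym2.mem_map.2 ⟨A, h, rfl⟩
  refine ⟨⟨?_, ?_⟩, ?_⟩
  · rintro _ ⟨e, he, rfl⟩ hAe
    exact (hs e he).1 fun h => hAe (mem h)
  · rintro u' w' ⟨e, he, heq⟩ hAe
    have hAe : A ∉ e := fun h => hAe (heq ▸ mem h)
    obtain ⟨u, w, rfl⟩ := edgeSegment_eq_of_sym2 e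
    have hu := hV ⟨_, he, Sym2.mem_mk_left u w⟩
    have hw := hV ⟨_, he, Sym2.mem_mk_right u w⟩
    have huw : u ≠ w := fun h => hE _ he (Sym2.mk_isDiag_iff.2 h)
    simp only [Sym2.mem_iff, not_or] at hAe
    have hd := hg.tri _ ⟨A, hA, rfl⟩ _ ⟨u, hu, rfl⟩ _ ⟨w, hw, rfl⟩ (hinj.ne hA hu hAe.1)
      (hinj.ne hA hw hAe.2) (hinj.ne hu hw huw)
    rw [Sym2.map_mk, Sym2.eq_iff] at heq
    rcases heq with ⟨rfl, rfl⟩ | ⟨rfl, rfl⟩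
    · exact hd
    · rw [tdet_swap_right]
      exact neg_ne_zero.2 hd
  · rintro _ ⟨e, he, rfl⟩ hAe x hx hx'
    obtain ⟨w, hw, hwA⟩ := Sym2.mem_map.1 hAe
    obtain rfl := hinj (hV ⟨e, he, hw⟩) hA (congrArg (planeProj b) hwA)
    exact (hs e he).2 hw x hx hx'

set_option maxHeartbeats 1000000 in
theorem eventually_reach {ι : Type*} {l : Filter ι} (h : Arc E A B Z) {V : Set Space}
    (hV : verts (Corner A B Z E) ⊆ V) {ψ : ι → Space → Space} {P : ι → Space}
    (hψ : ∀ x, Tendsto (fun i => ψ i x) l (𝓝 x)) (hP : Tendsto P l (𝓝 (mid A B))) :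
    ∀ᶠ i in l, Set.InjOn (fun x => planeProj b (ψ i x)) V →
      planeProj b (P i) ∉ (fun x => planeProj b (ψ i x)) '' V →
      SG (insert (planeProj b (P i)) ((fun x => planeProj b (ψ i x)) '' V)) →
      tdet (planeProj b (P i)) (planeProj b (ψ i Z)) (planeProj b (ψ i A)) *
        tdet (planeProj b (P i)) (planeProj b (ψ i Z)) (planeProj b (ψ i B)) < 0 →
      Reach b ((E.ncard + 2) * (E.ncard + 3) + 4)
        (Corner (ψ i A) (ψ i B) (P i) (Sym2.map (ψ i) '' E))
        (Corner (ψ i A) (ψ i B) (ψ i Z) (Sym2.map (ψ i) '' E)) := by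
  have hfin : E.Finite := h.two.fin.subset fun e he => Or.inr (Or.inr he)
  have hmB : B ≠ mid A B := by rw [mid_comm]; exact h.symm.mid_ne
  have htri : ∀ C, C ∈ convexHull ℝ {C, mid A B, Z} := fun C => subset_convexHull ℝ _ (by simp)
  have s1 := eventually_separated h.two.fin (h.separated (y := Z)
    (subset_convexHull ℝ _ (by simp)) (subset_convexHull ℝ _ (by simp))) hψ
  have twoM := h.two.move_vertex h.fresh h.mid_fresh h.mid_ne hmB
  have hχ := tendsto_update hψ hP
  have s2 := eventually_separated twoM.fin (h.separated (y := mid A B)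
    (subset_convexHull ℝ _ (by simp)) (by rw [mid_comm]; exact subset_convexHull ℝ _ (by simp))) hχ
  filter_upwards [s1, s2, h.eventually_half hψ hP,
    h.symm.eventually_half hψ (by rwa [mid_comm])] with i s1 s2 hA hB inj nP sg sep
  have vA : A ∈ V := hV ⟨s(A, Z), Or.inl rfl, by simp⟩
  have vB : B ∈ V := hV ⟨s(B, Z), Or.inr (Or.inl rfl), by simp⟩
  have vZ : Z ∈ V := hV ⟨s(A, Z), Or.inl rfl, by simp⟩
  have vE : verts E ⊆ V := fun x ⟨e, he, hx⟩ => hV ⟨e, Or.inr (Or.inr he), hx⟩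
  have sgV := sg.mono (Set.subset_insert _ _)
  have hm : ∀ {x}, x ∈ V → planeProj b (ψ i x) ∈ insert (planeProj b (P i))
      ((fun x => planeProj b (ψ i x)) '' V) := fun hx => Or.inr ⟨_, hx, rfl⟩
  have hmP : planeProj b (P i) ∈ insert (planeProj b (P i))
      ((fun x => planeProj b (ψ i x)) '' V) := Or.inl rfl
  have neP : ∀ {x}, x ∈ V → planeProj b (P i) ≠ planeProj b (ψ i x) := fun hx h' =>
    nP ⟨_, hx, h'.symm⟩
  have nd : ∀ e ∈ E, ¬ e.IsDiag := fun e he => h.two.nd e (Or.inr (Or.inr he))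
  have neZ : ∀ {e x}, e ∈ E → x ∈ e → planeProj b (ψ i x) ≠ planeProj b (ψ i Z) := by
    intro e x he hx
    refine inj.ne (vE ⟨e, he, hx⟩) vZ ?_
    rintro rfl
    exact h.fresh e he hx
  have gZ : Good b (Corner (ψ i A) (ψ i B) (ψ i Z) (Sym2.map (ψ i) '' E)) := by
    rw [← Corner.map]
    exact Good.map_of_generic h.two s1 (inj.mono hV) (sgV.mono (Set.image_mono hV))
  have gP : Good b (Corner (ψ i A) (ψ i B) (P i) (Sym2.map (ψ i) '' E)) := by
    have hv : ∀ x ∈ verts (Corner A B (mid A B) E), x ≠ mid A B → x ∈ V := by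
      rintro x ⟨e, rfl | rfl | he, hx⟩ hne
      · rwa [(Sym2.mem_iff.1 hx).resolve_right hne]
      · rwa [(Sym2.mem_iff.1 hx).resolve_right hne]
      · exact vE ⟨e, he, hx⟩
    rw [← map_update_corner h.mid_ne hmB h.mid_fresh]
    refine Good.map_of_generic twoM s2 ?_ (sg.mono ?_)
    · intro x hx y hy hxy
      by_cases hxm : x = mid A B <;> by_cases hym : y = mid A B
      · rw [hxm, hym]
      · simp only [hxm, Function.update_self, Function.update_of_ne hym] at hxy
        exact absurd hxy (neP (hv y hy hym))
      · simp only [hym, Function.update_self, Function.update_of_ne hxm] at hxy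
        exact absurd hxy.symm (neP (hv x hx hxm))
      · simp only [Function.update_of_ne hym, Function.update_of_ne hxm] at hxy
        exact inj (hv x hx hxm) (hv y hy hym) hxy
    · rintro _ ⟨x, hx, rfl⟩
      by_cases hxm : x = mid A B
      · simp only [hxm, Function.update_self]
        exact hmP
      · simp only [Function.update_of_ne hxm]
        exact hm (hv x hx hxm)
  have tA := half_track nd vE vA inj sgV hA
  have tB := half_track nd vE vB inj sgV hB
  have ht : Track b (Sym2.map (ψ i) '' E) (ψ i A) (ψ i B) (P i) (ψ i Z) := by
    refine ⟨gP, gZ, tA.1, tB.1, sep, ?_, ?_⟩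
    · rintro _ ⟨e, he, rfl⟩ _ ⟨f, hf, rfl⟩ hef x hxe hxf hx
      by_cases hcom : ∃ v ∈ e, v ∈ f
      · obtain ⟨v, hve, hvf⟩ := hcom
        have := gZ.adj (Or.inr (Or.inr ⟨e, he, rfl⟩)) (Or.inr (Or.inr ⟨f, hf, rfl⟩)) hef
          (Sym2.mem_map.2 ⟨v, hve, rfl⟩) (Sym2.mem_map.2 ⟨v, hvf, rfl⟩) hxe hxf
        have hv := vE ⟨e, he, hve⟩
        rw [this] at hx
        exact sg.tri _ hmP _ (hm vZ) _ (hm hv) (neP vZ) (neP hv) (neZ he hve).symm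
          (tdet_eq_zero_of_mem_segment hx)
      · push Not at hcom
        obtain ⟨r, s, rfl⟩ := edgeSegment_eq_of_sym2 e
        obtain ⟨u, t, rfl⟩ := edgeSegment_eq_of_sym2 f
        rw [Sym2.map_mk, sh_mk] at hxe hxf
        have vr := vE ⟨_, he, Sym2.mem_mk_left r s⟩
        have vs := vE ⟨_, he, Sym2.mem_mk_right r s⟩
        have vu := vE ⟨_, hf, Sym2.mem_mk_left u t⟩
        have vt := vE ⟨_, hf, Sym2.mem_mk_right u t⟩
        have hr := hcom r (by simp)
        have hs := hcom s (by simp)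
        simp only [Sym2.mem_iff, not_or] at hr hs
        refine sg.six _ (hm vr) _ (hm vs) _ (hm vu) _ (hm vt) _ hmP _ (hm vZ) ?_ x hxe hxf hx
        have n1 := inj.ne vr vs fun h' => nd _ he (Sym2.mk_isDiag_iff.2 h')
        have n2 := inj.ne vu vt fun h' => nd _ hf (Sym2.mk_isDiag_iff.2 h')
        have n3 := inj.ne vr vu hr.1
        have n4 := inj.ne vr vt hr.2
        have n5 := inj.ne vs vu hs.1
        have n6 := inj.ne vs vt hs.2
        simp [n1, n2, n3, n4, n5, n6, (neP vr).symm, (neP vs).symm, (neP vu).symm, (neP vt).symm,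
          neP vZ, neZ he (Sym2.mem_mk_left r s), neZ he (Sym2.mem_mk_right r s),
          neZ hf (Sym2.mem_mk_left u t), neZ hf (Sym2.mem_mk_right u t)]
    · rintro _ ⟨e, he, rfl⟩ x ⟨hx, hx'⟩ y ⟨hy, hy'⟩
      by_contra hne
      obtain ⟨u, w, rfl⟩ := edgeSegment_eq_of_sym2 e
      have vu := vE ⟨_, he, Sym2.mem_mk_left u w⟩
      have vw := vE ⟨_, he, Sym2.mem_mk_right u w⟩
      have huw := inj.ne vu vw fun h' => nd _ he (Sym2.mk_isDiag_iff.2 h')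
      rw [Sym2.map_mk, sh_mk] at hx hy
      have l1 := tdet_eq_zero_of_mem_segment hx
      have l2 := tdet_eq_zero_of_mem_segment hy
      have m1 := tdet_eq_zero_of_mem_segment hx'
      have m2 := tdet_eq_zero_of_mem_segment hy'
      exact sg.tri _ hmP _ (hm vZ) _ (hm vu) (neP vZ) (neP vu) (neZ he (Sym2.mem_mk_left u w)).symm
        (tdet_eq_zero_trans hne (tdet_eq_zero_trans (neP vZ) m1 m2 (tdet_self_left _ _))
          (tdet_eq_zero_trans (neP vZ) m1 m2 (tdet_self_right _ _))
          (tdet_eq_zero_trans huw l1 l2 (tdet_self_left _ _)))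
  have hle := Set.ncard_image_le (f := Sym2.map (ψ i)) hfin
  refine (ht.reach tA.2 tB.2).mono ?_
  gcongr

end Arc

theorem eventually_sep {A B m Z : Space} (hm : m ∈ openSegment ℝ A B)
    (hd : tdet (planeProj b A) (planeProj b B) (planeProj b Z) ≠ 0) : ∀ᶠ x in 𝓝 m,
    tdet (planeProj b x) (planeProj b Z) (planeProj b A) *
      tdet (planeProj b x) (planeProj b Z) (planeProj b B) < 0 := by
  have hc : Continuous fun x => tdet (planeProj b x) (planeProj b Z) (planeProj b A) *
      tdet (planeProj b x) (planeProj b Z) (planeProj b B) :=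
    (continuous_tdet continuous_planeProj continuous_const continuous_const).mul
      (continuous_tdet continuous_planeProj continuous_const continuous_const)
  refine hc.continuousAt.eventually_lt continuousAt_const ?_
  obtain ⟨α, β, h1, h2, h3, rfl⟩ := hm
  have e1 : tdet (planeProj b (α • A + β • B)) (planeProj b Z) (planeProj b A) =
      β * tdet (planeProj b A) (planeProj b B) (planeProj b Z) := by
    obtain rfl : α = 1 - β := by linarith
    simp [tdet]; ring
  have e2 : tdet (planeProj b (α • A + β • B)) (planeProj b Z) (planeProj b B) =
      -(α * tdet (planeProj b A) (planeProj b B) (planeProj b Z)) := by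
    obtain rfl : α = 1 - β := by linarith
    simp [tdet]; ring
  rw [e1, e2]
  have := mul_pos (mul_pos h1 h2) (mul_self_pos.2 hd)
  nlinarith

theorem SG.exists_between {W : Set Plane} (hg : SG W) (hW : W.Finite) {A B m Z Z' : Space}
    (hm : m ∈ openSegment ℝ A B) (hd : tdet (planeProj b A) (planeProj b B) (planeProj b Z) ≠ 0)
    (hd' : tdet (planeProj b A) (planeProj b B) (planeProj b Z') ≠ 0) {p : Space → Prop}
    (hp : ∀ᶠ x in 𝓝 m, p x) : ∃ P, p P ∧ planeProj b P ∉ W ∧ SG (insert (planeProj b P) W) ∧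
      tdet (planeProj b P) (planeProj b Z) (planeProj b A) *
        tdet (planeProj b P) (planeProj b Z) (planeProj b B) < 0 ∧
      tdet (planeProj b P) (planeProj b Z') (planeProj b A) *
        tdet (planeProj b P) (planeProj b Z') (planeProj b B) < 0 := by
  obtain ⟨δ, hδ, h⟩ := Metric.eventually_nhds_iff.1
    (hp.and ((eventually_sep hm hd).and (eventually_sep hm hd')))
  obtain ⟨P, h1, h2, h3⟩ := hg.exists_near hW m hδ
  exact ⟨P, (h h1).1, h2, h3, (h h1).2⟩

/-- The vertices in `V` are moved by `ψ` to points in general position, arbitrarily close. -/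
structure GenericSeq (b : OrthonormalBasis (Fin 3) ℝ Space) (V : Set Space)
    (ψ : ℕ → Space → Space) : Prop where
  tendsto : ∀ x, Tendsto (fun n => ψ n x) atTop (𝓝 x)
  inj : ∀ n, Set.InjOn (fun x => planeProj b (ψ n x)) V
  sg : ∀ n, SG ((fun x => planeProj b (ψ n x)) '' V)

theorem tendsto_mid {ψ : ℕ → Space → Space} (h : ∀ x, Tendsto (fun n => ψ n x) atTop (𝓝 x))
    (A B : Space) : Tendsto (fun n => mid (ψ n A) (ψ n B)) atTop (𝓝 (mid A B)) :=
  ((h A).add (h B)).const_smul (2⁻¹ : ℝ)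

theorem tendsto_of_dist_lt {P Q : ℕ → Space} {x : Space} (hQ : Tendsto Q atTop (𝓝 x))
    (h : ∀ᶠ n in atTop, dist (P n) (Q n) < 1 / ((n : ℝ) + 1)) : Tendsto P atTop (𝓝 x) :=
  hQ.congr_dist (squeeze_zero' (Eventually.of_forall fun _ => dist_nonneg)
    (h.mono fun n hn => by rw [dist_comm]; exact hn.le) tendsto_one_div_add_atTop_nhds_zero_nat)

theorem GenericSeq.tdet_ne_zero {V : Set Space} {ψ : ℕ → Space → Space} (h : GenericSeq b V ψ)
    {x y z : Space} (hx : x ∈ V) (hy : y ∈ V) (hz : z ∈ V) (hxy : x ≠ y) (hxz : x ≠ z) (hyz : y ≠ z)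
    (n : ℕ) : tdet (planeProj b (ψ n x)) (planeProj b (ψ n y)) (planeProj b (ψ n z)) ≠ 0 :=
  (h.sg n).tri _ ⟨x, hx, rfl⟩ _ ⟨y, hy, rfl⟩ _ ⟨z, hz, rfl⟩ ((h.inj n).ne hx hy hxy)
    ((h.inj n).ne hx hz hxz) ((h.inj n).ne hy hz hyz)

namespace Arc

variable {E : Set (Sym2 Space)} {A B Z Z' : Space} {V : Set Space} {ψ : ℕ → Space → Space}

theorem left_ne (h : Arc E A B Z) : A ≠ Z := fun h' =>
  h.two.nd _ (Or.inl rfl) (Sym2.mk_isDiag_iff.2 h')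

theorem tdet_ne_zero (h : Arc E A B Z) (hV : verts (Corner A B Z E) ⊆ V) (hψ : GenericSeq b V ψ)
    (n : ℕ) : tdet (planeProj b (ψ n A)) (planeProj b (ψ n B)) (planeProj b (ψ n Z)) ≠ 0 :=
  hψ.tdet_ne_zero (hV ⟨s(A, Z), Or.inl rfl, by simp⟩) (hV ⟨s(B, Z), Or.inr (Or.inl rfl), by simp⟩)
    (hV ⟨s(A, Z), Or.inl rfl, by simp⟩) h.ne h.left_ne h.symm.left_ne n

theorem eventually_swing (h : Arc E A B Z) (h' : Arc E A B Z') (hfin : V.Finite)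
    (hV : verts (Corner A B Z E) ⊆ V) (hV' : verts (Corner A B Z' E) ⊆ V)
    (hψ : GenericSeq b V ψ) : ∀ᶠ n in atTop,
      Reach b (2 * ((E.ncard + 2) * (E.ncard + 3) + 4))
        (Sym2.map (ψ n) '' Corner A B Z E) (Sym2.map (ψ n) '' Corner A B Z' E) := by
  have key : ∀ n, ∃ P, dist P (mid (ψ n A) (ψ n B)) < 1 / ((n : ℝ) + 1) ∧ _ := fun n =>
    (hψ.sg n).exists_between (hfin.image _) (mid_mem _ _) (h.tdet_ne_zero hV hψ n)
      (h'.tdet_ne_zero hV' hψ n) (Metric.ball_mem_nhds _ (by positivity))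
  choose P hP hg using key
  have ht := tendsto_of_dist_lt (tendsto_mid hψ.tendsto A B) (Eventually.of_forall hP)
  filter_upwards [h.eventually_reach hV hψ.tendsto ht, h'.eventually_reach hV' hψ.tendsto ht]
    with n r r'
  obtain ⟨h1, h2, h3, h4⟩ := hg n
  rw [Corner.map, Corner.map, two_mul]
  exact (r (hψ.inj n) h1 h2 h3).symm.trans (r' (hψ.inj n) h1 h2 h4)

end Arc

theorem Good.exists_near_of_insert {F : Set (Sym2 Space)} {A B : Space}
    (h : Good b (insert s(A, B) F)) (hAB : s(A, B) ∉ F) {δ : ℝ} (hδ : 0 < δ) :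
    ∃ m ∈ openSegment ℝ A B, dist m (mid A B) < δ ∧ ∀ e ∈ F, planeProj b m ∉ sh b e := by
  have hne : planeProj b A ≠ planeProj b B := h.proj_ne (Or.inl rfl)
  have hfin : F.Finite := h.fin.subset fun e he => Or.inr he
  let γ : ℝ → Space := fun t => mid A B + t • (B - A)
  have hγ : ∀ t ∈ Set.Ioo (0 : ℝ) 2⁻¹, γ t ∈ openSegment ℝ A B := fun t ht =>
    ⟨2⁻¹ - t, 2⁻¹ + t, by linarith [ht.2], by linarith [ht.1], by norm_num, by
      simp only [γ, mid]; module⟩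
  have hbad : {t ∈ Set.Ioo (0 : ℝ) 2⁻¹ | ∃ e ∈ F, planeProj b (γ t) ∈ sh b e}.Finite := by
    have : {t ∈ Set.Ioo (0 : ℝ) 2⁻¹ | ∃ e ∈ F, planeProj b (γ t) ∈ sh b e} =
        ⋃ e ∈ F, {t ∈ Set.Ioo (0 : ℝ) 2⁻¹ | planeProj b (γ t) ∈ sh b e} := by
      ext t
      simp only [Set.mem_ofPred_eq, Set.mem_iUnion, exists_prop]
      tauto
    rw [this]
    refine hfin.biUnion fun e he => Set.Subsingleton.finite ?_
    rintro s ⟨hs, hse⟩ t ⟨ht, hte⟩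
    have hmem : ∀ r ∈ Set.Ioo (0 : ℝ) 2⁻¹, planeProj b (γ r) ∈ sh b s(A, B) := fun r hr => by
      rw [sh, edgeSegment_map, edgeSegment_mk]
      exact ⟨_, openSegment_subset_segment ℝ _ _ (hγ r hr), rfl⟩
    have heq := h.inter_subsingleton (Or.inl rfl) (Or.inr he) (fun h' => hAB (h' ▸ he)) (hmem s hs)
      hse (hmem t ht) hte
    simp only [γ, map_add, map_smul, map_sub, add_right_inj] at heq
    exact smul_left_injective ℝ (sub_ne_zero.2 hne.symm) heq
  have hc : Tendsto γ (𝓝[>] 0) (𝓝 (mid A B)) := by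
    have : Continuous γ := by fun_prop
    have h0 := this.tendsto 0
    simp only [γ, zero_smul, add_zero] at h0
    exact h0.mono_left nhdsWithin_le_nhds
  have hev : ∀ᶠ t in 𝓝[>] (0 : ℝ), t ∉ {t ∈ Set.Ioo (0 : ℝ) 2⁻¹ | ∃ e ∈ F, planeProj b (γ t) ∈ sh b e} := by
    have := hbad.isClosed.isOpen_compl.mem_nhds (x := (0 : ℝ)) (fun h => lt_irrefl _ h.1.1)
    exact mem_nhdsWithin_of_mem_nhds this
  obtain ⟨t, ⟨h1, h2⟩, h3⟩ := ((hc.eventually (Metric.ball_mem_nhds _ hδ)).and hev).and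
    (Ioo_mem_nhdsGT (by norm_num : (0 : ℝ) < 2⁻¹)) |>.exists
  exact ⟨γ t, hγ t h3, h1, fun e he hm => h2 ⟨h3, e, he, hm⟩⟩

theorem map_mem_image_iff {V : Set Space} {φ : Space → Space} (hφ : Set.InjOn φ V)
    {E : Set (Sym2 Space)} (hE : verts E ⊆ V) {A B : Space} (hA : A ∈ V) (hB : B ∈ V)
    (h : s(φ A, φ B) ∈ Sym2.map φ '' E) : s(A, B) ∈ E := by
  obtain ⟨e, he, heq⟩ := h
  obtain ⟨u, w, rfl⟩ := edgeSegment_eq_of_sym2 e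
  have hu := hE ⟨_, he, Sym2.mem_mk_left u w⟩
  have hw := hE ⟨_, he, Sym2.mem_mk_right u w⟩
  rw [Sym2.map_mk, Sym2.eq_iff] at heq
  rcases heq with ⟨h1, h2⟩ | ⟨h1, h2⟩
  · rwa [← hφ hu hA h1, ← hφ hw hB h2]
  · rwa [← hφ hu hB h1, ← hφ hw hA h2, Sym2.eq_swap]

namespace Arc

variable {E : Set (Sym2 Space)} {A B Z : Space} {V : Set Space} {ψ : ℕ → Space → Space}

theorem eventually_split (h : Arc E A B Z) (htwo : TwoRegular (insert s(A, B) E))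
    (hsp : Separated (insert s(A, B) E)) (hAB : s(A, B) ∉ E) (hfin : V.Finite)
    (hV : verts (Corner A B Z E) ⊆ V) (hψ : GenericSeq b V ψ) : ∀ᶠ n in atTop,
      Reach b ((E.ncard + 2) * (E.ncard + 3) + 4)
        (Sym2.map (ψ n) '' insert s(A, B) E) (Sym2.map (ψ n) '' Corner A B Z E) := by
  have hA : A ∈ V := hV ⟨s(A, Z), Or.inl rfl, by simp⟩
  have hB : B ∈ V := hV ⟨s(B, Z), Or.inr (Or.inl rfl), by simp⟩
  have hE : verts E ⊆ V := fun x ⟨e, he, hx⟩ => hV ⟨e, Or.inr (Or.inr he), hx⟩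
  have hV' : verts (insert s(A, B) E) ⊆ V := by
    rintro x ⟨e, rfl | he, hx⟩
    · rcases Sym2.mem_iff.1 hx with rfl | rfl <;> assumption
    · exact hE ⟨e, he, hx⟩
  have key : ∀ n, ∃ P, Good b (Sym2.map (ψ n) '' insert s(A, B) E) →
      (dist P (mid (ψ n A) (ψ n B)) < 1 / ((n : ℝ) + 1) ∧
        Reach b 0 (Sym2.map (ψ n) '' insert s(A, B) E)
          (Corner (ψ n A) (ψ n B) P (Sym2.map (ψ n) '' E))) ∧
      planeProj b P ∉ (fun x => planeProj b (ψ n x)) '' V ∧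
      SG (insert (planeProj b P) ((fun x => planeProj b (ψ n x)) '' V)) ∧
      tdet (planeProj b P) (planeProj b (ψ n Z)) (planeProj b (ψ n A)) *
        tdet (planeProj b P) (planeProj b (ψ n Z)) (planeProj b (ψ n B)) < 0 := by
    intro n
    by_cases hg : Good b (Sym2.map (ψ n) '' insert s(A, B) E)
    swap
    · exact ⟨0, fun h' => absurd h' hg⟩
    rw [Set.image_insert_eq, Sym2.map_mk] at hg ⊢
    have hmem : s(ψ n A, ψ n B) ∉ Sym2.map (ψ n) '' E := fun h' =>
      hAB (map_mem_image_iff (fun x hx y hy hxy => hψ.inj n hx hy (congrArg _ hxy)) hE hA hB h')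
    obtain ⟨m, hm, hd, hmE⟩ := hg.exists_near_of_insert hmem (δ := 1 / ((n : ℝ) + 1)) (by positivity)
    have r := Reach.of_subdivide hg hmem hm hmE
    have r' := eventually_perturb r.choose_spec.choose
      (tendsto_update (φ := fun _ => id) (fun x => tendsto_const_nhds) (tendsto_id (x := 𝓝 m)))
    have hAm : ψ n A ≠ m := fun h' =>
      r.choose_spec.choose.nd _ (Or.inl rfl) (Sym2.mk_isDiag_iff.2 h')
    have hBm : ψ n B ≠ m := fun h' =>
      r.choose_spec.choose.nd _ (Or.inr (Or.inl rfl)) (Sym2.mk_isDiag_iff.2 h')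
    have hmF : ∀ e ∈ Sym2.map (ψ n) '' E, m ∉ e := fun e he hme => hmE e he (by
      rw [sh, edgeSegment_map]
      exact ⟨m, mem_edgeSegment hme, rfl⟩)
    have hd' := h.tdet_ne_zero hV hψ n
    obtain ⟨P, hp, h1, h2, h3, -⟩ := (hψ.sg n).exists_between (hfin.image _) hm hd' hd'
      (((continuous_id.dist continuous_const).continuousAt.eventually_lt continuousAt_const hd).and
        r')
    refine ⟨P, fun _ => ⟨⟨hp.1, ?_⟩, h1, h2, h3⟩⟩
    have := hp.2
    rw [id_eq, map_update_corner hAm hBm hmF, Sym2.map_id, Set.image_id] at this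
    exact r.trans this
  choose P hP using key
  have hgood : ∀ᶠ n in atTop, Good b (Sym2.map (ψ n) '' insert s(A, B) E) := by
    filter_upwards [eventually_separated htwo.fin hsp hψ.tendsto] with n hn
    exact Good.map_of_generic htwo hn ((hψ.inj n).mono hV') ((hψ.sg n).mono (Set.image_mono hV'))
  have ht := tendsto_of_dist_lt (tendsto_mid hψ.tendsto A B) (hgood.mono fun n hn => (hP n hn).1.1)
  filter_upwards [h.eventually_reach hV hψ.tendsto ht, hgood] with n r hg
  obtain ⟨⟨-, r0⟩, h1, h2, h3⟩ := hP n hg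
  rw [Corner.map]
  have := r0.trans (r (hψ.inj n) h1 h2 h3)
  rwa [zero_add] at this

end Arc

/-! ### Elementary moves of links -/

theorem notMem_half_triangle {A B Z : Space} (hAB : A ≠ B)
    (h : ∀ c t : ℝ, 0 ≤ c → 0 ≤ t → c • (Z - A) + t • (B - A) = 0 → c = 0) :
    A ∉ convexHull ℝ {B, mid A B, Z} := by
  intro hA
  obtain ⟨α, β, γ, h1, h2, h3, h4, h5⟩ := mem_triangle_iff.1 hA
  have key : γ • (Z - A) + (α + 2⁻¹ * β) • (B - A) = 0 := by
    obtain rfl : α = 1 - β - γ := by linarith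
    rw [mid] at h5
    rw [← sub_eq_zero] at h5
    rw [← h5]
    module
  obtain rfl := h γ _ h3 (by positivity) key
  rw [zero_smul, zero_add, smul_eq_zero, sub_eq_zero] at key
  rcases key with h0 | h0
  · linarith
  · exact hAB h0.symm

theorem Arc.of_between {E : Set (Sym2 Space)} {A B X : Space} (two : TwoRegular (Corner A B X E))
    (fresh : ∀ e ∈ E, X ∉ e) (sp : Separated E)
    (edge : ∀ e ∈ E, ∀ x ∈ edgeSegment e, x ∈ segment ℝ A B → x = A ∧ A ∈ e ∨ x = B ∧ B ∈ e)
    (hX : X ∈ openSegment ℝ A B) : Arc E A B X := by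
  have hne : A ≠ B := by
    rintro rfl
    rw [openSegment_same] at hX
    exact two.nd _ (Or.inl rfl) (Sym2.mk_isDiag_iff.2 (Set.mem_singleton_iff.1 hX).symm)
  have key : ∀ {A B}, A ≠ B → X ∈ openSegment ℝ A B → A ∉ convexHull ℝ {B, mid A B, X} := by
    rintro A B hne ⟨α, β, h1, h2, h3, rfl⟩
    refine notMem_half_triangle hne fun c t hc ht h0 => ?_
    have : (c * β + t) • (B - A) = 0 := by
      obtain rfl : α = 1 - β := by linarith
      rw [← h0]
      module
    have := (smul_eq_zero.1 this).resolve_right (sub_ne_zero.2 hne.symm)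
    have := mul_nonneg hc h2.le
    exact (mul_eq_zero.1 (by linarith : c * β = 0)).resolve_right h2.ne'
  refine ⟨two, fresh, sp, fun e he x hx hx' => edge e he x hx ?_, key hne hX, ?_⟩
  · rwa [triangle_of_mem (openSegment_subset_segment ℝ _ _ hX)] at hx'
  · rw [mid_comm]
    exact key hne.symm (by rwa [openSegment_symm])

theorem Arc.of_affineIndependent {E : Set (Sym2 Space)} {A B C : Space}
    (two : TwoRegular (Corner A B C E)) (fresh : ∀ e ∈ E, C ∉ e) (sp : Separated E)
    (edge : ∀ e ∈ E, ∀ x ∈ edgeSegment e, x ∈ convexHull ℝ {A, B, C} →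
      x = A ∧ A ∈ e ∨ x = B ∧ B ∈ e)
    (hC : AffineIndependent ℝ ![A, B, C]) : Arc E A B C := by
  rw [affineIndependent_iff_not_collinear_set] at hC
  have key : ∀ {A B}, ¬ Collinear ℝ {A, B, C} → A ∉ convexHull ℝ {B, mid A B, C} := by
    intro A B hcol
    refine notMem_half_triangle ?_ fun c t hc ht h0 => ?_
    · rintro rfl
      exact hcol (by simpa using collinear_pair ℝ A C)
    · by_contra hc0
      refine hcol ((collinear_iff_of_mem (p₀ := A) (by simp)).2 ⟨B - A, ?_⟩)
      have h1 : C = (-(c⁻¹ * t)) • (B - A) +ᵥ A := by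
        have := congrArg (c⁻¹ • ·) h0
        simp only [smul_add, smul_smul, inv_mul_cancel₀ hc0, one_smul, smul_zero] at this
        rw [neg_smul, ← eq_neg_of_add_eq_zero_left this]
        simp
      rintro x (rfl | rfl | rfl)
      · exact ⟨0, by simp⟩
      · exact ⟨1, by simp⟩
      · exact ⟨_, h1⟩
  refine ⟨two, fresh, sp, edge, key hC, ?_⟩
  rw [mid_comm]
  exact key (by rwa [Set.insert_comm])

theorem Arc.ncard {E : Set (Sym2 Space)} {A B Z : Space} (h : Arc E A B Z) :
    (Corner A B Z E).ncard = E.ncard + 2 := by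
  have hfin : E.Finite := h.two.fin.subset fun e he => Or.inr (Or.inr he)
  have h1 : s(B, Z) ∉ E := fun h' => h.fresh _ h' (by simp)
  have h2 : s(A, Z) ∉ insert s(B, Z) E := by
    rintro (h' | h')
    · exact h.ne (Sym2.congr_left.1 h')
    · exact h.fresh _ h' (by simp)
  rw [Set.ncard_insert_of_notMem h2 (hfin.insert _), Set.ncard_insert_of_notMem h1 hfin]

theorem Arc.ncard_pos {E : Set (Sym2 Space)} {A B Z : Space} (h : Arc E A B Z) : 0 < E.ncard := by
  have hfin : E.Finite := h.two.fin.subset fun e he => Or.inr (Or.inr he)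
  obtain ⟨f, ⟨hf, hA⟩, hne⟩ := Set.exists_ne_of_one_lt_ncard
    (s := {f ∈ Corner A B Z E | A ∈ f})
    (by rw [h.two.deg s(A, Z) (Or.inl rfl) A (by simp)]; norm_num) s(A, Z)
  refine (Set.ncard_pos hfin).2 ⟨f, ?_⟩
  rcases hf with rfl | rfl | hf
  · exact absurd rfl hne
  · rcases Sym2.mem_iff.1 hA with h' | h'
    · exact absurd h' h.ne
    · exact absurd h' h.left_ne
  · exact hf

namespace PolygonalLink

variable {L L' : PolygonalLink}

theorem twoRegular (L : PolygonalLink) : TwoRegular L.edges := ⟨L.finite, L.not_isDiag, L.two_edges⟩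

theorem separated (L : PolygonalLink) : Separated L.edges := by
  intro e he f hf hv
  have hef : e ≠ f := by
    rintro rfl
    obtain ⟨u, w, rfl⟩ := edgeSegment_eq_of_sym2 e
    exact hv u (by simp) (by simp)
  exact Set.disjoint_left.2 fun p hp hp' =>
    hv p (L.embedded e he f hf hef ⟨hp, hp'⟩).1 (L.embedded e he f hf hef ⟨hp, hp'⟩).2

theorem SplitEdge.exists_arc (h : SplitEdge L L') : ∃ E A B X, L.edges = insert s(A, B) E ∧
    s(A, B) ∉ E ∧ L'.edges = Corner A B X E ∧ Arc E A B X := by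
  obtain ⟨A, B, X, hAB, hX, hL'⟩ := h
  have hne : A ≠ B := fun h' => L.not_isDiag _ hAB (Sym2.mk_isDiag_iff.2 h')
  have hedges : L'.edges = Corner A B X (L.edges \ {s(A, B)}) := by
    ext e
    rw [hL', Sym2.eq_swap (a := X)]
    simp only [Corner, Set.mem_insert_iff, Set.mem_sdiff, Set.mem_singleton_iff]
    tauto
  have hedge : ∀ e ∈ L.edges \ {s(A, B)}, ∀ x ∈ edgeSegment e, x ∈ segment ℝ A B →
      x = A ∧ A ∈ e ∨ x = B ∧ B ∈ e := by
    rintro e ⟨he, hne'⟩ x hx hx'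
    obtain ⟨h1, h2⟩ := L.embedded e he _ hAB hne' ⟨hx, by rwa [edgeSegment_mk]⟩
    rcases Sym2.mem_iff.1 h2 with rfl | rfl
    · exact Or.inl ⟨rfl, h1⟩
    · exact Or.inr ⟨rfl, h1⟩
  refine ⟨L.edges \ {s(A, B)}, A, B, X, (Loc.insert_diff hAB).symm, fun h => h.2 rfl, hedges,
    .of_between (hedges ▸ L'.twoRegular) ?_ (fun e he f hf => L.separated e he.1 f hf.1) hedge hX⟩
  intro e he hXe
  rcases hedge e he X (mem_edgeSegment hXe) (openSegment_subset_segment ℝ _ _ hX) with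
    ⟨rfl, -⟩ | ⟨rfl, -⟩
  · exact hne (left_mem_openSegment_iff.1 hX)
  · exact hne (right_mem_openSegment_iff.1 hX)

theorem PushAcross.exists_arc (h : PushAcross L L') : ∃ E A B X C, L.edges = Corner A B X E ∧
    L'.edges = Corner A B C E ∧ Arc E A B X ∧ Arc E A B C := by
  obtain ⟨A, B, X, C, hAX, hXB, hX, hC, hind, htri, hL'⟩ := h
  rw [Sym2.eq_swap] at hXB
  have hAB : A ≠ B := by
    rintro rfl
    rw [openSegment_same] at hX
    exact L.not_isDiag _ hAX (Sym2.mk_isDiag_iff.2 (Set.mem_singleton_iff.1 hX).symm)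
  set E : Set (Sym2 Space) := L.edges \ {s(A, X), s(B, X)} with hE
  have hedges : L.edges = Corner A B X E := by
    ext e
    simp only [hE, Corner, Set.mem_insert_iff, Set.mem_sdiff, Set.mem_singleton_iff]
    constructor
    · tauto
    · rintro (rfl | rfl | h)
      · exact hAX
      · exact hXB
      · exact h.1
  have hedges' : L'.edges = Corner A B C E := by
    ext e
    rw [hL', Sym2.eq_swap (a := X), Sym2.eq_swap (a := C)]
    simp only [hE, Corner, Set.mem_insert_iff, Set.mem_sdiff, Set.mem_singleton_iff]
    tauto
  have hfresh : ∀ e ∈ E, X ∉ e := by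
    rintro e ⟨he, hne⟩ hXe
    simp only [Set.mem_insert_iff, Set.mem_singleton_iff, not_or] at hne
    exact L.twoRegular.not_three he hAX hXB hne.1 hne.2 (fun h => hAB (Sym2.congr_left.1 h)) hXe
      (by simp) (by simp)
  have hedge : ∀ e ∈ E, ∀ x ∈ edgeSegment e, x ∈ segment ℝ A B →
      x = A ∧ A ∈ e ∨ x = B ∧ B ∈ e := by
    rintro e he x hx hx'
    have hne := he.2
    simp only [Set.mem_insert_iff, Set.mem_singleton_iff, not_or] at hne
    rcases openSegment_cases hX hx' with h | h
    · obtain ⟨h1, h2⟩ := L.embedded e he.1 _ hAX hne.1 ⟨hx, by rwa [edgeSegment_mk]⟩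
      rcases Sym2.mem_iff.1 h2 with rfl | rfl
      · exact Or.inl ⟨rfl, h1⟩
      · exact absurd h1 (hfresh e he)
    · obtain ⟨h1, h2⟩ := L.embedded e he.1 _ hXB hne.2 ⟨hx, by rwa [edgeSegment_mk]⟩
      rcases Sym2.mem_iff.1 h2 with rfl | rfl
      · exact Or.inr ⟨rfl, h1⟩
      · exact absurd h1 (hfresh e he)
  have hcar : ∀ e ∈ E, edgeSegment e ⊆ L.carrier := fun e he => Set.subset_biUnion_of_mem he.1
  have hsp : Separated E := fun e he f hf => L.separated e he.1 f hf.1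
  exact ⟨E, A, B, X, C, hedges, hedges',
    .of_between (hedges ▸ L.twoRegular) hfresh hsp hedge hX,
    .of_affineIndependent (hedges' ▸ L'.twoRegular)
      (fun e he hCe => hC (hcar e he (mem_edgeSegment hCe))) hsp
      (fun e he x hx hx' => hedge e he x hx (htri ▸ ⟨hx', hcar e he hx⟩)) hind⟩

theorem SplitEdge.ncard (h : SplitEdge L L') : L'.edges.ncard = L.edges.ncard + 1 := by
  obtain ⟨E, A, B, X, hL, hAB, hL', harc⟩ := h.exists_arc
  rw [hL', harc.ncard, hL, Set.ncard_insert_of_notMem hAB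
    (L.finite.subset (hL ▸ Set.subset_insert _ _))]

theorem PushAcross.ncard (h : PushAcross L L') : L'.edges.ncard = L.edges.ncard := by
  obtain ⟨E, A, B, X, C, hL, hL', h1, h2⟩ := h.exists_arc
  rw [hL', hL, h1.ncard, h2.ncard]

theorem ElementaryMove.ncard (h : ElementaryMove L L') :
    L.edges.ncard ≤ L'.edges.ncard + 1 ∧ L'.edges.ncard ≤ L.edges.ncard + 1 := by
  rcases h with h | h | h | h <;> have := h.ncard <;> omega

theorem sweep_cost {m N : ℕ} (hm : 0 < m) (hN : m + 2 ≤ N) :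
    2 * ((m + 2) * (m + 3) + 4) ≤ 2 * (N + 1) ^ 2 := by
  have : (m + 2) * (m + 3) + 4 ≤ (m + 3) ^ 2 := by nlinarith
  have : (m + 3) ^ 2 ≤ (N + 1) ^ 2 := Nat.pow_le_pow_left (by omega) 2
  omega

theorem ElementaryMove.eventually_reach (h : ElementaryMove L L') {V : Set Space} (hfin : V.Finite)
    (hV : verts L.edges ⊆ V) (hV' : verts L'.edges ⊆ V) {ψ : ℕ → Space → Space}
    (hψ : GenericSeq b V ψ) {N : ℕ} (hN : L.edges.ncard ≤ N) (hN' : L'.edges.ncard ≤ N) :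
    ∀ᶠ n in atTop, Reach b (2 * (N + 1) ^ 2) (Sym2.map (ψ n) '' L.edges)
      (Sym2.map (ψ n) '' L'.edges) := by
  have split : ∀ {L L' : PolygonalLink}, SplitEdge L L' → verts L'.edges ⊆ V →
      L'.edges.ncard ≤ N → ∀ᶠ n in atTop, Reach b (2 * (N + 1) ^ 2) (Sym2.map (ψ n) '' L.edges)
      (Sym2.map (ψ n) '' L'.edges) := by
    intro L L' h hV' hN'
    obtain ⟨E, A, B, X, hL, hAB, hL', harc⟩ := h.exists_arc
    rw [hL', harc.ncard] at hN'
    rw [hL'] at hV'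
    filter_upwards [harc.eventually_split (hL ▸ L.twoRegular) (hL ▸ L.separated) hAB hfin hV' hψ]
      with n hn
    rw [hL, hL']
    exact hn.mono ((by omega : _ ≤ 2 * _).trans (sweep_cost harc.ncard_pos hN'))
  have push : ∀ {L L' : PolygonalLink}, PushAcross L L' → verts L.edges ⊆ V → verts L'.edges ⊆ V →
      L'.edges.ncard ≤ N → ∀ᶠ n in atTop, Reach b (2 * (N + 1) ^ 2) (Sym2.map (ψ n) '' L.edges)
      (Sym2.map (ψ n) '' L'.edges) := by
    intro L L' h hV hV' hN'
    obtain ⟨E, A, B, X, C, hL, hL', h1, h2⟩ := h.exists_arc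
    rw [hL', h2.ncard] at hN'
    rw [hL'] at hV'
    rw [hL] at hV
    filter_upwards [h1.eventually_swing h2 hfin hV hV' hψ] with n hn
    rw [hL, hL']
    exact hn.mono (sweep_cost h1.ncard_pos hN')
  rcases h with h | h | h | h
  · exact split h hV' hN'
  · exact (split h hV hN).mono fun n hn => hn.symm
  · exact push h hV hV' hN'
  · exact (push h hV' hV hN).mono fun n hn => hn.symm

end PolygonalLink

/-- If two polygonal links with at most `n` edges each have regular projections to a fixed plane
and are related by `k` elementary moves, then their diagrams are related
by at most `2k(n + k/2 + 1)²` Reidemeister moves. -/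
theorem theorem7p3 (b : OrthonormalBasis (Fin 3) ℝ Space) (n k : ℕ) (L L' : PolygonalLink)
    (hn : L.edges.ncard ≤ n) (hn' : L'.edges.ncard ≤ n)
    (hreg : L.IsRegular b) (hreg' : L'.IsRegular b)
    (hk : PolygonalLink.TransformsIn k L L') :
    ∃ m : ℕ, (m : ℝ) ≤ 2 * (k : ℝ) * ((n : ℝ) + (k : ℝ) / 2 + 1) ^ 2 ∧
      LinkDiagram.TransformsIn m (L.diagram b hreg) (L'.diagram b hreg') := by
  obtain ⟨S, rfl, rfl, hS⟩ := hk
  have h1 : ∀ i ≤ k, (S i).edges.ncard ≤ n + i := by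
    intro i
    induction i with
    | zero => exact fun _ => hn
    | succ i ih => intro hi; have := ih (by omega); have := (hS i (by omega)).ncard; omega
  have h2 : ∀ j ≤ k, (S (k - j)).edges.ncard ≤ n + j := by
    intro j
    induction j with
    | zero => exact fun _ => hn'
    | succ j ih =>
      intro hj
      have := ih (by omega)
      have h := (hS (k - (j + 1)) (by omega)).ncard
      rw [show k - (j + 1) + 1 = k - j by omega] at h
      omega
  have h3 : ∀ i ≤ k, (S i).edges.ncard ≤ n + k / 2 := by
    intro i hi
    have e1 := h1 i hi
    have e2 := h2 (k - i) (by omega)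
    rw [Nat.sub_sub_self hi] at e2
    omega
  have hfin : (⋃ i ∈ Set.Iic k, verts (S i).edges).Finite :=
    (Set.finite_Iic k).biUnion fun i _ => verts_finite (S i).finite
  have hsub : ∀ i ≤ k, verts (S i).edges ⊆ ⋃ i ∈ Set.Iic k, verts (S i).edges := fun i hi =>
    Set.subset_biUnion_of_mem (u := fun i => verts (S i).edges) hi
  obtain ⟨ψ, ht, hψ⟩ := exists_generic (b := b) hfin
  have hgen : GenericSeq b (⋃ i ∈ Set.Iic k, verts (S i).edges) ψ :=
    ⟨ht, fun m => (hψ m).1, fun m => (hψ m).2⟩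
  have hstep : ∀ i ≤ k, ∀ᶠ m in atTop, Reach b (i * (2 * (n + k / 2 + 1) ^ 2))
      (S 0).edges (Sym2.map (ψ m) '' (S i).edges) := by
    intro i
    induction i with
    | zero =>
      intro _
      rw [zero_mul]
      exact eventually_perturb (Good.of_link hreg) ht
    | succ i ih =>
      intro hi
      filter_upwards [ih (by omega), (hS i (by omega)).eventually_reach hfin (hsub i (by omega))
        (hsub (i + 1) hi) hgen (h3 i (by omega)) (h3 (i + 1) hi)] with m r r'
      rw [Nat.succ_mul]
      exact r.trans r'
  obtain ⟨m, r, r'⟩ := ((hstep k le_rfl).and (eventually_perturb (Good.of_link hreg') ht)).exists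
  obtain ⟨j, hj, htr⟩ := reach_iff_of_links hreg hreg' (r.trans r'.symm)
  refine ⟨j, ?_, htr⟩
  calc (j : ℝ) ≤ ((k * (2 * (n + k / 2 + 1) ^ 2) + 0 : ℕ) : ℝ) := by exact_mod_cast hj
    _ = 2 * k * (n + ((k / 2 : ℕ) : ℝ) + 1) ^ 2 := by push_cast; ring
    _ ≤ 2 * k * (n + (k : ℝ) / 2 + 1) ^ 2 := by
      gcongr
      exact Nat.cast_div_le
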